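/- **Setting.** Let $(M^{n+1},g)$ be a smooth Riemannian manifold. Curvature is $R(X,Y)=\nabla_X\nabla_Y-\nabla_Y\nabla_X-\nabla_{[X,Y]}$, and $\mathrm{Ric}(u,v)=\mathrm{tr}\,(e\mapsto R(e,u)v)$. For $p\in M$ and an orthonormal basis $E_1,\dots,E_{n+1}$ of $T_pM$ let $F(x)=\exp_p(x_iE_i)$ be geodesic normal coordinates. For $\rho>0$ and $w\in C^2(S^n)$, where $S^n\subset T_pM$ is the unit sphere, let $S_\rho(p,w)$ be the hypersurface parametrized by $z\mapsto F(\rho(1-w(z))\Theta(z))$, where $\Theta$ is a local parametrization of $S^n$. Let $N$ be its inward unit normal, $Z_i=\partial_{z^i}[F(\rho(1-w)\Theta)]$, let $A$ be its shape operator, $g(AZ_i,Z_j)=-g(\nabla_{Z_i}N,Z_j)$, and let $A_{ij}(w)$ be its matrix, $AZ_j=\sum_iA_{ij}Z_i$. Write $\Theta_i=\partial_{z^i}\Theta$, $w_i=\partial_{z^i}w$, $w_{ij}=\partial_{z^i}\partial_{z^j}w$. All expansions are at a point where $g(\Theta_i,\Theta_j)=\delta_{ij}$ and $\overline\nabla_{\Theta_i}\Theta_j=0$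 ($\overline\nabla$ the Levi-Civita connection of $S^n$). Repeated indices are summed, all curvature terms are taken at $p$. **Error terms.** $\mathcal O(\rho^d)$ is $\rho^d$ times a smooth function (or tensor field) on $S^n$ that is bounded in $C^\infty$. $L^j(w)$ is a linear differential operator of order $\le j$ in $w$ on $S^n$ whose smooth coefficients are bounded in $C^\infty$. $Q^j(w)$ is a smooth function of the point of $S^n$ and of the $j$-jet of $w$ (for jets of norm $<\delta$), with all derivatives bounded, vanishing quadratically at the zero jet. $L^j\ltimes L^k$ and $L^j\ltimes Q^k$ are finite sums of products of such operators. These objects may depend on $\rho$, $p$ and $(E_i)$ but not on $w$; in the expansion of $A_{ij}$ they carry the indices $i,j$, as components of tensors on $S^n$. **Claim.** For every compact $K\subset M$ there are $\rho_0>0$, $\delta>0$ and bounds for all these objects (for each order of differentiation, and for the number of summands) such that for all $p\in K$, all orthonormal bases $(E_i)$ of $T_pM$ and all $\rho\in(0,\rho_0)$ the following holds. (1) There are such error terms for which, for all $w\in C^2(S^n)$ and at every point where $|(w,\nabla w)|<\delta$, $$\begin{aligned}\rho A_{ij}(w)={}&(1+w)\delta_{ij}+w_{ij}+\tfrac13\,g(R(\Theta,\Theta_i)\Theta,\Theta_j)\,\rho^2\\&-\tfrac13\Big[g(R(\Theta,\Theta_i)\Theta,\Theta_j)\,w+g(R(\Theta,\Theta_i)\Theta,\Theta_k)\,w_{kj}\\&\qquad-\big(g(R(\Theta_k,\Theta_i)\Theta,\Theta_j)+g(R(\Theta,\Theta_i)\Theta_k,\Theta_j)\big)w_k\Big]\rho^2\\&+\tfrac14\,g(\nabla_\Theta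 R(\Theta,\Theta_i)\Theta,\Theta_j)\,\rho^3+\mathcal O(\rho^4)+\rho^3L^2(w)+Q^1(w)+L^2(w)\ltimes L^0(w)+L^2(w)\ltimes Q^1(w).\end{aligned}$$ (2) For every $1\le k\le n$ there are such error terms for which the $k$-curvature $H_k$, the $k$-th elementary symmetric function of the eigenvalues of $A$, satisfies, for all $w\in C^2(S^n)$ and at every point where $|(w,\nabla w,\nabla^2w)|<\delta$, $$\begin{aligned}\rho^kH_k={}&\tbinom nk+\tbinom{n-1}{k-1}\Big[(\Delta_{S^n}+n)w-\tfrac13\mathrm{Ric}(\Theta,\Theta)\rho^2-\tfrac14\nabla_\Theta\mathrm{Ric}(\Theta,\Theta)\rho^3\\&\qquad+\tfrac13\big(\mathrm{Ric}(\Theta,\Theta)w-2\,\mathrm{Ric}(\nabla w,\Theta)-g(R(\Theta,\Theta_i)\Theta,\Theta_j)w_{ij}\big)\rho^2\Big]\\&-\tfrac13\tbinom{n-2}{k-2}\Big[\mathrm{Ric}(\Theta,\Theta)(\Delta_{S^n}w+(n-1)w)+g(R(\Theta,\Theta_i)\Theta,\Theta_j)w_{ij}\Big]\rho^2\\&+\mathcal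 O(\rho^4)+\rho^3L^2(w)+Q^2(w),\end{aligned}$$ where $\binom{n-2}{k-2}$ is read as $0$ for $k=1$. -/

import Mathlib

set_option maxSynthPendingDepth 3

open scoped Manifold ContDiff

namespace PerturbedSphere

noncomputable section

/-! ### Riemannian geometry in coordinates

A metric on (an open subset of) `ℝᵐ` is given by `h x u v`, the scalar product at the point `x` of
the vectors `u` and `v`. -/

/-- The standard basis vector `e_i` of `ℝᵐ`. -/
def stdVec {m : ℕ} (i : Fin m) : EuclideanSpace ℝ (Fin m) := EuclideanSpace.single i 1

/-- The matrix `g_ij` of metric coefficients at `x`. -/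
def gram {m : ℕ}
    (h : EuclideanSpace ℝ (Fin m) → EuclideanSpace ℝ (Fin m) → EuclideanSpace ℝ (Fin m) → ℝ)
    (x : EuclideanSpace ℝ (Fin m)) : Matrix (Fin m) (Fin m) ℝ :=
  Matrix.of fun i j => h x (stdVec i) (stdVec j)

/-- The Christoffel symbols of the Levi-Civita connection, as the vector
`Γ(u, v) = ½ g^{kl} (D_u h(v, e_l) + D_v h(u, e_l) - D_{e_l} h(u, v)) e_k`. -/
def christoffel {m : ℕ}
    (h : EuclideanSpace ℝ (Fin m) → EuclideanSpace ℝ (Fin m) → EuclideanSpace ℝ (Fin m) → ℝ)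
    (x u v : EuclideanSpace ℝ (Fin m)) : EuclideanSpace ℝ (Fin m) :=
  ∑ k, ((1 / 2 : ℝ) * ∑ l, (gram h x)⁻¹ k l *
    (fderiv ℝ (fun y => h y v (stdVec l)) x u + fderiv ℝ (fun y => h y u (stdVec l)) x v
      - fderiv ℝ (fun y => h y u v) x (stdVec l))) • stdVec k

/-- The covariant derivative at `x`, in the direction `u`, of the vector field `Y`. -/
def covD {m : ℕ}
    (h : EuclideanSpace ℝ (Fin m) → EuclideanSpace ℝ (Fin m) → EuclideanSpace ℝ (Fin m) → ℝ)
    (u : EuclideanSpace ℝ (Fin m)) (Y : EuclideanSpace ℝ (Fin m) → EuclideanSpace ℝ (Fin m))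
    (x : EuclideanSpace ℝ (Fin m)) : EuclideanSpace ℝ (Fin m) :=
  fderiv ℝ Y x u + christoffel h x u (Y x)

/-- The curvature tensor `R(u, v) a = ∇_u ∇_v a - ∇_v ∇_u a`, computed by extending `u`, `v`, `a`
to vector fields with constant components (the bracket of which vanishes). -/
def curv {m : ℕ}
    (h : EuclideanSpace ℝ (Fin m) → EuclideanSpace ℝ (Fin m) → EuclideanSpace ℝ (Fin m) → ℝ)
    (x u v a : EuclideanSpace ℝ (Fin m)) : EuclideanSpace ℝ (Fin m) :=
  covD h u (covD h v (fun _ => a)) x - covD h v (covD h u (fun _ => a)) x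

/-- The covariant derivative `(∇_b R)(u, v) a` of the curvature tensor. -/
def covCurv {m : ℕ}
    (h : EuclideanSpace ℝ (Fin m) → EuclideanSpace ℝ (Fin m) → EuclideanSpace ℝ (Fin m) → ℝ)
    (x b u v a : EuclideanSpace ℝ (Fin m)) : EuclideanSpace ℝ (Fin m) :=
  covD h b (fun y => curv h y u v a) x - curv h x (christoffel h x b u) v a
    - curv h x u (christoffel h x b v) a - curv h x u v (christoffel h x b a)

/-- The Ricci tensor `Ric(u, v)`, the trace of `e ↦ R(e, u) v`. -/
def ricci {m : ℕ}
    (h : EuclideanSpace ℝ (Fin m) → EuclideanSpace ℝ (Fin m) → EuclideanSpace ℝ (Fin m) → ℝ)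
    (x u v : EuclideanSpace ℝ (Fin m)) : ℝ :=
  ∑ i, curv h x (stdVec i) u v i

/-- The covariant derivative `(∇_b Ric)(u, v)` of the Ricci tensor. -/
def covRicci {m : ℕ}
    (h : EuclideanSpace ℝ (Fin m) → EuclideanSpace ℝ (Fin m) → EuclideanSpace ℝ (Fin m) → ℝ)
    (x b u v : EuclideanSpace ℝ (Fin m)) : ℝ :=
  fderiv ℝ (fun y => ricci h y u v) x b - ricci h x (christoffel h x b u) v
    - ricci h x u (christoffel h x b v)

/-! ### Parametrized hypersurfaces -/

/-- The `i`-th partial derivative. -/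
def pd {n : ℕ} {W : Type*} [NormedAddCommGroup W] [NormedSpace ℝ W] (i : Fin n)
    (f : EuclideanSpace ℝ (Fin n) → W) (z : EuclideanSpace ℝ (Fin n)) : W :=
  fderiv ℝ f z (stdVec i)

/-- The matrix `g(Z_i, Z_j)` of the first fundamental form of the hypersurface parametrized by
`X`, where `Z_i = ∂_i X`. -/
def firstForm {m n : ℕ}
    (h : EuclideanSpace ℝ (Fin m) → EuclideanSpace ℝ (Fin m) → EuclideanSpace ℝ (Fin m) → ℝ)
    (X : EuclideanSpace ℝ (Fin n) → EuclideanSpace ℝ (Fin m)) (z : EuclideanSpace ℝ (Fin n)) :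
    Matrix (Fin n) (Fin n) ℝ :=
  Matrix.of fun i j => h (X z) (pd i X z) (pd j X z)

/-- `Ñ = -υ + A^j Z_j` with the coefficients `A^j` that make `Ñ` orthogonal to all the `Z_i`;
here `υ` is a vector field along the hypersurface that is transverse to it. -/
def preNormal {m n : ℕ}
    (h : EuclideanSpace ℝ (Fin m) → EuclideanSpace ℝ (Fin m) → EuclideanSpace ℝ (Fin m) → ℝ)
    (X υ : EuclideanSpace ℝ (Fin n) → EuclideanSpace ℝ (Fin m))
    (z : EuclideanSpace ℝ (Fin n)) : EuclideanSpace ℝ (Fin m) :=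
  -υ z + ∑ j, (∑ k, (firstForm h X z)⁻¹ j k * h (X z) (υ z) (pd k X z)) • pd j X z

/-- The unit normal `N = Ñ / g(Ñ, Ñ)^{1/2}`, which points to the side opposite to `υ`. -/
def unitNormal {m n : ℕ}
    (h : EuclideanSpace ℝ (Fin m) → EuclideanSpace ℝ (Fin m) → EuclideanSpace ℝ (Fin m) → ℝ)
    (X υ : EuclideanSpace ℝ (Fin n) → EuclideanSpace ℝ (Fin m))
    (z : EuclideanSpace ℝ (Fin n)) : EuclideanSpace ℝ (Fin m) :=
  (Real.sqrt (h (X z) (preNormal h X υ z) (preNormal h X υ z)))⁻¹ • preNormal h X υ z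

/-- The matrix `b_ij = -g(∇_{Z_i} N, Z_j)` of the second fundamental form. -/
def secondForm {m n : ℕ}
    (h : EuclideanSpace ℝ (Fin m) → EuclideanSpace ℝ (Fin m) → EuclideanSpace ℝ (Fin m) → ℝ)
    (X υ : EuclideanSpace ℝ (Fin n) → EuclideanSpace ℝ (Fin m)) (z : EuclideanSpace ℝ (Fin n)) :
    Matrix (Fin n) (Fin n) ℝ :=
  Matrix.of fun i j =>
    -h (X z) (pd i (unitNormal h X υ) z + christoffel h (X z) (pd i X z) (unitNormal h X υ z))
      (pd j X z)

/-- The matrix `A_ij` of the shape operator `A` in the basis `Z_1, …, Z_n`, that is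
`A Z_j = ∑ i, A_ij Z_i`, where `g(A Z_i, Z_j) = b_ij`. -/
def shapeMatrix {m n : ℕ}
    (h : EuclideanSpace ℝ (Fin m) → EuclideanSpace ℝ (Fin m) → EuclideanSpace ℝ (Fin m) → ℝ)
    (X υ : EuclideanSpace ℝ (Fin n) → EuclideanSpace ℝ (Fin m)) (z : EuclideanSpace ℝ (Fin n)) :
    Matrix (Fin n) (Fin n) ℝ :=
  (firstForm h X z)⁻¹ * secondForm h X υ z

/-- The `k`-th elementary symmetric function of the eigenvalues of `A`, counted with multiplicity;
for the matrix of a shape operator (which has `n` real eigenvalues, the principal curvatures) this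
is the `k`-curvature `H_k`. -/
def kCurvature {n : ℕ} (k : ℕ) (A : Matrix (Fin n) (Fin n) ℝ) : ℝ :=
  A.charpoly.roots.esymm k

/-! ### Geodesics, the exponential map and geodesic normal coordinates -/

section Manifold

variable {m : ℕ} {M : Type*} [TopologicalSpace M] [ChartedSpace (EuclideanSpace ℝ (Fin m)) M]
  [IsManifold (𝓡 m) ∞ M]

/-- The pull-back `Φ^* g` of a Riemannian metric by a map `Φ : ℝᵐ → M`. -/
def pullback
    (g : Bundle.ContMDiffRiemannianMetric (𝓡 m) ∞ (EuclideanSpace ℝ (Fin m))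
      (fun x : M => TangentSpace (𝓡 m) x))
    (Φ : EuclideanSpace ℝ (Fin m) → M) (x u v : EuclideanSpace ℝ (Fin m)) : ℝ :=
  g.inner (Φ x) (mfderiv (𝓡 m) (𝓡 m) Φ x u) (mfderiv (𝓡 m) (𝓡 m) Φ x v)

/-- The curve `γ` satisfies the geodesic equation `c'' + Γ(c', c') = 0` at time `t`, read in the
preferred chart at `γ t`. -/
def IsGeodesicAt
    (g : Bundle.ContMDiffRiemannianMetric (𝓡 m) ∞ (EuclideanSpace ℝ (Fin m))
      (fun x : M => TangentSpace (𝓡 m) x))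
    (γ : ℝ → M) (t : ℝ) : Prop :=
  let c : ℝ → EuclideanSpace ℝ (Fin m) := fun s => extChartAt (𝓡 m) (γ t) (γ s)
  ContinuousAt γ t ∧ ContDiffAt ℝ 2 c t ∧
    deriv (deriv c) t
      + christoffel (pullback g (extChartAt (𝓡 m) (γ t)).symm) (c t) (deriv c t) (deriv c t) = 0

/-- `γ` is, on `[0, 1]`, the geodesic that starts at `p` with velocity `v`. (The tangent space at
`p` is identified with `ℝᵐ` through the preferred chart at `p`.) -/
def IsGeodesicFrom
    (g : Bundle.ContMDiffRiemannianMetric (𝓡 m) ∞ (EuclideanSpace ℝ (Fin m))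
      (fun x : M => TangentSpace (𝓡 m) x))
    (p : M) (v : TangentSpace (𝓡 m) p) (γ : ℝ → M) : Prop :=
  γ 0 = p ∧ deriv (fun s => extChartAt (𝓡 m) p (γ s)) 0 = v ∧
    ∀ t ∈ Set.Icc (0 : ℝ) 1, IsGeodesicAt g γ t

open Classical in
/-- The exponential map: `exp_p v = γ 1` for the geodesic `γ` that starts at `p` with velocity `v`,
with the junk value `p` where there is no such geodesic on `[0, 1]`. -/
def expMap
    (g : Bundle.ContMDiffRiemannianMetric (𝓡 m) ∞ (EuclideanSpace ℝ (Fin m))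
      (fun x : M => TangentSpace (𝓡 m) x))
    (p : M) (v : TangentSpace (𝓡 m) p) : M :=
  if H : ∃ γ : ℝ → M, IsGeodesicFrom g p v γ then H.choose 1 else p

/-- `E_1, …, E_m` is an orthonormal basis of `T_p M`. -/
def IsOrthonormalFrame
    (g : Bundle.ContMDiffRiemannianMetric (𝓡 m) ∞ (EuclideanSpace ℝ (Fin m))
      (fun x : M => TangentSpace (𝓡 m) x))
    (p : M) (E : Fin m → TangentSpace (𝓡 m) p) : Prop :=
  ∀ i j, g.inner p (E i) (E j) = if i = j then 1 else 0

/-- Geodesic normal coordinates `F(x) = exp_p (x_i E_i)`. -/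
def normalCoord
    (g : Bundle.ContMDiffRiemannianMetric (𝓡 m) ∞ (EuclideanSpace ℝ (Fin m))
      (fun x : M => TangentSpace (𝓡 m) x))
    (p : M) (E : Fin m → TangentSpace (𝓡 m) p) (x : EuclideanSpace ℝ (Fin m)) : M :=
  expMap g p (∑ i, x i • E i)

/-- The metric coefficients `g(X_i, X_j)` in geodesic normal coordinates at `p`, where
`X_i = F_* ∂_{x_i}`. A vector `u` of `ℝᵐ` stands for the vector `u_i X_i` tangent to `M` at `F(x)`;
in particular, at `x = 0`, for the vector `u_i E_i` of `T_p M`. -/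
def normalMetric
    (g : Bundle.ContMDiffRiemannianMetric (𝓡 m) ∞ (EuclideanSpace ℝ (Fin m))
      (fun x : M => TangentSpace (𝓡 m) x))
    (p : M) (E : Fin m → TangentSpace (𝓡 m) p) :
    EuclideanSpace ℝ (Fin m) → EuclideanSpace ℝ (Fin m) → EuclideanSpace ℝ (Fin m) → ℝ :=
  pullback g (normalCoord g p E)

/-- The curvature term `g(R(a, b) c, d)` at the point `p`. -/
def riemAt
    (g : Bundle.ContMDiffRiemannianMetric (𝓡 m) ∞ (EuclideanSpace ℝ (Fin m))
      (fun x : M => TangentSpace (𝓡 m) x))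
    (p : M) (E : Fin m → TangentSpace (𝓡 m) p) (a b c d : EuclideanSpace ℝ (Fin m)) : ℝ :=
  normalMetric g p E 0 (curv (normalMetric g p E) 0 a b c) d

/-- The curvature term `g((∇_v R)(a, b) c, d)` at the point `p`. -/
def covRiemAt
    (g : Bundle.ContMDiffRiemannianMetric (𝓡 m) ∞ (EuclideanSpace ℝ (Fin m))
      (fun x : M => TangentSpace (𝓡 m) x))
    (p : M) (E : Fin m → TangentSpace (𝓡 m) p) (v a b c d : EuclideanSpace ℝ (Fin m)) : ℝ :=
  normalMetric g p E 0 (covCurv (normalMetric g p E) 0 v a b c) d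

/-- The Ricci curvature `Ric(a, b)` at the point `p`. -/
def ricAt
    (g : Bundle.ContMDiffRiemannianMetric (𝓡 m) ∞ (EuclideanSpace ℝ (Fin m))
      (fun x : M => TangentSpace (𝓡 m) x))
    (p : M) (E : Fin m → TangentSpace (𝓡 m) p) (a b : EuclideanSpace ℝ (Fin m)) : ℝ :=
  ricci (normalMetric g p E) 0 a b

/-- The term `(∇_v Ric)(a, b)` at the point `p`. -/
def covRicAt
    (g : Bundle.ContMDiffRiemannianMetric (𝓡 m) ∞ (EuclideanSpace ℝ (Fin m))
      (fun x : M => TangentSpace (𝓡 m) x))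
    (p : M) (E : Fin m → TangentSpace (𝓡 m) p) (v a b : EuclideanSpace ℝ (Fin m)) : ℝ :=
  covRicci (normalMetric g p E) 0 v a b

end Manifold

/-! ### Perturbed geodesic spheres -/

/-- A parametrization of the sphere, seen as a map into `ℝⁿ⁺¹`. -/
def amb {n : ℕ}
    (Θ : EuclideanSpace ℝ (Fin n) → Metric.sphere (0 : EuclideanSpace ℝ (Fin (n + 1))) 1)
    (z : EuclideanSpace ℝ (Fin n)) : EuclideanSpace ℝ (Fin (n + 1)) := Θ z

/-- The coordinate vector `Θ_i = ∂_i Θ`. -/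
def tang {n : ℕ}
    (Θ : EuclideanSpace ℝ (Fin n) → Metric.sphere (0 : EuclideanSpace ℝ (Fin (n + 1))) 1)
    (z : EuclideanSpace ℝ (Fin n)) (i : Fin n) : EuclideanSpace ℝ (Fin (n + 1)) :=
  pd i (amb Θ) z

/-- `w_i = ∂_i w`. -/
def d1 {n : ℕ} (w : Metric.sphere (0 : EuclideanSpace ℝ (Fin (n + 1))) 1 → ℝ)
    (Θ : EuclideanSpace ℝ (Fin n) → Metric.sphere (0 : EuclideanSpace ℝ (Fin (n + 1))) 1)
    (z : EuclideanSpace ℝ (Fin n)) (i : Fin n) : ℝ :=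
  pd i (fun y => w (Θ y)) z

/-- `w_ij = ∂_i ∂_j w`. -/
def d2 {n : ℕ} (w : Metric.sphere (0 : EuclideanSpace ℝ (Fin (n + 1))) 1 → ℝ)
    (Θ : EuclideanSpace ℝ (Fin n) → Metric.sphere (0 : EuclideanSpace ℝ (Fin (n + 1))) 1)
    (z : EuclideanSpace ℝ (Fin n)) (i j : Fin n) : ℝ :=
  pd i (pd j (fun y => w (Θ y))) z

/-- `Θ` is a local parametrization of the unit sphere `Sⁿ` whose coordinate vectors `Θ_i = ∂_i Θ`
satisfy, at the point `z`, `g(Θ_i, Θ_j) = δ_ij` and `∇_{Θ_i} Θ_j = 0` for the Levi-Civita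
connection of `Sⁿ` (the tangential part of `∂_i ∂_j Θ`). -/
structure IsNormalParam {n : ℕ}
    (Θ : EuclideanSpace ℝ (Fin n) → Metric.sphere (0 : EuclideanSpace ℝ (Fin (n + 1))) 1)
    (z : EuclideanSpace ℝ (Fin n)) : Prop where
  smooth : ContDiffAt ℝ ∞ (amb Θ) z
  orthonormal : ∀ i j : Fin n, inner ℝ (tang Θ z i) (tang Θ z j) = if i = j then (1 : ℝ) else 0
  parallel : ∀ i j k : Fin n, inner ℝ (pd i (pd j (amb Θ)) z) (tang Θ z k) = (0 : ℝ)

/-- The parametrization `z ↦ ρ (1 - w(z)) Θ(z)`, in geodesic normal coordinates, of the perturbed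
geodesic sphere `S_ρ(p, w)`. -/
def perturbedSphere {n : ℕ} (ρ : ℝ)
    (w : Metric.sphere (0 : EuclideanSpace ℝ (Fin (n + 1))) 1 → ℝ)
    (Θ : EuclideanSpace ℝ (Fin n) → Metric.sphere (0 : EuclideanSpace ℝ (Fin (n + 1))) 1)
    (z : EuclideanSpace ℝ (Fin n)) : EuclideanSpace ℝ (Fin (n + 1)) :=
  (ρ * (1 - w (Θ z))) • amb Θ z

/-- The gradient `∇w = w_k Θ_k` on the sphere, at a point where the `Θ_k` are orthonormal. -/
def sphGrad {n : ℕ} (w : Metric.sphere (0 : EuclideanSpace ℝ (Fin (n + 1))) 1 → ℝ)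
    (Θ : EuclideanSpace ℝ (Fin n) → Metric.sphere (0 : EuclideanSpace ℝ (Fin (n + 1))) 1)
    (z : EuclideanSpace ℝ (Fin n)) : EuclideanSpace ℝ (Fin (n + 1)) :=
  ∑ k, d1 w Θ z k • tang Θ z k

/-- The `1`-jet `(w, ∇w)`. -/
def jet1 {n : ℕ} (w : Metric.sphere (0 : EuclideanSpace ℝ (Fin (n + 1))) 1 → ℝ)
    (Θ : EuclideanSpace ℝ (Fin n) → Metric.sphere (0 : EuclideanSpace ℝ (Fin (n + 1))) 1)
    (z : EuclideanSpace ℝ (Fin n)) : ℝ × EuclideanSpace ℝ (Fin (n + 1)) :=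
  (w (Θ z), sphGrad w Θ z)

/-- Bilinear forms on the ambient space `ℝⁿ⁺¹` of the sphere. The value on `(Θ_i, Θ_j)` is the
`ij`-component. -/
abbrev Bilin (n : ℕ) : Type :=
  EuclideanSpace ℝ (Fin (n + 1)) →L[ℝ] EuclideanSpace ℝ (Fin (n + 1)) →L[ℝ] ℝ

/-- The `2`-jet `(w, ∇w, ∇²w)`, where `∇²w = w_kl Θ_k ⊗ Θ_l` at a point where the coordinates are
normal. -/
def jet2 {n : ℕ} (w : Metric.sphere (0 : EuclideanSpace ℝ (Fin (n + 1))) 1 → ℝ)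
    (Θ : EuclideanSpace ℝ (Fin n) → Metric.sphere (0 : EuclideanSpace ℝ (Fin (n + 1))) 1)
    (z : EuclideanSpace ℝ (Fin n)) : ℝ × EuclideanSpace ℝ (Fin (n + 1)) × Bilin n :=
  (w (Θ z), sphGrad w Θ z,
    ∑ k, ∑ l, d2 w Θ z k l • (innerSL ℝ (tang Θ z k)).smulRight (innerSL ℝ (tang Θ z l)))

/-- The shape operator matrix `A_ij(w)` of `S_ρ(p, w)` at the point with parameter `z`, with
respect to the unit normal that points to the inside. -/
def shapeOp {n : ℕ} {M : Type*} [TopologicalSpace M]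
    [ChartedSpace (EuclideanSpace ℝ (Fin (n + 1))) M] [IsManifold (𝓡 (n + 1)) ∞ M]
    (g : Bundle.ContMDiffRiemannianMetric (𝓡 (n + 1)) ∞ (EuclideanSpace ℝ (Fin (n + 1)))
      (fun x : M => TangentSpace (𝓡 (n + 1)) x))
    (p : M) (E : Fin (n + 1) → TangentSpace (𝓡 (n + 1)) p) (ρ : ℝ)
    (w : Metric.sphere (0 : EuclideanSpace ℝ (Fin (n + 1))) 1 → ℝ)
    (Θ : EuclideanSpace ℝ (Fin n) → Metric.sphere (0 : EuclideanSpace ℝ (Fin (n + 1))) 1)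
    (z : EuclideanSpace ℝ (Fin n)) : Matrix (Fin n) (Fin n) ℝ :=
  shapeMatrix (normalMetric g p E) (perturbedSphere ρ w Θ) (amb Θ) z

/-! ### Error terms -/

/-- `f` represents (as the restriction to `Sⁿ` of a map that is smooth away from the origin) a
smooth map on `Sⁿ` whose derivatives of every order `r` are bounded by `C r`. With values in `W`,
this is a coefficient of an `O(ρ^d) = ρ^d f` term; with values in the continuous linear maps
`J →L[ℝ] W` on a jet space `J`, it is the linear differential operator `L^j` that sends `w` to
`f(Θ) (j-jet of w)`, with smooth coefficients bounded in the `C^∞` topology. -/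
def SmoothOnSphere {n : ℕ} {W : Type*} [NormedAddCommGroup W] [NormedSpace ℝ W] (C : ℕ → ℝ)
    (f : EuclideanSpace ℝ (Fin (n + 1)) → W) : Prop :=
  ContDiffOn ℝ ∞ f {0}ᶜ ∧
    ∀ (r : ℕ) (x : EuclideanSpace ℝ (Fin (n + 1))), ‖x‖ = 1 → ‖iteratedFDeriv ℝ r f x‖ ≤ C r

/-- `q` represents a nonlinear differential operator `Q^j`, which sends `w` to
`q(Θ, j-jet of w)`: a smooth function of the point of the sphere and of the jet (of norm less
than `δ`), whose derivatives of every order `r` are bounded by `C r`, and which vanishes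
quadratically at the zero jet. -/
def QuadraticOp {n : ℕ} {J W : Type*} [NormedAddCommGroup J] [NormedSpace ℝ J]
    [NormedAddCommGroup W] [NormedSpace ℝ W] (C : ℕ → ℝ) (δ : ℝ)
    (q : EuclideanSpace ℝ (Fin (n + 1)) × J → W) : Prop :=
  ContDiffOn ℝ ∞ q ({0}ᶜ ×ˢ Metric.ball 0 δ) ∧
    (∀ (r : ℕ) (x : EuclideanSpace ℝ (Fin (n + 1))) (ξ : J), ‖x‖ = 1 → ‖ξ‖ < δ →
      ‖iteratedFDeriv ℝ r q (x, ξ)‖ ≤ C r) ∧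
    ∀ x : EuclideanSpace ℝ (Fin (n + 1)), ‖x‖ = 1 →
      q (x, 0) = 0 ∧ fderiv ℝ (fun ξ => q (x, ξ)) 0 = 0

end

end PerturbedSphere

open PerturbedSphere

set_option linter.unusedSectionVars false

/-! In normal coordinates the hypersurface is the explicit map `z ↦ ρ (1 - w) Θ`, so at each point
the rescaled shape operator `ρ A` is a function of `ρ`, of the normal coordinate system (centre and
frame), of `Θ` and of the 2-jet of `w`. This function is smooth across `ρ = 0` near the zero jet.
The claim therefore splits into two independent parts: joint smoothness near a compact set of
parameters, and the values of finitely many Taylor coefficients, for which pointwise asymptotics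
suffice.

The passage from the pointwise to the uniform statement is `exists_expansion`. The function is split
into its value at the zero jet, its derivative there and a rest that vanishes quadratically. The
first two are expanded in `ρ` by Hadamard's lemma with parameters, and a polynomial in `ρ` that is
`O(ρ^d)` has no coefficients below degree `d`, so the Taylor coefficients are the ones computed
pointwise. All remainders are smooth in all variables jointly, hence bounded with their derivatives
on compact sets (`exists_bound_slice`); this gives the constants `C r`.

For the coefficients, the Gauss lemma is derived from the fact that rays are geodesics. It gives an
exact formula (`shapeMatrix_perturbedSphere`): up to normalization the unit normal is dual to the
conormal `Θ + ∇w / (1 - w)`, and `ρ A` is a form depending on the 1-jet plus the Hessian of `w`,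
both evaluated in a frame that inverts the first fundamental form. On geodesic spheres only the
operator `Γ(x, ·)` along the ray through `x` remains. It satisfies a Riccati equation driven by the
curvature, and comparison of powers gives `Γ(x, v) = t/3 R(x, v)x + t²/4 ∇_x R(x, v)x + O(t³)`, the
source of the constants `1/3` and `1/4`. The gradient terms come from the first derivatives of the
Christoffel symbols at the centre, which are linear in the curvature.

The shape operator is affine in the Hessian, so in part (1) only the 1-jet has to be small. The
frame that multiplies the Hessian is even in the gradient; its linear part thus involves only `w`,
and the products are of the types `L² ⋉ L⁰` and `L² ⋉ Q¹`.

For `H_k`, the eigenvalues are real because `A = G⁻¹ b` with `G` positive definite and `b`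
symmetric, so `H_k` is the sum of the principal `k`-minors. Writing the matrix as `1 + N`, one
expands in the elementary symmetric functions of `N`. At the zero jet `N = O(ρ²)`, so only `e_1`
matters for the value and only `e_1`, `e_2` for the linearization; the trace identities turn the
result into Ricci curvature.

It remains to see that `exp` provides smooth families of normal metrics. Geodesics depend smoothly
on their initial data by the inverse function theorem in a space of velocity curves, and they are
unique on a Hausdorff manifold, so `expMap` is this smooth map. Near a point, the pairs (centre,
orthonormal frame) form a compact set of parameters, and finitely many such neighbourhoods cover
`K`. -/

namespace PerturbedSphere

open Set Filter Topology

/-! ### The composition operator on spaces of continuous functions -/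

section Composition

variable {X : Type} [TopologicalSpace X] [CompactSpace X]
  {V : Type} [NormedAddCommGroup V] [NormedSpace ℝ V]

open Classical in
/-- The map `c ↦ f ∘ c` on continuous functions, with the value `0` where `f ∘ c` is not
continuous. -/
noncomputable def compOp {W : Type} [NormedAddCommGroup W] (f : V → W) (c : C(X, V)) : C(X, W) :=
  if h : Continuous (fun t => f (c t)) then ⟨fun t => f (c t), h⟩ else 0

/-- The continuous functions with values in `U`. -/
def mapsInto (X : Type) [TopologicalSpace X] {V : Type} [TopologicalSpace V] (U : Set V) :
    Set C(X, V) := {c | ∀ t, c t ∈ U}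

theorem isOpen_mapsInto {U : Set V} (hU : IsOpen U) : IsOpen (mapsInto X U) := by
  have := ContinuousMap.isOpen_setOfPred_mapsTo (X := X) (Y := V) (K := univ) isCompact_univ hU
  simpa [mapsInto, MapsTo] using this

theorem compOp_apply {W : Type} [NormedAddCommGroup W] {f : V → W} {U : Set V}
    (hf : ContinuousOn f U) {c : C(X, V)} (hc : c ∈ mapsInto X U) (t : X) :
    compOp f c t = f (c t) := by
  have h : Continuous (fun t => f (c t)) := hf.comp_continuous c.continuous hc
  simp [compOp, h]

/-- The range of `c` is compact: a function continuous on the open set `U` is uniformly continuous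
near it, and a thickening of it stays in `U`. One radius for all `t` is what turns pointwise
estimates into estimates in the supremum norm. -/
theorem exists_ball_of_compact {W : Type} [PseudoMetricSpace W] {f : V → W} {U : Set V}
    (hU : IsOpen U) (hf : ContinuousOn f U) {c : C(X, V)} (hc : c ∈ mapsInto X U) {ε : ℝ}
    (hε : 0 < ε) :
    ∃ δ > 0, ∀ t y, dist y (c t) < δ → y ∈ U ∧ dist (f y) (f (c t)) < ε := by
  have hK : IsCompact (range c) := isCompact_range c.continuous
  have h1 := hK.uniformContinuousAt_of_continuousAt f
    (by rintro _ ⟨t, rfl⟩; exact hf.continuousAt (hU.mem_nhds (hc t)))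
    (Metric.dist_mem_uniformity hε)
  obtain ⟨δ₁, h₁, h₂⟩ := Metric.mem_uniformity_dist.1 h1
  obtain ⟨δ₂, h₃, h₄⟩ := hK.exists_thickening_subset_open hU
    (by rintro _ ⟨t, rfl⟩; exact hc t)
  refine ⟨min δ₁ δ₂, lt_min h₁ h₃, fun t y hy => ⟨h₄ ?_, ?_⟩⟩
  · exact Metric.mem_thickening_iff.2 ⟨c t, ⟨t, rfl⟩, hy.trans_le (min_le_right _ _)⟩
  · have := h₂ (a := c t) (b := y) (by rw [dist_comm]; exact hy.trans_le (min_le_left _ _)) ⟨t, rfl⟩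
    rw [dist_comm]; exact this

theorem continuousOn_compOp {W : Type} [NormedAddCommGroup W] {f : V → W} {U : Set V}
    (hU : IsOpen U) (hf : ContinuousOn f U) : ContinuousOn (compOp (X := X) f) (mapsInto X U) := by
  intro c hc
  refine (Metric.continuousAt_iff.2 fun ε hε => ?_).continuousWithinAt
  obtain ⟨δ, hδ, h⟩ := exists_ball_of_compact hU hf hc (half_pos hε)
  refine ⟨δ, hδ, fun {d} hd => ?_⟩
  have hd' : ∀ t, dist (d t) (c t) < δ := fun t => (ContinuousMap.dist_apply_le_dist t).trans_lt hd
  refine lt_of_le_of_lt ((ContinuousMap.dist_le (half_pos hε).le).2 fun t => ?_) (half_lt_self hε)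
  rw [compOp_apply hf hc, compOp_apply hf (fun t => (h t _ (hd' t)).1)]
  exact (h t _ (hd' t)).2.le

/-- Pointwise application of a continuous family of continuous linear maps. -/
noncomputable def pointwiseApply (X : Type) [TopologicalSpace X] [CompactSpace X] (V W : Type)
    [NormedAddCommGroup V] [NormedSpace ℝ V] [NormedAddCommGroup W] [NormedSpace ℝ W] :
    C(X, V →L[ℝ] W) →L[ℝ] C(X, V) →L[ℝ] C(X, W) :=
  LinearMap.mkContinuous₂
    (LinearMap.mk₂ ℝ (fun a c => (⟨fun t => a t (c t), a.continuous.clm_apply c.continuous⟩ : C(X, W)))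
      (by intros; ext; simp) (by intros; ext; simp) (by intros; ext; simp) (by intros; ext; simp)) 1
    (fun a c => by
      refine (ContinuousMap.norm_le _ (by positivity)).2 fun t => ?_
      simp only [LinearMap.mk₂_apply, ContinuousMap.coe_mk, one_mul]
      exact ((a t).le_opNorm _).trans
        (mul_le_mul (a.norm_coe_le_norm t) (c.norm_coe_le_norm t) (norm_nonneg _) (norm_nonneg _)))

@[simp] theorem pointwiseApply_apply {W : Type} [NormedAddCommGroup W] [NormedSpace ℝ W]
    (a : C(X, V →L[ℝ] W)) (c : C(X, V)) (t : X) : pointwiseApply X V W a c t = a t (c t) := rfl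

/-- The mean value inequality is applied on a ball around each `c t`. On these balls the derivative
of `f` varies by at most `ε`, with a radius independent of `t`, so the linearization error is at
most `ε ‖d - c‖` in the supremum norm. -/
theorem hasFDerivAt_compOp {W : Type} [NormedAddCommGroup W] [NormedSpace ℝ W] {f : V → W}
    {U : Set V} (hU : IsOpen U) (hf : ContDiffOn ℝ 1 f U) {c : C(X, V)} (hc : c ∈ mapsInto X U) :
    HasFDerivAt (compOp f) (pointwiseApply X V W (compOp (fderiv ℝ f) c)) c := by
  have hf' : ContinuousOn (fderiv ℝ f) U := hf.continuousOn_fderiv_of_isOpen hU le_rfl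
  refine HasFDerivAt.of_isLittleO (Asymptotics.isLittleO_iff.2 fun ε hε => ?_)
  obtain ⟨δ, hδ, h⟩ := exists_ball_of_compact hU hf' hc hε
  filter_upwards [Metric.ball_mem_nhds c hδ] with d hd
  have hd' : ∀ t, dist (d t) (c t) < δ := fun t => (ContinuousMap.dist_apply_le_dist t).trans_lt hd
  refine (ContinuousMap.norm_le _ (by positivity)).2 fun t => ?_
  have e1 : compOp f d t = f (d t) := compOp_apply hf.continuousOn (fun t => (h t _ (hd' t)).1) t
  have e2 : compOp f c t = f (c t) := compOp_apply hf.continuousOn hc t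
  simp only [ContinuousMap.sub_apply, pointwiseApply_apply, e1, e2, compOp_apply hf' hc]
  have key := Convex.norm_image_sub_le_of_norm_hasFDerivWithin_le' (f := f) (f' := fderiv ℝ f)
    (s := Metric.ball (c t) δ) (φ := fderiv ℝ f (c t)) (x := c t) (y := d t) (C := ε)
    (fun y hy => ((hf.differentiableOn (by simp)).differentiableAt
      (hU.mem_nhds (h t y hy).1)).hasFDerivAt.hasFDerivWithinAt)
    (fun y hy => by rw [← dist_eq_norm]; exact (h t y hy).2.le)
    (convex_ball _ _) (Metric.mem_ball_self hδ) (hd' t)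
  refine key.trans (mul_le_mul_of_nonneg_left ?_ hε.le)
  exact (d - c).norm_coe_le_norm t

/-- Induction on the order: the derivative of composition with `f` is composition with `Df`,
followed by a continuous bilinear pairing. The target space is quantified inside the induction
because `Df` takes values in another space than `f`. -/
theorem contDiffOn_compOp_nat {U : Set V} (hU : IsOpen U) (k : ℕ) :
    ∀ {W : Type} [NormedAddCommGroup W] [NormedSpace ℝ W] {f : V → W}, ContDiffOn ℝ k f U →
      ContDiffOn ℝ k (compOp (X := X) f) (mapsInto X U) := by
  induction k with
  | zero =>
    intro W _ _ f hf
    simp only [Nat.cast_zero, contDiffOn_zero] at hf ⊢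
    exact continuousOn_compOp hU hf
  | succ k ih =>
    intro W _ _ f hf
    have hf1 : ContDiffOn ℝ 1 f U := hf.of_le (by norm_cast; omega)
    have hd : ContDiffOn ℝ k (fderiv ℝ f) U :=
      ((contDiffOn_succ_iff_fderiv_of_isOpen hU).1 (by exact_mod_cast hf)).2.2
    have := (contDiffOn_succ_iff_hasFDerivWithinAt_of_uniqueDiffOn (n := (k : ℕ∞ω))
      (isOpen_mapsInto (X := X) hU).uniqueDiffOn (f := compOp f)).2
      ⟨fun h => by simp at h, fun c => pointwiseApply X V W (compOp (fderiv ℝ f) c),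
        (pointwiseApply X V W).contDiff.comp_contDiffOn (ih hd),
        fun c hc => (hasFDerivAt_compOp hU hf1 hc).hasFDerivWithinAt⟩
    exact_mod_cast this

theorem contDiffOn_compOp {U : Set V} (hU : IsOpen U) {W : Type} [NormedAddCommGroup W]
    [NormedSpace ℝ W] {f : V → W} (hf : ContDiffOn ℝ ∞ f U) :
    ContDiffOn ℝ ∞ (compOp (X := X) f) (mapsInto X U) :=
  contDiffOn_infty.2 fun k => contDiffOn_compOp_nat hU k (contDiffOn_infty.1 hf k)

end Composition

/-! ### Integration of continuous functions on an interval -/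

section Integral

variable {W : Type} [NormedAddCommGroup W] [NormedSpace ℝ W]

/-- The integral `∫ s in a'..b', c s`, where `c` is a continuous function on `[a, b]`, extended by
constants. -/
noncomputable def integralIcc {a b : ℝ} (hab : a ≤ b) (a' b' : ℝ) : C(Icc a b, W) →L[ℝ] W :=
  LinearMap.mkContinuous
    { toFun := fun c => ∫ s in a'..b', c (projIcc a b hab s)
      map_add' := fun c d => by
        simp only [ContinuousMap.add_apply]
        exact intervalIntegral.integral_add
          (c.continuous.comp continuous_projIcc).continuousOn.intervalIntegrable
          (d.continuous.comp continuous_projIcc).continuousOn.intervalIntegrable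
      map_smul' := fun r c => by simp } |b' - a'|
    (fun c => by
      rw [mul_comm]
      exact intervalIntegral.norm_integral_le_of_norm_le_const fun s _ => c.norm_coe_le_norm _)

theorem integralIcc_apply {a b : ℝ} (hab : a ≤ b) (a' b' : ℝ) (c : C(Icc a b, W)) :
    integralIcc hab a' b' c = ∫ s in a'..b', c (projIcc a b hab s) := rfl

end Integral

/-! ### Taylor expansion in one variable, with smooth parameters -/

section Hadamard

variable {Y W : Type} [NormedAddCommGroup Y] [NormedSpace ℝ Y] [NormedAddCommGroup W]
  [NormedSpace ℝ W] [CompleteSpace W]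

/-- The linear map that sends `(ρ, y)` to the curve `s ↦ (s ρ, y)`. -/
noncomputable def scaleCurve (Y : Type) [NormedAddCommGroup Y] [NormedSpace ℝ Y] :
    ℝ × Y →L[ℝ] C(Icc (0 : ℝ) 1, ℝ × Y) :=
  LinearMap.mkContinuous
    { toFun := fun q => ⟨fun s => ((s : ℝ) * q.1, q.2), by fun_prop⟩
      map_add' := fun p q => by ext s <;> simp [mul_add]
      map_smul' := fun r q => by ext s <;> simp [mul_left_comm] } 1
    (fun q => by
      refine (ContinuousMap.norm_le _ (by positivity)).2 fun s => ?_
      simp only [LinearMap.coe_mk, AddHom.coe_mk, ContinuousMap.coe_mk, one_mul, Prod.norm_def]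
      refine max_le_max ?_ le_rfl
      rw [norm_mul]
      refine mul_le_of_le_one_left (norm_nonneg _) ?_
      rw [Real.norm_eq_abs, abs_of_nonneg s.2.1]; exact s.2.2)

theorem scaleCurve_apply (q : ℝ × Y) (s : Icc (0 : ℝ) 1) :
    scaleCurve Y q s = ((s : ℝ) * q.1, q.2) := rfl

/-- **Hadamard's lemma** in the first variable, with smooth dependence on parameters. -/
theorem exists_hadamard {𝒰 : Set (ℝ × Y)} (hU : IsOpen 𝒰)
    (hstar : ∀ q ∈ 𝒰, ∀ s ∈ Icc (0 : ℝ) 1, (s * q.1, q.2) ∈ 𝒰) {g : ℝ × Y → W}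
    (hg : ContDiffOn ℝ ∞ g 𝒰) :
    ∃ R : ℝ × Y → W, ContDiffOn ℝ ∞ R 𝒰 ∧ ∀ q ∈ 𝒰, g q = g (0, q.2) + q.1 • R q := by
  set D : ℝ × Y → W := fun q => fderiv ℝ g q (1, 0) with hD
  have hDs : ContDiffOn ℝ ∞ D 𝒰 := (hg.fderiv_of_isOpen hU le_rfl).clm_apply contDiffOn_const
  have hmap : ∀ q ∈ 𝒰, scaleCurve Y q ∈ mapsInto (Icc (0 : ℝ) 1) 𝒰 :=
    fun q hq s => hstar q hq s s.2
  -- The remainder is the integral of `∂₁ g (s ρ, y)` over `s` in `[0, 1]`. As a function of `(ρ,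
  -- y)` it is a linear map into curves, then the smooth composition operator, then a continuous
  -- linear functional, so it is smooth without differentiation under the integral sign.
  refine ⟨fun q => integralIcc zero_le_one 0 1 (compOp D (scaleCurve Y q)), ?_, fun q hq => ?_⟩
  · exact (integralIcc zero_le_one 0 1).contDiff.comp_contDiffOn
      ((contDiffOn_compOp hU hDs).comp (scaleCurve Y).contDiff.contDiffOn hmap)
  · have hderiv : ∀ s ∈ uIcc (0 : ℝ) 1,
        HasDerivAt (fun s : ℝ => g (s * q.1, q.2)) (q.1 • D (s * q.1, q.2)) s := by
      intro s hs
      rw [uIcc_of_le zero_le_one] at hs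
      have h1 : HasFDerivAt g (fderiv ℝ g (s * q.1, q.2)) (s * q.1, q.2) :=
        ((hg.differentiableOn (by simp)).differentiableAt
          (hU.mem_nhds (hstar q hq s hs))).hasFDerivAt
      have h2 : HasDerivAt (fun s : ℝ => (s * q.1, q.2)) (q.1, (0 : Y)) s := by
        have := (hasDerivAt_id s).mul_const q.1
        simp only [one_mul] at this
        exact this.prodMk (hasDerivAt_const _ _)
      have h3 := h1.comp_hasDerivAt s h2
      have e : (q.1, (0 : Y)) = q.1 • ((1 : ℝ), (0 : Y)) := by simp
      rw [e, map_smul] at h3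
      exact h3
    have hcont : ContinuousOn (fun s : ℝ => q.1 • D (s * q.1, q.2)) (uIcc 0 1) := by
      refine continuousOn_const.smul (hDs.continuousOn.comp (by fun_prop) fun s hs => ?_)
      rw [uIcc_of_le zero_le_one] at hs
      exact hstar q hq s hs
    have h := intervalIntegral.integral_eq_sub_of_hasDerivAt hderiv hcont.intervalIntegrable
    simp only [one_mul, zero_mul] at h
    beta_reduce
    rw [integralIcc_apply, ← intervalIntegral.integral_smul]
    rw [eq_comm, ← eq_sub_iff_add_eq', show g q = g (q.1, q.2) from rfl, ← h]
    refine intervalIntegral.integral_congr fun s hs => ?_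
    rw [uIcc_of_le zero_le_one] at hs
    rw [compOp_apply hDs.continuousOn (hmap q hq), scaleCurve_apply, projIcc_of_mem _ hs]

/-- Taylor's formula in the first variable, with smooth dependence on parameters. -/
theorem exists_taylor {𝒰 : Set (ℝ × Y)} (hU : IsOpen 𝒰)
    (hstar : ∀ q ∈ 𝒰, ∀ s ∈ Icc (0 : ℝ) 1, (s * q.1, q.2) ∈ 𝒰) {g : ℝ × Y → W}
    (hg : ContDiffOn ℝ ∞ g 𝒰) (d : ℕ) :
    ∃ (c : ℕ → Y → W) (R : ℝ × Y → W), (∀ j, ContDiffOn ℝ ∞ (c j) {y | (0, y) ∈ 𝒰}) ∧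
      ContDiffOn ℝ ∞ R 𝒰 ∧
      ∀ q ∈ 𝒰, g q = ∑ j ∈ Finset.range d, q.1 ^ j • c j q.2 + q.1 ^ d • R q := by
  induction d with
  | zero => exact ⟨0, g, fun j => contDiffOn_const, hg, fun q _ => by simp⟩
  | succ d ih =>
    obtain ⟨c, R, hc, hR, h⟩ := ih
    obtain ⟨R', hR', h'⟩ := exists_hadamard hU hstar hR
    -- Hadamard's lemma splits the old remainder: its value at `ρ = 0` is the new coefficient.
    refine ⟨fun j => if j = d then fun y => R (0, y) else c j, R', fun j => ?_, hR', fun q hq => ?_⟩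
    · by_cases hj : j = d
      · simp only [hj, if_true]
        exact hR.comp (by fun_prop) fun y hy => hy
      · simpa [hj] using hc j
    · rw [h q hq, h' q hq, Finset.sum_range_succ]
      have : ∑ j ∈ Finset.range d, q.1 ^ j • (if j = d then fun y => R (0, y) else c j) q.2
          = ∑ j ∈ Finset.range d, q.1 ^ j • c j q.2 :=
        Finset.sum_congr rfl fun j hj => by
          rw [if_neg (Finset.mem_range.1 hj).ne]
      rw [this]
      simp only [if_true, smul_add, smul_smul, pow_succ]
      abel

/-- The coefficients of a polynomial that is `O(ρ^d)` as `ρ → 0+` vanish below degree `d`. -/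
theorem eq_zero_of_poly_isBigO {W : Type} [NormedAddCommGroup W] [NormedSpace ℝ W] (d : ℕ)
    (c : ℕ → W)
    (h : (fun ρ : ℝ => ∑ j ∈ Finset.range d, ρ ^ j • c j) =O[𝓝[>] 0] fun ρ : ℝ => ρ ^ d) :
    ∀ j < d, c j = 0 := by
  induction d generalizing c with
  | zero => intro j hj; omega
  | succ d ih =>
    have h0 : c 0 = 0 := by
      have t1 : Tendsto (fun ρ : ℝ => ∑ j ∈ Finset.range (d + 1), ρ ^ j • c j) (𝓝[>] 0)
          (𝓝 (∑ j ∈ Finset.range (d + 1), (0 : ℝ) ^ j • c j)) :=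
        ((continuous_finsetSum _ fun j _ => by fun_prop).tendsto 0).mono_left nhdsWithin_le_nhds
      have t2 : Tendsto (fun ρ : ℝ => ρ ^ (d + 1)) (𝓝[>] 0) (𝓝 0) := by
        have : Continuous (fun ρ : ℝ => ρ ^ (d + 1)) := by fun_prop
        simpa using (this.tendsto 0).mono_left nhdsWithin_le_nhds
      have := tendsto_nhds_unique t1 (h.trans_tendsto t2)
      simpa [Finset.sum_range_succ'] using this
    have h1 := ih (fun j => c (j + 1)) (by
      have hpos : ∀ᶠ ρ : ℝ in 𝓝[>] 0, ρ ≠ 0 := by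
        filter_upwards [self_mem_nhdsWithin] with ρ hρ using ne_of_gt hρ
      obtain ⟨K, hK⟩ := h.bound
      refine Asymptotics.IsBigO.of_bound K ?_
      filter_upwards [hK, hpos] with ρ h1 h2
      have e : ∑ j ∈ Finset.range (d + 1), ρ ^ j • c j
          = ρ • ∑ j ∈ Finset.range d, ρ ^ j • c (j + 1) := by
        rw [Finset.sum_range_succ', h0, Finset.smul_sum]
        simp [pow_succ', smul_smul]
      rw [e, norm_smul, pow_succ', norm_mul, mul_left_comm] at h1
      exact le_of_mul_le_mul_left h1 (norm_pos_iff.2 h2))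
    intro j hj
    rcases j with _ | j
    · exact h0
    · exact h1 j (by omega)

end Hadamard

/-! ### Uniform bounds on slices -/

section Slices

variable {P Y W : Type} [NormedAddCommGroup P] [NormedSpace ℝ P] [NormedAddCommGroup Y]
  [NormedSpace ℝ Y] [NormedAddCommGroup W] [NormedSpace ℝ W]

theorem norm_iteratedFDeriv_slice_le {𝒰 : Set (P × Y)} (hU : IsOpen 𝒰) {F : P × Y → W}
    (hF : ContDiffOn ℝ ∞ F 𝒰) (r : ℕ) {p : P} {y : Y} (hy : (p, y) ∈ 𝒰) :
    ‖iteratedFDeriv ℝ r (fun y => F (p, y)) y‖ ≤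
      ‖iteratedFDeriv ℝ r F (p, y)‖ * ∏ _i : Fin r, ‖ContinuousLinearMap.inr ℝ P Y‖ := by
  set f : P × Y → W := fun z => F ((p, 0) + z)
  set s : Set (P × Y) := (fun z => ((p, 0) : P × Y) + z) ⁻¹' 𝒰
  have hs : IsOpen s := hU.preimage (by fun_prop)
  have hf : ContDiffOn ℝ r f s :=
    (hF.of_le (by exact_mod_cast le_top)).comp (by fun_prop) fun z hz => hz
  have hs' : IsOpen ((ContinuousLinearMap.inr ℝ P Y) ⁻¹' s) :=
    hs.preimage (ContinuousLinearMap.inr ℝ P Y).continuous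
  have hx : ContinuousLinearMap.inr ℝ P Y y ∈ s := by simpa [s] using hy
  have e : (fun y => F (p, y)) = f ∘ (ContinuousLinearMap.inr ℝ P Y) := by
    funext y; simp [f]
  have h := (ContinuousLinearMap.inr ℝ P Y).iteratedFDerivWithin_comp_right hf hs.uniqueDiffOn
    hs'.uniqueDiffOn hx le_rfl
  rw [iteratedFDerivWithin_of_isOpen r hs' hx, iteratedFDerivWithin_of_isOpen r hs hx, ← e,
    iteratedFDeriv_comp_add_left] at h
  rw [h]
  refine (ContinuousMultilinearMap.norm_compContinuousLinearMap_le _ _).trans ?_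
  simp

/-- This is the origin of all uniform constants: the derivatives of the joint function are
continuous, hence bounded on the compact set, and those of a slice are restrictions of them to the
directions of `Y`. -/
theorem exists_bound_slice {𝒰 : Set (P × Y)} (hU : IsOpen 𝒰) {F : P × Y → W}
    (hF : ContDiffOn ℝ ∞ F 𝒰) {𝒦 : Set (P × Y)} (hK : IsCompact 𝒦) (hKU : 𝒦 ⊆ 𝒰) :
    ∃ C : ℕ → ℝ, ∀ r p y, (p, y) ∈ 𝒦 → ‖iteratedFDeriv ℝ r (fun y => F (p, y)) y‖ ≤ C r := by
  have : ∀ r : ℕ, ∃ C : ℝ, ∀ q ∈ 𝒦, ‖iteratedFDeriv ℝ r F q‖ ≤ C := fun r => by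
    have h1 : ContinuousOn (iteratedFDeriv ℝ r F) 𝒰 :=
      (hF.continuousOn_iteratedFDerivWithin (m := r) (by exact_mod_cast le_top)
        hU.uniqueDiffOn).congr fun q hq => (iteratedFDerivWithin_of_isOpen r hU hq).symm
    exact hK.exists_bound_of_continuousOn (h1.mono hKU)
  choose C hC using this
  refine ⟨fun r => C r * ∏ _i : Fin r, ‖ContinuousLinearMap.inr ℝ P Y‖, fun r p y h => ?_⟩
  exact (norm_iteratedFDeriv_slice_le hU hF r (hKU h)).trans
    (mul_le_mul_of_nonneg_right (hC r _ h) (Finset.prod_nonneg fun _ _ => norm_nonneg _))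

end Slices

/-! ### Smooth families over the sphere -/

theorem SmoothOnSphere.mono {n : ℕ} {W : Type*} [NormedAddCommGroup W] [NormedSpace ℝ W]
    {C C' : ℕ → ℝ} {f : EuclideanSpace ℝ (Fin (n + 1)) → W} (h : SmoothOnSphere C f)
    (hC : ∀ r, C r ≤ C' r) : SmoothOnSphere C' f :=
  ⟨h.1, fun r x hx => (h.2 r x hx).trans (hC r)⟩

theorem QuadraticOp.mono {n : ℕ} {J W : Type*} [NormedAddCommGroup J] [NormedSpace ℝ J]
    [NormedAddCommGroup W] [NormedSpace ℝ W] {C C' : ℕ → ℝ} {δ δ' : ℝ}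
    {q : EuclideanSpace ℝ (Fin (n + 1)) × J → W} (h : QuadraticOp C δ q)
    (hC : ∀ r, C r ≤ C' r) (hδ : δ' ≤ δ) : QuadraticOp C' δ' q :=
  ⟨h.1.mono (prod_mono_right (Metric.ball_subset_ball hδ)),
    fun r x ξ hx hξ => (h.2.1 r x ξ hx (hξ.trans_le hδ)).trans (hC r), h.2.2⟩

/-- The radial projection to the unit sphere. -/
noncomputable def radial {m : ℕ} (x : EuclideanSpace ℝ (Fin m)) : EuclideanSpace ℝ (Fin m) :=
  ‖x‖⁻¹ • x

theorem norm_radial {m : ℕ} {x : EuclideanSpace ℝ (Fin m)} (hx : x ≠ 0) : ‖radial x‖ = 1 := by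
  rw [radial, norm_smul, norm_inv, norm_norm, inv_mul_cancel₀ (norm_ne_zero_iff.2 hx)]

theorem radial_eq {m : ℕ} {x : EuclideanSpace ℝ (Fin m)} (hx : ‖x‖ = 1) : radial x = x := by
  simp [radial, hx]

theorem contDiffOn_radial {m : ℕ} :
    ContDiffOn ℝ ∞ (radial : EuclideanSpace ℝ (Fin m) → _) {0}ᶜ := fun _ hx =>
  ((contDiffAt_norm ℝ hx).inv (norm_ne_zero_iff.2 hx) |>.smul contDiffAt_id).contDiffWithinAt

theorem isBigO_one_of_continuousOn {Y W : Type} [NormedAddCommGroup Y] [NormedAddCommGroup W]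
    {u : Set Y} {ε : ℝ} (hε : 0 < ε) {R : ℝ × Y → W} (hR : ContinuousOn R (Ioo (-ε) ε ×ˢ u)) {y : Y}
    (hy : y ∈ u) : (fun ρ : ℝ => R (ρ, y)) =O[𝓝[>] 0] fun _ => (1 : ℝ) := by
  have h1 : ContinuousOn (fun ρ : ℝ => R (ρ, y)) (Ioo (-ε) ε) :=
    hR.comp (by fun_prop) fun ρ hρ => ⟨hρ, hy⟩
  have h2 : ContinuousAt (fun ρ : ℝ => R (ρ, y)) 0 :=
    h1.continuousAt (Ioo_mem_nhds (by linarith) hε)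
  exact (h2.tendsto.mono_left nhdsWithin_le_nhds).isBigO_one ℝ

/-- A smooth family of functions with a prescribed pointwise expansion in `ρ` has a remainder that
is uniformly smooth. -/
theorem exists_uniform_remainder {n : ℕ} {Λ W : Type} [NormedAddCommGroup Λ] [NormedSpace ℝ Λ]
    [NormedAddCommGroup W] [NormedSpace ℝ W] [CompleteSpace W] {K : Set Λ} (hK : IsCompact K)
    {u : Set (Λ × EuclideanSpace ℝ (Fin (n + 1)))} (hu : IsOpen u)
    (hKu : ∀ l ∈ K, ∀ x, x ≠ 0 → (l, x) ∈ u) {ε : ℝ} (hε : 0 < ε)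
    {g : ℝ × Λ × EuclideanSpace ℝ (Fin (n + 1)) → W} (hg : ContDiffOn ℝ ∞ g (Ioo (-ε) ε ×ˢ u))
    (d : ℕ) {a : ℕ → Λ → EuclideanSpace ℝ (Fin (n + 1)) → W}
    (ha : ∀ l ∈ K, ∀ x, ‖x‖ = 1 →
      (fun ρ : ℝ => g (ρ, l, x) - ∑ i ∈ Finset.range d, ρ ^ i • a i l x)
        =O[𝓝[>] 0] fun ρ : ℝ => ρ ^ d) :
    ∃ C : ℕ → ℝ, ∀ l ∈ K, ∀ ρ, 0 < ρ → ρ < ε / 2 →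
      ∃ O : EuclideanSpace ℝ (Fin (n + 1)) → W, SmoothOnSphere C O ∧ ∀ x, ‖x‖ = 1 →
        g (ρ, l, x) = ∑ i ∈ Finset.range d, ρ ^ i • a i l x + ρ ^ d • O x := by
  have hstar : ∀ q ∈ (Ioo (-ε) ε ×ˢ u : Set (ℝ × _)), ∀ s ∈ Icc (0 : ℝ) 1,
      (s * q.1, q.2) ∈ (Ioo (-ε) ε ×ˢ u : Set (ℝ × _)) := by
    rintro ⟨r, y⟩ ⟨hr, hy⟩ s ⟨hs0, hs1⟩
    refine ⟨?_, hy⟩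
    simp only [mem_Ioo] at hr ⊢
    constructor <;> nlinarith
  obtain ⟨c, R, hc, hR, h⟩ := exists_taylor (isOpen_Ioo.prod hu) hstar hg d
  have hnz : ∀ x : EuclideanSpace ℝ (Fin (n + 1)), ‖x‖ = 1 → x ≠ 0 := fun x hx => by
    rintro rfl; simp at hx
  -- The prescribed expansion and Taylor's formula differ by a polynomial in `ρ` that is `O(ρ^d)`,
  -- so their coefficients agree at every point. In particular no regularity of `a` in `l` and `x`
  -- has to be assumed.
  have hca : ∀ l ∈ K, ∀ x, ‖x‖ = 1 → ∀ j < d, c j (l, x) = a j l x := by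
    intro l hl x hx j hj
    have hy : (l, x) ∈ u := hKu l hl x (hnz x hx)
    refine sub_eq_zero.1 (eq_zero_of_poly_isBigO d (fun j => c j (l, x) - a j l x) ?_ j hj)
    have h1 : (fun ρ : ℝ => ρ ^ d • R (ρ, l, x)) =O[𝓝[>] 0] fun ρ : ℝ => ρ ^ d := by
      simpa using (Asymptotics.isBigO_refl (fun ρ : ℝ => ρ ^ d) (𝓝[>] 0)).smul
        (isBigO_one_of_continuousOn hε hR.continuousOn hy)
    refine ((ha l hl x hx).sub h1).congr' ?_ EventuallyEq.rfl
    have : Ioo (-ε) ε ∈ 𝓝[>] (0 : ℝ) := nhdsWithin_le_nhds (Ioo_mem_nhds (by linarith) hε)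
    filter_upwards [this] with ρ hρ
    rw [h (ρ, l, x) ⟨hρ, hy⟩]
    simp only [smul_sub, Finset.sum_sub_distrib]
    abel
  -- The variables are regrouped so that `(ρ, l)` is the parameter and `x` the variable of the
  -- slice.
  set U' : Set ((ℝ × Λ) × EuclideanSpace ℝ (Fin (n + 1))) :=
    (fun q => (q.1.1, q.1.2, q.2)) ⁻¹' (Ioo (-ε) ε ×ˢ u)
  have hU' : IsOpen U' := (isOpen_Ioo.prod hu).preimage (by fun_prop)
  have hF : ContDiffOn ℝ ∞ (fun q : (ℝ × Λ) × EuclideanSpace ℝ (Fin (n + 1)) =>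
      R (q.1.1, q.1.2, q.2)) U' := hR.comp (by fun_prop) fun q hq => hq
  obtain ⟨C, hC⟩ := exists_bound_slice hU' hF
    (𝒦 := (Icc (-(ε / 2)) (ε / 2) ×ˢ K) ×ˢ Metric.sphere 0 1)
    ((isCompact_Icc.prod hK).prod (isCompact_sphere _ _)) (by
      rintro ⟨⟨r, l⟩, x⟩ ⟨⟨hr, hl⟩, hx⟩
      simp only [mem_sphere_iff_norm, sub_zero] at hx
      simp only [mem_Icc] at hr
      exact ⟨⟨by dsimp only; linarith, by dsimp only; linarith⟩, hKu l hl x (hnz x hx)⟩)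
  refine ⟨C, fun l hl ρ h0 h1 => ⟨fun x => R (ρ, l, x), ⟨?_, fun r x hx => ?_⟩, fun x hx => ?_⟩⟩
  · exact hR.comp (by fun_prop) fun x hx => ⟨⟨by linarith, by linarith⟩, hKu l hl x hx⟩
  · exact hC r (ρ, l) x ⟨⟨⟨by dsimp only; linarith, by dsimp only; linarith⟩, hl⟩, by simpa using hx⟩
  · rw [h (ρ, l, x) ⟨⟨by dsimp only; linarith, by dsimp only; linarith⟩, hKu l hl x (hnz x hx)⟩]
    simp only
    congr 1
    exact Finset.sum_congr rfl fun j hj => by rw [hca l hl x hx j (Finset.mem_range.1 hj)]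

/-- A smooth family of nonlinear functions of a jet, of which the value and the derivative at the
zero jet have prescribed pointwise expansions in `ρ`, is the sum of these expansions and of
uniformly smooth error terms. -/
theorem exists_expansion {n : ℕ} {Λ J W : Type} [NormedAddCommGroup Λ] [NormedSpace ℝ Λ]
    [NormedAddCommGroup J] [NormedSpace ℝ J] [FiniteDimensional ℝ J]
    [NormedAddCommGroup W] [NormedSpace ℝ W] [CompleteSpace W] {K : Set Λ} (hK : IsCompact K)
    {𝒰 : Set (ℝ × Λ × EuclideanSpace ℝ (Fin (n + 1)) × J)} (hU : IsOpen 𝒰)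
    (hKU : ∀ l ∈ K, ∀ x, ‖x‖ = 1 → (0, l, x, 0) ∈ 𝒰)
    {f : ℝ × Λ × EuclideanSpace ℝ (Fin (n + 1)) × J → W} (hf : ContDiffOn ℝ ∞ f 𝒰) (d₀ d₁ : ℕ)
    {a : ℕ → Λ → EuclideanSpace ℝ (Fin (n + 1)) → W}
    {b : ℕ → Λ → EuclideanSpace ℝ (Fin (n + 1)) → J → W}
    (ha : ∀ l ∈ K, ∀ x, ‖x‖ = 1 →
      (fun ρ : ℝ => f (ρ, l, x, 0) - ∑ i ∈ Finset.range d₀, ρ ^ i • a i l x)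
        =O[𝓝[>] 0] fun ρ : ℝ => ρ ^ d₀)
    (hb : ∀ l ∈ K, ∀ x, ‖x‖ = 1 → ∀ ξ,
      (fun ρ : ℝ => fderiv ℝ (fun ξ => f (ρ, l, x, ξ)) 0 ξ
        - ∑ i ∈ Finset.range d₁, ρ ^ i • b i l x ξ) =O[𝓝[>] 0] fun ρ : ℝ => ρ ^ d₁) :
    ∃ ρ₀ > 0, ∃ δ > 0, ∃ C : ℕ → ℝ, ∀ l ∈ K, ∀ ρ, 0 < ρ → ρ < ρ₀ →
      ∃ (O : EuclideanSpace ℝ (Fin (n + 1)) → W) (L : EuclideanSpace ℝ (Fin (n + 1)) → J →L[ℝ] W)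
        (Q : EuclideanSpace ℝ (Fin (n + 1)) × J → W),
        SmoothOnSphere C O ∧ SmoothOnSphere C L ∧ QuadraticOp C δ Q ∧
        ∀ x ξ, ‖x‖ = 1 → ‖ξ‖ < δ →
          f (ρ, l, x, ξ) = ∑ i ∈ Finset.range d₀, ρ ^ i • a i l x + ρ ^ d₀ • O x
            + ∑ i ∈ Finset.range d₁, ρ ^ i • b i l x ξ + ρ ^ d₁ • L x ξ + Q (x, ξ) := by
  let V := EuclideanSpace ℝ (Fin (n + 1))
  have hnz : ∀ x : V, ‖x‖ = 1 → x ≠ 0 := fun x hx => by rintro rfl; simp at hx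
  -- a product neighbourhood
  obtain ⟨u, v, hu, hv, hKu, h0v, huv⟩ := generalized_tube_lemma
    (s := K ×ˢ Metric.sphere (0 : V) 1) (hK.prod (isCompact_sphere _ _))
    (t := {((0 : ℝ), (0 : J))}) isCompact_singleton
    (n := (fun q : (Λ × V) × (ℝ × J) => (q.2.1, q.1.1, q.1.2, q.2.2)) ⁻¹' 𝒰)
    (hU.preimage (by fun_prop)) (by
      rintro ⟨⟨l, x⟩, r, ξ⟩ ⟨⟨hl, hx⟩, hr⟩
      obtain ⟨rfl, rfl⟩ := Prod.mk.inj (show (r, ξ) = (0, 0) from hr)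
      exact hKU l hl x (by simpa using hx))
  obtain ⟨ε, hε, hball⟩ := Metric.isOpen_iff.1 hv _ (h0v rfl)
  -- Error terms have to be smooth on the complement of the origin, not only on the sphere;
  -- composition with the radial projection provides this extension.
  set u' : Set (Λ × V) := {q | q.2 ∈ ({0}ᶜ : Set V) ∧ (q.1, radial q.2) ∈ u} with hu'
  have hop : IsOpen ((univ : Set Λ) ×ˢ ({0}ᶜ : Set V)) := isOpen_univ.prod isOpen_compl_singleton
  have hu'o : IsOpen u' := by
    have : ContinuousOn (fun q : Λ × V => (q.1, radial q.2)) (univ ×ˢ {0}ᶜ) :=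
      continuousOn_fst.prodMk (contDiffOn_radial.continuousOn.comp continuousOn_snd fun q hq => hq.2)
    convert! this.isOpen_inter_preimage hop hu using 1
    ext q; simp [hu']
  have hKu' : ∀ l ∈ K, ∀ x : V, x ≠ 0 → (l, x) ∈ u' := fun l hl x hx =>
    ⟨hx, hKu ⟨hl, by simpa using norm_radial hx⟩⟩
  have hmem : ∀ (ρ : ℝ) (q : Λ × V) (ξ : J), ρ ∈ Ioo (-ε) ε → q ∈ u' → ‖ξ‖ < ε →
      (ρ, q.1, radial q.2, ξ) ∈ 𝒰 := fun ρ q ξ hρ hq hξ => by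
    refine huv (a := ((q.1, radial q.2), (ρ, ξ))) ⟨hq.2, hball ?_⟩
    simp only [Metric.mem_ball, Prod.dist_eq, max_lt_iff, dist_zero_right]
    exact ⟨abs_lt.2 hρ, hξ⟩
  -- the family, made homogeneous of degree zero
  set F : (ℝ × Λ × V) × J → W := fun q => f (q.1.1, q.1.2.1, radial q.1.2.2, q.2) with hFdef
  set 𝒱 : Set (ℝ × Λ × V) := Ioo (-ε) ε ×ˢ u' with h𝒱
  have h𝒱o : IsOpen 𝒱 := isOpen_Ioo.prod hu'o
  have hFo : IsOpen (𝒱 ×ˢ Metric.ball (0 : J) ε) := h𝒱o.prod Metric.isOpen_ball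
  have hF : ContDiffOn ℝ ∞ F (𝒱 ×ˢ Metric.ball (0 : J) ε) := by
    refine hf.comp ?_ fun q hq => hmem _ _ _ hq.1.1 hq.1.2 (by simpa using hq.2)
    refine ContDiffOn.prodMk (by fun_prop) (ContDiffOn.prodMk (by fun_prop)
      (ContDiffOn.prodMk (contDiffOn_radial.comp (by fun_prop) fun q hq => hq.1.2.1) (by fun_prop)))
  have hF0 : ContDiffOn ℝ ∞ (fun q => F (q, 0)) 𝒱 :=
    hF.comp (by fun_prop) fun q hq => ⟨hq, Metric.mem_ball_self hε⟩
  set D : ℝ × Λ × V → (J →L[ℝ] W) := fun q =>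
    (fderiv ℝ F (q, 0)).comp (ContinuousLinearMap.inr ℝ (ℝ × Λ × V) J) with hDdef
  have hD : ContDiffOn ℝ ∞ D 𝒱 := by
    have : ContDiffOn ℝ ∞ (fun q : ℝ × Λ × V => fderiv ℝ F (q, 0)) 𝒱 :=
      (hF.fderiv_of_isOpen hFo le_rfl).comp (by fun_prop) fun q hq => ⟨hq, Metric.mem_ball_self hε⟩
    exact this.clm_comp contDiffOn_const
  have hDF : ∀ q ∈ 𝒱, HasFDerivAt (fun ξ => F (q, ξ)) (D q) 0 := fun q hq => by
    have h1 : HasFDerivAt F (fderiv ℝ F (q, 0)) (q, 0) :=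
      ((hF.differentiableOn (by simp)).differentiableAt
        (hFo.mem_nhds ⟨hq, Metric.mem_ball_self hε⟩)).hasFDerivAt
    have h2 : HasFDerivAt (fun ξ : J => (q, ξ)) (ContinuousLinearMap.inr ℝ (ℝ × Λ × V) J) 0 :=
      hasFDerivAt_prodMk_right q 0
    exact h1.comp (0 : J) h2
  have hmem0 : ∀ l ∈ K, ∀ x : V, ‖x‖ = 1 → ∀ᶠ ρ : ℝ in 𝓝[>] 0, (ρ, l, x) ∈ 𝒱 := by
    intro l hl x hx
    filter_upwards [nhdsWithin_le_nhds (Ioo_mem_nhds (show -ε < 0 by linarith) hε)] with ρ hρ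
    exact ⟨hρ, hKu' l hl x (hnz x hx)⟩
  obtain ⟨C₁, hC₁⟩ := exists_uniform_remainder hK hu'o hKu' hε hF0 d₀ (a := a)
    (by intro l hl x hx; simpa [hFdef, radial_eq hx] using ha l hl x hx)
  -- The linear part takes values in a space of operators, while `b` is prescribed separately for
  -- each `ξ`. It is first expanded with Taylor coefficients that are operators, and these are
  -- identified with `b` after evaluation at `ξ`.
  obtain ⟨C₂, hC₂⟩ : ∃ C : ℕ → ℝ, ∀ l ∈ K, ∀ ρ, 0 < ρ → ρ < ε / 2 →
      ∃ L : V → J →L[ℝ] W, SmoothOnSphere C L ∧ ∀ x, ‖x‖ = 1 → ∀ ξ,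
        D (ρ, l, x) ξ = ∑ i ∈ Finset.range d₁, ρ ^ i • b i l x ξ + ρ ^ d₁ • L x ξ := by
    have hstar : ∀ q ∈ 𝒱, ∀ s ∈ Icc (0 : ℝ) 1, (s * q.1, q.2) ∈ 𝒱 := by
      rintro ⟨r, y⟩ ⟨hr, hy⟩ s ⟨hs0, hs1⟩
      refine ⟨?_, hy⟩
      simp only [mem_Ioo] at hr ⊢
      constructor <;> nlinarith
    obtain ⟨c, R, hc, hR, h⟩ := exists_taylor h𝒱o hstar hD d₁
    have hbO : ∀ l ∈ K, ∀ x, ‖x‖ = 1 → (fun ρ : ℝ => D (ρ, l, x)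
        - ∑ i ∈ Finset.range d₁, ρ ^ i • c i (l, x)) =O[𝓝[>] 0] fun ρ : ℝ => ρ ^ d₁ := by
      intro l hl x hx
      have hy : (l, x) ∈ u' := hKu' l hl x (hnz x hx)
      have h1 : (fun ρ : ℝ => ρ ^ d₁ • R (ρ, l, x)) =O[𝓝[>] 0] fun ρ : ℝ => ρ ^ d₁ := by
        simpa using (Asymptotics.isBigO_refl (fun ρ : ℝ => ρ ^ d₁) (𝓝[>] 0)).smul
          (isBigO_one_of_continuousOn hε hR.continuousOn hy)
      refine h1.congr' ?_ EventuallyEq.rfl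
      filter_upwards [hmem0 l hl x hx] with ρ hρ
      rw [h (ρ, l, x) hρ]; simp
    have hcb : ∀ l ∈ K, ∀ x, ‖x‖ = 1 → ∀ j < d₁, ∀ ξ, c j (l, x) ξ = b j l x ξ := by
      intro l hl x hx j hj ξ
      refine sub_eq_zero.1 (eq_zero_of_poly_isBigO d₁ (fun j => c j (l, x) ξ - b j l x ξ) ?_ j hj)
      have h2 : (fun ρ : ℝ => (D (ρ, l, x) - ∑ i ∈ Finset.range d₁, ρ ^ i • c i (l, x)) ξ)
          =O[𝓝[>] 0] fun ρ : ℝ => ρ ^ d₁ := by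
        refine (Asymptotics.IsBigO.of_bound ‖ξ‖ (Eventually.of_forall fun ρ => ?_)).trans
          (hbO l hl x hx)
        rw [mul_comm]; exact ContinuousLinearMap.le_opNorm _ _
      refine ((hb l hl x hx ξ).sub h2).congr' ?_ EventuallyEq.rfl
      filter_upwards [hmem0 l hl x hx] with ρ hρ
      have : fderiv ℝ (fun ξ => f (ρ, l, x, ξ)) 0 = D (ρ, l, x) := by
        rw [← (hDF _ hρ).fderiv]; simp [hFdef, radial_eq hx]
      rw [this]
      simp only [smul_sub, Finset.sum_sub_distrib, _root_.sub_apply,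
        _root_.sum_apply, _root_.smul_apply]
      abel
    obtain ⟨C, hC⟩ := exists_uniform_remainder hK hu'o hKu' hε hD d₁
      (a := fun i l x => c i (l, x)) hbO
    refine ⟨C, fun l hl ρ h0 h1 => ?_⟩
    obtain ⟨L, hL, hL'⟩ := hC l hl ρ h0 h1
    refine ⟨L, hL, fun x hx ξ => ?_⟩
    rw [hL' x hx]
    simp only [_root_.add_apply, _root_.sum_apply,
      _root_.smul_apply]
    congr 1
    exact Finset.sum_congr rfl fun j hj => by rw [hcb l hl x hx j (Finset.mem_range.1 hj)]
  -- the quadratic term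
  set Q : (ℝ × Λ) × (V × J) → W := fun q =>
    F ((q.1.1, q.1.2, q.2.1), q.2.2) - F ((q.1.1, q.1.2, q.2.1), 0)
      - D (q.1.1, q.1.2, q.2.1) q.2.2 with hQdef
  set 𝒬 : Set ((ℝ × Λ) × (V × J)) :=
    (fun q => ((q.1.1, q.1.2, q.2.1), q.2.2)) ⁻¹' (𝒱 ×ˢ Metric.ball (0 : J) ε)
  have h𝒬 : IsOpen 𝒬 := hFo.preimage (by fun_prop)
  have hQ : ContDiffOn ℝ ∞ Q 𝒬 := by
    have hp : ContDiffOn ℝ ∞ (fun q : (ℝ × Λ) × (V × J) => (q.1.1, q.1.2, q.2.1)) 𝒬 := by fun_prop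
    have hp' : ContDiffOn ℝ ∞ (fun q : (ℝ × Λ) × (V × J) => ((q.1.1, q.1.2, q.2.1), q.2.2)) 𝒬 := by
      fun_prop
    refine ((hF.comp hp' fun q hq => hq).sub (hF0.comp hp fun q hq => hq.1)).sub ?_
    exact (hD.comp (f := fun q : (ℝ × Λ) × (V × J) => (q.1.1, q.1.2, q.2.1)) (by fun_prop)
        fun q hq => hq.1).clm_apply (by fun_prop)
  obtain ⟨C₃, hC₃⟩ := exists_bound_slice h𝒬 hQ
    (𝒦 := (Icc (-(ε / 2)) (ε / 2) ×ˢ K) ×ˢ (Metric.sphere 0 1 ×ˢ Metric.closedBall 0 (ε / 2)))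
    ((isCompact_Icc.prod hK).prod ((isCompact_sphere _ _).prod
      (have := FiniteDimensional.proper_real J; isCompact_closedBall _ _))) (by
      rintro ⟨⟨r, l⟩, x, ξ⟩ ⟨⟨hr, hl⟩, hx, hξ⟩
      simp only [mem_Icc] at hr
      refine ⟨⟨⟨by dsimp only; linarith, by dsimp only; linarith⟩,
        hKu' l hl x (hnz x (by simpa using hx))⟩, ?_⟩
      simp only [Metric.mem_ball, Metric.mem_closedBall] at hξ ⊢
      linarith)
  refine ⟨ε / 2, half_pos hε, ε / 2, half_pos hε, fun r => max (C₁ r) (max (C₂ r) (C₃ r)),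
    fun l hl ρ h0 h1 => ?_⟩
  obtain ⟨O, hO, hO'⟩ := hC₁ l hl ρ h0 h1
  obtain ⟨L, hL, hL'⟩ := hC₂ l hl ρ h0 h1
  have hρ : ρ ∈ Ioo (-ε) ε := ⟨by linarith, by linarith⟩
  refine ⟨O, L, fun y => Q ((ρ, l), y), hO.mono fun r => le_max_left _ _,
    hL.mono fun r => (le_max_left _ _).trans (le_max_right _ _), ⟨?_, ?_, ?_⟩, ?_⟩
  · refine hQ.comp (by fun_prop) fun y hy => ⟨⟨hρ, hKu' l hl _ hy.1⟩, ?_⟩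
    exact Metric.ball_subset_ball (by linarith) hy.2
  · intro r x ξ hx hξ
    refine (hC₃ r (ρ, l) (x, ξ) ⟨⟨⟨by dsimp only; linarith, by dsimp only; linarith⟩, hl⟩, ?_, ?_⟩).trans
      ((le_max_right _ _).trans (le_max_right _ _))
    · simpa using hx
    · simpa using hξ.le
  · intro x hx
    refine ⟨by simp [hQdef], ?_⟩
    have hq : (ρ, l, x) ∈ 𝒱 := ⟨hρ, hKu' l hl x (hnz x hx)⟩
    have h2 := ((hDF _ hq).sub_const (F ((ρ, l, x), 0))).sub (D (ρ, l, x)).hasFDerivAt (x := 0)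
    rw [sub_self] at h2
    exact h2.fderiv
  · intro x ξ hx hξ
    have e1 := hO' x hx
    have e2 := hL' x hx ξ
    have e3 : f (ρ, l, x, ξ) = F ((ρ, l, x), ξ) := by simp [hFdef, radial_eq hx]
    rw [e3, hQdef]
    simp only
    rw [e1, e2]
    abel

/-! ### Metrics on open subsets of Euclidean space -/

/-- `ℝᵐ`. -/
abbrev Euc (m : ℕ) : Type := EuclideanSpace ℝ (Fin m)

section Metric

variable {m : ℕ}

theorem inner_stdVec_right (x : Euc m) (i : Fin m) : inner ℝ x (stdVec i) = x i := by
  simp [stdVec, EuclideanSpace.inner_single_right]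

theorem inner_stdVec_left (x : Euc m) (i : Fin m) : inner ℝ (stdVec i) x = x i := by
  simp [stdVec, EuclideanSpace.inner_single_left]

theorem sum_smul_stdVec (x : Euc m) : ∑ i, x i • stdVec i = x := by
  ext j
  simp [stdVec, Pi.single_apply]

theorem inner_eq_sum (x y : Euc m) : inner ℝ x y = ∑ i, x i * y i := by
  simp [PiLp.inner_apply, mul_comm]

/-- `h` is on `U` the smooth Riemannian metric `⟨T u, v⟩`. -/
structure MetricOn (h : Euc m → Euc m → Euc m → ℝ) (T : Euc m → Euc m →L[ℝ] Euc m)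
    (U : Set (Euc m)) : Prop where
  isOpen : IsOpen U
  smooth : ContDiffOn ℝ ∞ T U
  eq : ∀ x ∈ U, ∀ u v, h x u v = inner ℝ (T x u) v
  symm : ∀ x ∈ U, ∀ u v, inner ℝ (T x u) v = inner ℝ (T x v) u
  pos : ∀ x ∈ U, ∀ u, u ≠ 0 → 0 < inner ℝ (T x u) u

/-- The Christoffel symbols of the first kind. -/
noncomputable def kos (T : Euc m → Euc m →L[ℝ] Euc m) (y u v a : Euc m) : ℝ :=
  (1 / 2 : ℝ) * (inner ℝ (fderiv ℝ T y u v) a + inner ℝ (fderiv ℝ T y v u) a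
    - inner ℝ (fderiv ℝ T y a u) v)

/-- The Christoffel symbols of the first kind, as a vector. -/
noncomputable def kosVec (T : Euc m → Euc m →L[ℝ] Euc m) (y u v : Euc m) : Euc m :=
  ∑ l, kos T y u v (stdVec l) • stdVec l

theorem inner_kosVec (T : Euc m → Euc m →L[ℝ] Euc m) (y u v a : Euc m) :
    inner ℝ (kosVec T y u v) a = kos T y u v a := by
  have h : kos T y u v a = ∑ l, a l * kos T y u v (stdVec l) := by
    conv_lhs => rw [← sum_smul_stdVec a]
    simp only [kos, map_sum, map_smul, inner_sum, inner_smul_right, _root_.sum_apply, sum_inner,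
      _root_.smul_apply, real_inner_smul_left, ← Finset.sum_add_distrib, ← Finset.sum_sub_distrib,
      Finset.mul_sum]
    exact Finset.sum_congr rfl fun i _ => by ring
  rw [h, kosVec, sum_inner]
  exact Finset.sum_congr rfl fun i _ => by
    rw [real_inner_smul_left, inner_stdVec_left, mul_comm]

namespace MetricOn

variable {h : Euc m → Euc m → Euc m → ℝ} {T : Euc m → Euc m →L[ℝ] Euc m} {U : Set (Euc m)}

theorem contDiffAt (H : MetricOn h T U) {x : Euc m} (hx : x ∈ U) : ContDiffAt ℝ ∞ T x :=
  H.smooth.contDiffAt (H.isOpen.mem_nhds hx)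

theorem hasFDerivAt (H : MetricOn h T U) {x : Euc m} (hx : x ∈ U) :
    HasFDerivAt T (fderiv ℝ T x) x :=
  ((H.contDiffAt hx).differentiableAt (by simp)).hasFDerivAt

theorem hasFDerivAt_inner (H : MetricOn h T U) {x : Euc m} (hx : x ∈ U) (u v : Euc m) :
    HasFDerivAt (fun y => inner ℝ (T y u) v)
      ((innerSL ℝ v).comp ((ContinuousLinearMap.apply ℝ (Euc m) u).comp (fderiv ℝ T x))) x := by
  have h1 : HasFDerivAt (fun y => innerSL ℝ v (ContinuousLinearMap.apply ℝ (Euc m) u (T y)))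
    ((innerSL ℝ v).comp ((ContinuousLinearMap.apply ℝ (Euc m) u).comp (fderiv ℝ T x))) x :=
    (innerSL ℝ v).hasFDerivAt.comp x
      ((ContinuousLinearMap.apply ℝ (Euc m) u).hasFDerivAt.comp x (H.hasFDerivAt hx))
  refine h1.congr_of_eventuallyEq (Eventually.of_forall fun y => ?_)
  simp [real_inner_comm]

theorem fderiv_eq (H : MetricOn h T U) {x : Euc m} (hx : x ∈ U) (u v w : Euc m) :
    fderiv ℝ (fun y => h y u v) x w = inner ℝ (fderiv ℝ T x w u) v := by
  have e : (fun y => h y u v) =ᶠ[𝓝 x] fun y => inner ℝ (T y u) v := by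
    filter_upwards [H.isOpen.mem_nhds hx] with y hy using H.eq y hy u v
  rw [e.fderiv_eq, (H.hasFDerivAt_inner hx u v).fderiv]
  simp [real_inner_comm]

theorem symm_fderiv (H : MetricOn h T U) {x : Euc m} (hx : x ∈ U) (u v w : Euc m) :
    inner ℝ (fderiv ℝ T x w u) v = inner ℝ (fderiv ℝ T x w v) u := by
  rw [← H.fderiv_eq hx, ← H.fderiv_eq hx]
  have e : (fun y => h y u v) =ᶠ[𝓝 x] fun y => h y v u := by
    filter_upwards [H.isOpen.mem_nhds hx] with y hy
    rw [H.eq y hy, H.eq y hy, H.symm y hy]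
  rw [e.fderiv_eq]

theorem injective (H : MetricOn h T U) {x : Euc m} (hx : x ∈ U) : Function.Injective (T x) := by
  refine (injective_iff_map_eq_zero _).2 fun u hu => ?_
  by_contra hne
  have := H.pos x hx u hne
  rw [hu, inner_zero_left] at this
  exact lt_irrefl _ this

theorem isUnit (H : MetricOn h T U) {x : Euc m} (hx : x ∈ U) : IsUnit (T x) := by
  rw [ContinuousLinearMap.isUnit_iff_bijective]
  exact ⟨H.injective hx, (LinearMap.injective_iff_surjective (f := (T x : Euc m →ₗ[ℝ] Euc m))).1
    (H.injective hx)⟩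

theorem inverse_apply (H : MetricOn h T U) {x : Euc m} (hx : x ∈ U) (u : Euc m) :
    T x (Ring.inverse (T x) u) = u := by
  have := Ring.mul_inverse_cancel _ (H.isUnit hx)
  exact congrArg (fun S : Euc m →L[ℝ] Euc m => S u) this

theorem inverse_apply' (H : MetricOn h T U) {x : Euc m} (hx : x ∈ U) (u : Euc m) :
    Ring.inverse (T x) (T x u) = u := by
  have := Ring.inverse_mul_cancel _ (H.isUnit hx)
  exact congrArg (fun S : Euc m →L[ℝ] Euc m => S u) this

theorem ext_inner (H : MetricOn h T U) {x : Euc m} (hx : x ∈ U) {u v : Euc m}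
    (huv : ∀ a, inner ℝ (T x u) a = inner ℝ (T x v) a) : u = v :=
  H.injective hx (ext_inner_right ℝ huv)

/-- A vector in the kernel of the Gram matrix would give a nonzero vector of length zero. -/
theorem isUnit_gram (H : MetricOn h T U) {x : Euc m} (hx : x ∈ U) : IsUnit (gram h x).det := by
  rw [← Matrix.isUnit_iff_isUnit_det, ← Matrix.mulVec_injective_iff_isUnit]
  refine (injective_iff_map_eq_zero (Matrix.mulVecLin (gram h x))).2 fun c hc => ?_
  have key : inner ℝ (T x (∑ j, c j • stdVec j)) (∑ i, c i • stdVec i)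
      = ∑ i, c i * (Matrix.mulVec (gram h x) c i) := by
    simp only [inner_sum, map_sum, sum_inner, map_smul, real_inner_smul_left, inner_smul_right,
      Matrix.mulVec, dotProduct, gram, Matrix.of_apply, H.eq x hx, Finset.mul_sum]
    refine Finset.sum_congr rfl fun i _ => Finset.sum_congr rfl fun j _ => ?_
    rw [H.symm x hx (stdVec i)]; ring
  have h0 : (∑ j, c j • (stdVec j : Euc m)) = 0 := by
    by_contra hne
    have h1 := H.pos x hx _ hne
    rw [key] at h1
    simp only [Matrix.mulVecLin_apply] at hc
    simp [hc] at h1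
  funext i
  have := congrArg (fun v : Euc m => v i) h0
  simpa [stdVec, Pi.single_apply] using this

/-- Pairing with the metric undoes the inverse Gram matrix in the definition of `christoffel`.
Symmetry, bilinearity, compatibility with the metric and smoothness of the Christoffel symbols are
all read off from this Koszul formula. -/
theorem koszul (H : MetricOn h T U) {x : Euc m} (hx : x ∈ U) (u v a : Euc m) :
    inner ℝ (T x (christoffel h x u v)) a = kos T x u v a := by
  have hstd : ∀ j, inner ℝ (T x (christoffel h x u v)) (stdVec j) = kos T x u v (stdVec j) := by
    intro j
    have h1 : ∀ l, (fderiv ℝ (fun y => h y v (stdVec l)) x u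
        + fderiv ℝ (fun y => h y u (stdVec l)) x v - fderiv ℝ (fun y => h y u v) x (stdVec l))
        = 2 * kos T x u v (stdVec l) := fun l => by
      rw [H.fderiv_eq hx, H.fderiv_eq hx, H.fderiv_eq hx, kos]; ring
    have h2 : ∀ k, inner ℝ (T x (stdVec k)) (stdVec j) = gram h x j k := fun k => by
      rw [gram, Matrix.of_apply, H.eq x hx, H.symm x hx]
    simp only [christoffel, h1, map_sum, map_smul, sum_inner, real_inner_smul_left, h2]
    have h3 := congrFun (congrArg (fun A => Matrix.mulVec A fun l => kos T x u v (stdVec l))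
      (Matrix.mul_nonsing_inv _ (H.isUnit_gram hx))) j
    simp only [← Matrix.mulVec_mulVec, Matrix.one_mulVec] at h3
    rw [← h3]
    simp only [Matrix.mulVec, dotProduct, Finset.mul_sum, Finset.sum_mul]
    refine Finset.sum_congr rfl fun k _ => Finset.sum_congr rfl fun l _ => by ring
  rw [← inner_kosVec, ← sum_smul_stdVec a]
  simp only [inner_sum, inner_smul_right, hstd, inner_kosVec]

theorem T_christoffel (H : MetricOn h T U) {x : Euc m} (hx : x ∈ U) (u v : Euc m) :
    T x (christoffel h x u v) = kosVec T x u v :=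
  ext_inner_right ℝ fun a => by rw [H.koszul hx, inner_kosVec]

theorem christoffel_eq (H : MetricOn h T U) {x : Euc m} (hx : x ∈ U) (u v : Euc m) :
    christoffel h x u v = Ring.inverse (T x) (kosVec T x u v) := by
  rw [← H.T_christoffel hx, H.inverse_apply' hx]

theorem christoffel_symm (H : MetricOn h T U) {x : Euc m} (hx : x ∈ U) (u v : Euc m) :
    christoffel h x u v = christoffel h x v u :=
  H.ext_inner hx fun a => by
    rw [H.koszul hx, H.koszul hx, kos, kos, H.symm_fderiv hx u v a]; ring

theorem christoffel_add (H : MetricOn h T U) {x : Euc m} (hx : x ∈ U) (u v v' : Euc m) :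
    christoffel h x u (v + v') = christoffel h x u v + christoffel h x u v' :=
  H.ext_inner hx fun a => by
    rw [map_add, inner_add_left, H.koszul hx, H.koszul hx, H.koszul hx, kos, kos, kos]
    simp only [map_add, _root_.add_apply, inner_add_left, inner_add_right]; ring

theorem christoffel_smul (H : MetricOn h T U) {x : Euc m} (hx : x ∈ U) (u v : Euc m) (r : ℝ) :
    christoffel h x u (r • v) = r • christoffel h x u v :=
  H.ext_inner hx fun a => by
    rw [map_smul, real_inner_smul_left, H.koszul hx, H.koszul hx, kos, kos]
    simp only [map_smul, _root_.smul_apply, real_inner_smul_left, inner_smul_right]; ring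

theorem christoffel_add_left (H : MetricOn h T U) {x : Euc m} (hx : x ∈ U) (u u' v : Euc m) :
    christoffel h x (u + u') v = christoffel h x u v + christoffel h x u' v := by
  rw [H.christoffel_symm hx, H.christoffel_add hx, H.christoffel_symm hx v,
    H.christoffel_symm hx v]

theorem christoffel_smul_left (H : MetricOn h T U) {x : Euc m} (hx : x ∈ U) (u v : Euc m) (r : ℝ) :
    christoffel h x (r • u) v = r • christoffel h x u v := by
  rw [H.christoffel_symm hx, H.christoffel_smul hx, H.christoffel_symm hx v]

/-- The Levi-Civita connection is compatible with the metric. -/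
theorem compat (H : MetricOn h T U) {x : Euc m} (hx : x ∈ U) (u v w : Euc m) :
    inner ℝ (fderiv ℝ T x w u) v = inner ℝ (T x (christoffel h x w u)) v
      + inner ℝ (T x (christoffel h x w v)) u := by
  rw [H.koszul hx, H.koszul hx, kos, kos, H.symm_fderiv hx v u w, H.symm_fderiv hx w v u,
    H.symm_fderiv hx w u v]
  ring

theorem contDiffOn_inverse (H : MetricOn h T U) :
    ContDiffOn ℝ ∞ (fun y => Ring.inverse (T y)) U := by
  intro x hx
  obtain ⟨t, ht⟩ := H.isUnit hx
  have h1 := contDiffAt_ringInverse ℝ (n := ∞) t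
  rw [ht] at h1
  exact h1.comp_contDiffWithinAt x (H.smooth x hx)

theorem contDiffOn_fderiv (H : MetricOn h T U) : ContDiffOn ℝ ∞ (fderiv ℝ T) U :=
  H.smooth.fderiv_of_isOpen H.isOpen le_rfl

theorem contDiffOn_kosVec (H : MetricOn h T U) {Z : Type*} [NormedAddCommGroup Z] [NormedSpace ℝ Z]
    {s : Set Z} {y u v : Z → Euc m} (hy : ContDiffOn ℝ ∞ y s) (hu : ContDiffOn ℝ ∞ u s)
    (hv : ContDiffOn ℝ ∞ v s) (hs : MapsTo y s U) :
    ContDiffOn ℝ ∞ (fun z => kosVec T (y z) (u z) (v z)) s := by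
  have hd : ContDiffOn ℝ ∞ (fun z => fderiv ℝ T (y z)) s := H.contDiffOn_fderiv.comp hy hs
  refine ContDiffOn.sum fun l _ => ContDiffOn.fun_smul (ContDiffOn.mul contDiffOn_const ?_)
    contDiffOn_const
  refine ContDiffOn.sub (ContDiffOn.add ?_ ?_) ?_
  · exact ((hd.clm_apply hu).clm_apply hv).inner ℝ contDiffOn_const
  · exact ((hd.clm_apply hv).clm_apply hu).inner ℝ contDiffOn_const
  · exact ((hd.clm_apply contDiffOn_const).clm_apply hu).inner ℝ hv

theorem contDiffOn_christoffel (H : MetricOn h T U) {Z : Type*} [NormedAddCommGroup Z]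
    [NormedSpace ℝ Z] {s : Set Z} {y u v : Z → Euc m} (hy : ContDiffOn ℝ ∞ y s)
    (hu : ContDiffOn ℝ ∞ u s) (hv : ContDiffOn ℝ ∞ v s) (hs : MapsTo y s U) :
    ContDiffOn ℝ ∞ (fun z => christoffel h (y z) (u z) (v z)) s := by
  have h1 : ContDiffOn ℝ ∞ (fun z => Ring.inverse (T (y z))) s := H.contDiffOn_inverse.comp hy hs
  exact (h1.clm_apply (H.contDiffOn_kosVec hy hu hv hs)).congr fun z hz =>
    H.christoffel_eq (hs hz) _ _

/-- The transformation law of the Christoffel symbols. -/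
theorem christoffel_pullback (H : MetricOn h T U) {h' : Euc m → Euc m → Euc m → ℝ}
    {T' : Euc m → Euc m →L[ℝ] Euc m} {U' : Set (Euc m)} (H' : MetricOn h' T' U') {x : Euc m}
    (hx : x ∈ U') {τ : Euc m → Euc m} (hτ : ContDiffAt ℝ 2 τ x) (hτx : τ x ∈ U)
    (hsurj : Function.Surjective (fderiv ℝ τ x))
    (heq : ∀ᶠ y in 𝓝 x, ∀ u v, h' y u v = h (τ y) (fderiv ℝ τ y u) (fderiv ℝ τ y v))
    (u v : Euc m) :
    fderiv ℝ τ x (christoffel h' x u v) = fderiv ℝ (fderiv ℝ τ) x u v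
      + christoffel h (τ x) (fderiv ℝ τ x u) (fderiv ℝ τ x v) := by
  have hd1 : HasFDerivAt τ (fderiv ℝ τ x) x :=
    (hτ.differentiableAt (by simp)).hasFDerivAt
  have hd2 : HasFDerivAt (fderiv ℝ τ) (fderiv ℝ (fderiv ℝ τ) x) x :=
    ((hτ.fderiv_right (m := 1) (by norm_num)).differentiableAt (by simp)).hasFDerivAt
  have hsym : IsSymmSndFDerivAt ℝ τ x := hτ.isSymmSndFDerivAt (by simp)
  have hTτ : HasFDerivAt (fun y => T (τ y)) ((fderiv ℝ T (τ x)).comp (fderiv ℝ τ x)) x :=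
    (H.hasFDerivAt hτx).comp x hd1
  have hnear : ∀ᶠ y in 𝓝 x, τ y ∈ U := hd1.continuousAt.eventually (H.isOpen.mem_nhds hτx)
  have hD : ∀ a b w, inner ℝ (fderiv ℝ T' x w a) b
      = inner ℝ (fderiv ℝ T (τ x) (fderiv ℝ τ x w) (fderiv ℝ τ x a)) (fderiv ℝ τ x b)
        + inner ℝ (T (τ x) (fderiv ℝ (fderiv ℝ τ) x w a)) (fderiv ℝ τ x b)
        + inner ℝ (T (τ x) (fderiv ℝ τ x a)) (fderiv ℝ (fderiv ℝ τ) x w b) := by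
    intro a b w
    rw [← H'.fderiv_eq hx]
    have e : (fun y => h' y a b) =ᶠ[𝓝 x]
        fun y => inner ℝ (T (τ y) (fderiv ℝ τ y a)) (fderiv ℝ τ y b) := by
      filter_upwards [heq, hnear] with y hy hy'
      rw [hy, H.eq _ hy']
    have hA : ∀ a, HasFDerivAt (fun y => fderiv ℝ τ y a)
        ((ContinuousLinearMap.apply ℝ (Euc m) a).comp (fderiv ℝ (fderiv ℝ τ) x)) x := fun a =>
      (ContinuousLinearMap.apply ℝ (Euc m) a).hasFDerivAt.comp x hd2
    have hin := (hTτ.clm_apply (hA a)).inner ℝ (hA b)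
    rw [e.fderiv_eq, hin.fderiv]
    simp [inner_add_left]
    ring
  -- The Koszul formula of the pull-back metric contains six terms with the second derivative of
  -- `τ`. By its symmetry four of them cancel, and the other two coincide and give the inhomogeneous
  -- term.
  have key : ∀ a, inner ℝ (T (τ x) (fderiv ℝ τ x (christoffel h' x u v))) (fderiv ℝ τ x a)
      = inner ℝ (T (τ x) (fderiv ℝ (fderiv ℝ τ) x u v
        + christoffel h (τ x) (fderiv ℝ τ x u) (fderiv ℝ τ x v))) (fderiv ℝ τ x a) := by
    intro a
    rw [← H.eq _ hτx, ← heq.self_of_nhds, H'.eq x hx, H'.koszul hx, map_add, inner_add_left,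
      H.koszul hτx, kos, kos, hD, hD, hD, hsym.eq v u, hsym.eq a u, hsym.eq a v,
      H.symm _ hτx (fderiv ℝ τ x v), H.symm _ hτx (fderiv ℝ (fderiv ℝ τ) x u a)]
    ring
  refine H.ext_inner hτx fun a => ?_
  obtain ⟨a', rfl⟩ := hsurj a
  exact key a'

end MetricOn

/-! ### Metrics in geodesic normal coordinates -/

/-- A metric on a ball around the origin for which the coordinates are geodesic normal
coordinates. -/
structure NormalMetricOn (h : Euc m → Euc m → Euc m → ℝ) (T : Euc m → Euc m →L[ℝ] Euc m)
    (R : ℝ) : Prop extends MetricOn h T (Metric.ball 0 R) where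
  pos_radius : 0 < R
  zero_eq : T 0 = 1
  radial_geodesic : ∀ x ∈ Metric.ball 0 R, christoffel h x x x = 0

end Metric

/-! ### Taylor expansions at the origin -/

section Taylor

variable {W : Type} [NormedAddCommGroup W] [NormedSpace ℝ W] [CompleteSpace W]

/-- Taylor's formula has a smooth remainder, so it may be differentiated twice; this identifies its
coefficients with the given derivatives at `0`. -/
theorem taylor_two {f : ℝ → W} {ε : ℝ} (hε : 0 < ε) (hf : ContDiffOn ℝ ∞ f (Ioo (-ε) ε)) {f₁ f₂ : W}
    (h₁ : HasDerivAt f f₁ 0) (h₂ : HasDerivAt (deriv f) f₂ 0) :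
    (fun t => f t - f 0 - t • f₁ - (t ^ 2 / 2) • f₂) =O[𝓝 0] fun t : ℝ => t ^ 3 := by
  have hs : IsOpen (Ioo (-ε) ε ×ˢ (univ : Set ℝ)) := isOpen_Ioo.prod isOpen_univ
  have hg : ContDiffOn ℝ ∞ (fun q : ℝ × ℝ => f q.1) (Ioo (-ε) ε ×ˢ (univ : Set ℝ)) :=
    hf.comp (by fun_prop) fun q hq => hq.1
  obtain ⟨c, R, -, hR, h⟩ := exists_taylor hs
    (by
      rintro ⟨r, y⟩ ⟨hr, hy⟩ s ⟨hs0, hs1⟩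
      refine ⟨?_, hy⟩
      simp only [mem_Ioo] at hr ⊢
      constructor <;> nlinarith) hg 3
  have h0 : Ioo (-ε) ε ∈ 𝓝 (0 : ℝ) := Ioo_mem_nhds (by linarith) hε
  set r : ℝ → W := fun t => R (t, 0) with hr
  have hrs : ContDiffOn ℝ ∞ r (Ioo (-ε) ε) := hR.comp (by fun_prop) fun t ht => ⟨ht, mem_univ _⟩
  have hexp : ∀ t ∈ Ioo (-ε) ε, f t = c 0 0 + t • c 1 0 + t ^ 2 • c 2 0 + t ^ 3 • r t := by
    intro t ht
    have := h (t, 0) ⟨ht, mem_univ _⟩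
    simpa [Finset.sum_range_succ] using this
  have hrd : ∀ t ∈ Ioo (-ε) ε, HasDerivAt r (deriv r t) t := fun t ht =>
    ((hrs.contDiffAt (isOpen_Ioo.mem_nhds ht)).differentiableAt (by simp)).hasDerivAt
  have hd : ∀ t ∈ Ioo (-ε) ε, HasDerivAt f
      (c 1 0 + (2 * t) • c 2 0 + ((3 * t ^ 2) • r t + t ^ 3 • deriv r t)) t := by
    intro t ht
    have e : f =ᶠ[𝓝 t] fun t => c 0 0 + t • c 1 0 + t ^ 2 • c 2 0 + t ^ 3 • r t := by
      filter_upwards [isOpen_Ioo.mem_nhds ht] with s hs using hexp s hs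
    refine HasDerivAt.congr_of_eventuallyEq ?_ e
    have d1 : HasDerivAt (fun t : ℝ => t • c 1 0) (c 1 0) t := by
      simpa using (hasDerivAt_id t).smul_const (c 1 0)
    have d2 : HasDerivAt (fun t : ℝ => t ^ 2 • c 2 0) ((2 * t) • c 2 0) t := by
      simpa using (hasDerivAt_pow 2 t).smul_const (c 2 0)
    have d3 : HasDerivAt (fun t : ℝ => t ^ 3 • r t) (t ^ 3 • deriv r t + (3 * t ^ 2) • r t) t := by
      simpa using (hasDerivAt_pow 3 t).fun_smul (hrd t ht)
    convert! ((d1.const_add (c 0 0)).add d2).add d3 using 1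
    abel
  have e1 : f₁ = c 1 0 := by
    have := h₁.unique (hd 0 ⟨by linarith, hε⟩)
    simpa using this
  have e2 : f₂ = (2 : ℝ) • c 2 0 := by
    have hdr : DifferentiableAt ℝ (deriv r) 0 := by
      have := (hrs.contDiffAt h0).differentiableAt (by simp)
      have h2 : ContDiffAt ℝ 1 (deriv r) 0 := by
        have := (hrs.contDiffAt h0).fderiv_right (m := 1) (by norm_cast)
        exact (this.clm_apply contDiffAt_const (g := fun _ => (1 : ℝ))).congr_of_eventuallyEq
          (Eventually.of_forall fun t => by simp)
      exact h2.differentiableAt (by simp)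
    have e : deriv f =ᶠ[𝓝 0] fun t =>
        c 1 0 + (2 * t) • c 2 0 + ((3 * t ^ 2) • r t + t ^ 3 • deriv r t) := by
      filter_upwards [h0] with t ht using (hd t ht).deriv
    refine h₂.unique (HasDerivAt.congr_of_eventuallyEq ?_ e)
    have d1 : HasDerivAt (fun t : ℝ => (2 * t) • c 2 0) ((2 : ℝ) • c 2 0) 0 := by
      simpa using ((hasDerivAt_id (0 : ℝ)).const_mul 2).smul_const (c 2 0)
    have d2 : HasDerivAt (fun t : ℝ => (3 * t ^ 2) • r t) 0 0 := by
      have := ((hasDerivAt_pow 2 (0 : ℝ)).const_mul 3).fun_smul (hrd 0 ⟨by linarith, hε⟩)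
      simpa using this
    have d3 : HasDerivAt (fun t : ℝ => t ^ 3 • deriv r t) 0 0 := by
      have := (hasDerivAt_pow 3 (0 : ℝ)).fun_smul hdr.hasDerivAt
      simpa using this
    simpa using (d1.const_add (c 1 0)).fun_add (d2.fun_add d3)
  have hc0 : f 0 = c 0 0 := by simpa using hexp 0 ⟨by linarith, hε⟩
  have hb : r =O[𝓝 0] fun _ => (1 : ℝ) := (hrd 0 ⟨by linarith, hε⟩).continuousAt.isBigO_one ℝ
  have := (Asymptotics.isBigO_refl (fun t : ℝ => t ^ 3) (𝓝 0)).smul hb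
  simp only [smul_eq_mul, mul_one] at this
  refine this.congr' ?_ EventuallyEq.rfl
  filter_upwards [h0] with t ht
  rw [hexp t ht, e1, e2, hc0, smul_smul]
  have : t ^ 2 / 2 * 2 = t ^ 2 := by ring
  rw [this]
  abel

theorem taylor_one {f : ℝ → W} {ε : ℝ} (hε : 0 < ε) (hf : ContDiffOn ℝ ∞ f (Ioo (-ε) ε)) {f₁ : W}
    (h₁ : HasDerivAt f f₁ 0) :
    (fun t => f t - f 0 - t • f₁) =O[𝓝 0] fun t : ℝ => t ^ 2 := by
  have h0 : Ioo (-ε) ε ∈ 𝓝 (0 : ℝ) := Ioo_mem_nhds (by linarith) hε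
  have h2 : DifferentiableAt ℝ (deriv f) 0 := by
    have := (hf.contDiffAt h0).fderiv_right (m := 1) (by norm_cast)
    exact ((this.clm_apply contDiffAt_const (g := fun _ => (1 : ℝ))).congr_of_eventuallyEq
      (Eventually.of_forall fun t => by simp)).differentiableAt (by simp)
  have h := taylor_two hε hf h₁ h2.hasDerivAt
  have h3 : (fun t : ℝ => t ^ 3) =O[𝓝 0] fun t : ℝ => t ^ 2 :=
    (Asymptotics.isLittleO_pow_pow (by norm_num)).isBigO
  have h4 : (fun t : ℝ => (t ^ 2 / 2) • deriv (deriv f) 0) =O[𝓝 0] fun t : ℝ => t ^ 2 := by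
    refine Asymptotics.IsBigO.of_bound (‖deriv (deriv f) 0‖) (Eventually.of_forall fun t => ?_)
    rw [norm_smul, norm_div, mul_comm]
    refine mul_le_mul_of_nonneg_left ?_ (norm_nonneg _)
    rw [Real.norm_ofNat]
    linarith [norm_nonneg (t ^ 2)]
  refine ((h.trans h3).add h4).congr_left fun t => by abel

end Taylor

/-! ### Gauss lemma and radial identities in normal coordinates -/

section NormalMetric

variable {m : ℕ} {h : Euc m → Euc m → Euc m → ℝ} {T : Euc m → Euc m →L[ℝ] Euc m} {R : ℝ}

/-- The curvature tensor in terms of the Christoffel symbols. -/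
theorem curv_eq (h : Euc m → Euc m → Euc m → ℝ) (x u v a : Euc m) :
    curv h x u v a = fderiv ℝ (fun y => christoffel h y v a) x u
      + christoffel h x u (christoffel h x v a)
      - (fderiv ℝ (fun y => christoffel h y u a) x v
        + christoffel h x v (christoffel h x u a)) := by
  have e : ∀ v, covD h v (fun _ => a) = fun y => christoffel h y v a := fun v => by
    funext y; simp [covD]
  rw [curv, e, e, covD, covD]

theorem MetricOn.contDiffOn_christoffel_const {U : Set (Euc m)} (H : MetricOn h T U) (u v : Euc m) :
    ContDiffOn ℝ ∞ (fun y => christoffel h y u v) U :=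
  H.contDiffOn_christoffel contDiffOn_id contDiffOn_const contDiffOn_const fun _ hx => hx

theorem MetricOn.contDiffOn_curv {U : Set (Euc m)} (H : MetricOn h T U) (u v a : Euc m) :
    ContDiffOn ℝ ∞ (fun y => curv h y u v a) U := by
  have h1 : ∀ u v, ContDiffOn ℝ ∞ (fun y => fderiv ℝ (fun y => christoffel h y v a) y u) U :=
    fun u v => ((H.contDiffOn_christoffel_const v a).fderiv_of_isOpen H.isOpen le_rfl).clm_apply
      contDiffOn_const
  have h2 : ∀ u v, ContDiffOn ℝ ∞ (fun y => christoffel h y u (christoffel h y v a)) U :=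
    fun u v => H.contDiffOn_christoffel contDiffOn_id contDiffOn_const
      (H.contDiffOn_christoffel_const v a) fun _ hx => hx
  exact (((h1 u v).add (h2 u v)).sub ((h1 v u).add (h2 v u))).congr fun y _ => curv_eq h y u v a

namespace NormalMetricOn

theorem zero_mem (N : NormalMetricOn h T R) : (0 : Euc m) ∈ Metric.ball (0 : Euc m) R :=
  Metric.mem_ball_self N.pos_radius

theorem eventually_ray (N : NormalMetricOn h T R) (x : Euc m) :
    ∃ ε : ℝ, 0 < ε ∧ ∀ t ∈ Ioo (-ε) ε, t • x ∈ Metric.ball (0 : Euc m) R := by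
  have hc : Continuous fun t : ℝ => t • x := by fun_prop
  have h0 : (fun t : ℝ => t • x) ⁻¹' Metric.ball 0 R ∈ 𝓝 (0 : ℝ) :=
    hc.continuousAt.preimage_mem_nhds (Metric.isOpen_ball.mem_nhds (by simpa using N.pos_radius))
  obtain ⟨ε, hε, h1⟩ := Metric.mem_nhds_iff.1 h0
  exact ⟨ε, hε, fun t ht => h1 (by simpa [abs_lt] using ht)⟩

theorem smooth_ray (N : NormalMetricOn h T R) {W : Type} [NormedAddCommGroup W] [NormedSpace ℝ W]
    {F : Euc m → W} (hF : ContDiffOn ℝ ∞ F (Metric.ball 0 R)) (x : Euc m) :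
    ∃ ε : ℝ, 0 < ε ∧ (∀ t ∈ Ioo (-ε) ε, t • x ∈ Metric.ball (0 : Euc m) R) ∧
      ContDiffOn ℝ ∞ (fun t : ℝ => F (t • x)) (Ioo (-ε) ε) := by
  obtain ⟨ε, hε, h1⟩ := N.eventually_ray x
  exact ⟨ε, hε, h1, hF.comp (by fun_prop) h1⟩

/-- Away from the origin the equation at the point `s x` is divided by `s²`, by bilinearity. The
case `t = 0` is the limit, and it is the one from which polarization makes all Christoffel symbols
vanish at the centre. -/
theorem christoffel_ray (N : NormalMetricOn h T R) {x : Euc m} {t : ℝ}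
    (ht : t • x ∈ Metric.ball (0 : Euc m) R) : christoffel h (t • x) x x = 0 := by
  have hne : ∀ s : ℝ, s ≠ 0 → s • x ∈ Metric.ball (0 : Euc m) R →
      christoffel h (s • x) x x = 0 := by
    intro s hs hsx
    have h1 := N.radial_geodesic _ hsx
    rw [N.christoffel_smul hsx, N.christoffel_smul_left hsx, smul_smul] at h1
    exact (smul_eq_zero.1 h1).resolve_left (mul_ne_zero hs hs)
  by_cases h0 : t = 0
  · subst h0
    obtain ⟨ε, hε, h1, h2⟩ := N.smooth_ray (N.contDiffOn_christoffel_const x x) x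
    have hc : ContinuousAt (fun t : ℝ => christoffel h (t • x) x x) 0 :=
      h2.continuousOn.continuousAt (Ioo_mem_nhds (by linarith) hε)
    refine tendsto_nhds_unique (hc.tendsto.mono_left (nhdsWithin_le_nhds (s := {0}ᶜ))) ?_
    refine tendsto_const_nhds.congr' ?_
    filter_upwards [self_mem_nhdsWithin, nhdsWithin_le_nhds
      (Ioo_mem_nhds (show -ε < 0 by linarith) hε)] with s hs hs'
    exact (hne s hs (h1 s hs')).symm
  · exact hne t h0 ht

theorem christoffel_zero (N : NormalMetricOn h T R) (u v : Euc m) : christoffel h 0 u v = 0 := by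
  have h0 : ∀ x, christoffel h 0 x x = 0 := fun x => by
    have := N.christoffel_ray (x := x) (t := 0) (by simpa using N.pos_radius)
    simpa using this
  have h1 := h0 (u + v)
  rw [N.christoffel_add N.zero_mem, N.christoffel_add_left N.zero_mem,
    N.christoffel_add_left N.zero_mem, h0, h0, N.christoffel_symm N.zero_mem v u, zero_add,
    add_zero, ← two_smul ℝ] at h1
  exact (smul_eq_zero.1 h1).resolve_left two_ne_zero

theorem fderiv_zero (N : NormalMetricOn h T R) : fderiv ℝ T 0 = 0 := by
  ext1 w; ext1 u
  refine ext_inner_right ℝ fun v => ?_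
  rw [N.compat N.zero_mem, N.christoffel_zero, N.christoffel_zero]
  simp

theorem eventually_mem (_ : NormalMetricOn h T R) {y : Euc m} (hy : y ∈ Metric.ball (0 : Euc m) R)
    (v : Euc m) : ∀ᶠ s : ℝ in 𝓝 0, y + s • v ∈ Metric.ball (0 : Euc m) R := by
  have hc : Continuous fun s : ℝ => y + s • v := by fun_prop
  exact hc.continuousAt.eventually (Metric.isOpen_ball.mem_nhds (by simpa using hy))

theorem hasDerivAt_T_ray (N : NormalMetricOn h T R) {x : Euc m} {t : ℝ}
    (ht : t • x ∈ Metric.ball (0 : Euc m) R) (u : Euc m) :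
    HasDerivAt (fun t : ℝ => T (t • x) u) (fderiv ℝ T (t • x) x u) t := by
  have h1 : HasDerivAt (fun t : ℝ => t • x) x t := by
    simpa using (hasDerivAt_id t).smul_const x
  have h2 := (N.hasFDerivAt ht).comp_hasDerivAt t h1
  simpa using h2.clm_apply (hasDerivAt_const t u)

/-- The norm of the position vector. -/
theorem inner_T_self (N : NormalMetricOn h T R) {x : Euc m} (hx : x ∈ Metric.ball (0 : Euc m) R) :
    inner ℝ (T x x) x = inner ℝ x x := by
  have hmem : ∀ t ∈ Icc (0 : ℝ) 1, t • x ∈ Metric.ball (0 : Euc m) R := fun t ht => by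
    have := (convex_ball (0 : Euc m) R).smul_mem_of_zero_mem N.zero_mem hx ht
    exact this
  have hd : ∀ t ∈ Icc (0 : ℝ) 1, HasDerivAt (fun t : ℝ => inner ℝ (T (t • x) x) x) 0 t := by
    intro t ht
    have h1 := (N.hasDerivAt_T_ray (hmem t ht) x).inner ℝ (hasDerivAt_const t x)
    -- With three equal arguments the Koszul formula says that half the radial derivative of `g(x,
    -- x)` is `g(Γ(x, x), x)`, which is zero: the speed of a radial geodesic is constant.
    have h2 := N.koszul (hmem t ht) x x x
    rw [N.christoffel_ray (hmem t ht), kos] at h2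
    simp only [map_zero, inner_zero_left] at h2
    refine h1.congr_deriv ?_
    simp only [inner_zero_right, zero_add]
    linarith
  have hc := constant_of_has_deriv_right_zero
    (fun t ht => (hd t ht).continuousAt.continuousWithinAt)
    (fun t ht => (hd t ⟨ht.1, ht.2.le⟩).hasDerivWithinAt) 1 ⟨zero_le_one, le_rfl⟩
  simpa [N.zero_eq] using hc

theorem fderiv_T_radial (N : NormalMetricOn h T R) {x : Euc m} (hx : x ∈ Metric.ball (0 : Euc m) R)
    (a : Euc m) : inner ℝ (fderiv ℝ T x a x) x + 2 * inner ℝ (T x x) a = 2 * inner ℝ x a := by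
  have h1 : HasFDerivAt (fun y => inner ℝ (T y y) y) _ x :=
    ((N.hasFDerivAt hx).clm_apply (hasFDerivAt_id x)).inner ℝ (hasFDerivAt_id x)
  have h2 : HasFDerivAt (fun y : Euc m => inner ℝ y y) _ x :=
    (hasFDerivAt_id x).inner ℝ (hasFDerivAt_id x)
  have e : (fun y => inner ℝ (T y y) y) =ᶠ[𝓝 x] fun y : Euc m => inner ℝ y y := by
    filter_upwards [Metric.isOpen_ball.mem_nhds hx] with y hy using N.inner_T_self hy
  have h3 := congrArg (fun L : Euc m →L[ℝ] ℝ => L a) (h1.unique (h2.congr_of_eventuallyEq e))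
  simp [inner_add_left] at h3
  rw [N.symm x hx a x, real_inner_comm x a] at h3
  linarith

/-- The **Gauss lemma**. -/
theorem gauss (N : NormalMetricOn h T R) {x : Euc m} (hx : x ∈ Metric.ball (0 : Euc m) R) :
    T x x = x := by
  refine ext_inner_right ℝ fun a => ?_
  have hmem : ∀ t ∈ Icc (0 : ℝ) 1, t • x ∈ Metric.ball (0 : Euc m) R := fun t ht =>
    (convex_ball (0 : Euc m) R).smul_mem_of_zero_mem N.zero_mem hx ht
  -- The Koszul formula expresses the radial derivative of `g(x, a)` through the derivative of `g(x,
  -- x)` in the direction `a`, which is known from `g_y(y, y) = |y|²`. Together they say that the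
  -- defect, multiplied by `t`, is constant; it vanishes at `t = 0`.
  have hd : ∀ t ∈ Icc (0 : ℝ) 1,
      HasDerivAt (fun t : ℝ => t * (inner ℝ (T (t • x) x) a - inner ℝ x a)) 0 t := by
    intro t ht
    have h1 := (N.hasDerivAt_T_ray (hmem t ht) x).inner ℝ (hasDerivAt_const t a)
    have h2 := N.koszul (hmem t ht) x x a
    rw [N.christoffel_ray (hmem t ht), kos] at h2
    simp only [map_zero, inner_zero_left] at h2
    have h3 := N.fderiv_T_radial (hmem t ht) a
    simp only [map_smul, real_inner_smul_left, inner_smul_right] at h3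
    refine ((hasDerivAt_id t).fun_mul (h1.sub_const (inner ℝ x a))).congr_deriv ?_
    simp only [inner_zero_right, zero_add, id]
    by_cases h0 : t = 0
    · subst h0; simp [N.zero_eq]
    · have h4 : t * inner ℝ (fderiv ℝ T (t • x) a x) x + 2 * inner ℝ (T (t • x) x) a
          = 2 * inner ℝ x a := mul_left_cancel₀ h0 (by linear_combination h3)
      linear_combination (1 / 2) * h4 - t * h2
  have hc := constant_of_has_deriv_right_zero
    (fun t ht => (hd t ht).continuousAt.continuousWithinAt)
    (fun t ht => (hd t ⟨ht.1, ht.2.le⟩).hasDerivWithinAt) 1 ⟨zero_le_one, le_rfl⟩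
  simp at hc
  linarith

theorem T_ray (N : NormalMetricOn h T R) {x : Euc m} {t : ℝ}
    (ht : t • x ∈ Metric.ball (0 : Euc m) R) : T (t • x) x = x := by
  by_cases h0 : t = 0
  · subst h0; simp [N.zero_eq]
  · have := N.gauss ht
    rw [map_smul] at this
    exact smul_right_injective _ h0 this

theorem fderiv_T_apply (N : NormalMetricOn h T R) {x : Euc m} (hx : x ∈ Metric.ball (0 : Euc m) R)
    (u : Euc m) : fderiv ℝ T x u x = u - T x u := by
  have h1 : HasFDerivAt (fun y => T y y) _ x :=
    (N.hasFDerivAt hx).clm_apply (hasFDerivAt_id x)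
  have e : (fun y => T y y) =ᶠ[𝓝 x] fun y : Euc m => y := by
    filter_upwards [Metric.isOpen_ball.mem_nhds hx] with y hy using N.gauss hy
  have h3 := congrArg (fun L : Euc m →L[ℝ] Euc m => L u)
    (h1.unique ((hasFDerivAt_id x).congr_of_eventuallyEq e))
  simp at h3
  rw [eq_sub_iff_add_eq, add_comm]; exact h3

theorem fderiv_T_ray_apply (N : NormalMetricOn h T R) {x : Euc m} {t : ℝ}
    (ht : t • x ∈ Metric.ball (0 : Euc m) R) (u : Euc m) :
    t • fderiv ℝ T (t • x) u x = u - T (t • x) u := by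
  rw [← N.fderiv_T_apply ht, map_smul]

/-- By the differentiated Gauss lemma, the derivative of the metric operator in the direction `v`,
applied to `x` and paired with `a`, is symmetric in `v` and `a`. Two of the three Koszul terms then
cancel, and only half the radial derivative of the metric is left. -/
theorem T_christoffel_ray (N : NormalMetricOn h T R) {x : Euc m} {t : ℝ}
    (ht : t • x ∈ Metric.ball (0 : Euc m) R) (v : Euc m) :
    T (t • x) (christoffel h (t • x) x v) = (1 / 2 : ℝ) • fderiv ℝ T (t • x) x v := by
  refine ext_inner_right ℝ fun a => ?_
  rw [N.koszul ht, kos, real_inner_smul_left]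
  by_cases h0 : t = 0
  · subst h0; simp [N.fderiv_zero]
  · have h1 : inner ℝ (fderiv ℝ T (t • x) v x) a = inner ℝ (fderiv ℝ T (t • x) a x) v := by
      refine mul_left_cancel₀ h0 ?_
      rw [← real_inner_smul_left, ← real_inner_smul_left, N.fderiv_T_ray_apply ht,
        N.fderiv_T_ray_apply ht, inner_sub_left, inner_sub_left, N.symm _ ht v,
        real_inner_comm]
    rw [h1]; ring

/-- This is the derivative of `Γ_y(y, y) = 0` at `y = t x` in the direction `v`, divided by `t`. It
removes from the curvature the one derivative of `Γ` that is not radial. -/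
theorem fderiv_christoffel_ray (N : NormalMetricOn h T R) {x : Euc m} {t : ℝ}
    (ht : t • x ∈ Metric.ball (0 : Euc m) R) (v : Euc m) :
    t • fderiv ℝ (fun y => christoffel h y x x) (t • x) v
      = (-2 : ℝ) • christoffel h (t • x) x v := by
  by_cases h0 : t = 0
  · subst h0; simp [N.christoffel_zero]
  have hline : HasDerivAt (fun s : ℝ => t • x + s • v) v 0 := by
    simpa using ((hasDerivAt_id (0 : ℝ)).smul_const v).const_add (t • x)
  have hd : ∀ a b, HasDerivAt (fun s : ℝ => christoffel h (t • x + s • v) a b)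
      (fderiv ℝ (fun y => christoffel h y a b) (t • x) v) 0 := fun a b => by
    have h1 : HasFDerivAt (fun y => christoffel h y a b)
        (fderiv ℝ (fun y => christoffel h y a b) (t • x)) (t • x + (0 : ℝ) • v) := by
      rw [zero_smul, add_zero]
      exact (((N.contDiffOn_christoffel_const a b).contDiffAt
        (Metric.isOpen_ball.mem_nhds ht)).differentiableAt (by simp)).hasFDerivAt
    exact h1.comp_hasDerivAt 0 hline
  have e : (fun s : ℝ => t ^ 2 • christoffel h (t • x + s • v) x x
      + ((2 * t * s) • christoffel h (t • x + s • v) x v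
        + s ^ 2 • christoffel h (t • x + s • v) v v)) =ᶠ[𝓝 0] fun _ => 0 := by
    filter_upwards [N.eventually_mem ht v] with s hs
    have h1 := N.radial_geodesic _ hs
    rw [N.christoffel_add hs, N.christoffel_add_left hs, N.christoffel_add_left hs] at h1
    simp only [N.christoffel_smul hs, N.christoffel_smul_left hs, N.christoffel_symm hs v x] at h1
    rw [← h1]
    module
  have h1 := (((hd x x).const_smul (t ^ 2)).add ((((hasDerivAt_id (0 : ℝ)).const_mul
    (2 * t)).fun_smul (hd x v)).add ((hasDerivAt_pow 2 (0 : ℝ)).fun_smul (hd v v))))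
  have h2 := h1.unique ((hasDerivAt_const (0 : ℝ) (0 : Euc m)).congr_of_eventuallyEq e)
  simp at h2
  have h3 : t • (t • fderiv ℝ (fun y => christoffel h y x x) (t • x) v)
      = t • ((-2 : ℝ) • christoffel h (t • x) x v) := by
    rw [smul_smul, smul_smul, ← sq, eq_neg_of_add_eq_zero_left h2, ← neg_smul]
    congr 1; ring
  exact smul_right_injective _ h0 h3

end NormalMetricOn

end NormalMetric

section NormalMetric

variable {m : ℕ} {h : Euc m → Euc m → Euc m → ℝ} {T : Euc m → Euc m →L[ℝ] Euc m} {R : ℝ}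

/-- The derivative of the Christoffel symbols at the origin. -/
noncomputable def dGamma (h : Euc m → Euc m → Euc m → ℝ) (a b c : Euc m) : Euc m :=
  fderiv ℝ (fun y => christoffel h y b c) 0 a

namespace NormalMetricOn

/-! ### The curvature at the origin -/

theorem mem_nhds (N : NormalMetricOn h T R) : Metric.ball (0 : Euc m) R ∈ 𝓝 0 :=
  Metric.ball_mem_nhds _ N.pos_radius

theorem hasFDerivAt_christoffel (N : NormalMetricOn h T R) {y : Euc m}
    (hy : y ∈ Metric.ball (0 : Euc m) R) (b c : Euc m) :
    HasFDerivAt (fun y => christoffel h y b c) (fderiv ℝ (fun y => christoffel h y b c) y) y :=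
  (((N.contDiffOn_christoffel_const b c).contDiffAt
    (Metric.isOpen_ball.mem_nhds hy)).differentiableAt (by simp)).hasFDerivAt

theorem dGamma_symm (N : NormalMetricOn h T R) (a b c : Euc m) :
    dGamma h a b c = dGamma h a c b := by
  have e : (fun y => christoffel h y b c) =ᶠ[𝓝 0] fun y => christoffel h y c b := by
    filter_upwards [N.mem_nhds] with y hy using N.christoffel_symm hy b c
  rw [dGamma, dGamma, e.fderiv_eq]

theorem dGamma_add (N : NormalMetricOn h T R) (a b c c' : Euc m) :
    dGamma h a b (c + c') = dGamma h a b c + dGamma h a b c' := by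
  have e : (fun y => christoffel h y b (c + c')) =ᶠ[𝓝 0]
      fun y => christoffel h y b c + christoffel h y b c' := by
    filter_upwards [N.mem_nhds] with y hy using N.christoffel_add hy b c c'
  rw [dGamma, e.fderiv_eq, ((N.hasFDerivAt_christoffel N.zero_mem b c).fun_add
    (N.hasFDerivAt_christoffel N.zero_mem b c')).fderiv]
  rfl

theorem dGamma_neg (N : NormalMetricOn h T R) (a b c : Euc m) :
    dGamma h a b (-c) = -dGamma h a b c := by
  have e : (fun y => christoffel h y b (-c)) =ᶠ[𝓝 0] fun y => -christoffel h y b c := by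
    filter_upwards [N.mem_nhds] with y hy
    rw [← neg_one_smul ℝ c, N.christoffel_smul hy, neg_one_smul]
  rw [dGamma, e.fderiv_eq, (N.hasFDerivAt_christoffel N.zero_mem b c).fun_neg.fderiv]
  rfl

theorem dGamma_add_left (N : NormalMetricOn h T R) (a b b' c : Euc m) :
    dGamma h a (b + b') c = dGamma h a b c + dGamma h a b' c := by
  rw [N.dGamma_symm, N.dGamma_add, N.dGamma_symm a c, N.dGamma_symm a c]

theorem dGamma_neg_left (N : NormalMetricOn h T R) (a b c : Euc m) :
    dGamma h a (-b) c = -dGamma h a b c := by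
  rw [N.dGamma_symm, N.dGamma_neg, N.dGamma_symm a c]

theorem dGamma_add_fst (a a' b c : Euc m) :
    dGamma h (a + a') b c = dGamma h a b c + dGamma h a' b c := map_add _ _ _

theorem dGamma_neg_fst (a b c : Euc m) : dGamma h (-a) b c = -dGamma h a b c := map_neg _ _

theorem hasDerivAt_christoffel_ray (N : NormalMetricOn h T R) {x : Euc m} {t : ℝ}
    (ht : t • x ∈ Metric.ball (0 : Euc m) R) (b c : Euc m) :
    HasDerivAt (fun t : ℝ => christoffel h (t • x) b c)
      (fderiv ℝ (fun y => christoffel h y b c) (t • x) x) t := by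
  have h1 : HasDerivAt (fun t : ℝ => t • x) x t := by
    simpa using (hasDerivAt_id t).smul_const x
  exact (N.hasFDerivAt_christoffel ht b c).comp_hasDerivAt t h1

theorem zero_smul_mem (N : NormalMetricOn h T R) (x : Euc m) :
    (0 : ℝ) • x ∈ Metric.ball (0 : Euc m) R := by
  rw [zero_smul]; exact N.zero_mem

theorem dGamma_self (N : NormalMetricOn h T R) (a : Euc m) : dGamma h a a a = 0 := by
  have h1 := N.hasDerivAt_christoffel_ray (N.zero_smul_mem a) a a
  rw [zero_smul] at h1
  obtain ⟨ε, hε, h2⟩ := N.eventually_ray a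
  refine h1.unique ((hasDerivAt_const (0 : ℝ) (0 : Euc m)).congr_of_eventuallyEq ?_)
  filter_upwards [Ioo_mem_nhds (show -ε < 0 by linarith) hε] with t ht
  exact N.christoffel_ray (h2 t ht)

/-- Since `Γ(x, x)` vanishes along the ray through `x`, the cubic expression `dΓ(x; x, x)` is
identically zero, and the cyclic sum is its polarization. Subtracting the values at `a + b` and `a -
b` isolates the part linear in `b`, since the cubic part is zero; replacing `a` by `a + c` completes
the polarization. -/
theorem dGamma_cyclic (N : NormalMetricOn h T R) (a b c : Euc m) :
    dGamma h a b c + dGamma h b a c + dGamma h c a b = 0 := by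
  have key : ∀ a b, dGamma h b a a + (2 : ℝ) • dGamma h a a b = 0 := by
    intro a b
    have h1 := N.dGamma_self (a + b)
    have h2 := N.dGamma_self (a + -b)
    simp only [dGamma_add_fst, dGamma_neg_fst, N.dGamma_add, N.dGamma_neg, N.dGamma_add_left,
      N.dGamma_neg_left, N.dGamma_self, N.dGamma_symm _ b a] at h1 h2
    have h3 : (2 : ℝ) • (dGamma h b a a + (2 : ℝ) • dGamma h a a b) = 0 := by
      rw [← sub_eq_zero.2 (h1.trans h2.symm)]
      module
    exact (smul_eq_zero.1 h3).resolve_left two_ne_zero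
  have h1 := key (a + c) b
  have h2 := key a b
  have h3 := key c b
  simp only [dGamma_add_fst, N.dGamma_add, N.dGamma_add_left] at h1
  have h4 : (2 : ℝ) • (dGamma h a b c + dGamma h b a c + dGamma h c a b) = 0 := by
    have : (2 : ℝ) • (dGamma h a b c + dGamma h b a c + dGamma h c a b)
        = (dGamma h b a a + dGamma h b c a + (dGamma h b a c + dGamma h b c c)
          + (2 : ℝ) • (dGamma h a a b + dGamma h c a b + (dGamma h a c b + dGamma h c c b)))
          - (dGamma h b a a + (2 : ℝ) • dGamma h a a b)
          - (dGamma h b c c + (2 : ℝ) • dGamma h c c b) := by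
      rw [N.dGamma_symm b c a, N.dGamma_symm a c b]; module
    rw [this, h2, h3, sub_zero, sub_zero, ← h1]
  exact (smul_eq_zero.1 h4).resolve_left two_ne_zero

theorem curv_zero (N : NormalMetricOn h T R) (a b c : Euc m) :
    curv h 0 a b c = dGamma h a b c - dGamma h b a c := by
  simp only [curv_eq, N.christoffel_zero, dGamma, add_zero]

/-- At the centre the curvature is the antisymmetrization of `dΓ`, because the quadratic terms
vanish. Together with the cyclic identity this linear relation can be solved for `dΓ`. -/
theorem three_dGamma (N : NormalMetricOn h T R) (a b c : Euc m) :
    dGamma h a b c = (1 / 3 : ℝ) • (curv h 0 a b c + curv h 0 a c b) := by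
  have h1 := N.dGamma_cyclic a b c
  rw [N.curv_zero, N.curv_zero, N.dGamma_symm a c b]
  have : dGamma h c a b = -(dGamma h a b c + dGamma h b a c) := by
    rw [eq_neg_iff_add_eq_zero, ← h1]; abel
  rw [this]; module

theorem curv_swap (N : NormalMetricOn h T R) (a b c : Euc m) :
    curv h 0 a b c = -curv h 0 b a c := by
  rw [N.curv_zero, N.curv_zero, neg_sub]

theorem curv_bianchi (N : NormalMetricOn h T R) (a b c : Euc m) :
    curv h 0 a b c + curv h 0 b c a + curv h 0 c a b = 0 := by
  rw [N.curv_zero, N.curv_zero, N.curv_zero, N.dGamma_symm c b a, N.dGamma_symm a c b,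
    N.dGamma_symm b c a]
  abel

/-- Differentiating compatibility with the metric at the centre expresses the second derivative of
the metric through `dΓ`. Its symmetry in the two directions of differentiation is the asserted
skewness. -/
theorem curv_skew (N : NormalMetricOn h T R) (a b c d : Euc m) :
    inner ℝ (curv h 0 a b c) d = -inner ℝ (curv h 0 a b d) c := by
  have hT2 : ContDiffAt ℝ 2 T 0 := (N.contDiffAt N.zero_mem).of_le ENat.LEInfty.out
  have hd2 : HasFDerivAt (fderiv ℝ T) (fderiv ℝ (fderiv ℝ T) 0) 0 :=
    ((hT2.fderiv_right (m := 1) (by norm_num)).differentiableAt (by simp)).hasFDerivAt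
  have hsym : IsSymmSndFDerivAt ℝ T 0 := hT2.isSymmSndFDerivAt (by simp)
  have key : ∀ e a b c, inner ℝ (fderiv ℝ (fderiv ℝ T) 0 e a b) c
      = inner ℝ (dGamma h e a b) c + inner ℝ (dGamma h e a c) b := by
    intro e a b c
    have h1 : HasFDerivAt (fun y => inner ℝ (fderiv ℝ T y a b) c) _ 0 :=
      ((hd2.clm_apply (hasFDerivAt_const a 0)).clm_apply (hasFDerivAt_const b 0)).inner ℝ
        (hasFDerivAt_const c 0)
    have h2 : ∀ b c, HasFDerivAt (fun y => inner ℝ (T y (christoffel h y a b)) c) _ 0 := fun b c =>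
      ((N.hasFDerivAt N.zero_mem).clm_apply (N.hasFDerivAt_christoffel N.zero_mem a b)).inner ℝ
        (hasFDerivAt_const c 0)
    have e1 : (fun y => inner ℝ (fderiv ℝ T y a b) c) =ᶠ[𝓝 0] fun y =>
        inner ℝ (T y (christoffel h y a b)) c + inner ℝ (T y (christoffel h y a c)) b := by
      filter_upwards [N.mem_nhds] with y hy using N.compat hy b c a
    have h3 := congrArg (fun L : Euc m →L[ℝ] ℝ => L e)
      (h1.unique (((h2 b c).add (h2 c b)).congr_of_eventuallyEq e1))
    simpa [N.christoffel_zero, N.zero_eq, dGamma] using h3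
  have h1 := key a b c d
  have h2 := key b a c d
  rw [hsym.eq a b] at h1
  rw [N.curv_zero, N.curv_zero, inner_sub_left, inner_sub_left]
  linarith

/-- The usual linear combination of four Bianchi identities, using skewness in the first and in the
last pair. -/
theorem curv_pair (N : NormalMetricOn h T R) (a b c d : Euc m) :
    inner ℝ (curv h 0 a b c) d = inner ℝ (curv h 0 c d a) b := by
  have B : ∀ a b c d, inner ℝ (curv h 0 a b c) d + inner ℝ (curv h 0 b c a) d
      + inner ℝ (curv h 0 c a b) d = 0 := fun a b c d => by
    rw [← inner_add_left, ← inner_add_left, N.curv_bianchi, inner_zero_left]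
  have S : ∀ a b c d, inner ℝ (curv h 0 a b c) d = -inner ℝ (curv h 0 b a c) d := fun a b c d => by
    rw [N.curv_swap, inner_neg_left]
  linarith [B a b c d, B b c d a, B c d a b, B d a b c, N.curv_skew a b c d, N.curv_skew b c d a,
    N.curv_skew c d a b, N.curv_skew d a b c, S a b c d, S b c d a, S c d a b, S d a b c,
    N.curv_skew b c a d, N.curv_skew c a b d, N.curv_skew c d b a, N.curv_skew d b c a,
    N.curv_skew d a c b, N.curv_skew a c d b, N.curv_skew a b d c, N.curv_skew b d a c,
    S c a b d, S d b c a, S a c d b, S b d a c]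

/-- The derivative of the Christoffel symbols at the origin, in terms of the curvature. -/
theorem inner_dGamma (N : NormalMetricOn h T R) (x u v w : Euc m) :
    inner ℝ (dGamma h x u v) w
      = -(1 / 3) * (inner ℝ (curv h 0 w u x) v + inner ℝ (curv h 0 x u w) v) := by
  rw [N.three_dGamma, real_inner_smul_left, inner_add_left, N.curv_skew x u v w,
    N.curv_pair x v u w, N.curv_swap u w x, inner_neg_left]
  ring

theorem covCurv_zero (N : NormalMetricOn h T R) (b u v a : Euc m) :
    covCurv h 0 b u v a = fderiv ℝ (fun y => curv h y u v a) 0 b := by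
  have hz : ∀ a c, dGamma h a c 0 = 0 := fun a c => by simpa using N.dGamma_add a c 0 0
  have hz' : ∀ a c, dGamma h a 0 c = 0 := fun a c => by rw [N.dGamma_symm, hz]
  have hz'' : ∀ b c, dGamma h 0 b c = 0 := fun b c => map_zero _
  simp [covCurv, covD, N.christoffel_zero, N.curv_zero, hz, hz', hz'']

/-! ### Expansions along rays -/

/-- The operator `v ↦ Γ(x, v)` at the point `t x`. -/
theorem christoffel_ray_eq (N : NormalMetricOn h T R) {x : Euc m} {t : ℝ}
    (ht : t • x ∈ Metric.ball (0 : Euc m) R) (v : Euc m) :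
    christoffel h (t • x) x v
      = ((1 / 2 : ℝ) • (Ring.inverse (T (t • x)) * fderiv ℝ T (t • x) x)) v := by
  rw [← N.inverse_apply' ht (christoffel h (t • x) x v), N.T_christoffel_ray ht, map_smul]
  rfl

/-- Along the ray, `Γ(x, ·)` is a smooth family of operators that vanishes at `t = 0`, so the
derivative at `0` of its value on a moving vector does not see the motion of the vector. -/
theorem hasDerivAt_christoffel_comp (N : NormalMetricOn h T R) (x : Euc m) {w : ℝ → Euc m}
    {w' : Euc m} (hw : HasDerivAt w w' 0) :
    HasDerivAt (fun t : ℝ => christoffel h (t • x) x (w t)) (dGamma h x x (w 0)) 0 := by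
  obtain ⟨ε, hε, h1, h2⟩ := N.smooth_ray (W := Euc m →L[ℝ] Euc m)
    (F := fun y => (1 / 2 : ℝ) • (Ring.inverse (T y) * fderiv ℝ T y x))
    (ContDiffOn.const_smul _ (N.contDiffOn_inverse.mul
      (N.contDiffOn_fderiv.clm_apply contDiffOn_const))) x
  set G : ℝ → Euc m →L[ℝ] Euc m := fun t =>
    (1 / 2 : ℝ) • (Ring.inverse (T (t • x)) * fderiv ℝ T (t • x) x) with hG
  have hI : Ioo (-ε) ε ∈ 𝓝 (0 : ℝ) := Ioo_mem_nhds (by linarith) hε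
  have hGd : HasDerivAt G (deriv G 0) 0 :=
    ((h2.contDiffAt hI).differentiableAt (by simp)).hasDerivAt
  have hG0 : G 0 = 0 := by simp [hG, N.fderiv_zero]
  have e : ∀ w : ℝ → Euc m, (fun t : ℝ => christoffel h (t • x) x (w t)) =ᶠ[𝓝 0]
      fun t => G t (w t) := fun w => by
    filter_upwards [hI] with t ht using N.christoffel_ray_eq (h1 t ht) (w t)
  have h3 : ∀ {w : ℝ → Euc m} {w' : Euc m}, HasDerivAt w w' 0 →
      HasDerivAt (fun t : ℝ => christoffel h (t • x) x (w t)) (deriv G 0 (w 0)) 0 := by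
    intro w w' hw
    refine HasDerivAt.congr_of_eventuallyEq ?_ (e w)
    simpa [hG0] using hGd.clm_apply hw
  have h4 := N.hasDerivAt_christoffel_ray (N.zero_smul_mem x) x (w 0)
  rw [zero_smul] at h4
  rw [dGamma, h4.unique (h3 (hasDerivAt_const (0 : ℝ) (w 0)))]
  exact h3 hw

theorem dGamma_ray (N : NormalMetricOn h T R) (x v : Euc m) :
    dGamma h x x v = (1 / 3 : ℝ) • curv h 0 x v x := by
  rw [N.three_dGamma]
  have : curv h 0 x x v = 0 := by
    rw [N.curv_zero, sub_self]
  rw [this, zero_add]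

theorem smooth_christoffel_ray (N : NormalMetricOn h T R) (x u v : Euc m) :
    ∃ ε : ℝ, 0 < ε ∧ (∀ t ∈ Ioo (-ε) ε, t • x ∈ Metric.ball (0 : Euc m) R) ∧
      ContDiffOn ℝ ∞ (fun t : ℝ => christoffel h (t • x) u v) (Ioo (-ε) ε) :=
  N.smooth_ray (N.contDiffOn_christoffel_const u v) x

theorem hasDerivAt_ray (N : NormalMetricOn h T R) (x v : Euc m) :
    HasDerivAt (fun t : ℝ => christoffel h (t • x) x v) ((1 / 3 : ℝ) • curv h 0 x v x) 0 := by
  rw [← N.dGamma_ray]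
  exact N.hasDerivAt_christoffel_comp x (hasDerivAt_const (0 : ℝ) v)

theorem differentiableAt_deriv {W : Type} [NormedAddCommGroup W] [NormedSpace ℝ W] {f : ℝ → W}
    {ε : ℝ} (hf : ContDiffOn ℝ ∞ f (Ioo (-ε) ε)) {t : ℝ} (ht : t ∈ Ioo (-ε) ε) :
    ContDiffAt ℝ ∞ (deriv f) t := by
  have := (hf.contDiffAt (isOpen_Ioo.mem_nhds ht)).fderiv_right (m := ∞) (by norm_cast)
  exact (this.clm_apply contDiffAt_const (g := fun _ => (1 : ℝ))).congr_of_eventuallyEq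
    (Eventually.of_forall fun t => by simp)

/-- Put `c(t) = Γ(x, v)` at `t x`. The definition of the curvature becomes a Riccati equation `t
R(x, v)x = t c' + t Γ(x, c) + 2 c`. With `c = t S/3 + t² f₂/2 + O(t³)` and `t Γ(x, c) = O(t³)`, the
coefficients of `t²` give `S' = 2 f₂`, where `S` and `S'` are the curvature term and its covariant
derivative. -/
theorem hasDerivAt_deriv_ray (N : NormalMetricOn h T R) (x v : Euc m) :
    HasDerivAt (deriv fun t : ℝ => christoffel h (t • x) x v)
      ((1 / 2 : ℝ) • covCurv h 0 x x v x) 0 := by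
  obtain ⟨ε₁, hε₁, hmem₁, hc₁⟩ := N.smooth_christoffel_ray x x v
  obtain ⟨ε₂, hε₂, hmem₂, hR₂⟩ := N.smooth_ray (N.contDiffOn_curv x v x) x
  obtain ⟨ε₃, hε₃, hmem₃, hG₃⟩ := N.smooth_ray
    (F := fun y => christoffel h y x (christoffel h y x v))
    (N.contDiffOn_christoffel contDiffOn_id contDiffOn_const (N.contDiffOn_christoffel_const x v)
      fun _ hx => hx) x
  obtain ⟨ε, hε, h1, h2, h3⟩ : ∃ ε : ℝ, 0 < ε ∧ ε ≤ ε₁ ∧ ε ≤ ε₂ ∧ ε ≤ ε₃ :=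
    ⟨min ε₁ (min ε₂ ε₃), by positivity, min_le_left _ _,
      (min_le_right _ _).trans (min_le_left _ _), (min_le_right _ _).trans (min_le_right _ _)⟩
  have sub : ∀ {ε'}, ε ≤ ε' → Ioo (-ε) ε ⊆ Ioo (-ε') ε' := fun hh =>
    Ioo_subset_Ioo (by linarith) hh
  replace hc := hc₁.mono (sub h1)
  replace hR := hR₂.mono (sub h2)
  replace hG := hG₃.mono (sub h3)
  have hmem : ∀ t ∈ Ioo (-ε) ε, t • x ∈ Metric.ball (0 : Euc m) R := fun t ht =>
    hmem₁ t (sub h1 ht)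
  have h0 : (0 : ℝ) ∈ Ioo (-ε) ε := ⟨by linarith, hε⟩
  set c : ℝ → Euc m := fun t => christoffel h (t • x) x v with hcdef
  set S := curv h 0 x v x with hS
  set S' := covCurv h 0 x x v x with hS'
  have hc' : HasDerivAt c ((1 / 3 : ℝ) • S) 0 := N.hasDerivAt_ray x v
  have hdd : HasDerivAt (deriv c) (deriv (deriv c) 0) 0 :=
    ((differentiableAt_deriv hc h0).differentiableAt (by simp)).hasDerivAt
  set f₂ := deriv (deriv c) 0 with hf₂
  have hRd : HasDerivAt (fun t : ℝ => curv h (t • x) x v x) S' 0 := by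
    have hh1 : HasDerivAt (fun t : ℝ => t • x) x 0 := by
      simpa using (hasDerivAt_id (0 : ℝ)).smul_const x
    have hh2 : HasFDerivAt (fun y => curv h y x v x) (fderiv ℝ (fun y => curv h y x v x) 0)
        ((0 : ℝ) • x) := by
      rw [zero_smul]
      exact (((N.contDiffOn_curv x v x).contDiffAt N.mem_nhds).differentiableAt
        (by simp)).hasFDerivAt
    rw [hS', N.covCurv_zero]
    exact hh2.comp_hasDerivAt 0 hh1
  have hGd : HasDerivAt (fun t : ℝ => christoffel h (t • x) x (c t)) 0 0 := by
    have := N.hasDerivAt_christoffel_comp x hc'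
    have e : c 0 = 0 := by simp [hcdef, N.christoffel_zero]
    rw [e] at this
    have hz : dGamma h x x 0 = 0 := by simpa using N.dGamma_add x x 0 0
    rwa [hz] at this
  have t1 := taylor_two hε hc hc' hdd
  have t2 := taylor_one hε (fun t ht => (differentiableAt_deriv hc ht).contDiffWithinAt) hdd
  have t3 := taylor_one hε hR hRd
  have t4 := taylor_one hε hG hGd
  -- The term of the curvature with the derivative of `Γ(x, x)` in the direction `v` is replaced,
  -- after multiplication by `t`, by `-2 c`.
  have hid : ∀ t ∈ Ioo (-ε) ε, t • curv h (t • x) x v x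
      = t • deriv c t + t • christoffel h (t • x) x (c t) + (2 : ℝ) • c t := by
    intro t ht
    have e1 : fderiv ℝ (fun y => christoffel h y v x) (t • x) x = deriv c t := by
      rw [(N.hasDerivAt_christoffel_ray (hmem t ht) x v).deriv]
      have e : (fun y => christoffel h y v x) =ᶠ[𝓝 (t • x)] fun y => christoffel h y x v := by
        filter_upwards [Metric.isOpen_ball.mem_nhds (hmem t ht)] with y hy using
          N.christoffel_symm hy v x
      rw [e.fderiv_eq]
    have hz : christoffel h (t • x) v 0 = 0 := by
      simpa using N.christoffel_smul (hmem t ht) v 0 0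
    rw [curv_eq, e1, N.christoffel_ray (hmem t ht), hz, add_zero, smul_sub,
      N.fderiv_christoffel_ray (hmem t ht), N.christoffel_symm (hmem t ht) v x]
    module
  have mulO : ∀ {F : ℝ → Euc m} , F =O[𝓝 0] (fun t : ℝ => t ^ 2) →
      (fun t : ℝ => t • F t) =O[𝓝 0] fun t : ℝ => t ^ 3 := fun hF => by
    have := (Asymptotics.isBigO_refl (fun t : ℝ => t) (𝓝 0)).smul hF
    refine this.congr_right fun t => by simp only [smul_eq_mul]; ring
  have hO := ((mulO t3).sub ((mulO t2).add ((mulO t4).add (t1.const_smul_left (2 : ℝ))))).mono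
    (nhdsWithin_le_nhds (s := Ioi 0))
  -- The remainders of the four expansions, combined as in the Riccati equation, leave only a
  -- multiple of `t²`; it is `O(t³)`, hence zero.
  have hpoly := eq_zero_of_poly_isBigO 3
    (fun j => if j = 2 then (2 : ℝ) • f₂ - S' else 0) (by
      refine hO.congr' ?_ EventuallyEq.rfl
      filter_upwards [nhdsWithin_le_nhds (isOpen_Ioo.mem_nhds h0)] with t ht
      have hidt := hid t ht
      have e0 : c 0 = 0 := by simp [hcdef, N.christoffel_zero]
      have e2 : deriv c 0 = (1 / 3 : ℝ) • S := hc'.deriv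
      have e3 : curv h ((0 : ℝ) • x) x v x = S := by rw [zero_smul]
      have e4 : christoffel h ((0 : ℝ) • x) x (christoffel h ((0 : ℝ) • x) x v) = 0 := by
        rw [zero_smul, N.christoffel_zero]
      simp only [Finset.sum_range_succ, Finset.sum_range_zero]
      simp only [e0, e2, e3, e4]
      simp only [smul_sub, hidt]
      norm_num
      module) 2 (by norm_num)
  simp only [if_true] at hpoly
  have : f₂ = (1 / 2 : ℝ) • S' := by
    rw [← sub_eq_zero.1 hpoly]; module
  rw [← this]
  exact hdd

/-- The expansion of `Γ(x, v)` along the ray through `x`. -/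
theorem isBigO_christoffel_ray (N : NormalMetricOn h T R) (x v : Euc m) :
    (fun t : ℝ => christoffel h (t • x) x v - (t / 3) • curv h 0 x v x
      - (t ^ 2 / 4) • covCurv h 0 x x v x) =O[𝓝 0] fun t : ℝ => t ^ 3 := by
  obtain ⟨ε, hε, hmem, hc⟩ := N.smooth_christoffel_ray x x v
  refine (taylor_two hε hc (N.hasDerivAt_ray x v) (N.hasDerivAt_deriv_ray x v)).congr_left
    fun t => ?_
  simp only [zero_smul, N.christoffel_zero, smul_smul]
  module

theorem isBigO_deriv_christoffel_ray (N : NormalMetricOn h T R) (x v : Euc m) :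
    (fun t : ℝ => deriv (fun t : ℝ => christoffel h (t • x) x v) t - (1 / 3 : ℝ) • curv h 0 x v x)
      =O[𝓝 0] fun t : ℝ => t := by
  have h1 := (N.hasDerivAt_deriv_ray x v).isBigO_sub
  simpa [(N.hasDerivAt_ray x v).deriv] using h1

/-- The expansion of the inverse metric along a ray. -/
theorem isBigO_inverse_ray (N : NormalMetricOn h T R) (x u : Euc m) :
    (fun t : ℝ => Ring.inverse (T (t • x)) u - u + (t ^ 2 / 3) • curv h 0 x u x)
      =O[𝓝 0] fun t : ℝ => t ^ 3 := by
  obtain ⟨ε, hε, hmem, hf⟩ := N.smooth_ray (F := fun y => Ring.inverse (T y) u)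
    (N.contDiffOn_inverse.clm_apply contDiffOn_const) x
  set f : ℝ → Euc m := fun t => Ring.inverse (T (t • x)) u with hfdef
  have h0 : (0 : ℝ) ∈ Ioo (-ε) ε := ⟨by linarith, hε⟩
  -- Differentiating `T(t x) f(t) = u`, and using that the radial derivative of `T` is `2 T Γ(x,
  -- ·)`, gives the linear equation `f' = -2 Γ(x, f)`. Its second derivative at `0` comes from the
  -- first derivative of `Γ(x, ·)`.
  have hd : ∀ t ∈ Ioo (-ε) ε, HasDerivAt f ((-2 : ℝ) • christoffel h (t • x) x (f t)) t := by
    intro t ht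
    have h1 : HasDerivAt f (deriv f t) t :=
      ((hf.contDiffAt (isOpen_Ioo.mem_nhds ht)).differentiableAt (by simp)).hasDerivAt
    have hT : HasDerivAt (fun t : ℝ => T (t • x)) (fderiv ℝ T (t • x) x) t := by
      have hx : HasDerivAt (fun t : ℝ => t • x) x t := by
        simpa using (hasDerivAt_id t).smul_const x
      exact (N.hasFDerivAt (hmem t ht)).comp_hasDerivAt t hx
    have e : (fun t : ℝ => T (t • x) (f t)) =ᶠ[𝓝 t] fun _ => u := by
      filter_upwards [isOpen_Ioo.mem_nhds ht] with s hs using N.inverse_apply (hmem s hs) u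
    have h2 := (hT.clm_apply h1).unique ((hasDerivAt_const t u).congr_of_eventuallyEq e)
    refine h1.congr_deriv (N.injective (hmem t ht) ?_)
    rw [map_smul, N.T_christoffel_ray (hmem t ht), smul_smul]
    rw [eq_neg_of_add_eq_zero_right h2]
    norm_num
  have hf0 : f 0 = u := by simp [hfdef, N.zero_eq]
  have hd0 : HasDerivAt f 0 0 := by
    have := hd 0 h0
    rwa [zero_smul, N.christoffel_zero, smul_zero] at this
  have hd2 : HasDerivAt (deriv f) ((-2 : ℝ) • (1 / 3 : ℝ) • curv h 0 x u x) 0 := by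
    have e : deriv f =ᶠ[𝓝 0] fun t => (-2 : ℝ) • christoffel h (t • x) x (f t) := by
      filter_upwards [isOpen_Ioo.mem_nhds h0] with t ht using (hd t ht).deriv
    refine HasDerivAt.congr_of_eventuallyEq ?_ e
    have := (N.hasDerivAt_christoffel_comp x hd0).const_smul (-2 : ℝ)
    rwa [hf0, N.dGamma_ray] at this
  refine (taylor_two hε hf hd0 hd2).congr_left fun t => ?_
  rw [hf0]
  module

theorem christoffel_sum_left (N : NormalMetricOn h T R) {y : Euc m}
    (hy : y ∈ Metric.ball (0 : Euc m) R) (w v : Euc m) :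
    christoffel h y w v = ∑ i, w i • christoffel h y (stdVec i) v := by
  have : ∀ (s : Finset (Fin m)), christoffel h y (∑ i ∈ s, w i • stdVec i) v
      = ∑ i ∈ s, w i • christoffel h y (stdVec i) v := by
    classical
    intro s
    induction s using Finset.induction_on with
    | empty => simpa using N.christoffel_smul_left hy 0 v 0
    | insert i s hi ih =>
      rw [Finset.sum_insert hi, Finset.sum_insert hi, N.christoffel_add_left hy, ih,
        N.christoffel_smul_left hy]
  rw [← this, sum_smul_stdVec]

/-- The expansion of the Christoffel symbols along a ray. -/
theorem isBigO_christoffel_inverse (N : NormalMetricOn h T R) (x u v : Euc m) :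
    (fun t : ℝ => christoffel h (t • x) (Ring.inverse (T (t • x)) u) v - t • dGamma h x u v)
      =O[𝓝 0] fun t : ℝ => t ^ 2 := by
  have hO : ∀ u, (fun t : ℝ => christoffel h (t • x) u v - t • dGamma h x u v)
      =O[𝓝 0] fun t : ℝ => t ^ 2 := fun u => by
    obtain ⟨ε, hε, hmem, hc⟩ := N.smooth_christoffel_ray x u v
    have hd := N.hasDerivAt_christoffel_ray (N.zero_smul_mem x) u v
    rw [zero_smul] at hd
    refine (taylor_one hε hc hd).congr_left fun t => ?_
    rw [zero_smul, N.christoffel_zero, sub_zero, dGamma]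
  have hO' : ∀ i : Fin m, (fun t : ℝ => christoffel h (t • x) (stdVec i) v) =O[𝓝 0]
      fun _ : ℝ => (1 : ℝ) := fun i => by
    obtain ⟨ε, hε, hmem, hc⟩ := N.smooth_christoffel_ray x (stdVec i) v
    exact (hc.continuousOn.continuousAt (Ioo_mem_nhds (by linarith) hε)).isBigO_one ℝ
  have hI : (fun t : ℝ => Ring.inverse (T (t • x)) u - u) =O[𝓝 0] fun t : ℝ => t ^ 2 := by
    have h1 : (fun t : ℝ => (t ^ 2 / 3) • curv h 0 x u x) =O[𝓝 0] fun t : ℝ => t ^ 2 := by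
      refine Asymptotics.IsBigO.of_bound ‖curv h 0 x u x‖ (Eventually.of_forall fun t => ?_)
      rw [norm_smul, norm_div, mul_comm]
      refine mul_le_mul_of_nonneg_left ?_ (norm_nonneg _)
      rw [Real.norm_ofNat]
      linarith [norm_nonneg (t ^ 2)]
    have h2 := ((N.isBigO_inverse_ray x u).trans
      ((Asymptotics.isLittleO_pow_pow (by norm_num : 2 < 3)).isBigO)).sub h1
    exact h2.congr_left fun t => by abel
  -- The bounds on `Γ` are available for fixed vectors, so the small moving vector `T⁻¹ u - u =
  -- O(t²)` is expanded in coordinates.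
  have hsum : (fun t : ℝ => ∑ i, (Ring.inverse (T (t • x)) u - u) i
      • christoffel h (t • x) (stdVec i) v) =O[𝓝 0] fun t : ℝ => t ^ 2 := by
    refine Asymptotics.IsBigO.fun_sum (A := fun i t => (Ring.inverse (T (t • x)) u - u) i
      • christoffel h (t • x) (stdVec i) v) fun i _ => ?_
    have h1 : (fun t : ℝ => (Ring.inverse (T (t • x)) u - u) i) =O[𝓝 0] fun t : ℝ => t ^ 2 := by
      refine Asymptotics.IsBigO.trans (g := fun t : ℝ => Ring.inverse (T (t • x)) u - u) ?_ hI
      refine Asymptotics.IsBigO.of_bound 1 (Eventually.of_forall fun t => ?_)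
      rw [one_mul]; exact PiLp.norm_apply_le _ _
    simpa using h1.smul (hO' i)
  obtain ⟨ε, hε, hmem⟩ := N.eventually_ray x
  refine ((hO u).add hsum).congr' ?_ EventuallyEq.rfl
  filter_upwards [Ioo_mem_nhds (show -ε < 0 by linarith) hε] with t ht
  rw [← N.christoffel_sum_left (hmem t ht), sub_add_eq_add_sub, ← N.christoffel_add_left (hmem t ht)]
  congr 2
  abel

end NormalMetricOn

end NormalMetric

/-! ### Parametrized hypersurfaces -/

section MatrixCalculus

variable {E : Type*} [NormedAddCommGroup E] [NormedSpace ℝ E] {n : ℕ}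

theorem differentiableAt_det {A : E → Matrix (Fin n) (Fin n) ℝ} {z : E}
    (hA : ∀ i j, DifferentiableAt ℝ (fun y => A y i j) z) :
    DifferentiableAt ℝ (fun y => (A y).det) z := by
  simp only [Matrix.det_apply']
  refine DifferentiableAt.fun_sum fun σ _ => DifferentiableAt.const_mul ?_ _
  exact (HasFDerivAt.finsetProd (g := fun i y => A y (σ i) i)
    fun i _ => (hA (σ i) i).hasFDerivAt).differentiableAt

theorem differentiableAt_inv {A : E → Matrix (Fin n) (Fin n) ℝ} {z : E}
    (hA : ∀ i j, DifferentiableAt ℝ (fun y => A y i j) z) (h0 : IsUnit (A z).det) (i j : Fin n) :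
    DifferentiableAt ℝ (fun y => (A y)⁻¹ i j) z := by
  simp only [Matrix.inv_def, Matrix.smul_apply, Ring.inverse_eq_inv', smul_eq_mul,
    Matrix.adjugate_apply]
  refine ((differentiableAt_det hA).inv h0.ne_zero).mul (differentiableAt_det fun a b => ?_)
  by_cases hj : a = j
  · subst hj
    simp only [Matrix.updateRow_self]
    exact differentiableAt_const _
  · simpa only [Matrix.updateRow_ne hj] using hA a b

end MatrixCalculus

section Hypersurface

variable {m n : ℕ} {h : Euc m → Euc m → Euc m → ℝ} {T : Euc m → Euc m →L[ℝ] Euc m} {U : Set (Euc m)}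
  {X υ : Euc n → Euc m} {z : Euc n}

theorem differentiableAt_pd {W : Type*} [NormedAddCommGroup W] [NormedSpace ℝ W] {f : Euc n → W}
    (hf : ContDiffAt ℝ 2 f z) (i : Fin n) : DifferentiableAt ℝ (pd i f) z := by
  have h1 : ContDiffAt ℝ 1 (fderiv ℝ f) z := hf.fderiv_right (by norm_num)
  exact (h1.differentiableAt (by norm_num)).clm_apply (differentiableAt_const _)

namespace MetricOn

theorem differentiableAt_inner_comp (H : MetricOn h T U) (hX : DifferentiableAt ℝ X z)
    (hz : X z ∈ U) {a b : Euc n → Euc m} (ha : DifferentiableAt ℝ a z)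
    (hb : DifferentiableAt ℝ b z) : DifferentiableAt ℝ (fun y => h (X y) (a y) (b y)) z := by
  have h1 : DifferentiableAt ℝ (fun y => inner ℝ (T (X y) (a y)) (b y)) z :=
    ((((H.hasFDerivAt hz).differentiableAt).comp z hX).clm_apply ha).inner ℝ hb
  refine h1.congr_of_eventuallyEq ?_
  filter_upwards [hX.continuousAt.preimage_mem_nhds (H.isOpen.mem_nhds hz)] with y hy
  exact H.eq _ hy _ _

theorem differentiableAt_firstForm (H : MetricOn h T U) (hX : ContDiffAt ℝ 2 X z) (hz : X z ∈ U)
    (i j : Fin n) : DifferentiableAt ℝ (fun y => firstForm h X y i j) z :=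
  H.differentiableAt_inner_comp (hX.differentiableAt (by norm_num)) hz (differentiableAt_pd hX i)
    (differentiableAt_pd hX j)

theorem differentiableAt_preNormal (H : MetricOn h T U) (hX : ContDiffAt ℝ 2 X z) (hz : X z ∈ U)
    (hυ : DifferentiableAt ℝ υ z) (h0 : IsUnit (firstForm h X z).det) :
    DifferentiableAt ℝ (preNormal h X υ) z := by
  refine hυ.neg.add (DifferentiableAt.fun_sum fun j _ => DifferentiableAt.fun_smul
    (DifferentiableAt.fun_sum fun k _ => DifferentiableAt.mul ?_ ?_) (differentiableAt_pd hX j))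
  · exact differentiableAt_inv (H.differentiableAt_firstForm hX hz) h0 j k
  · exact H.differentiableAt_inner_comp (hX.differentiableAt (by norm_num)) hz hυ
      (differentiableAt_pd hX k)

theorem inner_preNormal_pd (H : MetricOn h T U) {y : Euc n} (hy : X y ∈ U)
    (h0 : IsUnit (firstForm h X y).det) (k : Fin n) :
    inner ℝ (T (X y) (preNormal h X υ y)) (pd k X y) = 0 := by
  have h1 := congrFun (Matrix.nonsing_inv_mul (firstForm h X y) h0)
  have hG : ∀ j, inner ℝ (T (X y) (pd j X y)) (pd k X y) = firstForm h X y k j := fun j => by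
    rw [firstForm, Matrix.of_apply, H.eq _ hy, H.symm _ hy]
  have h2 : Matrix.mulVec (firstForm h X y) (Matrix.mulVec (firstForm h X y)⁻¹
      fun k => h (X y) (υ y) (pd k X y)) k = h (X y) (υ y) (pd k X y) := by
    rw [Matrix.mulVec_mulVec, Matrix.mul_nonsing_inv _ h0, Matrix.one_mulVec]
  rw [preNormal, map_add, map_neg, inner_add_left, inner_neg_left, map_sum, sum_inner,
    ← H.eq _ hy (υ y), neg_add_eq_zero, ← h2, Matrix.mulVec, dotProduct]
  refine Finset.sum_congr rfl fun j _ => ?_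
  rw [map_smul, real_inner_smul_left, hG, mul_comm]
  rfl

/-- The second fundamental form in terms of the second derivatives of the parametrization. -/
theorem secondForm_eq (H : MetricOn h T U) (hX : ContDiffAt ℝ 2 X z) (hz : X z ∈ U)
    (hυ : DifferentiableAt ℝ υ z) (h0 : IsUnit (firstForm h X z).det)
    (hN : preNormal h X υ z ≠ 0) (i j : Fin n) :
    secondForm h X υ z i j = inner ℝ (T (X z) (unitNormal h X υ z))
      (pd i (pd j X) z + christoffel h (X z) (pd i X z) (pd j X z)) := by
  have hXd := hX.differentiableAt (n := 2) (by norm_num)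
  have hpre := H.differentiableAt_preNormal hX hz hυ h0
  have hNd : DifferentiableAt ℝ (unitNormal h X υ) z := by
    have h1 := H.differentiableAt_inner_comp hXd hz hpre hpre
    have h2 : h (X z) (preNormal h X υ z) (preNormal h X υ z) ≠ 0 := by
      rw [H.eq _ hz]; exact (H.pos _ hz _ hN).ne'
    have h3 : 0 < h (X z) (preNormal h X υ z) (preNormal h X υ z) := by
      rw [H.eq _ hz]; exact H.pos _ hz _ hN
    exact ((h1.sqrt h2).inv (Real.sqrt_pos.2 h3).ne').smul hpre
  -- Orthogonality of the normal to the hypersurface holds in a neighbourhood of `z` and may be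
  -- differentiated; this moves the derivative from the normal to the tangent vector.
  have hev : (fun y => inner ℝ (T (X y) (unitNormal h X υ y)) (pd j X y)) =ᶠ[𝓝 z] fun _ => 0 := by
    have hdet : ∀ᶠ y in 𝓝 z, (firstForm h X y).det ≠ 0 :=
      (differentiableAt_det (H.differentiableAt_firstForm hX hz)).continuousAt.eventually_ne
        h0.ne_zero
    filter_upwards [hdet, hXd.continuousAt.preimage_mem_nhds (H.isOpen.mem_nhds hz)] with y hy hyU
    rw [unitNormal, map_smul, real_inner_smul_left, H.inner_preNormal_pd hyU hy.isUnit, mul_zero]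
  have hT : HasFDerivAt (fun y => T (X y)) ((fderiv ℝ T (X z)).comp (fderiv ℝ X z)) z :=
    (H.hasFDerivAt hz).comp z hXd.hasFDerivAt
  have hd := ((hT.clm_apply hNd.hasFDerivAt).inner ℝ (differentiableAt_pd hX j).hasFDerivAt)
  have hd0 := (hd.congr_of_eventuallyEq hev.symm).unique (hasFDerivAt_const 0 z)
  have key := congrArg (fun L => L (stdVec i)) hd0
  simp only [ContinuousLinearMap.comp_apply, fderivInnerCLM_apply, ContinuousLinearMap.prod_apply,
    _root_.zero_apply, _root_.add_apply, ContinuousLinearMap.flip_apply,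
    inner_add_left] at key
  rw [H.compat hz] at key
  simp only [secondForm, Matrix.of_apply, H.eq _ hz, map_add, inner_add_left, inner_add_right]
  simp only [pd] at key ⊢
  rw [H.symm _ hz (christoffel h (X z) (fderiv ℝ X z (stdVec i)) (fderiv ℝ X z (stdVec j)))] at key
  linarith

end MetricOn

end Hypersurface

/-! ### The perturbed spheres in geodesic normal coordinates -/

/-- Smoothness of `Θ` is given as a map into the ambient space, that of `w` on the sphere as a
manifold. They are connected through the chart at `Θ z`: it is the stereographic projection from the
antipode, which is a smooth ambient map near `Θ z`. -/
theorem contDiffAt_comp_sphere {n : ℕ}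
    {w : Metric.sphere (0 : EuclideanSpace ℝ (Fin (n + 1))) 1 → ℝ}
    (hw : ContMDiff (𝓡 n) 𝓘(ℝ, ℝ) 2 w)
    {Θ : EuclideanSpace ℝ (Fin n) → Metric.sphere (0 : EuclideanSpace ℝ (Fin (n + 1))) 1}
    {z : EuclideanSpace ℝ (Fin n)} (hΘ : ContDiffAt ℝ ∞ (amb Θ) z) :
    ContDiffAt ℝ 2 (fun y => w (Θ y)) z := by
  have hfact : Fact (Module.finrank ℝ (Euc (n + 1)) = n + 1) := ⟨finrank_euclideanSpace_fin⟩
  have hΘ2 : ContDiffAt ℝ 2 (amb Θ) z := hΘ.of_le ENat.LEInfty.out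
  have hc : ContinuousAt Θ z := Topology.IsInducing.subtypeVal.continuousAt_iff.2 hΘ.continuousAt
  have hm : ContMDiffAt (𝓡 n) (𝓡 n) 2 Θ z := by
    rw [contMDiffAt_iff_target]
    refine ⟨hc, ContDiffAt.contMDiffAt ?_⟩
    set v := Θ z with hv
    let U : _ ≃ₗᵢ[ℝ] _ :=
      (OrthonormalBasis.fromOrthogonalSpanSingleton (𝕜 := ℝ) (E := Euc (n + 1))
        n (ne_zero_of_mem_unit_sphere (-v))).repr
    have h1 : ContDiffOn ℝ ω (stereoToFun ((-v : Metric.sphere (0 : Euc (n + 1)) 1) : Euc (n + 1)))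
      {x | innerSL ℝ ((-v : Metric.sphere (0 : Euc (n + 1)) 1) : Euc (n + 1)) x ≠ 1} :=
      contDiffOn_stereoToFun
    have hopen : IsOpen {x | innerSL ℝ ((-v : Metric.sphere (0 : Euc (n + 1)) 1) : Euc (n + 1)) x
        ≠ (1 : ℝ)} := isOpen_ne_fun (by fun_prop) continuous_const
    have h2 : amb Θ z ∈ {x | innerSL ℝ ((-v : Metric.sphere (0 : Euc (n + 1)) 1) : Euc (n + 1)) x
        ≠ (1 : ℝ)} := by
      have : ‖(v : Euc (n + 1))‖ = 1 := by simp
      change ¬ (inner ℝ (-(v : Euc (n + 1))) (v : Euc (n + 1)) = 1)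
      rw [inner_neg_left, real_inner_self_eq_norm_sq, this]
      norm_num
    have h3 := ((h1.contDiffAt (hopen.mem_nhds h2)).of_le (n := ω) (m := 2) le_top).comp z hΘ2
    exact (U.contDiff.of_le (n := ω) (m := 2) le_top).contDiffAt.comp z h3
  have := (hw.contMDiffAt (x := Θ z)).comp z hm
  exact this.contDiffAt


/-- `θ`, `e_1, …, e_n` is an orthonormal basis of `ℝⁿ⁺¹`. -/
structure AdaptedFrame {n : ℕ} (θ : Euc (n + 1)) (e : Fin n → Euc (n + 1)) : Prop where
  norm : ‖θ‖ = 1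
  perp : ∀ i, inner ℝ θ (e i) = 0
  orthonormal : ∀ i j, inner ℝ (e i) (e j) = if i = j then (1 : ℝ) else 0

namespace AdaptedFrame

variable {n : ℕ} {θ : Euc (n + 1)} {e : Fin n → Euc (n + 1)}

theorem inner_self (A : AdaptedFrame θ e) : inner ℝ θ θ = (1 : ℝ) := by
  rw [real_inner_self_eq_norm_sq, A.norm, one_pow]

theorem perp' (A : AdaptedFrame θ e) (i : Fin n) : inner ℝ (e i) θ = (0 : ℝ) := by
  rw [real_inner_comm, A.perp]

theorem orthonormal_cons (A : AdaptedFrame θ e) :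
    Orthonormal ℝ (Fin.cons θ e : Fin (n + 1) → Euc (n + 1)) := by
  rw [orthonormal_iff_ite]
  intro i j
  refine Fin.cases ?_ (fun i => ?_) i <;> refine Fin.cases ?_ (fun j => ?_) j
  · simpa using A.inner_self
  · simpa [(Fin.succ_ne_zero j).symm] using A.perp j
  · simpa [Fin.succ_ne_zero i] using A.perp' i
  · simpa using A.orthonormal i j

/-- The orthonormal basis `θ`, `e_1, …, e_n`. -/
noncomputable def basis (A : AdaptedFrame θ e) : OrthonormalBasis (Fin (n + 1)) ℝ (Euc (n + 1)) :=
  OrthonormalBasis.mk A.orthonormal_cons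
    (A.orthonormal_cons.linearIndependent.span_eq_top_of_card_eq_finrank' (by simp)).ge

theorem basis_zero (A : AdaptedFrame θ e) : A.basis 0 = θ := by simp [basis]

theorem basis_succ (A : AdaptedFrame θ e) (i : Fin n) : A.basis i.succ = e i := by simp [basis]

theorem expand (A : AdaptedFrame θ e) (v : Euc (n + 1)) :
    v = inner ℝ θ v • θ + ∑ i, inner ℝ (e i) v • e i := by
  conv_lhs => rw [← A.basis.sum_repr' v, Fin.sum_univ_succ]
  simp only [A.basis_zero, A.basis_succ]

theorem expand_of_perp (A : AdaptedFrame θ e) {v : Euc (n + 1)} (hv : inner ℝ θ v = (0 : ℝ)) :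
    v = ∑ i, inner ℝ (e i) v • e i := by
  conv_lhs => rw [A.expand v, hv, zero_smul, zero_add]

theorem sum_inner_mul (A : AdaptedFrame θ e) {u : Euc (n + 1)} (hu : inner ℝ θ u = (0 : ℝ))
    (v : Euc (n + 1)) : ∑ i, inner ℝ (e i) u * inner ℝ (e i) v = (inner ℝ u v : ℝ) := by
  conv_rhs => rw [A.expand_of_perp hu, sum_inner]
  exact Finset.sum_congr rfl fun i _ => by rw [real_inner_smul_left]

theorem ext_inner (A : AdaptedFrame θ e) {u v : Euc (n + 1)}
    (h0 : inner ℝ θ u = (inner ℝ θ v : ℝ)) (h : ∀ i, inner ℝ (e i) u = (inner ℝ (e i) v : ℝ)) :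
    u = v := by
  rw [A.expand u, A.expand v, h0]
  simp only [h]

end AdaptedFrame

section Param

variable {n : ℕ} {Θ : EuclideanSpace ℝ (Fin n) → Metric.sphere (0 : EuclideanSpace ℝ (Fin (n + 1))) 1}
  {z : EuclideanSpace ℝ (Fin n)}

theorem norm_amb (z : EuclideanSpace ℝ (Fin n)) : ‖amb Θ z‖ = 1 := by simp [amb]

theorem inner_amb_self (z : EuclideanSpace ℝ (Fin n)) : inner ℝ (amb Θ z) (amb Θ z) = (1 : ℝ) := by
  rw [real_inner_self_eq_norm_sq, norm_amb, one_pow]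

theorem inner_amb_pd (hd : DifferentiableAt ℝ (amb Θ) z) (i : Fin n) :
    inner ℝ (amb Θ z) (pd i (amb Θ) z) = (0 : ℝ) := by
  have h1 := hd.hasFDerivAt.inner ℝ hd.hasFDerivAt
  have h2 : HasFDerivAt (fun y => inner ℝ (amb Θ y) (amb Θ y)) (0 : Euc n →L[ℝ] ℝ) z := by
    simp only [inner_amb_self]; exact hasFDerivAt_const _ _
  have h3 := congrArg (fun L => L (stdVec i)) (h1.unique h2)
  simp only [ContinuousLinearMap.comp_apply, fderivInnerCLM_apply, ContinuousLinearMap.prod_apply,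
    _root_.zero_apply] at h3
  rw [real_inner_comm (amb Θ z)] at h3
  rw [pd]
  linarith

theorem IsNormalParam.contDiffAt_two (hP : IsNormalParam Θ z) : ContDiffAt ℝ 2 (amb Θ) z :=
  hP.smooth.of_le ENat.LEInfty.out

theorem IsNormalParam.frame (hP : IsNormalParam Θ z) : AdaptedFrame (amb Θ z) (tang Θ z) :=
  ⟨norm_amb z, inner_amb_pd (hP.contDiffAt_two.differentiableAt (by norm_num)), hP.orthonormal⟩

/-- The radial component comes from differentiating `⟨Θ, Θ_j⟩ = 0`; the tangential one is the
Levi-Civita derivative, which vanishes. -/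
theorem IsNormalParam.pd_pd (hP : IsNormalParam Θ z) (i j : Fin n) :
    pd i (pd j (amb Θ)) z = -(if i = j then (1 : ℝ) else 0) • amb Θ z := by
  refine hP.frame.ext_inner ?_ fun k => ?_
  · have hev : (fun y => inner ℝ (amb Θ y) (pd j (amb Θ) y)) =ᶠ[𝓝 z] fun _ => (0 : ℝ) := by
      filter_upwards [hP.contDiffAt_two.eventually (by simp)] with y hy
      exact inner_amb_pd (hy.differentiableAt (by norm_num)) j
    have h1 := (hP.contDiffAt_two.differentiableAt (by norm_num)).hasFDerivAt.inner ℝ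
      (differentiableAt_pd hP.contDiffAt_two j).hasFDerivAt
    have h3 := congrArg (fun L => L (stdVec i))
      ((h1.congr_of_eventuallyEq hev.symm).unique (hasFDerivAt_const _ _))
    simp only [ContinuousLinearMap.comp_apply, fderivInnerCLM_apply,
      ContinuousLinearMap.prod_apply, _root_.zero_apply] at h3
    have h4 := hP.orthonormal i j
    rw [inner_smul_right, inner_amb_self]
    simp only [tang, pd] at h3 h4 ⊢
    linarith
  · rw [real_inner_comm, hP.parallel, inner_smul_right, hP.frame.perp', mul_zero]

theorem pd_smul {W : Type*} [NormedAddCommGroup W] [NormedSpace ℝ W] {a : Euc n → ℝ}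
    {f : Euc n → W} (ha : DifferentiableAt ℝ a z) (hf : DifferentiableAt ℝ f z) (i : Fin n) :
    pd i (fun y => a y • f y) z = a z • pd i f z + pd i a z • f z := by
  rw [pd, fderiv_fun_smul ha hf]
  simp [pd]

theorem pd_pd_smul {W : Type*} [NormedAddCommGroup W] [NormedSpace ℝ W] {a : Euc n → ℝ}
    {f : Euc n → W} (ha : ContDiffAt ℝ 2 a z) (hf : ContDiffAt ℝ 2 f z) (i j : Fin n) :
    pd i (pd j (fun y => a y • f y)) z = a z • pd i (pd j f) z + pd i a z • pd j f z
      + pd j a z • pd i f z + pd i (pd j a) z • f z := by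
  have hev : pd j (fun y => a y • f y) =ᶠ[𝓝 z] fun y => a y • pd j f y + pd j a y • f y := by
    filter_upwards [ha.eventually (by simp), hf.eventually (by simp)] with y hy hy'
    exact pd_smul (hy.differentiableAt (by norm_num)) (hy'.differentiableAt (by norm_num)) j
  have h1 := ha.differentiableAt (by norm_num)
  have h2 := hf.differentiableAt (by norm_num)
  have h3 := pd_smul h1 (differentiableAt_pd hf j) i
  have h4 := pd_smul (differentiableAt_pd ha j) h2 i
  have hadd : pd i (fun y => a y • pd j f y + pd j a y • f y) z
      = pd i (fun y => a y • pd j f y) z + pd i (fun y => pd j a y • f y) z := by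
    rw [pd, fderiv_fun_add (h1.fun_smul (differentiableAt_pd hf j))
      ((differentiableAt_pd ha j).fun_smul h2)]
    rfl
  have h5 : pd i (pd j (fun y => a y • f y)) z = pd i (fun y => a y • pd j f y + pd j a y • f y) z := by
    rw [pd, pd, hev.fderiv_eq]
  rw [h5, hadd, h3, h4]
  abel

variable {w : Metric.sphere (0 : EuclideanSpace ℝ (Fin (n + 1))) 1 → ℝ} {ρ : ℝ}

theorem pd_radius (hw : ContDiffAt ℝ 2 (fun y => w (Θ y)) z) (i : Fin n) :
    pd i (fun y => ρ * (1 - w (Θ y))) z = -(ρ * d1 w Θ z i) := by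
  have h1 := hw.differentiableAt (by norm_num)
  rw [pd, fderiv_const_mul (h1.const_sub 1), fderiv_const_sub]
  simp [d1, pd]

theorem pd_pd_radius (hw : ContDiffAt ℝ 2 (fun y => w (Θ y)) z) (i j : Fin n) :
    pd i (pd j (fun y => ρ * (1 - w (Θ y)))) z = -(ρ * d2 w Θ z i j) := by
  have hev : pd j (fun y => ρ * (1 - w (Θ y))) =ᶠ[𝓝 z] fun y => -(ρ * pd j (fun y => w (Θ y)) y) := by
    filter_upwards [hw.eventually (by simp)] with y hy
    exact pd_radius hy j
  rw [pd, hev.fderiv_eq, fderiv_fun_neg, fderiv_const_mul (differentiableAt_pd hw j)]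
  simp [d2, pd]

theorem contDiffAt_perturbedSphere (hw : ContDiffAt ℝ 2 (fun y => w (Θ y)) z)
    (hP : IsNormalParam Θ z) : ContDiffAt ℝ 2 (perturbedSphere ρ w Θ) z :=
  (contDiffAt_const.mul (contDiffAt_const.sub hw)).smul hP.contDiffAt_two

theorem pd_perturbedSphere (hw : ContDiffAt ℝ 2 (fun y => w (Θ y)) z)
    (hP : IsNormalParam Θ z) (i : Fin n) :
    pd i (perturbedSphere ρ w Θ) z
      = ρ • ((1 - w (Θ z)) • tang Θ z i - d1 w Θ z i • amb Θ z) := by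
  have ha : ContDiffAt ℝ 2 (fun y => ρ * (1 - w (Θ y))) z :=
    contDiffAt_const.mul (contDiffAt_const.sub hw)
  have := pd_smul (ha.differentiableAt (by norm_num))
    (hP.contDiffAt_two.differentiableAt (by norm_num)) i
  change pd i (fun y => (ρ * (1 - w (Θ y))) • amb Θ y) z = _
  rw [this, pd_radius hw, tang]
  module

theorem pd_pd_perturbedSphere (hw : ContDiffAt ℝ 2 (fun y => w (Θ y)) z)
    (hP : IsNormalParam Θ z) (i j : Fin n) :
    pd i (pd j (perturbedSphere ρ w Θ)) z
      = -(ρ • (((1 - w (Θ z)) * (if i = j then 1 else 0) + d2 w Θ z i j) • amb Θ z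
        + d1 w Θ z i • tang Θ z j + d1 w Θ z j • tang Θ z i)) := by
  have ha : ContDiffAt ℝ 2 (fun y => ρ * (1 - w (Θ y))) z :=
    contDiffAt_const.mul (contDiffAt_const.sub hw)
  have := pd_pd_smul ha hP.contDiffAt_two i j
  change pd i (pd j (fun y => (ρ * (1 - w (Θ y))) • amb Θ y)) z = _
  rw [this, pd_radius hw, pd_radius hw, pd_pd_radius hw, hP.pd_pd, tang, tang]
  module

theorem inner_sphGrad (hP : IsNormalParam Θ z) (i : Fin n) :
    inner ℝ (sphGrad w Θ z) (tang Θ z i) = d1 w Θ z i := by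
  rw [sphGrad, sum_inner, Finset.sum_eq_single i]
  · rw [real_inner_smul_left, hP.orthonormal, if_pos rfl, mul_one]
  · intro j _ hj
    rw [real_inner_smul_left, hP.orthonormal, if_neg hj, mul_zero]
  · simp

theorem inner_sphGrad_amb (hP : IsNormalParam Θ z) :
    inner ℝ (amb Θ z) (sphGrad w Θ z) = (0 : ℝ) := by
  rw [sphGrad, inner_sum]
  exact Finset.sum_eq_zero fun i _ => by rw [inner_smul_right, hP.frame.perp, mul_zero]

end Param

/-! ### Linear algebra of the first fundamental form -/

section FirstOp

variable {m : ℕ}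

/-- The first fundamental form of a perturbed sphere, up to the factor `ρ²`, extended to the
ambient space. -/
noncomputable def firstOp (S : Euc m →L[ℝ] Euc m) (s : ℝ) (ξ : Euc m) : Euc m →L[ℝ] Euc m :=
  s ^ 2 • S + (innerSL ℝ ξ).smulRight ξ

/-- The squared norm of the conormal `θ + ξ / s`. -/
noncomputable def conormSq (S : Euc m →L[ℝ] Euc m) (s : ℝ) (ξ : Euc m) : ℝ :=
  1 + (s ^ 2)⁻¹ * inner ℝ ξ (Ring.inverse S ξ)

/-- The inverse of the first fundamental form, divided by the norm of the conormal. -/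
noncomputable def frameOp (S : Euc m →L[ℝ] Euc m) (s : ℝ) (ξ : Euc m) : Euc m →L[ℝ] Euc m :=
  (Real.sqrt (conormSq S s ξ))⁻¹ • Ring.inverse (firstOp S s ξ)

variable {S : Euc m →L[ℝ] Euc m} {s : ℝ} {ξ x : Euc m}

theorem firstOp_apply (u : Euc m) : firstOp S s ξ u = s ^ 2 • S u + (inner ℝ ξ u : ℝ) • ξ := by
  simp [firstOp]

theorem firstOp_symm (hS : ∀ u v, inner ℝ (S u) v = (inner ℝ (S v) u : ℝ)) (u v : Euc m) :
    inner ℝ (firstOp S s ξ u) v = (inner ℝ (firstOp S s ξ v) u : ℝ) := by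
  rw [firstOp_apply, firstOp_apply, inner_add_left, inner_add_left, real_inner_smul_left,
    real_inner_smul_left, real_inner_smul_left, real_inner_smul_left, hS]
  ring

theorem firstOp_pos (hp : ∀ u, u ≠ 0 → 0 < (inner ℝ (S u) u : ℝ)) (hs : 0 < s) (u : Euc m)
    (hu : u ≠ 0) : 0 < (inner ℝ (firstOp S s ξ u) u : ℝ) := by
  rw [firstOp_apply, inner_add_left, real_inner_smul_left, real_inner_smul_left]
  have := mul_pos (pow_pos hs 2) (hp u hu)
  nlinarith [mul_self_nonneg (inner ℝ ξ u : ℝ)]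

theorem isUnit_of_pos (hp : ∀ u, u ≠ 0 → 0 < (inner ℝ (S u) u : ℝ)) : IsUnit S := by
  have hinj : Function.Injective S := by
    refine (injective_iff_map_eq_zero _).2 fun u hu => ?_
    by_contra hne
    have := hp u hne
    rw [hu, inner_zero_left] at this
    exact lt_irrefl _ this
  rw [ContinuousLinearMap.isUnit_iff_bijective]
  exact ⟨hinj, (LinearMap.injective_iff_surjective (f := (S : Euc m →ₗ[ℝ] Euc m))).1 hinj⟩

theorem apply_inverse_of_isUnit (hS : IsUnit S) (u : Euc m) : S (Ring.inverse S u) = u :=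
  congrArg (fun A : Euc m →L[ℝ] Euc m => A u) (Ring.mul_inverse_cancel _ hS)

theorem inverse_apply_of_isUnit (hS : IsUnit S) (u : Euc m) : Ring.inverse S (S u) = u :=
  congrArg (fun A : Euc m →L[ℝ] Euc m => A u) (Ring.inverse_mul_cancel _ hS)

theorem inner_inverse_nonneg (hp : ∀ u, u ≠ 0 → 0 < (inner ℝ (S u) u : ℝ)) (u : Euc m) :
    0 ≤ (inner ℝ u (Ring.inverse S u) : ℝ) := by
  by_cases h0 : Ring.inverse S u = 0
  · rw [h0, inner_zero_right]
  · have := hp _ h0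
    rw [apply_inverse_of_isUnit (isUnit_of_pos hp)] at this
    exact this.le

theorem conormSq_pos (hp : ∀ u, u ≠ 0 → 0 < (inner ℝ (S u) u : ℝ)) :
    0 < conormSq S s ξ := by
  have := mul_nonneg (inv_nonneg.2 (sq_nonneg s)) (inner_inverse_nonneg hp ξ)
  rw [conormSq]; linarith

theorem firstOp_radial (hx : S x = x) (hξ : inner ℝ x ξ = (0 : ℝ)) :
    firstOp S s ξ x = s ^ 2 • x := by
  rw [firstOp_apply, hx, real_inner_comm, hξ, zero_smul, add_zero]

/-- The radial vector is an eigenvector of the symmetric operator `firstOp`, so its orthogonal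
complement is invariant. The inverse taken in the ambient space thus restricts to the inverse on the
tangent space of the sphere, and everything can be written without a choice of tangent frame. -/
theorem inner_inverse_firstOp (hS : ∀ u v, inner ℝ (S u) v = (inner ℝ (S v) u : ℝ))
    (hp : ∀ u, u ≠ 0 → 0 < (inner ℝ (S u) u : ℝ)) (hs : 0 < s) (hx : S x = x)
    (hξ : inner ℝ x ξ = (0 : ℝ)) {u : Euc m} (hu : inner ℝ x u = (0 : ℝ)) :
    inner ℝ x (Ring.inverse (firstOp S s ξ) u) = (0 : ℝ) := by
  have h1 : (inner ℝ (firstOp S s ξ x) (Ring.inverse (firstOp S s ξ) u) : ℝ) = 0 := by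
    rw [firstOp_symm hS, apply_inverse_of_isUnit (isUnit_of_pos (firstOp_pos hp hs)),
      real_inner_comm, hu]
  rw [firstOp_radial hx hξ, real_inner_smul_left] at h1
  exact (mul_eq_zero.1 h1).resolve_left (pow_ne_zero 2 hs.ne')

end FirstOp

/-- The Christoffel symbols of the metric `⟨T u, v⟩`. -/
noncomputable def gam {m : ℕ} (T : Euc m → Euc m →L[ℝ] Euc m) (y u v : Euc m) : Euc m :=
  Ring.inverse (T y) (kosVec T y u v)

/-- The part of the second fundamental form of a perturbed sphere that depends only on the `1`-jet
`j`. -/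
noncomputable def jetForm {m : ℕ} (T : Euc m → Euc m →L[ℝ] Euc m) (ρ : ℝ) (x : Euc m)
    (j : ℝ × Euc m) (u v : Euc m) : ℝ :=
  inner ℝ (T ((ρ * (1 - j.1)) • x) u)
      ((1 - j.1) • v + (ρ * (1 - j.1) ^ 2) • gam T ((ρ * (1 - j.1)) • x) x v)
    + 2 / (1 - j.1) * (inner ℝ j.2 u * inner ℝ j.2 v)
    - ρ / (1 - j.1) * inner ℝ j.2 (gam T ((ρ * (1 - j.1)) • x)
        ((1 - j.1) • u - (inner ℝ j.2 u : ℝ) • x) ((1 - j.1) • v - (inner ℝ j.2 v : ℝ) • x))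

/-! ### Bilinearity of `gam` and `jetForm` -/

section Gam

variable {m : ℕ} (T : Euc m → Euc m →L[ℝ] Euc m) (y u u' v v' : Euc m)

theorem gam_add_left : gam T y (u + u') v = gam T y u v + gam T y u' v := by
  rw [gam, gam, gam, ← map_add]
  congr 1
  refine ext_inner_right ℝ fun a => ?_
  simp only [inner_add_left, inner_kosVec, kos, map_add, _root_.add_apply]
  ring

theorem gam_smul_left (r : ℝ) : gam T y (r • u) v = r • gam T y u v := by
  rw [gam, gam, ← map_smul]
  congr 1
  refine ext_inner_right ℝ fun a => ?_
  simp only [inner_kosVec, kos, map_smul, _root_.smul_apply, real_inner_smul_left]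
  ring

theorem gam_add_right : gam T y u (v + v') = gam T y u v + gam T y u v' := by
  rw [gam, gam, gam, ← map_add]
  congr 1
  refine ext_inner_right ℝ fun a => ?_
  simp only [inner_add_left, inner_kosVec, kos, map_add, _root_.add_apply, inner_add_right]
  ring

theorem gam_smul_right (r : ℝ) : gam T y u (r • v) = r • gam T y u v := by
  rw [gam, gam, ← map_smul]
  congr 1
  refine ext_inner_right ℝ fun a => ?_
  simp only [inner_kosVec, kos, map_smul, _root_.smul_apply, real_inner_smul_left, inner_smul_right]
  ring

variable {T y u u' v v'} {ρ : ℝ} {x : Euc m} {j : ℝ × Euc m}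

theorem jetForm_add_left :
    jetForm T ρ x j (u + u') v = jetForm T ρ x j u v + jetForm T ρ x j u' v := by
  have h : (1 - j.1) • (u + u') - (inner ℝ j.2 (u + u') : ℝ) • x
      = ((1 - j.1) • u - (inner ℝ j.2 u : ℝ) • x) + ((1 - j.1) • u' - (inner ℝ j.2 u' : ℝ) • x) := by
    rw [inner_add_right]; module
  rw [jetForm, h, gam_add_left, map_add, inner_add_left, inner_add_right j.2 u u',
    inner_add_right j.2 (gam _ _ _ _), jetForm, jetForm]
  ring

theorem jetForm_smul_left (r : ℝ) : jetForm T ρ x j (r • u) v = r * jetForm T ρ x j u v := by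
  have h : (1 - j.1) • (r • u) - (inner ℝ j.2 (r • u) : ℝ) • x
      = r • ((1 - j.1) • u - (inner ℝ j.2 u : ℝ) • x) := by
    rw [inner_smul_right]; module
  rw [jetForm, h, gam_smul_left, map_smul, real_inner_smul_left, inner_smul_right,
    inner_smul_right, jetForm]
  ring

theorem jetForm_add_right :
    jetForm T ρ x j u (v + v') = jetForm T ρ x j u v + jetForm T ρ x j u v' := by
  have h : (1 - j.1) • (v + v') - (inner ℝ j.2 (v + v') : ℝ) • x
      = ((1 - j.1) • v - (inner ℝ j.2 v : ℝ) • x) + ((1 - j.1) • v' - (inner ℝ j.2 v' : ℝ) • x) := by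
    rw [inner_add_right]; module
  rw [jetForm, h, gam_add_right, gam_add_right, jetForm, jetForm]
  simp only [smul_add, inner_add_right]
  ring

theorem jetForm_smul_right (r : ℝ) : jetForm T ρ x j u (r • v) = r * jetForm T ρ x j u v := by
  have h : (1 - j.1) • (r • v) - (inner ℝ j.2 (r • v) : ℝ) • x
      = r • ((1 - j.1) • v - (inner ℝ j.2 v : ℝ) • x) := by
    rw [inner_smul_right]; module
  rw [jetForm, h, gam_smul_right, gam_smul_right, jetForm]
  simp only [inner_add_right, inner_smul_right]
  ring

theorem jetForm_sum_left {ι : Type*} (t : Finset ι) (c : ι → ℝ) (u : ι → Euc m) :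
    jetForm T ρ x j (∑ i ∈ t, c i • u i) v = ∑ i ∈ t, c i * jetForm T ρ x j (u i) v := by
  classical
  induction t using Finset.induction_on with
  | empty => simpa using jetForm_smul_left (T := T) (ρ := ρ) (x := x) (j := j) (u := 0) (v := v) 0
  | insert i t hi ih =>
    rw [Finset.sum_insert hi, Finset.sum_insert hi, jetForm_add_left, jetForm_smul_left, ih]

end Gam

/-! ### Exact formula for the shape operator of a perturbed sphere -/

section Exact

variable {n : ℕ} {h : Euc (n + 1) → Euc (n + 1) → Euc (n + 1) → ℝ}
  {T : Euc (n + 1) → Euc (n + 1) →L[ℝ] Euc (n + 1)} {R : ℝ}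

theorem MetricOn.gam_eq {m : ℕ} {h : Euc m → Euc m → Euc m → ℝ} {T : Euc m → Euc m →L[ℝ] Euc m}
    {U : Set (Euc m)} (H : MetricOn h T U) {y : Euc m} (hy : y ∈ U) (u v : Euc m) :
    gam T y u v = christoffel h y u v := (H.christoffel_eq hy u v).symm

/-- The radial component of the Christoffel symbols, by the Gauss lemma. -/
theorem NormalMetricOn.inner_radial_christoffel (N : NormalMetricOn h T R) {x : Euc (n + 1)} {s ρ : ℝ}
    (hy : (ρ * s) • x ∈ Metric.ball (0 : Euc (n + 1)) R) (u v ξ : Euc (n + 1)) :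
    ρ * inner ℝ x (christoffel h ((ρ * s) • x) (s • u - (inner ℝ ξ u : ℝ) • x)
        (s • v - (inner ℝ ξ v : ℝ) • x))
      = s * inner ℝ u v - s * inner ℝ (T ((ρ * s) • x) u) v
        - ρ * s ^ 2 * inner ℝ (T ((ρ * s) • x) u) (christoffel h ((ρ * s) • x) x v) := by
  set y := (ρ * s) • x with hydef
  have hTx : T y x = x := N.T_ray hy
  have hxT : ∀ a, (inner ℝ x a : ℝ) = inner ℝ (T y a) x := fun a => by
    rw [N.symm _ hy, hTx]
  have hxx : christoffel h y x x = 0 := N.christoffel_ray hy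
  have hTg : ∀ v, T y (christoffel h y x v) = (1 / 2 : ℝ) • fderiv ℝ T y x v := fun v =>
    N.T_christoffel_ray hy v
  have hrad : ∀ a, (inner ℝ (fderiv ℝ T y x a) x : ℝ) = 0 := fun a => by
    have := hTg x
    rw [hxx, map_zero] at this
    rw [N.symm_fderiv hy, (smul_eq_zero.1 this.symm).resolve_left (by norm_num), inner_zero_left]
  have h1 : ∀ a, (inner ℝ x (christoffel h y x a) : ℝ) = 0 := fun a => by
    rw [hxT, hTg, real_inner_smul_left, hrad, mul_zero]
  have h2 : ∀ a, (inner ℝ x (christoffel h y a x) : ℝ) = 0 := fun a => by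
    rw [N.christoffel_symm hy, h1]
  -- The radial vector is fixed by the metric operator, so its product with `Γ(u, v)` is a Koszul
  -- expression. The factor `ρ s` times the two derivatives along `u` and `v` is given by the Gauss
  -- lemma, and the third derivative is radial, hence twice `Γ(x, ·)`.
  have h3 : ρ * s * inner ℝ x (christoffel h y u v)
      = inner ℝ u v - inner ℝ (T y u) v - (ρ * s) * inner ℝ (T y u) (christoffel h y x v) := by
    have e1 := congrArg (fun a => (inner ℝ a v : ℝ)) (N.fderiv_T_ray_apply hy u)
    have e2 := congrArg (fun a => (inner ℝ a u : ℝ)) (N.fderiv_T_ray_apply hy v)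
    simp only [real_inner_smul_left, inner_sub_left] at e1 e2
    rw [← hydef] at e1 e2
    rw [hxT, N.koszul hy, kos, N.symm _ hy u (christoffel h y x v), hTg, real_inner_smul_left,
      N.symm_fderiv hy v x u, N.symm_fderiv hy u x v, N.symm_fderiv hy u v x]
    rw [real_inner_comm u v, N.symm _ hy v u] at e2
    rw [N.symm_fderiv hy v u x]
    rw [N.symm_fderiv hy u v x]
    linarith
  have h4 : christoffel h y (s • u - (inner ℝ ξ u : ℝ) • x) (s • v - (inner ℝ ξ v : ℝ) • x)
      = (s ^ 2) • christoffel h y u v - (s * inner ℝ ξ v) • christoffel h y u x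
        - (s * inner ℝ ξ u) • christoffel h y x v := by
    rw [sub_eq_add_neg, sub_eq_add_neg, ← neg_smul, ← neg_smul, N.christoffel_add hy,
      N.christoffel_add_left hy, N.christoffel_add_left hy]
    simp only [N.christoffel_smul hy, N.christoffel_smul_left hy, hxx]
    module
  rw [h4, inner_sub_right, inner_sub_right, inner_smul_right, inner_smul_right, inner_smul_right,
    h1, h2]
  linear_combination s * h3

variable {θ ξ : Euc (n + 1)} {e : Fin n → Euc (n + 1)} {S : Euc (n + 1) →L[ℝ] Euc (n + 1)} {s : ℝ}

theorem inner_conormal (A : AdaptedFrame θ e) (hp : ∀ u, u ≠ 0 → 0 < (inner ℝ (S u) u : ℝ))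
    (hS : ∀ u v, inner ℝ (S u) v = (inner ℝ (S v) u : ℝ)) (hx : S θ = θ)
    (hξ : inner ℝ θ ξ = (0 : ℝ)) :
    inner ℝ (θ + s⁻¹ • ξ) (Ring.inverse S (θ + s⁻¹ • ξ)) = conormSq S s ξ := by
  have hSU := isUnit_of_pos hp
  have h1 : Ring.inverse S θ = θ := by
    conv_lhs => rw [← hx]
    exact inverse_apply_of_isUnit hSU θ
  have h2 : (inner ℝ θ (Ring.inverse S ξ) : ℝ) = 0 := by
    conv_lhs => rw [← hx]
    rw [hS, apply_inverse_of_isUnit hSU, real_inner_comm, hξ]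
  have h3 : (inner ℝ ξ θ : ℝ) = 0 := by rw [real_inner_comm, hξ]
  rw [map_add, map_smul, h1, conormSq, inner_add_left, inner_add_right, inner_add_right,
    real_inner_smul_left, real_inner_smul_left, inner_smul_right, inner_smul_right, h2,
    A.inner_self, h3]
  ring

/-- The inverse of the matrix of the first fundamental form of a perturbed sphere. -/
theorem firstOp_matrix_mul (A : AdaptedFrame θ e) (hp : ∀ u, u ≠ 0 → 0 < (inner ℝ (S u) u : ℝ))
    (hS : ∀ u v, inner ℝ (S u) v = (inner ℝ (S v) u : ℝ)) (hx : S θ = θ)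
    (hξ : inner ℝ θ ξ = (0 : ℝ)) (hs : 0 < s) {ρ : ℝ} (hρ : 0 < ρ) :
    Matrix.of (fun i j => ρ ^ 2 * (inner ℝ (firstOp S s ξ (e i)) (e j) : ℝ))
      * Matrix.of (fun i j => (ρ ^ 2)⁻¹ * (inner ℝ (e j) (Ring.inverse (firstOp S s ξ) (e i)) : ℝ))
      = 1 := by
  have hBU : IsUnit (firstOp S s ξ) := isUnit_of_pos (firstOp_pos hp hs)
  have hperp : ∀ i, inner ℝ θ (firstOp S s ξ (e i)) = (0 : ℝ) := fun i => by
    rw [real_inner_comm, firstOp_symm hS, firstOp_radial hx hξ, real_inner_smul_left, A.perp,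
      mul_zero]
  have hB : ∀ a b, (inner ℝ a (Ring.inverse (firstOp S s ξ) b) : ℝ)
      = inner ℝ b (Ring.inverse (firstOp S s ξ) a) := fun a b => by
    have := firstOp_symm (s := s) (ξ := ξ) hS (Ring.inverse (firstOp S s ξ) a)
      (Ring.inverse (firstOp S s ξ) b)
    rwa [apply_inverse_of_isUnit hBU, apply_inverse_of_isUnit hBU] at this
  ext i j
  rw [Matrix.mul_apply, Matrix.one_apply, ← A.orthonormal]
  have h1 : (inner ℝ (e i) (e j) : ℝ)
      = inner ℝ (firstOp S s ξ (e i)) (Ring.inverse (firstOp S s ξ) (e j)) := by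
    rw [hB, inverse_apply_of_isUnit hBU, real_inner_comm]
  rw [h1, ← A.sum_inner_mul (hperp i)]
  refine Finset.sum_congr rfl fun k _ => ?_
  rw [Matrix.of_apply, Matrix.of_apply, hB (e j), real_inner_comm (e k)]
  field_simp

theorem AdaptedFrame.posDef_firstOp (A : AdaptedFrame θ e)
    (hp : ∀ u, u ≠ 0 → 0 < (inner ℝ (S u) u : ℝ))
    (hS : ∀ u v, inner ℝ (S u) v = (inner ℝ (S v) u : ℝ)) (hs : 0 < s) {ρ : ℝ} (hρ : 0 < ρ) :
    (Matrix.of fun i j => ρ ^ 2 * (inner ℝ (firstOp S s ξ (e i)) (e j) : ℝ)).PosDef := by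
  refine Matrix.PosDef.of_dotProduct_mulVec_pos (Matrix.IsHermitian.ext fun i j => ?_)
    fun {c} hc => ?_
  · rw [star_trivial, Matrix.of_apply, Matrix.of_apply, firstOp_symm hS]
  · have h0 : ∑ i, c i • e i ≠ 0 := fun h0 => hc <| by
      ext i
      have h1 := congrArg (fun v => (inner ℝ (e i) v : ℝ)) h0
      simpa [inner_sum, inner_smul_right, A.orthonormal] using h1
    have h1 := mul_pos (pow_pos hρ 2) (firstOp_pos (ξ := ξ) hp hs _ h0)
    refine h1.trans_eq ?_
    simp only [map_sum, map_smul, sum_inner, inner_sum, real_inner_smul_left, inner_smul_right,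
      star_trivial, dotProduct, Matrix.mulVec, Matrix.of_apply, Finset.mul_sum]
    rw [Finset.sum_comm]
    refine Finset.sum_congr rfl fun i _ => Finset.sum_congr rfl fun j _ => ?_
    rw [firstOp_symm hS]
    ring

theorem pd_pd_symm {m k : ℕ} {X : Euc k → Euc m} {z : Euc k} (hX : ContDiffAt ℝ 2 X z)
    (i j : Fin k) : pd i (pd j X) z = pd j (pd i X) z := by
  have hd : DifferentiableAt ℝ (fderiv ℝ X) z :=
    (hX.fderiv_right (m := 1) (by norm_num)).differentiableAt (by norm_num)
  have h1 : ∀ i j, pd i (pd j X) z = fderiv ℝ (fderiv ℝ X) z (stdVec i) (stdVec j) := fun i j => by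
    have h2 : HasFDerivAt (pd j X) _ z := hd.hasFDerivAt.clm_apply (hasFDerivAt_const (stdVec j) z)
    rw [pd, h2.fderiv]
    simp
  rw [h1, h1, (hX.isSymmSndFDerivAt (by simp)).eq]

/-- The vector orthogonal to a perturbed sphere is dual to the conormal. -/
theorem eq_conormal (A : AdaptedFrame θ e) (hp : ∀ u, u ≠ 0 → 0 < (inner ℝ (S u) u : ℝ))
    (hS : ∀ u v, inner ℝ (S u) v = (inner ℝ (S v) u : ℝ)) (hx : S θ = θ)
    (hξ : inner ℝ θ ξ = (0 : ℝ)) (hs : 0 < s) {P : Euc (n + 1)}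
    (hP : ∀ i, (inner ℝ (S P) (s • e i - (inner ℝ ξ (e i) : ℝ) • θ) : ℝ) = 0)
    (hP' : (inner ℝ (θ + s⁻¹ • ξ) P : ℝ) = -1) :
    S P = -(conormSq S s ξ)⁻¹ • (θ + s⁻¹ • ξ) ∧ (inner ℝ (S P) P : ℝ) = (conormSq S s ξ)⁻¹ := by
  have hD := conormSq_pos (s := s) (ξ := ξ) hp
  -- Orthogonality to the tangent vectors determines the covector `S P` up to a factor, namely its
  -- radial component. The normalization in `hP'` then fixes the factor.
  have hτ : S P = (inner ℝ θ (S P) : ℝ) • (θ + s⁻¹ • ξ) := by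
    refine A.ext_inner ?_ fun i => ?_
    · rw [inner_smul_right, inner_add_right, A.inner_self, inner_smul_right, hξ]
      ring
    · have h1 := hP i
      rw [inner_sub_right, inner_smul_right, inner_smul_right] at h1
      rw [inner_smul_right, inner_add_right, A.perp', inner_smul_right,
        real_inner_comm ξ (e i), real_inner_comm (S P) (e i), real_inner_comm (S P) θ]
      field_simp
      linarith
  set c : ℝ := inner ℝ θ (S P) with hc
  have h2 : P = c • Ring.inverse S (θ + s⁻¹ • ξ) := by
    rw [← map_smul, ← hτ, inverse_apply_of_isUnit (isUnit_of_pos hp)]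
  have h3 : c * conormSq S s ξ = -1 := by
    rw [h2, inner_smul_right, inner_conormal A hp hS hx hξ] at hP'
    exact hP'
  have h4 : c = -(conormSq S s ξ)⁻¹ := by
    field_simp
    linarith
  refine ⟨by rw [hτ, h4], ?_⟩
  rw [hτ, real_inner_smul_left, hP', h4]
  ring

set_option maxHeartbeats 800000 in
/-- The shape operator of a perturbed sphere, in terms of the `2`-jet of the perturbation. -/
theorem NormalMetricOn.shapeMatrix_perturbedSphere (N : NormalMetricOn h T R) {ρ : ℝ} (hρ : 0 < ρ)
    {w : Metric.sphere (0 : EuclideanSpace ℝ (Fin (n + 1))) 1 → ℝ}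
    {Θ : EuclideanSpace ℝ (Fin n) → Metric.sphere (0 : EuclideanSpace ℝ (Fin (n + 1))) 1}
    {z : EuclideanSpace ℝ (Fin n)} (hw : ContDiffAt ℝ 2 (fun y => w (Θ y)) z)
    (hP : IsNormalParam Θ z) (hs : w (Θ z) < 1)
    (hy : (ρ * (1 - w (Θ z))) • amb Θ z ∈ Metric.ball (0 : Euc (n + 1)) R) :
    (firstForm h (perturbedSphere ρ w Θ) z).PosDef ∧
    (secondForm h (perturbedSphere ρ w Θ) (amb Θ) z).IsHermitian ∧
    ∀ i j, ρ * shapeMatrix h (perturbedSphere ρ w Θ) (amb Θ) z i j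
      = jetForm T ρ (amb Θ z) (jet1 w Θ z)
          (frameOp (T ((ρ * (1 - w (Θ z))) • amb Θ z)) (1 - w (Θ z)) (sphGrad w Θ z) (tang Θ z i))
          (tang Θ z j)
        + (jet2 w Θ z).2.2
          (frameOp (T ((ρ * (1 - w (Θ z))) • amb Θ z)) (1 - w (Θ z)) (sphGrad w Θ z) (tang Θ z i))
          (tang Θ z j) := by
  have A := hP.frame
  have hgr : ∀ i, inner ℝ (sphGrad w Θ z) (tang Θ z i) = d1 w Θ z i := inner_sphGrad hP
  have hgx := inner_sphGrad_amb (w := w) hP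
  have hXz : perturbedSphere ρ w Θ z = (ρ * (1 - w (Θ z))) • amb Θ z := rfl
  have hX := contDiffAt_perturbedSphere (ρ := ρ) hw hP
  have hZ := pd_perturbedSphere (ρ := ρ) hw hP
  have hZZ := pd_pd_perturbedSphere (ρ := ρ) hw hP
  have hTx := N.T_ray hy
  have hrc := fun u v => N.inner_radial_christoffel (x := amb Θ z) (s := 1 - w (Θ z)) (ρ := ρ) hy
    u v (sphGrad w Θ z)
  have hjf : jet1 w Θ z = (w (Θ z), sphGrad w Θ z) := rfl
  have hj2 : ∀ u v, (jet2 w Θ z).2.2 u v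
      = ∑ k, ∑ l, d2 w Θ z k l * (inner ℝ (tang Θ z k) u * inner ℝ (tang Θ z l) v) := fun u v => by
    simp [jet2]
  set θ := amb Θ z with hθ
  set e := tang Θ z with he
  set ξ := sphGrad w Θ z with hξ
  set s := 1 - w (Θ z) with hsdef
  have hs0 : 0 < s := sub_pos.2 hs
  set y := (ρ * s) • θ with hydef
  set S := T y with hSdef
  have hSs : ∀ u v, inner ℝ (S u) v = (inner ℝ (S v) u : ℝ) := N.symm y hy
  have hSp : ∀ u, u ≠ 0 → 0 < (inner ℝ (S u) u : ℝ) := N.pos y hy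
  have hSx : ∀ a, (inner ℝ (S a) θ : ℝ) = inner ℝ θ a := fun a => by
    rw [hSs, hTx]
  -- the first fundamental form and its inverse
  have hG : firstForm h (perturbedSphere ρ w Θ) z
      = Matrix.of fun i j => ρ ^ 2 * (inner ℝ (firstOp S s ξ (e i)) (e j) : ℝ) := by
    ext i j
    rw [firstForm, Matrix.of_apply, Matrix.of_apply, hXz, N.eq y hy, hZ, hZ, firstOp_apply,
      ← hgr, ← hgr]
    simp only [map_smul, map_sub, real_inner_smul_left, inner_smul_right, inner_sub_left,
      inner_sub_right, inner_add_left, hTx, hSx, A.perp, A.inner_self, ← hSdef]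
    ring
  have hGG := firstOp_matrix_mul A hSp hSs hTx hgx hs0 hρ
  rw [← hG] at hGG
  have hdet : IsUnit (firstForm h (perturbedSphere ρ w Θ) z).det :=
    Matrix.isUnit_det_of_right_inverse hGG
  have hinv := Matrix.inv_eq_right_inv hGG
  -- the normal
  have hD := conormSq_pos (s := s) (ξ := ξ) hSp
  have hgx' : (inner ℝ ξ θ : ℝ) = 0 := by rw [real_inner_comm, hgx]
  set P := preNormal h (perturbedSphere ρ w Θ) (amb Θ) z with hP'
  -- The conormal annihilates every `Z_i`, so only the term `-Θ` of the pre-normal contributes,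
  -- whatever the coefficients of the `Z_j` are.
  have hνP : (inner ℝ (θ + s⁻¹ • ξ) P : ℝ) = -1 := by
    have hνZ : ∀ i, inner ℝ (θ + s⁻¹ • ξ) (pd i (perturbedSphere ρ w Θ) z) = (0 : ℝ) := fun i => by
      rw [hZ, inner_smul_right, inner_sub_right, inner_smul_right, inner_smul_right,
        inner_add_left, inner_add_left, real_inner_smul_left, real_inner_smul_left, A.perp,
        A.inner_self, hgr, hgx']
      field_simp
      ring
    rw [hP', preNormal, inner_add_right, inner_neg_right, inner_sum]
    simp only [inner_smul_right, hνZ, mul_zero, Finset.sum_const_zero]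
    rw [← hθ, inner_add_left, A.inner_self, real_inner_smul_left, hgx']
    ring
  obtain ⟨hSP, hSPP⟩ := eq_conormal A hSp hSs hTx hgx hs0 (P := P) (fun i => by
    have h1 := N.inner_preNormal_pd (X := perturbedSphere ρ w Θ) (υ := amb Θ) (y := z) hy hdet i
    rw [hZ, inner_smul_right] at h1
    rw [hgr]
    exact (mul_eq_zero.1 h1).resolve_left hρ.ne') hνP
  have hpre0 : P ≠ 0 := by
    intro h0
    rw [h0, inner_zero_right] at hνP
    norm_num at hνP
  have hNν : S (unitNormal h (perturbedSphere ρ w Θ) (amb Θ) z)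
      = -(Real.sqrt (conormSq S s ξ))⁻¹ • (θ + s⁻¹ • ξ) := by
    rw [unitNormal, hXz, N.eq y hy, ← hP', ← hSdef, hSPP, map_smul, hSP, smul_smul, Real.sqrt_inv,
      inv_inv]
    congr 1
    rw [mul_neg, neg_inj]
    have := Real.sq_sqrt hD.le
    have h3 := (Real.sqrt_pos.2 hD).ne'
    field_simp
    exact this
  -- The second derivatives of the parametrization and the Christoffel term are paired with the
  -- conormal. Replacing the radial component of the Christoffel term by means of `hrc` produces
  -- `⟨e_i, e_j⟩`, which cancels the Kronecker symbol from the second derivatives of `Θ`.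
  have hb : ∀ i j, secondForm h (perturbedSphere ρ w Θ) (amb Θ) z i j
      = ρ * (Real.sqrt (conormSq S s ξ))⁻¹ * (jetForm T ρ θ (w (Θ z), ξ) (e i) (e j)
        + d2 w Θ z i j) := fun i j => by
    rw [N.secondForm_eq hX hy (hP.contDiffAt_two.differentiableAt (by norm_num)) hdet hpre0]
    rw [hXz, ← hSdef, hNν, hZZ, hZ, hZ, N.christoffel_smul hy, N.christoffel_smul_left hy,
      ← hgr i, ← hgr j, jetForm, N.gam_eq hy, N.gam_eq hy]
    have h1 := hrc (e i) (e j)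
    dsimp only
    rw [← hsdef, ← hydef, ← hSdef]
    generalize christoffel h y (s • e i - (inner ℝ ξ (e i) : ℝ) • θ)
      (s • e j - (inner ℝ ξ (e j) : ℝ) • θ) = G at h1 ⊢
    generalize christoffel h y θ (e j) = G' at h1 ⊢
    simp only [real_inner_smul_left, inner_add_right, inner_neg_right, inner_smul_right,
      inner_add_left, A.perp, A.inner_self, hgx', A.orthonormal] at h1 ⊢
    generalize (Real.sqrt (conormSq S s ξ))⁻¹ = q
    field_simp
    linear_combination (-q * s) * h1
  refine ⟨hG ▸ A.posDef_firstOp hSp hSs hs0 hρ, Matrix.IsHermitian.ext fun i j => ?_, fun i j => ?_⟩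
  · rw [star_trivial, N.secondForm_eq hX hy (hP.contDiffAt_two.differentiableAt (by norm_num)) hdet
      hpre0, N.secondForm_eq hX hy (hP.contDiffAt_two.differentiableAt (by norm_num)) hdet hpre0,
      N.christoffel_symm (x := perturbedSphere ρ w Θ z) hy, pd_pd_symm hX]
  -- The coefficients of the frame vector are, up to normalization, the entries of the inverse first
  -- fundamental form. The matrix product in the shape operator thus becomes linearity in the first
  -- argument.
  have hexp : frameOp S s ξ (e i) = ∑ k, ((Real.sqrt (conormSq S s ξ))⁻¹
      * inner ℝ (e k) (Ring.inverse (firstOp S s ξ) (e i))) • e k := by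
    rw [frameOp, _root_.smul_apply]
    conv_lhs => rw [A.expand_of_perp (inner_inverse_firstOp hSs hSp hs0 hTx hgx (A.perp i)),
      Finset.smul_sum]
    simp only [smul_smul]
  rw [shapeMatrix, hinv, Matrix.mul_apply, Finset.mul_sum, hjf, hexp, jetForm_sum_left, map_sum,
    _root_.sum_apply, ← Finset.sum_add_distrib]
  refine Finset.sum_congr rfl fun k _ => ?_
  rw [hb, map_smul, _root_.smul_apply, hj2, Finset.sum_eq_single k, Finset.sum_eq_single j,
    A.orthonormal, A.orthonormal, if_pos rfl, if_pos rfl, Matrix.of_apply]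
  · simp only [smul_eq_mul]
    field_simp
  · intro l _ hl
    rw [A.orthonormal l, if_neg hl]; ring
  · simp
  · intro l _ hl
    refine Finset.sum_eq_zero fun l' _ => ?_
    rw [A.orthonormal l, if_neg hl]; ring
  · simp

end Exact

/-! ### Smooth families of metrics in normal coordinates -/

section Family

variable {Λ : Type} [NormedAddCommGroup Λ] [NormedSpace ℝ Λ] {m : ℕ}

/-- A smooth family of metrics; those with parameter in the compact set `K` are given in geodesic
normal coordinates. -/
structure NormalFamily (h : Λ → Euc m → Euc m → Euc m → ℝ) (T : Λ × Euc m → Euc m →L[ℝ] Euc m)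
    (𝒱 K : Set Λ) (R : ℝ) : Prop where
  isOpen : IsOpen 𝒱
  isCompact : IsCompact K
  subset : K ⊆ 𝒱
  smooth : ContDiffOn ℝ ∞ T (𝒱 ×ˢ Metric.ball 0 R)
  normal : ∀ l ∈ K, NormalMetricOn (h l) (fun y => T (l, y)) R

theorem contDiffOn_ringInverse {Z : Type*} [NormedAddCommGroup Z] [NormedSpace ℝ Z] {s : Set Z}
    {f : Z → Euc m →L[ℝ] Euc m} (hf : ContDiffOn ℝ ∞ f s) (hu : ∀ z ∈ s, IsUnit (f z)) :
    ContDiffOn ℝ ∞ (fun z => Ring.inverse (f z)) s := by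
  intro z hz
  obtain ⟨t, ht⟩ := hu z hz
  have h1 := contDiffAt_ringInverse ℝ (n := ∞) t
  rw [ht] at h1
  exact h1.comp_contDiffWithinAt z (hf z hz)

theorem contDiffOn_gam {T : Λ × Euc m → Euc m →L[ℝ] Euc m} {𝒱 : Set Λ} {R : ℝ} (h𝒱 : IsOpen 𝒱)
    (hT : ContDiffOn ℝ ∞ T (𝒱 ×ˢ Metric.ball 0 R))
    {Z : Type*} [NormedAddCommGroup Z] [NormedSpace ℝ Z] {s : Set Z} {l : Z → Λ}
    {y u v : Z → Euc m} (hl : ContDiffOn ℝ ∞ l s) (hy : ContDiffOn ℝ ∞ y s)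
    (hu : ContDiffOn ℝ ∞ u s) (hv : ContDiffOn ℝ ∞ v s)
    (hs : ∀ z ∈ s, l z ∈ 𝒱 ∧ y z ∈ Metric.ball (0 : Euc m) R)
    (hunit : ∀ z ∈ s, IsUnit (T (l z, y z))) :
    ContDiffOn ℝ ∞ (fun z => gam (fun y => T (l z, y)) (y z) (u z) (v z)) s := by
  have hop : IsOpen (𝒱 ×ˢ Metric.ball (0 : Euc m) R) := h𝒱.prod Metric.isOpen_ball
  have hmaps : MapsTo (fun z => (l z, y z)) s (𝒱 ×ˢ Metric.ball (0 : Euc m) R) := fun z hz => hs z hz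
  have hTz : ContDiffOn ℝ ∞ (fun z => T (l z, y z)) s := hT.comp (hl.prodMk hy) hmaps
  have hD : ContDiffOn ℝ ∞ (fun z => fderiv ℝ (fun y => T (l z, y)) (y z)) s := by
    have h1 : ContDiffOn ℝ ∞ (fun z => (fderiv ℝ T (l z, y z)).comp
        (ContinuousLinearMap.inr ℝ Λ (Euc m))) s :=
      ((hT.fderiv_of_isOpen hop le_rfl).comp (hl.prodMk hy) hmaps).clm_comp contDiffOn_const
    refine h1.congr fun z hz => ?_
    have h2 := ((hT.contDiffAt (hop.mem_nhds (hmaps hz))).differentiableAt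
      (by simp)).hasFDerivAt
    exact (h2.comp (y z) (hasFDerivAt_prodMk_right (l z) (y z))).fderiv
  refine (contDiffOn_ringInverse hTz hunit).clm_apply ?_
  refine ContDiffOn.sum fun i _ => ContDiffOn.fun_smul (ContDiffOn.mul contDiffOn_const ?_)
    contDiffOn_const
  refine ContDiffOn.sub (ContDiffOn.add ?_ ?_) ?_
  · exact ((hD.clm_apply hu).clm_apply hv).inner ℝ contDiffOn_const
  · exact ((hD.clm_apply hv).clm_apply hu).inner ℝ contDiffOn_const
  · exact ((hD.clm_apply contDiffOn_const).clm_apply hu).inner ℝ hv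

/-- The point of the perturbed sphere, in normal coordinates. -/
def spherePoint (p : ℝ × Λ × Euc m × (ℝ × Euc m)) : Euc m := (p.1 * (1 - p.2.2.2.1)) • p.2.2.1

/-- The metric at that point. -/
def sphereMetric (T : Λ × Euc m → Euc m →L[ℝ] Euc m) (p : ℝ × Λ × Euc m × (ℝ × Euc m)) :
    Euc m →L[ℝ] Euc m := T (p.2.1, spherePoint p)

/-- The parameters for which the geometric quantities of perturbed spheres are regular. -/
def shapeDomain (T : Λ × Euc m → Euc m →L[ℝ] Euc m) (𝒱 : Set Λ) (R : ℝ) :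
    Set (ℝ × Λ × Euc m × (ℝ × Euc m)) :=
  {p | ((p.2.2.2.1 < 1 ∧ p.2.1 ∈ 𝒱 ∧ spherePoint p ∈ Metric.ball (0 : Euc m) R) ∧
    IsUnit (sphereMetric T p)) ∧ IsUnit (firstOp (sphereMetric T p) (1 - p.2.2.2.1) p.2.2.2.2) ∧
    0 < conormSq (sphereMetric T p) (1 - p.2.2.2.1) p.2.2.2.2}

variable {T : Λ × Euc m → Euc m →L[ℝ] Euc m} {𝒱 : Set Λ} {R : ℝ}

theorem contDiff_spherePoint : ContDiff ℝ ∞ (spherePoint (Λ := Λ) (m := m)) := by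
  unfold spherePoint; fun_prop

theorem contDiffOn_sphereMetric (hT : ContDiffOn ℝ ∞ T (𝒱 ×ˢ Metric.ball 0 R))
    {s : Set (ℝ × Λ × Euc m × (ℝ × Euc m))}
    (hs : ∀ p ∈ s, p.2.1 ∈ 𝒱 ∧ spherePoint p ∈ Metric.ball (0 : Euc m) R) :
    ContDiffOn ℝ ∞ (sphereMetric T) s :=
  hT.comp (t := 𝒱 ×ˢ Metric.ball 0 R) (ContDiff.contDiffOn
    ((contDiff_fst.comp contDiff_snd).prodMk contDiff_spherePoint)) hs

theorem contDiffOn_firstOp {s : Set (ℝ × Λ × Euc m × (ℝ × Euc m))}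
    (hS : ContDiffOn ℝ ∞ (sphereMetric T) s) :
    ContDiffOn ℝ ∞ (fun p => firstOp (sphereMetric T p) (1 - p.2.2.2.1) p.2.2.2.2) s := by
  unfold firstOp
  have h1 : ContDiff ℝ ∞ fun p : ℝ × Λ × Euc m × (ℝ × Euc m) => (1 - p.2.2.2.1) ^ 2 := by fun_prop
  have h2 : ContDiff ℝ ∞ fun p : ℝ × Λ × Euc m × (ℝ × Euc m) => p.2.2.2.2 := by fun_prop
  exact (h1.contDiffOn.fun_smul hS).add
    ((((innerSL ℝ).contDiff.comp h2).smulRight h2).contDiffOn)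

theorem contDiffOn_conormSq {s : Set (ℝ × Λ × Euc m × (ℝ × Euc m))}
    (hS : ContDiffOn ℝ ∞ (sphereMetric T) s) (hu : ∀ p ∈ s, IsUnit (sphereMetric T p))
    (hw : ∀ p ∈ s, p.2.2.2.1 < 1) :
    ContDiffOn ℝ ∞ (fun p => conormSq (sphereMetric T p) (1 - p.2.2.2.1) p.2.2.2.2) s := by
  unfold conormSq
  have h1 : ContDiff ℝ ∞ fun p : ℝ × Λ × Euc m × (ℝ × Euc m) => (1 - p.2.2.2.1) ^ 2 := by fun_prop
  have h2 : ContDiff ℝ ∞ fun p : ℝ × Λ × Euc m × (ℝ × Euc m) => p.2.2.2.2 := by fun_prop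
  refine contDiffOn_const.add (ContDiffOn.mul (h1.contDiffOn.inv fun p hp => ?_) ?_)
  · exact pow_ne_zero 2 (sub_pos.2 (hw p hp)).ne'
  · exact h2.contDiffOn.inner ℝ ((contDiffOn_ringInverse hS hu).clm_apply h2.contDiffOn)

theorem isOpen_shapeDomain (h𝒱 : IsOpen 𝒱) (hT : ContDiffOn ℝ ∞ T (𝒱 ×ˢ Metric.ball 0 R)) :
    IsOpen (shapeDomain T 𝒱 R) := by
  have h1 : IsOpen {p : ℝ × Λ × Euc m × (ℝ × Euc m) | p.2.2.2.1 < 1 ∧ p.2.1 ∈ 𝒱 ∧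
      spherePoint p ∈ Metric.ball (0 : Euc m) R} := by
    refine IsOpen.inter ?_ (IsOpen.inter ?_ ?_)
    · exact isOpen_lt (f := fun p : ℝ × Λ × Euc m × (ℝ × Euc m) => p.2.2.2.1) (by fun_prop)
        continuous_const
    · exact h𝒱.preimage (by fun_prop : Continuous fun p : ℝ × Λ × Euc m × (ℝ × Euc m) => p.2.1)
    · exact Metric.isOpen_ball.preimage contDiff_spherePoint.continuous
  have hS := contDiffOn_sphereMetric hT (s := {p : ℝ × Λ × Euc m × (ℝ × Euc m) | p.2.2.2.1 < 1 ∧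
    p.2.1 ∈ 𝒱 ∧ spherePoint p ∈ Metric.ball (0 : Euc m) R}) fun p hp => hp.2
  have h2 := hS.continuousOn.isOpen_inter_preimage h1 Units.isOpen
  have hS2 := hS.mono (inter_subset_left (t := sphereMetric T ⁻¹' {x | IsUnit x}))
  have h3 := (contDiffOn_firstOp hS2).continuousOn.isOpen_inter_preimage h2 Units.isOpen
  have h4 := (contDiffOn_conormSq hS2 (fun p hp => hp.2)
    fun p hp => hp.1.1).continuousOn.isOpen_inter_preimage h2 (isOpen_Ioi (a := (0 : ℝ)))
  convert! h3.inter h4 using 1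
  ext p
  constructor
  · rintro ⟨ha, hb, hc⟩; exact ⟨⟨ha, hb⟩, ha, hc⟩
  · rintro ⟨⟨ha, hb⟩, _, hc⟩; exact ⟨ha, hb, hc⟩

/-- The operator `frameOp` of the perturbed sphere. -/
noncomputable def sphereFrame (T : Λ × Euc m → Euc m →L[ℝ] Euc m)
    (p : ℝ × Λ × Euc m × (ℝ × Euc m)) : Euc m →L[ℝ] Euc m :=
  frameOp (sphereMetric T p) (1 - p.2.2.2.1) p.2.2.2.2

theorem contDiffOn_sphereFrame (hT : ContDiffOn ℝ ∞ T (𝒱 ×ˢ Metric.ball 0 R)) :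
    ContDiffOn ℝ ∞ (sphereFrame T) (shapeDomain T 𝒱 R) := by
  have hS := contDiffOn_sphereMetric hT (s := shapeDomain T 𝒱 R) fun p hp => hp.1.1.2
  have hc := contDiffOn_conormSq hS (fun p hp => hp.1.2) fun p hp => hp.1.1.1
  refine ContDiffOn.smul ((hc.sqrt fun p hp => hp.2.2.ne').inv fun p hp =>
    (Real.sqrt_pos.2 hp.2.2).ne') ?_
  exact contDiffOn_ringInverse (contDiffOn_firstOp hS) fun p hp => hp.2.1

theorem contDiffOn_jetForm (h𝒱 : IsOpen 𝒱) (hT : ContDiffOn ℝ ∞ T (𝒱 ×ˢ Metric.ball 0 R))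
    {u : ℝ × Λ × Euc m × (ℝ × Euc m) → Euc m} (hu : ContDiffOn ℝ ∞ u (shapeDomain T 𝒱 R))
    (v : Euc m) :
    ContDiffOn ℝ ∞ (fun p => jetForm (fun y => T (p.2.1, y)) p.1 p.2.2.1 p.2.2.2 (u p) v)
      (shapeDomain T 𝒱 R) := by
  have hS := contDiffOn_sphereMetric hT (s := shapeDomain T 𝒱 R) fun p hp => hp.1.1.2
  have hρ : ContDiff ℝ ∞ fun p : ℝ × Λ × Euc m × (ℝ × Euc m) => p.1 := by fun_prop
  have hl : ContDiff ℝ ∞ fun p : ℝ × Λ × Euc m × (ℝ × Euc m) => p.2.1 := by fun_prop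
  have hx : ContDiff ℝ ∞ fun p : ℝ × Λ × Euc m × (ℝ × Euc m) => p.2.2.1 := by fun_prop
  have hs : ContDiff ℝ ∞ fun p : ℝ × Λ × Euc m × (ℝ × Euc m) => 1 - p.2.2.2.1 := by fun_prop
  have hξ : ContDiff ℝ ∞ fun p : ℝ × Λ × Euc m × (ℝ × Euc m) => p.2.2.2.2 := by fun_prop
  have hs0 : ∀ p ∈ shapeDomain T 𝒱 R, 1 - p.2.2.2.1 ≠ 0 := fun p hp => (sub_pos.2 hp.1.1.1).ne'
  have hξu := hξ.contDiffOn (s := shapeDomain T 𝒱 R) |>.inner ℝ hu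
  have hξv := hξ.contDiffOn (s := shapeDomain T 𝒱 R) |>.inner ℝ (contDiffOn_const (c := v))
  have hg : ∀ a b : ℝ × Λ × Euc m × (ℝ × Euc m) → Euc m, ContDiffOn ℝ ∞ a (shapeDomain T 𝒱 R) →
      ContDiffOn ℝ ∞ b (shapeDomain T 𝒱 R) → ContDiffOn ℝ ∞ (fun p => gam (fun y => T (p.2.1, y))
        (spherePoint p) (a p) (b p)) (shapeDomain T 𝒱 R) := fun a b ha hb =>
    contDiffOn_gam h𝒱 hT hl.contDiffOn contDiff_spherePoint.contDiffOn ha hb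
      (fun p hp => hp.1.1.2) fun p hp => hp.1.2
  refine ContDiffOn.sub (ContDiffOn.add ?_ ?_) ?_
  · refine (hS.clm_apply hu).inner ℝ (ContDiffOn.add (hs.contDiffOn.fun_smul contDiffOn_const) ?_)
    exact (hρ.mul (hs.pow 2)).contDiffOn.fun_smul (hg _ _ hx.contDiffOn contDiffOn_const)
  · exact (contDiffOn_const.div hs.contDiffOn hs0).mul (hξu.mul hξv)
  · refine (hρ.contDiffOn.div hs.contDiffOn hs0).mul (hξ.contDiffOn.inner ℝ (hg _ _ ?_ ?_))
    · exact (hs.contDiffOn.fun_smul hu).sub (hξu.fun_smul hx.contDiffOn)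
    · exact (hs.contDiffOn.fun_smul contDiffOn_const).sub (hξv.fun_smul hx.contDiffOn)

/-- At `ρ = 0` and the zero jet the metric operator is the identity. Since the domain is open, all
quantities are smooth in a full neighbourhood of these points, across `ρ = 0`. -/
theorem NormalFamily.zero_mem_shapeDomain {h : Λ → Euc m → Euc m → Euc m → ℝ} {K : Set Λ}
    (F : NormalFamily h T 𝒱 K R) {l : Λ} (hl : l ∈ K) (x : Euc m) :
    ((0 : ℝ), l, x, (0 : ℝ × Euc m)) ∈ shapeDomain T 𝒱 R := by
  have N := F.normal l hl
  have e : sphereMetric T ((0 : ℝ), l, x, (0 : ℝ × Euc m)) = 1 := by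
    rw [sphereMetric, ← N.zero_eq]; simp [spherePoint]
  refine ⟨⟨⟨by simp, F.subset hl, by simpa [spherePoint] using N.pos_radius⟩, ?_⟩, ?_, ?_⟩
  · rw [e]; exact isUnit_one
  · rw [e]; simp [firstOp]
  · rw [e]; simp [conormSq]

end Family

/-! ### Bilinear forms -/

section Bilinear

variable {n : ℕ}

/-- The bilinear form with the given coefficients. -/
noncomputable def bilinOf (c : Fin (n + 1) → Fin (n + 1) → ℝ) : Bilin n :=
  ∑ a, ∑ b, c a b • (innerSL ℝ (stdVec a)).smulRight (innerSL ℝ (stdVec b))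

theorem bilinOf_apply (c : Fin (n + 1) → Fin (n + 1) → ℝ) (u v : Euc (n + 1)) :
    bilinOf c u v = ∑ a, ∑ b, c a b * (u a * v b) := by
  simp [bilinOf, inner_stdVec_left]

/-- This packs a function that is merely known to be bilinear into an element of `Bilin n`, in which
smoothness and asymptotics can be checked coefficient by coefficient. -/
theorem bilinOf_eq {β : Euc (n + 1) → Euc (n + 1) → ℝ}
    (h1 : ∀ u u' v, β (u + u') v = β u v + β u' v) (h2 : ∀ r u v, β (r • u) v = r * β u v)
    (h3 : ∀ u v v', β u (v + v') = β u v + β u v') (h4 : ∀ r u v, β u (r • v) = r * β u v)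
    (u v : Euc (n + 1)) : bilinOf (fun a b => β (stdVec a) (stdVec b)) u v = β u v := by
  let B : Euc (n + 1) →ₗ[ℝ] Euc (n + 1) →ₗ[ℝ] ℝ := LinearMap.mk₂ ℝ β h1 h2 h3 h4
  have h : B u v = ∑ a, ∑ b, u a * (v b * B (stdVec a) (stdVec b)) := by
    conv_lhs => rw [← sum_smul_stdVec u, ← sum_smul_stdVec v]
    simp only [map_sum, map_smul, LinearMap.sum_apply, LinearMap.smul_apply, smul_eq_mul, Finset.mul_sum]
    rw [Finset.sum_comm]
    exact Finset.sum_congr rfl fun a _ => Finset.sum_congr rfl fun b _ => by ring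
  rw [bilinOf_apply]
  refine Eq.trans ?_ h.symm
  refine Finset.sum_congr rfl fun a _ => Finset.sum_congr rfl fun b _ => ?_
  change β (stdVec a) (stdVec b) * _ = _ * (_ * β (stdVec a) (stdVec b))
  ring

theorem bilinOf_self (B : Bilin n) : bilinOf (fun a b => B (stdVec a) (stdVec b)) = B := by
  ext1 u; ext1 v
  exact bilinOf_eq (β := fun u v => B u v) (by simp) (by simp) (by simp) (by simp) u v

theorem isBigO_bilin {α : Type*} {l : Filter α} {F : α → Bilin n} {g : α → ℝ}
    (hF : ∀ u v, (fun t => F t u v) =O[l] g) : F =O[l] g := by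
  have h : ∀ t, ∑ a, ∑ b, F t (stdVec a) (stdVec b)
      • (innerSL ℝ (stdVec a)).smulRight (innerSL ℝ (stdVec b)) = F t := fun t => bilinOf_self (F t)
  refine Asymptotics.IsBigO.congr_left (Asymptotics.IsBigO.fun_sum (A := fun a t => ∑ b,
    F t (stdVec a) (stdVec b) • (innerSL ℝ (stdVec a)).smulRight (innerSL ℝ (stdVec b)))
    fun a _ => Asymptotics.IsBigO.fun_sum (A := fun b t => F t (stdVec a) (stdVec b)
      • (innerSL ℝ (stdVec a)).smulRight (innerSL ℝ (stdVec b))) fun b _ => ?_) h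
  have h1 := (hF (stdVec a) (stdVec b)).smul (Asymptotics.isBigO_refl (fun _ : α =>
    ((innerSL ℝ (stdVec a)).smulRight (innerSL ℝ (stdVec b)) : Bilin n)) l)
  refine h1.trans ?_
  refine Asymptotics.IsBigO.of_bound
    ‖((innerSL ℝ (stdVec a)).smulRight (innerSL ℝ (stdVec b)) : Bilin n)‖
    (Eventually.of_forall fun t => ?_)
  rw [norm_smul, mul_comm]

end Bilinear

/-! ### The second fundamental form near the zero jet -/

section Expand

variable {m : ℕ}

/-- The terms of the second fundamental form that vanish with the gradient, of which one occurrence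
is replaced by `ζ`. -/
noncomputable def remForm (T : Euc m → Euc m →L[ℝ] Euc m) (ρ : ℝ) (x : Euc m) (j : ℝ × Euc m)
    (ζ u v : Euc m) : ℝ :=
  inner ℝ j.2 u * ((2 / (1 - j.1)) * inner ℝ ζ v - ((1 - j.1) ^ 2)⁻¹ * inner ℝ ζ
      ((1 - j.1) • v + (ρ * (1 - j.1) ^ 2) • gam T ((ρ * (1 - j.1)) • x) x v))
    - ρ / (1 - j.1) * inner ℝ ζ (gam T ((ρ * (1 - j.1)) • x)
        ((1 - j.1) • u - (inner ℝ j.2 u : ℝ) • x) ((1 - j.1) • v - (inner ℝ j.2 v : ℝ) • x))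

theorem remForm_smul (T : Euc m → Euc m →L[ℝ] Euc m) (ρ : ℝ) (x : Euc m) (j : ℝ × Euc m)
    (ζ u v : Euc m) (r : ℝ) : remForm T ρ x j (r • ζ) u v = r * remForm T ρ x j ζ u v := by
  simp only [remForm, real_inner_smul_left]; ring

/-- For `c = firstOp⁻¹ u` one has `s² T c = u - ⟨ξ, c⟩ ξ`, so the metric disappears from the main
term and only `Γ(x, v)` is left in it. Everything else carries a gradient factor; in `remForm` one
such factor is exposed, so that its contribution to the linearization can be read off. -/
theorem jetForm_frameOp {T : Euc m → Euc m →L[ℝ] Euc m} {ρ : ℝ} {x : Euc m} {j : ℝ × Euc m}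
    (hs : 1 - j.1 ≠ 0) (hB : IsUnit (firstOp (T ((ρ * (1 - j.1)) • x)) (1 - j.1) j.2))
    (u v : Euc m) :
    jetForm T ρ x j (frameOp (T ((ρ * (1 - j.1)) • x)) (1 - j.1) j.2 u) v
      = (Real.sqrt (conormSq (T ((ρ * (1 - j.1)) • x)) (1 - j.1) j.2))⁻¹
        * ((1 - j.1)⁻¹ * inner ℝ u v + ρ * inner ℝ u (gam T ((ρ * (1 - j.1)) • x) x v)
          + remForm T ρ x j j.2
            (Ring.inverse (firstOp (T ((ρ * (1 - j.1)) • x)) (1 - j.1) j.2) u) v) := by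
  rw [frameOp, _root_.smul_apply, jetForm_smul_left]
  congr 1
  have h1 := apply_inverse_of_isUnit hB u
  set c := Ring.inverse (firstOp (T ((ρ * (1 - j.1)) • x)) (1 - j.1) j.2) u with hc
  rw [firstOp_apply] at h1
  have h2 : T ((ρ * (1 - j.1)) • x) c = ((1 - j.1) ^ 2)⁻¹ • (u - (inner ℝ j.2 c : ℝ) • j.2) := by
    rw [← h1, add_sub_cancel_right, smul_smul, inv_mul_cancel₀ (pow_ne_zero 2 hs), one_smul]
  rw [jetForm, h2, remForm, real_inner_smul_left, inner_sub_left, real_inner_smul_left]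
  set p := (1 - j.1) • v + (ρ * (1 - j.1) ^ 2) • gam T ((ρ * (1 - j.1)) • x) x v with hp
  have h3 : (inner ℝ u p : ℝ) = (1 - j.1) * inner ℝ u v
      + (ρ * (1 - j.1) ^ 2) * inner ℝ u (gam T ((ρ * (1 - j.1)) • x) x v) := by
    rw [hp, inner_add_right, inner_smul_right, inner_smul_right]
  rw [h3]
  field_simp
  ring

variable {n : ℕ} {Λ : Type} [NormedAddCommGroup Λ] [NormedSpace ℝ Λ]

/-- The second fundamental form of a perturbed sphere (without the second derivatives of the
perturbation), in the frame given by `sphereFrame`. -/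
noncomputable def sphereForm (T : Λ × Euc (n + 1) → Euc (n + 1) →L[ℝ] Euc (n + 1))
    (p : ℝ × Λ × Euc (n + 1) × (ℝ × Euc (n + 1))) : Bilin n :=
  bilinOf fun a b => jetForm (fun y => T (p.2.1, y)) p.1 p.2.2.1 p.2.2.2
    (sphereFrame T p (stdVec a)) (stdVec b)

theorem sphereForm_apply (T : Λ × Euc (n + 1) → Euc (n + 1) →L[ℝ] Euc (n + 1))
    (p : ℝ × Λ × Euc (n + 1) × (ℝ × Euc (n + 1))) (u v : Euc (n + 1)) :
    sphereForm T p u v = jetForm (fun y => T (p.2.1, y)) p.1 p.2.2.1 p.2.2.2 (sphereFrame T p u) v :=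
  bilinOf_eq (β := fun u v => jetForm (fun y => T (p.2.1, y)) p.1 p.2.2.1 p.2.2.2
    (sphereFrame T p u) v) (fun u u' v => by rw [map_add, jetForm_add_left])
    (fun r u v => by rw [map_smul, jetForm_smul_left]) (fun u v v' => jetForm_add_right)
    (fun r u v => jetForm_smul_right r) u v

variable {T : Λ × Euc (n + 1) → Euc (n + 1) →L[ℝ] Euc (n + 1)} {𝒱 K : Set Λ} {R : ℝ}
  {h : Λ → Euc (n + 1) → Euc (n + 1) → Euc (n + 1) → ℝ}

theorem contDiffOn_sphereForm (h𝒱 : IsOpen 𝒱) (hT : ContDiffOn ℝ ∞ T (𝒱 ×ˢ Metric.ball 0 R)) :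
    ContDiffOn ℝ ∞ (sphereForm T) (shapeDomain T 𝒱 R) := by
  unfold sphereForm bilinOf
  exact ContDiffOn.sum fun a _ => ContDiffOn.sum fun b _ => ContDiffOn.fun_smul
    (contDiffOn_jetForm h𝒱 hT ((contDiffOn_sphereFrame hT).clm_apply contDiffOn_const) _)
    contDiffOn_const

theorem contDiffOn_remForm (h𝒱 : IsOpen 𝒱) (hT : ContDiffOn ℝ ∞ T (𝒱 ×ˢ Metric.ball 0 R))
    {u : ℝ × Λ × Euc (n + 1) × (ℝ × Euc (n + 1)) → Euc (n + 1)}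
    (hu : ContDiffOn ℝ ∞ u (shapeDomain T 𝒱 R)) (ζ v : Euc (n + 1)) :
    ContDiffOn ℝ ∞ (fun p => remForm (fun y => T (p.2.1, y)) p.1 p.2.2.1 p.2.2.2 ζ (u p) v)
      (shapeDomain T 𝒱 R) := by
  have hρ : ContDiff ℝ ∞ fun p : ℝ × Λ × Euc (n + 1) × (ℝ × Euc (n + 1)) => p.1 := by fun_prop
  have hl : ContDiff ℝ ∞ fun p : ℝ × Λ × Euc (n + 1) × (ℝ × Euc (n + 1)) => p.2.1 := by fun_prop
  have hx : ContDiff ℝ ∞ fun p : ℝ × Λ × Euc (n + 1) × (ℝ × Euc (n + 1)) => p.2.2.1 := by fun_prop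
  have hs : ContDiff ℝ ∞ fun p : ℝ × Λ × Euc (n + 1) × (ℝ × Euc (n + 1)) => 1 - p.2.2.2.1 := by
    fun_prop
  have hξ : ContDiff ℝ ∞ fun p : ℝ × Λ × Euc (n + 1) × (ℝ × Euc (n + 1)) => p.2.2.2.2 := by fun_prop
  have hs0 : ∀ p ∈ shapeDomain T 𝒱 R, 1 - p.2.2.2.1 ≠ 0 := fun p hp => (sub_pos.2 hp.1.1.1).ne'
  have hξu := hξ.contDiffOn (s := shapeDomain T 𝒱 R) |>.inner ℝ hu
  have hξv := hξ.contDiffOn (s := shapeDomain T 𝒱 R) |>.inner ℝ (contDiffOn_const (c := v))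
  have hg : ∀ a b : ℝ × Λ × Euc (n + 1) × (ℝ × Euc (n + 1)) → Euc (n + 1),
      ContDiffOn ℝ ∞ a (shapeDomain T 𝒱 R) → ContDiffOn ℝ ∞ b (shapeDomain T 𝒱 R) →
      ContDiffOn ℝ ∞ (fun p => gam (fun y => T (p.2.1, y)) (spherePoint p) (a p) (b p))
        (shapeDomain T 𝒱 R) := fun a b ha hb =>
    contDiffOn_gam h𝒱 hT hl.contDiffOn contDiff_spherePoint.contDiffOn ha hb
      (fun p hp => hp.1.1.2) fun p hp => hp.1.2
  refine ContDiffOn.sub (hξu.mul (ContDiffOn.sub ?_ ?_)) ?_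
  · exact (contDiffOn_const.div hs.contDiffOn hs0).mul contDiffOn_const
  · refine ((hs.pow 2).contDiffOn.inv fun p hp => pow_ne_zero 2 (hs0 p hp)).mul
      (contDiffOn_const.inner ℝ ((hs.contDiffOn.fun_smul contDiffOn_const).add ?_))
    exact (hρ.mul (hs.pow 2)).contDiffOn.fun_smul (hg _ _ hx.contDiffOn contDiffOn_const)
  · refine (hρ.contDiffOn.div hs.contDiffOn hs0).mul (contDiffOn_const.inner ℝ (hg _ _ ?_ ?_))
    · exact (hs.contDiffOn.fun_smul hu).sub (hξu.fun_smul hx.contDiffOn)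
    · exact (hs.contDiffOn.fun_smul contDiffOn_const).sub (hξv.fun_smul hx.contDiffOn)

theorem NormalFamily.eventually_mem_shapeDomain (F : NormalFamily h T 𝒱 K R) {l : Λ} (hl : l ∈ K)
    (x : Euc (n + 1)) : ∀ᶠ ρ : ℝ in 𝓝 0, (ρ, l, x, (0 : ℝ × Euc (n + 1))) ∈ shapeDomain T 𝒱 R := by
  have hc : Continuous fun ρ : ℝ => (ρ, l, x, (0 : ℝ × Euc (n + 1))) := by fun_prop
  exact hc.continuousAt.preimage_mem_nhds ((isOpen_shapeDomain F.isOpen F.smooth).mem_nhds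
    (F.zero_mem_shapeDomain hl x))

theorem sphereMetric_zero (ρ : ℝ) (l : Λ) (x : Euc (n + 1)) :
    sphereMetric T (ρ, l, x, (0 : ℝ × Euc (n + 1))) = T (l, ρ • x) := by
  simp [sphereMetric, spherePoint]

theorem sphereFrame_zero (ρ : ℝ) (l : Λ) (x : Euc (n + 1)) :
    sphereFrame T (ρ, l, x, (0 : ℝ × Euc (n + 1))) = Ring.inverse (T (l, ρ • x)) := by
  rw [sphereFrame, sphereMetric_zero]
  simp [frameOp, conormSq, firstOp]

theorem NormalFamily.sphereForm_zero (F : NormalFamily h T 𝒱 K R) {l : Λ} (hl : l ∈ K) {ρ : ℝ}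
    {x : Euc (n + 1)} (hx : ρ • x ∈ Metric.ball (0 : Euc (n + 1)) R) (u v : Euc (n + 1)) :
    sphereForm T (ρ, l, x, (0 : ℝ × Euc (n + 1))) u v
      = inner ℝ u v + ρ * inner ℝ u (christoffel (h l) (ρ • x) x v) := by
  have N := F.normal l hl
  have h1 : T (l, ρ • x) (Ring.inverse (T (l, ρ • x)) u) = u := N.inverse_apply hx u
  rw [sphereForm_apply, sphereFrame_zero, ← N.gam_eq hx]
  simp [jetForm, h1, inner_add_right, inner_smul_right]

/-- A term with an explicit small factor contributes to the linearization only the value of its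
cofactor at the zero jet; the cofactor need not be differentiated. -/
theorem hasDerivAt_mul_continuousAt {g : ℝ → ℝ} (hg : ContinuousAt g 0) :
    HasDerivAt (fun t => t * g t) (g 0) 0 := by
  rw [hasDerivAt_iff_tendsto_slope]
  have : Tendsto g (𝓝[≠] 0) (𝓝 (g 0)) := hg.tendsto.mono_left nhdsWithin_le_nhds
  refine this.congr' ?_
  filter_upwards [self_mem_nhdsWithin] with t ht
  have ht' : t ≠ 0 := ht
  simp [slope_def_field, ht']

/-- The derivative of the second fundamental form at the zero jet. -/
theorem NormalFamily.fderiv_sphereForm (F : NormalFamily h T 𝒱 K R) {l : Λ} (hl : l ∈ K) {ρ : ℝ}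
    {x : Euc (n + 1)} (hp : (ρ, l, x, (0 : ℝ × Euc (n + 1))) ∈ shapeDomain T 𝒱 R)
    (j : ℝ × Euc (n + 1)) (u v : Euc (n + 1)) :
    fderiv ℝ (fun j => sphereForm T (ρ, l, x, j)) 0 j u v
      = j.1 * inner ℝ u v - ρ ^ 2 * j.1 * inner ℝ u (deriv (fun t : ℝ => christoffel (h l) (t • x) x v) ρ)
        - ρ * inner ℝ j.2 (christoffel (h l) (ρ • x) (Ring.inverse (T (l, ρ • x)) u) v) := by
  have N := F.normal l hl
  have hop := isOpen_shapeDomain F.isOpen F.smooth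
  have hx : ρ • x ∈ Metric.ball (0 : Euc (n + 1)) R := by
    simpa [spherePoint] using hp.1.1.2.2
  let κ : ℝ → ℝ × Λ × Euc (n + 1) × (ℝ × Euc (n + 1)) := fun t => (ρ, l, x, t • j)
  have hκ : Continuous κ := by fun_prop
  have hκ0 : κ 0 = (ρ, l, x, 0) := by simp [κ]
  have hκU : ∀ᶠ t in 𝓝 (0 : ℝ), κ t ∈ shapeDomain T 𝒱 R :=
    hκ.continuousAt.preimage_mem_nhds (hop.mem_nhds (by rw [hκ0]; exact hp))
  have hat : ∀ {W : Type} [NormedAddCommGroup W] [NormedSpace ℝ W]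
      {f : ℝ × Λ × Euc (n + 1) × (ℝ × Euc (n + 1)) → W},
      ContDiffOn ℝ ∞ f (shapeDomain T 𝒱 R) → ContinuousAt (fun t => f (κ t)) 0 := fun hf =>
    ContinuousAt.comp (by rw [hκ0]; exact hf.continuousOn.continuousAt (hop.mem_nhds hp))
      hκ.continuousAt
  -- the derivative along the line `t ↦ t j`
  have hD1 : HasDerivAt (fun t => sphereForm T (κ t) u v)
      (fderiv ℝ (fun j => sphereForm T (ρ, l, x, j)) 0 j u v) 0 := by
    have hd : HasFDerivAt (fun j => sphereForm T (ρ, l, x, j))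
        (fderiv ℝ (fun j => sphereForm T (ρ, l, x, j)) 0) ((0 : ℝ) • j) := by
      rw [zero_smul]
      refine DifferentiableAt.hasFDerivAt ?_
      have h1 : DifferentiableAt ℝ (sphereForm T)
          ((fun j : ℝ × Euc (n + 1) => (ρ, l, x, j)) 0) :=
        (((contDiffOn_sphereForm F.isOpen F.smooth).contDiffAt (hop.mem_nhds hp)).differentiableAt
          (by simp))
      have h2 : DifferentiableAt ℝ (sphereForm T ∘ fun j : ℝ × Euc (n + 1) => (ρ, l, x, j)) 0 :=
        h1.comp (0 : ℝ × Euc (n + 1)) (by fun_prop)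
      exact h2
    have h2 : HasDerivAt (fun t : ℝ => t • j) j 0 := by
      simpa using (hasDerivAt_id (0 : ℝ)).smul_const j
    have h3 := hd.comp_hasDerivAt (0 : ℝ) h2
    have h4 := (((ContinuousLinearMap.apply ℝ ℝ v).comp (ContinuousLinearMap.apply ℝ
      (Euc (n + 1) →L[ℝ] ℝ) u)).hasFDerivAt.comp_hasDerivAt (0 : ℝ) h3)
    exact h4
  -- the explicit form
  have hS := contDiffOn_sphereMetric F.smooth (s := shapeDomain T 𝒱 R) fun p hp => hp.1.1.2
  have hSi := contDiffOn_ringInverse hS fun p hp => hp.1.2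
  have hBi := contDiffOn_ringInverse (contDiffOn_firstOp hS) fun p hp => hp.2.1
  -- The squared norm of the conormal is `1` plus a quadratic term in the gradient, so normalizing
  -- the normal does not contribute to first order.
  have hq : HasDerivAt (fun t => (Real.sqrt (conormSq (sphereMetric T (κ t)) (1 - t * j.1)
      (t • j.2)))⁻¹) 0 0 := by
    have h1 : HasDerivAt (fun t => conormSq (sphereMetric T (κ t)) (1 - t * j.1) (t • j.2)) 0 0 := by
      have h2 := hasDerivAt_mul_continuousAt (g := fun t => t * (((1 - t * j.1) ^ 2)⁻¹
        * inner ℝ j.2 (Ring.inverse (sphereMetric T (κ t)) j.2))) (by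
          refine continuousAt_id.mul (ContinuousAt.mul (ContinuousAt.inv₀ (by fun_prop) (by simp)) ?_)
          exact continuousAt_const.inner ((hat hSi).clm_apply continuousAt_const))
      refine ((h2.const_add 1).congr_deriv (by simp)).congr_of_eventuallyEq
        (Eventually.of_forall fun t => ?_)
      simp only [conormSq, map_smul, real_inner_smul_left, inner_smul_right]
      ring
    have h0 : conormSq (sphereMetric T (κ 0)) (1 - 0 * j.1) ((0 : ℝ) • j.2) = 1 := by
      simp [conormSq]
    have h3 := (h1.sqrt (by rw [h0]; norm_num)).fun_inv (by rw [h0]; simp)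
    exact h3.congr_deriv (by simp)
  have hrem : ContinuousAt (fun t => remForm (fun y => T (l, y)) ρ x (t • j) j.2
      (Ring.inverse (firstOp (sphereMetric T (κ t)) (1 - t * j.1) (t • j.2)) u) v) 0 := by
    have hc : ContDiffOn ℝ ∞ (fun p : ℝ × Λ × Euc (n + 1) × (ℝ × Euc (n + 1)) =>
        Ring.inverse (firstOp (sphereMetric T p) (1 - p.2.2.2.1) p.2.2.2.2) u)
        (shapeDomain T 𝒱 R) := hBi.clm_apply contDiffOn_const
    exact hat (contDiffOn_remForm F.isOpen F.smooth hc j.2 v)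
  -- The perturbation changes the radius from `ρ` to `ρ (1 - t j.1)`; this is where the radial
  -- derivative of `Γ(x, v)` at `ρ x` enters.
  have hmain : HasDerivAt (fun t : ℝ => (1 - t * j.1)⁻¹ * inner ℝ u v
      + ρ * inner ℝ u (christoffel (h l) ((ρ * (1 - t * j.1)) • x) x v))
      (j.1 * inner ℝ u v - ρ ^ 2 * j.1
        * inner ℝ u (deriv (fun t : ℝ => christoffel (h l) (t • x) x v) ρ)) 0 := by
    have h1 : HasDerivAt (fun t : ℝ => 1 - t * j.1) (-j.1) 0 := by
      simpa using ((hasDerivAt_id (0 : ℝ)).mul_const j.1).const_sub 1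
    have h2 : HasDerivAt (fun t : ℝ => (1 - t * j.1)⁻¹) j.1 0 :=
      (h1.fun_inv (by simp)).congr_deriv (by simp)
    have h3 : HasDerivAt (fun t : ℝ => christoffel (h l) (t • x) x v)
        (deriv (fun t : ℝ => christoffel (h l) (t • x) x v) ρ) (ρ * (1 - 0 * j.1)) := by
      have := (N.hasDerivAt_christoffel_ray hx x v).differentiableAt.hasDerivAt
      simpa using this
    have h4 := h3.scomp (0 : ℝ) (h1.const_mul ρ)
    have h5 := ((innerSL ℝ u).hasFDerivAt.comp_hasDerivAt (0 : ℝ) h4).const_mul ρ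
    refine ((h2.mul_const (inner ℝ u v : ℝ)).fun_add h5).congr_deriv ?_
    simp only [innerSL_apply_apply, inner_smul_right]
    ring
  have hD2 := hq.fun_mul (hmain.fun_add (hasDerivAt_mul_continuousAt hrem))
  have heq : (fun t => sphereForm T (κ t) u v) =ᶠ[𝓝 0] fun t =>
      (Real.sqrt (conormSq (sphereMetric T (κ t)) (1 - t * j.1) (t • j.2)))⁻¹ *
      ((1 - t * j.1)⁻¹ * inner ℝ u v
      + ρ * inner ℝ u (christoffel (h l) ((ρ * (1 - t * j.1)) • x) x v)
      + t * remForm (fun y => T (l, y)) ρ x (t • j) j.2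
      (Ring.inverse (firstOp (sphereMetric T (κ t)) (1 - t * j.1) (t • j.2)) u) v) := by
    filter_upwards [hκU] with t ht
    have h1 := jetForm_frameOp (T := fun y => T (l, y)) (ρ := ρ) (x := x) (j := t • j)
      (sub_pos.2 ht.1.1.1).ne' ht.2.1 u v
    have h2 : (ρ * (1 - (t • j).1)) • x ∈ Metric.ball (0 : Euc (n + 1)) R := ht.1.1.2.2
    rw [sphereForm_apply]
    refine h1.trans ?_
    rw [N.gam_eq h2, ← remForm_smul]
    rfl
  rw [hD1.unique (hD2.congr_of_eventuallyEq heq)]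
  have e0 : κ 0 = (ρ, l, x, (0 : ℝ × Euc (n + 1))) := hκ0
  simp only [zero_mul, sub_zero, zero_smul, e0, sphereMetric_zero, zero_add, mul_one]
  have hc1 : (Real.sqrt (conormSq (T (l, ρ • x)) 1 0))⁻¹ = 1 := by simp [conormSq]
  have hc2 : firstOp (T (l, ρ • x)) 1 0 = T (l, ρ • x) := by simp [firstOp]
  rw [hc1, hc2, remForm]
  have hx' : (ρ * (1 - (0 : ℝ × Euc (n + 1)).1)) • x = ρ • x := by simp
  rw [hx', N.gam_eq hx, N.gam_eq hx]
  simp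
  ring

end Expand

/-! ### The coefficients of the expansion -/

section Coefficients

variable {n : ℕ} {h : Euc (n + 1) → Euc (n + 1) → Euc (n + 1) → ℝ}
  {T : Euc (n + 1) → Euc (n + 1) →L[ℝ] Euc (n + 1)} {R : ℝ}

theorem eq_zero_of_isBigO_cube {W : Type} [NormedAddCommGroup W] [NormedSpace ℝ W] {A B : W}
    (h : (fun t : ℝ => t • A + t ^ 2 • B) =O[𝓝 0] fun t : ℝ => t ^ 3) : A = 0 ∧ B = 0 := by
  have h1 := eq_zero_of_poly_isBigO 3 (fun j => if j = 1 then A else if j = 2 then B else 0)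
    ((h.mono nhdsWithin_le_nhds).congr_left fun t => by simp [Finset.sum_range_succ])
  exact ⟨by simpa using h1 1 (by norm_num), by simpa using h1 2 (by norm_num)⟩

namespace NormalMetricOn

theorem eventually_ball (N : NormalMetricOn h T R) (x : Euc (n + 1)) :
    ∀ᶠ t : ℝ in 𝓝 0, t • x ∈ Metric.ball (0 : Euc (n + 1)) R := by
  simpa using N.eventually_mem N.zero_mem x

/-- Both terms are coefficients in the expansion of `Γ(x, ·)`, and they inherit additivity from it
by uniqueness of the coefficients. -/
theorem curv_covCurv_add (N : NormalMetricOn h T R) (x v v' : Euc (n + 1)) :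
    curv h 0 x (v + v') x = curv h 0 x v x + curv h 0 x v' x ∧
    covCurv h 0 x x (v + v') x = covCurv h 0 x x v x + covCurv h 0 x x v' x := by
  have h1 := ((N.isBigO_christoffel_ray x v).add (N.isBigO_christoffel_ray x v')).sub
    (N.isBigO_christoffel_ray x (v + v'))
  have h2 : (fun t : ℝ => t • ((1 / 3 : ℝ) • (curv h 0 x (v + v') x
      - (curv h 0 x v x + curv h 0 x v' x))) + t ^ 2 • ((1 / 4 : ℝ) • (covCurv h 0 x x (v + v') x
      - (covCurv h 0 x x v x + covCurv h 0 x x v' x)))) =O[𝓝 0] fun t : ℝ => t ^ 3 := by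
    refine h1.congr' ?_ EventuallyEq.rfl
    filter_upwards [N.eventually_ball x] with t ht
    rw [N.christoffel_add ht]
    module
  obtain ⟨h3, h4⟩ := eq_zero_of_isBigO_cube h2
  exact ⟨sub_eq_zero.1 ((smul_eq_zero.1 h3).resolve_left (by norm_num)),
    sub_eq_zero.1 ((smul_eq_zero.1 h4).resolve_left (by norm_num))⟩

theorem curv_covCurv_smul (N : NormalMetricOn h T R) (x v : Euc (n + 1)) (r : ℝ) :
    curv h 0 x (r • v) x = r • curv h 0 x v x ∧
    covCurv h 0 x x (r • v) x = r • covCurv h 0 x x v x := by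
  have h1 := ((N.isBigO_christoffel_ray x v).const_smul_left r).sub
    (N.isBigO_christoffel_ray x (r • v))
  have h2 : (fun t : ℝ => t • ((1 / 3 : ℝ) • (curv h 0 x (r • v) x
      - r • curv h 0 x v x)) + t ^ 2 • ((1 / 4 : ℝ) • (covCurv h 0 x x (r • v) x
      - r • covCurv h 0 x x v x))) =O[𝓝 0] fun t : ℝ => t ^ 3 := by
    refine h1.congr' ?_ EventuallyEq.rfl
    filter_upwards [N.eventually_ball x] with t ht
    rw [Pi.smul_apply, N.christoffel_smul ht]
    module
  obtain ⟨h3, h4⟩ := eq_zero_of_isBigO_cube h2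
  exact ⟨sub_eq_zero.1 ((smul_eq_zero.1 h3).resolve_left (by norm_num)),
    sub_eq_zero.1 ((smul_eq_zero.1 h4).resolve_left (by norm_num))⟩

theorem isBigO_T_ray (N : NormalMetricOn h T R) (x : Euc (n + 1)) :
    (fun t : ℝ => T (t • x) - 1) =O[𝓝 0] fun t : ℝ => t ^ 2 := by
  obtain ⟨ε, hε, hmem, hc⟩ := N.smooth_ray N.smooth x
  have h1 : HasDerivAt (fun t : ℝ => T (t • x)) 0 0 := by
    have h2 : HasDerivAt (fun t : ℝ => t • x) x 0 := by
      simpa using (hasDerivAt_id (0 : ℝ)).smul_const x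
    have h3 : HasFDerivAt T (0 : Euc (n + 1) →L[ℝ] Euc (n + 1) →L[ℝ] Euc (n + 1)) ((0 : ℝ) • x) := by
      rw [← N.fderiv_zero, zero_smul]; exact N.hasFDerivAt N.zero_mem
    exact h3.comp_hasDerivAt (0 : ℝ) h2
  refine (taylor_one hε hc h1).congr_left fun t => ?_
  rw [zero_smul, N.zero_eq, smul_zero, sub_zero]

theorem isBigO_christoffel_ray_one (N : NormalMetricOn h T R) (x v : Euc (n + 1)) :
    (fun t : ℝ => christoffel h (t • x) x v) =O[𝓝 0] fun t : ℝ => t := by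
  obtain ⟨ε, hε, hmem, hc⟩ := N.smooth_christoffel_ray x x v
  have h1 := (hc.contDiffAt (Ioo_mem_nhds (by linarith) hε)).differentiableAt (by simp)
  have h2 := h1.isBigO_sub
  simpa [N.christoffel_zero] using h2

/-- The form `⟨u, T Γ(x, v)⟩` is half the radial derivative of the metric, hence symmetric. Since `T
= 1 + O(t²)` and `Γ(x, ·) = O(t)`, dropping `T` changes nothing below `t³`, and the symmetry passes
to the coefficient of `t²`. -/
theorem covCurv_pair (N : NormalMetricOn h T R) (x u v : Euc (n + 1)) :
    inner ℝ u (covCurv h 0 x x v x) = (inner ℝ v (covCurv h 0 x x u x) : ℝ) := by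
  have hin : ∀ (u : Euc (n + 1)) {E : ℝ → Euc (n + 1)}, E =O[𝓝 0] (fun t : ℝ => t ^ 3) →
      (fun t => (inner ℝ u (E t) : ℝ)) =O[𝓝 0] fun t : ℝ => t ^ 3 := fun u E hE => by
    refine Asymptotics.IsBigO.trans (g := E) ?_ hE
    exact Asymptotics.IsBigO.of_bound ‖u‖ (Eventually.of_forall fun t => norm_inner_le_norm _ _)
  have hT : ∀ v, (fun t : ℝ => (T (t • x) - 1) (christoffel h (t • x) x v)) =O[𝓝 0]
      fun t : ℝ => t ^ 3 := fun v => by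
    have h1 := (N.isBigO_T_ray x).norm_left.mul (N.isBigO_christoffel_ray_one x v).norm_left
    refine Asymptotics.IsBigO.trans (Asymptotics.IsBigO.of_bound 1
      (Eventually.of_forall fun t => ?_)) (h1.congr_right fun t => by ring)
    rw [one_mul, norm_mul, norm_norm, norm_norm]
    exact ContinuousLinearMap.le_opNorm _ _
  have h1 := ((hin u (N.isBigO_christoffel_ray x v)).sub (hin v (N.isBigO_christoffel_ray x u))).add
    ((hin u (hT v)).sub (hin v (hT u)))
  have h2 : (fun t : ℝ => t • ((1 / 3 : ℝ) * (inner ℝ v (curv h 0 x u x) - inner ℝ u (curv h 0 x v x)))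
      + t ^ 2 • ((1 / 4 : ℝ) * (inner ℝ v (covCurv h 0 x x u x) - inner ℝ u (covCurv h 0 x x v x))))
      =O[𝓝 0] fun t : ℝ => t ^ 3 := by
    refine h1.congr' ?_ EventuallyEq.rfl
    filter_upwards [N.eventually_ball x] with t ht
    have e : ∀ u v, (inner ℝ u (T (t • x) (christoffel h (t • x) x v)) : ℝ)
        = inner ℝ v (T (t • x) (christoffel h (t • x) x u)) := fun u v => by
      rw [N.T_christoffel_ray ht, N.T_christoffel_ray ht, inner_smul_right, inner_smul_right,
        real_inner_comm, N.symm_fderiv ht, real_inner_comm]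
    simp only [_root_.sub_apply, one_apply_eq_self, inner_sub_right, inner_smul_right,
      e u v, smul_eq_mul]
    ring
  have h4 := (eq_zero_of_isBigO_cube h2).2
  linarith

theorem dGamma_smul (N : NormalMetricOn h T R) (a b c : Euc (n + 1)) (r : ℝ) :
    dGamma h a b (r • c) = r • dGamma h a b c := by
  have e : (fun y => christoffel h y b (r • c)) =ᶠ[𝓝 0] fun y => r • christoffel h y b c := by
    filter_upwards [N.mem_nhds] with y hy using N.christoffel_smul hy b c r
  rw [dGamma, e.fderiv_eq, ((N.hasFDerivAt_christoffel N.zero_mem b c).fun_const_smul r).fderiv]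
  rfl

theorem dGamma_smul_left (N : NormalMetricOn h T R) (a b c : Euc (n + 1)) (r : ℝ) :
    dGamma h a (r • b) c = r • dGamma h a b c := by
  rw [N.dGamma_symm, N.dGamma_smul, N.dGamma_symm a c]

end NormalMetricOn

/-- The bilinear form `g(R(x, u) x, v)`. -/
noncomputable def curvForm (h : Euc (n + 1) → Euc (n + 1) → Euc (n + 1) → ℝ) (x : Euc (n + 1)) :
    Bilin n :=
  bilinOf fun a b => inner ℝ (stdVec a) (curv h 0 x (stdVec b) x)

/-- The bilinear form `g(∇_x R(x, u) x, v)`. -/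
noncomputable def covForm (h : Euc (n + 1) → Euc (n + 1) → Euc (n + 1) → ℝ) (x : Euc (n + 1)) :
    Bilin n :=
  bilinOf fun a b => inner ℝ (stdVec a) (covCurv h 0 x x (stdVec b) x)

/-- The bilinear form that describes the contribution of the gradient `ξ`. -/
noncomputable def gradForm (h : Euc (n + 1) → Euc (n + 1) → Euc (n + 1) → ℝ) (x ξ : Euc (n + 1)) :
    Bilin n :=
  bilinOf fun a b => inner ℝ ξ (dGamma h x (stdVec a) (stdVec b))

theorem NormalMetricOn.curvForm_apply (N : NormalMetricOn h T R) (x u v : Euc (n + 1)) :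
    curvForm h x u v = inner ℝ u (curv h 0 x v x) :=
  bilinOf_eq (β := fun u v => inner ℝ u (curv h 0 x v x)) (fun _ _ _ => inner_add_left _ _ _)
    (fun _ _ _ => real_inner_smul_left _ _ _)
    (fun u v v' => by rw [(N.curv_covCurv_add x v v').1, inner_add_right])
    (fun r u v => by rw [(N.curv_covCurv_smul x v r).1, inner_smul_right]) u v

theorem NormalMetricOn.covForm_apply (N : NormalMetricOn h T R) (x u v : Euc (n + 1)) :
    covForm h x u v = inner ℝ u (covCurv h 0 x x v x) :=
  bilinOf_eq (β := fun u v => inner ℝ u (covCurv h 0 x x v x)) (fun _ _ _ => inner_add_left _ _ _)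
    (fun _ _ _ => real_inner_smul_left _ _ _)
    (fun u v v' => by rw [(N.curv_covCurv_add x v v').2, inner_add_right])
    (fun r u v => by rw [(N.curv_covCurv_smul x v r).2, inner_smul_right]) u v

theorem NormalMetricOn.gradForm_apply (N : NormalMetricOn h T R) (x ξ u v : Euc (n + 1)) :
    gradForm h x ξ u v = inner ℝ ξ (dGamma h x u v) :=
  bilinOf_eq (β := fun u v => inner ℝ ξ (dGamma h x u v))
    (fun u u' v => by rw [N.dGamma_add_left, inner_add_right])
    (fun r u v => by rw [N.dGamma_smul_left, inner_smul_right])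
    (fun u v v' => by rw [N.dGamma_add, inner_add_right])
    (fun r u v => by rw [N.dGamma_smul, inner_smul_right]) u v

/-- The scalar product of `ℝⁿ⁺¹`. -/
noncomputable def innerForm : Bilin n := innerSL ℝ

theorem innerForm_apply (u v : Euc (n + 1)) : innerForm u v = inner ℝ u v := rfl

/-- The coefficients of the second fundamental form of geodesic spheres. -/
noncomputable def formCoeff (h : Euc (n + 1) → Euc (n + 1) → Euc (n + 1) → ℝ) (i : ℕ)
    (x : Euc (n + 1)) : Bilin n :=
  if i = 0 then innerForm else if i = 2 then (1 / 3 : ℝ) • curvForm h x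
    else if i = 3 then (1 / 4 : ℝ) • covForm h x else 0

/-- The coefficients of its linearization. -/
noncomputable def formLinCoeff (h : Euc (n + 1) → Euc (n + 1) → Euc (n + 1) → ℝ) (i : ℕ)
    (x : Euc (n + 1)) (j : ℝ × Euc (n + 1)) : Bilin n :=
  if i = 0 then j.1 • innerForm
    else if i = 2 then -((1 / 3 : ℝ) * j.1) • curvForm h x - gradForm h x j.2 else 0

end Coefficients

/-! ### Expansions in `ρ` at the zero jet -/

section FamilyExpand

variable {Λ : Type} [NormedAddCommGroup Λ] [NormedSpace ℝ Λ] {n : ℕ}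
  {T : Λ × Euc (n + 1) → Euc (n + 1) →L[ℝ] Euc (n + 1)} {𝒱 K : Set Λ} {R : ℝ}
  {h : Λ → Euc (n + 1) → Euc (n + 1) → Euc (n + 1) → ℝ}

theorem isBigO_inner_right {E : ℝ → Euc (n + 1)} {g : ℝ → ℝ} {l : Filter ℝ} (hE : E =O[l] g)
    (u : Euc (n + 1)) : (fun t => (inner ℝ u (E t) : ℝ)) =O[l] g :=
  Asymptotics.IsBigO.trans (g := E)
    (Asymptotics.IsBigO.of_bound ‖u‖ (Eventually.of_forall fun _ => norm_inner_le_norm _ _)) hE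

theorem NormalFamily.isBigO_sphereForm (F : NormalFamily h T 𝒱 K R) {l : Λ} (hl : l ∈ K)
    (x : Euc (n + 1)) :
    (fun ρ : ℝ => sphereForm T (ρ, l, x, (0 : ℝ × Euc (n + 1)))
      - ∑ i ∈ Finset.range 4, ρ ^ i • formCoeff (h l) i x) =O[𝓝[>] 0] fun ρ : ℝ => ρ ^ 4 := by
  have N := F.normal l hl
  refine Asymptotics.IsBigO.mono ?_ nhdsWithin_le_nhds
  refine isBigO_bilin fun u v => ?_
  have h1 := (Asymptotics.isBigO_refl (fun t : ℝ => t) (𝓝 0)).mul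
    (isBigO_inner_right (N.isBigO_christoffel_ray x v) u)
  refine (h1.congr_right fun t => by ring).congr' ?_ EventuallyEq.rfl
  filter_upwards [N.eventually_ball x] with t ht
  simp only [_root_.sub_apply, F.sphereForm_zero hl ht, Finset.sum_range_succ, formCoeff,
    Finset.sum_range_zero]
  simp [innerForm_apply, N.curvForm_apply, N.covForm_apply, inner_sub_right, inner_smul_right]
  ring

theorem NormalFamily.isBigO_fderiv_sphereForm (F : NormalFamily h T 𝒱 K R) {l : Λ} (hl : l ∈ K)
    (x : Euc (n + 1)) (j : ℝ × Euc (n + 1)) :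
    (fun ρ : ℝ => fderiv ℝ (fun j => sphereForm T (ρ, l, x, j)) 0 j
      - ∑ i ∈ Finset.range 3, ρ ^ i • formLinCoeff (h l) i x j) =O[𝓝[>] 0] fun ρ : ℝ => ρ ^ 3 := by
  have N := F.normal l hl
  refine Asymptotics.IsBigO.mono ?_ nhdsWithin_le_nhds
  refine isBigO_bilin fun u v => ?_
  have h1 := (Asymptotics.isBigO_refl (fun t : ℝ => t ^ 2) (𝓝 0)).mul
    ((isBigO_inner_right (N.isBigO_deriv_christoffel_ray x v) u).const_mul_left (-j.1))
  have h2 := (Asymptotics.isBigO_refl (fun t : ℝ => t) (𝓝 0)).mul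
    (isBigO_inner_right (N.isBigO_christoffel_inverse x u v) j.2)
  refine ((h1.congr_right fun t => by ring).sub (h2.congr_right fun t => by ring)).congr' ?_
    EventuallyEq.rfl
  filter_upwards [F.eventually_mem_shapeDomain hl x] with t ht
  simp only [_root_.sub_apply, F.fderiv_sphereForm hl ht, Finset.sum_range_succ, formLinCoeff,
    Finset.sum_range_zero]
  simp [innerForm_apply, N.curvForm_apply, N.gradForm_apply, inner_sub_right, inner_smul_right]
  ring

/-- The expansion of the frame of geodesic spheres. -/
theorem NormalFamily.isBigO_sphereFrame (F : NormalFamily h T 𝒱 K R) {l : Λ} (hl : l ∈ K)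
    (x u v : Euc (n + 1)) :
    (fun ρ : ℝ => (inner ℝ v (sphereFrame T (ρ, l, x, (0 : ℝ × Euc (n + 1))) u) : ℝ)
      - ∑ i ∈ Finset.range 3, ρ ^ i • (if i = 0 then inner ℝ v u
        else if i = 2 then -(1 / 3) * inner ℝ v (curv (h l) 0 x u x) else (0 : ℝ)))
      =O[𝓝[>] 0] fun ρ : ℝ => ρ ^ 3 := by
  refine Asymptotics.IsBigO.mono ?_ nhdsWithin_le_nhds
  refine (isBigO_inner_right ((F.normal l hl).isBigO_inverse_ray x u) v).congr_left fun t => ?_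
  rw [sphereFrame_zero]
  simp [Finset.sum_range_succ, inner_sub_right, inner_add_right, inner_smul_right]
  ring

/-- Boundedness of the linearization is all that is needed when no coefficient of it is prescribed,
that is, for the expansion with `d₁ = 0`. -/
theorem isBigO_one_fderiv_slice {J W : Type} [NormedAddCommGroup J] [NormedSpace ℝ J]
    [NormedAddCommGroup W] [NormedSpace ℝ W] {𝒰 : Set (ℝ × Λ × Euc (n + 1) × J)} (h𝒰 : IsOpen 𝒰)
    {f : ℝ × Λ × Euc (n + 1) × J → W} (hf : ContDiffOn ℝ ∞ f 𝒰) {l : Λ} {x : Euc (n + 1)}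
    (h0 : ((0 : ℝ), l, x, (0 : J)) ∈ 𝒰) (ξ : J) :
    (fun ρ : ℝ => fderiv ℝ (fun j => f (ρ, l, x, j)) 0 ξ) =O[𝓝 0] fun _ : ℝ => (1 : ℝ) := by
  have hc : Continuous fun ρ : ℝ => (ρ, l, x, (0 : J)) := by fun_prop
  have h1 : ContinuousAt (fun ρ : ℝ => fderiv ℝ f (ρ, l, x, (0 : J)) (0, 0, 0, ξ)) 0 := by
    have h2 : ContinuousAt (fderiv ℝ f) ((fun ρ : ℝ => (ρ, l, x, (0 : J))) 0) :=
      (hf.fderiv_of_isOpen (m := ∞) h𝒰 le_rfl).continuousOn.continuousAt (h𝒰.mem_nhds h0)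
    exact (ContinuousAt.comp (f := fun ρ : ℝ => (ρ, l, x, (0 : J))) h2
      hc.continuousAt).clm_apply continuousAt_const
  refine (h1.isBigO_one ℝ).congr' ?_ EventuallyEq.rfl
  filter_upwards [hc.continuousAt.preimage_mem_nhds (h𝒰.mem_nhds h0)] with ρ hρ
  have h3 : HasFDerivAt f (fderiv ℝ f (ρ, l, x, 0)) ((fun j : J => (ρ, l, x, j)) 0) :=
    ((hf.contDiffAt (h𝒰.mem_nhds hρ)).differentiableAt (by simp)).hasFDerivAt
  have h4 : HasFDerivAt (fun j : J => (ρ, l, x, j)) ((ContinuousLinearMap.inr ℝ ℝ _).comp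
      ((ContinuousLinearMap.inr ℝ Λ _).comp (ContinuousLinearMap.inr ℝ (Euc (n + 1)) J))) 0 :=
    ((hasFDerivAt_prodMk_right ρ _).comp (0 : J) ((hasFDerivAt_prodMk_right l _).comp (0 : J)
      (hasFDerivAt_prodMk_right x (0 : J))))
  have h5 := h3.comp (0 : J) h4
  rw [show (fun j => f (ρ, l, x, j)) = f ∘ fun j : J => (ρ, l, x, j) from rfl, h5.fderiv]
  rfl

end FamilyExpand

/-! ### Operations on error terms -/

section ErrorTerms

variable {n : ℕ} {W W' J : Type*} [NormedAddCommGroup W] [NormedSpace ℝ W]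
  [NormedAddCommGroup W'] [NormedSpace ℝ W'] [NormedAddCommGroup J] [NormedSpace ℝ J]
  {C C' : ℕ → ℝ} {f g : EuclideanSpace ℝ (Fin (n + 1)) → W}

theorem ne_zero_of_norm_eq_one {x : EuclideanSpace ℝ (Fin (n + 1))} (hx : ‖x‖ = 1) :
    x ∈ ({0}ᶜ : Set (EuclideanSpace ℝ (Fin (n + 1)))) := by
  rintro rfl
  simp at hx

theorem SmoothOnSphere.contDiffAt (hf : SmoothOnSphere C f) {x : EuclideanSpace ℝ (Fin (n + 1))}
    (hx : ‖x‖ = 1) : ContDiffAt ℝ ∞ f x :=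
  hf.1.contDiffAt (isOpen_compl_singleton.mem_nhds (ne_zero_of_norm_eq_one hx))

theorem smoothOnSphere_const (c : W) :
    SmoothOnSphere (fun _ => ‖c‖) (fun _ : EuclideanSpace ℝ (Fin (n + 1)) => c) := by
  refine ⟨contDiffOn_const, fun r x _ => ?_⟩
  rcases eq_or_ne r 0 with rfl | hr
  · rw [norm_iteratedFDeriv_zero]
  · rw [iteratedFDeriv_const_of_ne hr]
    simp

theorem SmoothOnSphere.clm (hf : SmoothOnSphere C f) (G : W →L[ℝ] W') :
    SmoothOnSphere (fun r => ‖G‖ * C r) fun x => G (f x) := by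
  refine ⟨G.contDiff.comp_contDiffOn hf.1, fun r x hx => ?_⟩
  exact (G.norm_iteratedFDeriv_comp_left (hf.contDiffAt hx) (by exact_mod_cast le_top)).trans
    (mul_le_mul_of_nonneg_left (hf.2 r x hx) (norm_nonneg _))

theorem SmoothOnSphere.add (hf : SmoothOnSphere C f) (hg : SmoothOnSphere C' g) :
    SmoothOnSphere (fun r => C r + C' r) fun x => f x + g x := by
  refine ⟨hf.1.add hg.1, fun r x hx => ?_⟩
  have h1 : iteratedFDeriv ℝ r (fun x => f x + g x) x
      = iteratedFDeriv ℝ r f x + iteratedFDeriv ℝ r g x :=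
    iteratedFDeriv_add_apply ((hf.contDiffAt hx).of_le (by exact_mod_cast le_top))
      ((hg.contDiffAt hx).of_le (by exact_mod_cast le_top))
  rw [h1]
  exact (norm_add_le _ _).trans (add_le_add (hf.2 r x hx) (hg.2 r x hx))

variable {δ : ℝ} {q : EuclideanSpace ℝ (Fin (n + 1)) × J → W}

theorem QuadraticOp.contDiffAt (hq : QuadraticOp C δ q) {x : EuclideanSpace ℝ (Fin (n + 1))} {ξ : J}
    (hx : ‖x‖ = 1) (hξ : ‖ξ‖ < δ) : ContDiffAt ℝ ∞ q (x, ξ) :=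
  hq.1.contDiffAt ((isOpen_compl_singleton.prod Metric.isOpen_ball).mem_nhds
    ⟨ne_zero_of_norm_eq_one hx, by simpa using hξ⟩)

theorem QuadraticOp.hasFDerivAt (hq : QuadraticOp C δ q) (hδ : 0 < δ)
    {x : EuclideanSpace ℝ (Fin (n + 1))} (hx : ‖x‖ = 1) :
    HasFDerivAt (fun ξ => q (x, ξ)) (0 : J →L[ℝ] W) 0 := by
  have h1 : DifferentiableAt ℝ q ((fun ξ : J => (x, ξ)) 0) :=
    (hq.contDiffAt hx (by simpa using hδ)).differentiableAt (by simp)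
  have h2 : DifferentiableAt ℝ (fun ξ : J => q (x, ξ)) 0 := h1.comp (0 : J) (by fun_prop)
  rw [← (hq.2.2 x hx).2]
  exact h2.hasFDerivAt

theorem QuadraticOp.clm (hq : QuadraticOp C δ q) (hδ : 0 < δ) (G : W →L[ℝ] W') :
    QuadraticOp (fun r => ‖G‖ * C r) δ fun p => G (q p) := by
  refine ⟨G.contDiff.comp_contDiffOn hq.1, fun r x ξ hx hξ => ?_, fun x hx => ⟨?_, ?_⟩⟩
  · exact (G.norm_iteratedFDeriv_comp_left (hq.contDiffAt hx hξ) (by exact_mod_cast le_top)).trans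
      (mul_le_mul_of_nonneg_left (hq.2.1 r x ξ hx hξ) (norm_nonneg _))
  · simp [(hq.2.2 x hx).1]
  · have := (G.hasFDerivAt.comp (0 : J) (hq.hasFDerivAt hδ hx)).fderiv
    simpa [Function.comp_def] using this

end ErrorTerms

/-! ### Expansion of the shape operator with its product error terms -/

section ShapeExpansion

variable {Λ : Type} [NormedAddCommGroup Λ] [NormedSpace ℝ Λ] {n : ℕ}
  {T : Λ × Euc (n + 1) → Euc (n + 1) →L[ℝ] Euc (n + 1)} {𝒱 K : Set Λ} {R : ℝ}
  {h : Λ → Euc (n + 1) → Euc (n + 1) → Euc (n + 1) → ℝ}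

/-- The operator `sphereFrame` as a bilinear form. -/
noncomputable def frameForm (T : Λ × Euc (n + 1) → Euc (n + 1) →L[ℝ] Euc (n + 1))
    (p : ℝ × Λ × Euc (n + 1) × (ℝ × Euc (n + 1))) : Bilin n :=
  bilinOf fun a b => inner ℝ (stdVec b) (sphereFrame T p (stdVec a))

theorem frameForm_apply (T : Λ × Euc (n + 1) → Euc (n + 1) →L[ℝ] Euc (n + 1))
    (p : ℝ × Λ × Euc (n + 1) × (ℝ × Euc (n + 1))) (u v : Euc (n + 1)) :
    frameForm T p u v = inner ℝ v (sphereFrame T p u) :=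
  bilinOf_eq (β := fun u v => inner ℝ v (sphereFrame T p u))
    (fun u u' v => by rw [map_add, inner_add_right])
    (fun r u v => by rw [map_smul, inner_smul_right]) (fun _ _ _ => inner_add_left _ _ _)
    (fun _ _ _ => real_inner_smul_left _ _ _) u v

theorem contDiffOn_frameForm (hT : ContDiffOn ℝ ∞ T (𝒱 ×ˢ Metric.ball 0 R)) :
    ContDiffOn ℝ ∞ (frameForm T) (shapeDomain T 𝒱 R) := by
  unfold frameForm bilinOf
  exact ContDiffOn.sum fun a _ => ContDiffOn.sum fun b _ => ContDiffOn.fun_smul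
    (contDiffOn_const.inner ℝ ((contDiffOn_sphereFrame hT).clm_apply contDiffOn_const))
    contDiffOn_const

/-- The coefficients of the frame of geodesic spheres. -/
noncomputable def frameCoeff (h : Euc (n + 1) → Euc (n + 1) → Euc (n + 1) → ℝ) (i : ℕ)
    (x : Euc (n + 1)) : Bilin n :=
  if i = 0 then innerForm else if i = 2 then -(1 / 3 : ℝ) • curvForm h x else 0

theorem NormalMetricOn.curvForm_symm {h : Euc (n + 1) → Euc (n + 1) → Euc (n + 1) → ℝ}
    {T : Euc (n + 1) → Euc (n + 1) →L[ℝ] Euc (n + 1)} (N : NormalMetricOn h T R)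
    (x u v : Euc (n + 1)) : curvForm h x u v = curvForm h x v u := by
  rw [N.curvForm_apply, N.curvForm_apply, real_inner_comm, N.curv_pair, real_inner_comm]

/-- The linear map `u ↦ R(x, u) x`. -/
noncomputable def NormalMetricOn.curvOp {h : Euc (n + 1) → Euc (n + 1) → Euc (n + 1) → ℝ}
    {T : Euc (n + 1) → Euc (n + 1) →L[ℝ] Euc (n + 1)} (N : NormalMetricOn h T R)
    (x : Euc (n + 1)) : Euc (n + 1) →L[ℝ] Euc (n + 1) :=
  LinearMap.toContinuousLinearMap
    { toFun := fun u => curv h 0 x u x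
      map_add' := fun u v => (N.curv_covCurv_add x u v).1
      map_smul' := fun r u => (N.curv_covCurv_smul x u r).1 }

theorem NormalMetricOn.curvOp_apply {h : Euc (n + 1) → Euc (n + 1) → Euc (n + 1) → ℝ}
    {T : Euc (n + 1) → Euc (n + 1) →L[ℝ] Euc (n + 1)} (N : NormalMetricOn h T R)
    (x u : Euc (n + 1)) : N.curvOp x u = curv h 0 x u x := rfl

theorem NormalFamily.isBigO_frameForm (F : NormalFamily h T 𝒱 K R) {l : Λ} (hl : l ∈ K)
    (x : Euc (n + 1)) :
    (fun ρ : ℝ => frameForm T (ρ, l, x, (0 : ℝ × Euc (n + 1)))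
      - ∑ i ∈ Finset.range 3, ρ ^ i • frameCoeff (h l) i x) =O[𝓝[>] 0] fun ρ : ℝ => ρ ^ 3 := by
  have N := F.normal l hl
  refine isBigO_bilin fun u v => ?_
  refine (F.isBigO_sphereFrame hl x u v).congr_left fun t => ?_
  simp only [_root_.sub_apply, Finset.sum_range_succ, frameCoeff, Finset.sum_range_zero]
  simp [innerForm_apply, N.curvForm_symm x u v, N.curvForm_apply, frameForm_apply,
    real_inner_comm]

/-- The gradient enters the first fundamental form and the norm of the conormal only quadratically.
This evenness is the reason why the Hessian is multiplied by `L⁰(w)` and not by a first order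
operator. -/
theorem frameForm_neg (ρ : ℝ) (l : Λ) (x ξ : Euc (n + 1)) (w : ℝ) :
    frameForm T (ρ, l, x, (w, -ξ)) = frameForm T (ρ, l, x, (w, ξ)) := by
  have h1 : sphereFrame T (ρ, l, x, (w, -ξ)) = sphereFrame T (ρ, l, x, (w, ξ)) := by
    have e1 : ∀ S : Euc (n + 1) →L[ℝ] Euc (n + 1), firstOp S (1 - w) (-ξ) = firstOp S (1 - w) ξ := by
      intro S
      ext1 u
      simp [firstOp_apply]
    have e2 : ∀ S : Euc (n + 1) →L[ℝ] Euc (n + 1), conormSq S (1 - w) (-ξ) = conormSq S (1 - w) ξ := by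
      intro S
      simp [conormSq]
    simp only [sphereFrame, frameOp, sphereMetric, spherePoint, e1, e2]
  simp only [frameForm, h1]

/-- Evaluation of bilinear forms on basis vectors. -/
noncomputable def evalBasis (i : Fin (n + 1) × Fin (n + 1)) : Bilin n →L[ℝ] ℝ :=
  (ContinuousLinearMap.apply ℝ ℝ (stdVec i.2)).comp
    (ContinuousLinearMap.apply ℝ (Euc (n + 1) →L[ℝ] ℝ) (stdVec i.1))

theorem evalBasis_apply (i : Fin (n + 1) × Fin (n + 1)) (B : Bilin n) :
    evalBasis i B = B (stdVec i.1) (stdVec i.2) := rfl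

/-- The bilinear form `e_a ⊗ W(e_b, ·)` as a function of the `2`-jet. -/
noncomputable def hessOp (i : Fin (n + 1) × Fin (n + 1)) :
    (ℝ × EuclideanSpace ℝ (Fin (n + 1)) × Bilin n) →L[ℝ] Bilin n :=
  (ContinuousLinearMap.smulRightL ℝ (Euc (n + 1)) (Euc (n + 1) →L[ℝ] ℝ)
    (innerSL ℝ (stdVec i.1))).comp ((ContinuousLinearMap.apply ℝ (Euc (n + 1) →L[ℝ] ℝ)
      (stdVec i.2)).comp ((ContinuousLinearMap.snd ℝ _ _).comp (ContinuousLinearMap.snd ℝ _ _)))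

theorem hessOp_apply (i : Fin (n + 1) × Fin (n + 1))
    (j : ℝ × EuclideanSpace ℝ (Fin (n + 1)) × Bilin n) (u v : Euc (n + 1)) :
    hessOp i j u v = u i.1 * j.2.2 (stdVec i.2) v := by
  simp [hessOp, inner_stdVec_left]

/-- This writes `W(A u, v)` as a finite sum of products, each with one factor linear in `W` and one
scalar entry of `A`, as the error terms `L² ⋉ L⁰` and `L² ⋉ Q¹` require. -/
theorem bilin_apply_sum (W : Bilin n) (A : Euc (n + 1) →L[ℝ] Euc (n + 1)) (u v : Euc (n + 1)) :
    ∑ i : Fin (n + 1) × Fin (n + 1), u i.1 * W (stdVec i.2) v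
      * inner ℝ (stdVec i.2) (A (stdVec i.1)) = W (A u) v := by
  conv_rhs => rw [← sum_smul_stdVec u]
  rw [Fintype.sum_prod_type, map_sum, map_sum, _root_.sum_apply]
  refine Finset.sum_congr rfl fun a _ => ?_
  conv_rhs => rw [map_smul, map_smul, _root_.smul_apply, ← sum_smul_stdVec (A (stdVec a)), map_sum,
    _root_.sum_apply, smul_eq_mul, Finset.mul_sum]
  refine Finset.sum_congr rfl fun b _ => ?_
  rw [inner_stdVec_left, map_smul, _root_.smul_apply, smul_eq_mul]
  ring

/-- The `1`-jet in the `2`-jet. -/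
noncomputable def truncJet (n : ℕ) :
    (ℝ × EuclideanSpace ℝ (Fin (n + 1)) × Bilin n) →L[ℝ] ℝ × EuclideanSpace ℝ (Fin (n + 1)) :=
  (ContinuousLinearMap.fst ℝ _ _).prod
    ((ContinuousLinearMap.fst ℝ _ _).comp (ContinuousLinearMap.snd ℝ _ _))

theorem truncJet_apply (j : ℝ × EuclideanSpace ℝ (Fin (n + 1)) × Bilin n) :
    truncJet n j = (j.1, j.2.1) := rfl

/-- An operator on `1`-jets as an operator on `2`-jets. -/
noncomputable def liftJet (n : ℕ) : ((ℝ × EuclideanSpace ℝ (Fin (n + 1))) →L[ℝ] Bilin n) →L[ℝ]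
    (ℝ × EuclideanSpace ℝ (Fin (n + 1)) × Bilin n) →L[ℝ] Bilin n :=
  (ContinuousLinearMap.compL ℝ (ℝ × EuclideanSpace ℝ (Fin (n + 1)) × Bilin n)
    (ℝ × EuclideanSpace ℝ (Fin (n + 1))) (Bilin n)).flip (truncJet n)

theorem liftJet_apply (A : (ℝ × EuclideanSpace ℝ (Fin (n + 1))) →L[ℝ] Bilin n)
    (j : ℝ × EuclideanSpace ℝ (Fin (n + 1)) × Bilin n) : liftJet n A j = A (j.1, j.2.1) := rfl

/-- The operator `∑ B(e_a, e_b) e_a ⊗ W(e_b, ·)` on `2`-jets. -/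
noncomputable def contractHess (n : ℕ) : Bilin n →L[ℝ]
    (ℝ × EuclideanSpace ℝ (Fin (n + 1)) × Bilin n) →L[ℝ] Bilin n :=
  ∑ i, (evalBasis i).smulRight (hessOp i)

theorem contractHess_apply (B : Bilin n) (j : ℝ × EuclideanSpace ℝ (Fin (n + 1)) × Bilin n)
    (u v : Euc (n + 1)) : contractHess n B j u v = ∑ i, hessOp i j u v * evalBasis i B := by
  simp only [contractHess, _root_.sum_apply, ContinuousLinearMap.smulRight_apply,
    _root_.smul_apply, smul_eq_mul]
  exact Finset.sum_congr rfl fun i _ => mul_comm _ _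

/-- The zeroth order part of an operator on `1`-jets. -/
noncomputable def zeroJet (i : Fin (n + 1) × Fin (n + 1)) :
    ((ℝ × EuclideanSpace ℝ (Fin (n + 1))) →L[ℝ] Bilin n) →L[ℝ] ℝ →L[ℝ] ℝ :=
  ((ContinuousLinearMap.compL ℝ ℝ (ℝ × EuclideanSpace ℝ (Fin (n + 1))) ℝ).flip
    (ContinuousLinearMap.inl ℝ ℝ _)).comp
    (ContinuousLinearMap.compL ℝ (ℝ × EuclideanSpace ℝ (Fin (n + 1))) (Bilin n) ℝ (evalBasis i))

theorem zeroJet_apply (i : Fin (n + 1) × Fin (n + 1))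
    (A : (ℝ × EuclideanSpace ℝ (Fin (n + 1))) →L[ℝ] Bilin n) (w : ℝ) :
    zeroJet i A w = evalBasis i (A (w, 0)) := rfl

/-- Evenness along the line gives `2 t A v = q(-t v) - q(t v)`, and the right-hand side has
derivative zero at `t = 0`. -/
theorem clm_eq_zero_of_even {E W : Type*} [NormedAddCommGroup E] [NormedSpace ℝ E]
    [NormedAddCommGroup W] [NormedSpace ℝ W] {A : E →L[ℝ] W} {q : E → W}
    (hq : HasFDerivAt q (0 : E →L[ℝ] W) 0) {v : E}
    (hv : ∀ᶠ t : ℝ in 𝓝 0, A (t • v) + q (t • v) = A (-(t • v)) + q (-(t • v))) : A v = 0 := by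
  have hq' : HasFDerivAt q (0 : E →L[ℝ] W) ((0 : ℝ) • v) := by rwa [zero_smul]
  have hq'' : HasFDerivAt q (0 : E →L[ℝ] W) (-((0 : ℝ) • v)) := by rwa [zero_smul, neg_zero]
  have hline : HasDerivAt (fun t : ℝ => t • v) v 0 := by
    simpa using (hasDerivAt_id (0 : ℝ)).smul_const v
  have h1 := hq'.comp_hasDerivAt (0 : ℝ) hline
  have h2 := hq''.comp_hasDerivAt (0 : ℝ) hline.fun_neg
  have h3 := h2.fun_sub h1
  have h4 : HasDerivAt (fun t : ℝ => t • ((2 : ℝ) • A v)) ((2 : ℝ) • A v) 0 := by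
    simpa using (hasDerivAt_id (0 : ℝ)).smul_const ((2 : ℝ) • A v)
  have h5 := (h4.congr_of_eventuallyEq (f₁ := fun t : ℝ => q (-(t • v)) - q (t • v)) (by
    filter_upwards [hv] with t ht
    rw [map_neg, map_smul] at ht
    have : q (-(t • v)) = t • A v + q (t • v) + t • A v := by rw [ht]; abel
    rw [this]
    module)).unique h3
  simpa using h5

/-- The expansion of the frame. -/
theorem NormalFamily.exists_frame_expansion (F : NormalFamily h T 𝒱 K R) :
    ∃ ρ₀ > 0, ∃ δ > 0, ∃ C : ℕ → ℝ, ∀ l ∈ K, ∀ ρ, 0 < ρ → ρ < ρ₀ →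
      ∃ (O : Euc (n + 1) → Bilin n) (L : Euc (n + 1) → (ℝ × Euc (n + 1)) →L[ℝ] Bilin n)
        (Q : Euc (n + 1) × (ℝ × Euc (n + 1)) → Bilin n),
        SmoothOnSphere C O ∧ SmoothOnSphere C L ∧ QuadraticOp C δ Q ∧
        ∀ x (j : ℝ × Euc (n + 1)), ‖x‖ = 1 → ‖j‖ < δ →
          frameForm T (ρ, l, x, j) = innerForm - (1 / 3 * ρ ^ 2) • curvForm (h l) x + ρ ^ 3 • O x
            + L x (j.1, 0) + Q (x, j) := by
  have hop := isOpen_shapeDomain F.isOpen F.smooth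
  have hf := contDiffOn_frameForm (n := n) F.smooth
  -- The frame at the zero jet is needed up to `ρ³`. Its linear part is left entirely in the error,
  -- whence `d₁ = 0`: multiplied by the Hessian it is already quadratic in `w`.
  obtain ⟨ρ₀, hρ₀, δ, hδ, C, H⟩ := exists_expansion F.isCompact hop
    (fun l hl x _ => F.zero_mem_shapeDomain hl x) hf 3 0
    (a := fun i l x => frameCoeff (h l) i x) (b := fun _ _ _ _ => 0)
    (fun l hl x _ => F.isBigO_frameForm hl x) (fun l hl x _ ξ => by
      simpa using (isBigO_one_fderiv_slice hop hf (F.zero_mem_shapeDomain hl x) ξ).mono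
        nhdsWithin_le_nhds)
  refine ⟨ρ₀, hρ₀, δ, hδ, C, fun l hl ρ h0 h1 => ?_⟩
  obtain ⟨O, L, Q, hO, hL, hQ, e⟩ := H l hl ρ h0 h1
  refine ⟨O, L, Q, hO, hL, hQ, fun x j hx hj => ?_⟩
  -- On pure gradients the frame is even, so the linear part vanishes there and depends only on the
  -- value of `w`.
  have hL0 : ∀ ξ : Euc (n + 1), L x (0, ξ) = 0 := fun ξ => by
    refine clm_eq_zero_of_even (hQ.hasFDerivAt hδ hx) ?_
    have hc : Continuous fun t : ℝ => ‖t • ((0 : ℝ), ξ)‖ := by fun_prop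
    have hlt : ‖(0 : ℝ) • ((0 : ℝ), ξ)‖ < δ := by rw [zero_smul, norm_zero]; exact hδ
    filter_upwards [hc.continuousAt.preimage_mem_nhds (Iio_mem_nhds hlt)] with t ht
    have ht' : ‖-(t • ((0 : ℝ), ξ))‖ < δ := by rw [norm_neg]; exact ht
    have e1 := e x _ hx ht
    have e2 := e x _ hx ht'
    have e3 : frameForm T (ρ, l, x, -(t • ((0 : ℝ), ξ))) = frameForm T (ρ, l, x, t • ((0 : ℝ), ξ)) := by
      have h1 : t • ((0 : ℝ), ξ) = (0, t • ξ) := by simp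
      have h2 : -(t • ((0 : ℝ), ξ)) = (0, -(t • ξ)) := by simp
      rw [h1, h2] at *
      exact frameForm_neg ρ l x (t • ξ) 0
    rw [e1, e2] at e3
    simp only [pow_zero, one_smul, add_assoc] at e3
    exact (add_left_cancel (add_left_cancel (add_left_cancel e3))).symm
  have hLj : L x j = L x (j.1, 0) := by
    have : L x j = L x (j.1, 0) + L x (0, j.2) := by rw [← map_add]; simp
    rw [this, hL0, add_zero]
  rw [e x j hx hj, hLj]
  simp only [Finset.sum_range_succ, Finset.sum_range_zero, frameCoeff]
  simp
  module

/-- The expansion of the second fundamental form of perturbed spheres. -/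
theorem NormalFamily.exists_shape_expansion (F : NormalFamily h T 𝒱 K R) :
    ∃ ρ₀ > 0, ∃ δ > 0, ∃ C : ℕ → ℝ, ∀ l ∈ K, ∀ ρ, 0 < ρ → ρ < ρ₀ →
      ∃ (O : Euc (n + 1) → Bilin n)
        (L : Euc (n + 1) → (ℝ × EuclideanSpace ℝ (Fin (n + 1)) × Bilin n) →L[ℝ] Bilin n)
        (Q : Euc (n + 1) × (ℝ × Euc (n + 1)) → Bilin n)
        (L₂ : Fin (n + 1) × Fin (n + 1) → Euc (n + 1) →
          (ℝ × EuclideanSpace ℝ (Fin (n + 1)) × Bilin n) →L[ℝ] Bilin n)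
        (L₀ : Fin (n + 1) × Fin (n + 1) → Euc (n + 1) → ℝ →L[ℝ] ℝ)
        (Q₁ : Fin (n + 1) × Fin (n + 1) → Euc (n + 1) × (ℝ × Euc (n + 1)) → ℝ),
        SmoothOnSphere C O ∧ SmoothOnSphere C L ∧ QuadraticOp C δ Q ∧
        (∀ i, SmoothOnSphere C (L₂ i) ∧ SmoothOnSphere C (L₀ i) ∧ QuadraticOp C δ (Q₁ i)) ∧
        ∀ x (j : ℝ × EuclideanSpace ℝ (Fin (n + 1)) × Bilin n) u v, ‖x‖ = 1 → ‖(j.1, j.2.1)‖ < δ →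
          sphereForm T (ρ, l, x, (j.1, j.2.1)) u v
            + j.2.2 (sphereFrame T (ρ, l, x, (j.1, j.2.1)) u) v
          = (1 + j.1) * inner ℝ u v + j.2.2 u v + 1 / 3 * curvForm (h l) x u v * ρ ^ 2
            - 1 / 3 * (curvForm (h l) x u v * j.1 + j.2.2 (curv (h l) 0 x u x) v) * ρ ^ 2
            - gradForm (h l) x j.2.1 u v * ρ ^ 2 + 1 / 4 * covForm (h l) x u v * ρ ^ 3
            + ρ ^ 4 * O x u v + ρ ^ 3 * L x j u v + Q (x, (j.1, j.2.1)) u v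
            + ∑ i, L₂ i x j u v * L₀ i x j.1 + ∑ i, L₂ i x j u v * Q₁ i (x, (j.1, j.2.1)) := by
  have hop := isOpen_shapeDomain F.isOpen F.smooth
  obtain ⟨ρ₁, hρ₁, δ₁, hδ₁, C₁, H₁⟩ := exists_expansion F.isCompact hop
    (fun l hl x _ => F.zero_mem_shapeDomain hl x) (contDiffOn_sphereForm F.isOpen F.smooth) 4 3
    (a := fun i l x => formCoeff (h l) i x) (b := fun i l x j => formLinCoeff (h l) i x j)
    (fun l hl x _ => F.isBigO_sphereForm hl x) (fun l hl x _ ξ => F.isBigO_fderiv_sphereForm hl x ξ)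
  obtain ⟨ρ₂, hρ₂, δ₂, hδ₂, C₂, H₂⟩ := F.exists_frame_expansion
  let CL : ℕ → ℝ := fun r => ‖liftJet n‖ * C₁ r + ‖contractHess n‖ * C₂ r
  let CH : ℕ → ℝ := fun _ => ∑ i : Fin (n + 1) × Fin (n + 1), ‖hessOp (n := n) i‖
  -- The absolute values ensure that each summand is bounded by the whole sum, since `C₂ r` is not
  -- known to be nonnegative.
  let C0 : ℕ → ℝ := fun r => ∑ i : Fin (n + 1) × Fin (n + 1), |‖zeroJet (n := n) i‖ * C₂ r|
  let CQ : ℕ → ℝ := fun r => ∑ i : Fin (n + 1) × Fin (n + 1), |‖evalBasis (n := n) i‖ * C₂ r|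
  refine ⟨min ρ₁ ρ₂, lt_min hρ₁ hρ₂, min δ₁ δ₂, lt_min hδ₁ hδ₂,
    fun r => max (C₁ r) (max (CL r) (max (CH r) (max (C0 r) (CQ r)))), fun l hl ρ h0 h1 => ?_⟩
  obtain ⟨O, L, Q, hO, hL, hQ, e⟩ := H₁ l hl ρ h0 (h1.trans_le (min_le_left _ _))
  obtain ⟨O', L', Q', hO', hL', hQ', e'⟩ := H₂ l hl ρ h0 (h1.trans_le (min_le_right _ _))
  have N := F.normal l hl
  -- The `ρ³` error of the frame, contracted with the Hessian, is linear in the 2-jet and joins `L`.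
  -- The linear and the quadratic part of the frame give the two product terms, with the same second
  -- order factors.
  refine ⟨O, fun x => liftJet n (L x) + contractHess n (O' x), Q, fun i _ => hessOp i,
    fun i x => zeroJet i (L' x), fun i p => evalBasis i (Q' p), hO.mono fun r => le_max_left _ _,
    ((hL.clm _).add (hO'.clm _)).mono fun r => ?_, hQ.mono (fun r => le_max_left _ _)
      (min_le_left _ _), fun i => ⟨(smoothOnSphere_const _).mono fun r => ?_,
      (hL'.clm _).mono fun r => ?_, (hQ'.clm hδ₂ _).mono (fun r => ?_) (min_le_right _ _)⟩, ?_⟩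
  · exact (le_max_left (CL r) _).trans (le_max_right _ _)
  · refine le_trans ?_ ((le_max_left (CH r) _).trans ((le_max_right _ _).trans (le_max_right _ _)))
    exact Finset.single_le_sum (f := fun i => ‖hessOp (n := n) i‖) (fun i _ => norm_nonneg _)
      (Finset.mem_univ i)
  · refine le_trans ?_ ((le_max_left (C0 r) _).trans ((le_max_right _ _).trans
      ((le_max_right _ _).trans (le_max_right _ _))))
    exact (le_abs_self _).trans (Finset.single_le_sum
      (f := fun i => |‖zeroJet (n := n) i‖ * C₂ r|) (fun i _ => abs_nonneg _) (Finset.mem_univ i))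
  · refine le_trans ?_ ((le_max_right (C0 r) _).trans ((le_max_right _ _).trans
      ((le_max_right _ _).trans (le_max_right _ _))))
    exact (le_abs_self _).trans (Finset.single_le_sum
      (f := fun i => |‖evalBasis (n := n) i‖ * C₂ r|) (fun i _ => abs_nonneg _) (Finset.mem_univ i))
  · intro x j u v hx hj
    have h2 := congrArg (fun B : Bilin n => B u v) (e x (j.1, j.2.1) hx (hj.trans_le (min_le_left _ _)))
    have h3 := e' x (j.1, j.2.1) hx (hj.trans_le (min_le_right _ _))
    have h4 : ∀ i : Fin (n + 1) × Fin (n + 1), u i.1 * j.2.2 (stdVec i.2) v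
        * inner ℝ (stdVec i.2) (sphereFrame T (ρ, l, x, (j.1, j.2.1)) (stdVec i.1))
        = u i.1 * j.2.2 (stdVec i.2) v
            * inner ℝ (stdVec i.2) (ContinuousLinearMap.id ℝ (Euc (n + 1)) (stdVec i.1))
          - 1 / 3 * ρ ^ 2 * (u i.1 * j.2.2 (stdVec i.2) v
            * inner ℝ (stdVec i.1) (curv (h l) 0 x (stdVec i.2) x))
          + ρ ^ 3 * (hessOp i j u v * evalBasis i (O' x))
          + hessOp i j u v * zeroJet i (L' x) j.1
          + hessOp i j u v * evalBasis i (Q' (x, (j.1, j.2.1))) := fun i => by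
      rw [← frameForm_apply, h3, hessOp_apply, zeroJet_apply, evalBasis_apply, evalBasis_apply,
        evalBasis_apply, ← N.curvForm_apply]
      simp only [_root_.add_apply, _root_.sub_apply, _root_.smul_apply, innerForm_apply, smul_eq_mul,
        ContinuousLinearMap.id_apply, real_inner_comm (stdVec i.1)]
      ring
    have h5 := bilin_apply_sum j.2.2 (sphereFrame T (ρ, l, x, (j.1, j.2.1))) u v
    have h6 := bilin_apply_sum j.2.2 (ContinuousLinearMap.id ℝ (Euc (n + 1))) u v
    have h7 : ∑ i : Fin (n + 1) × Fin (n + 1), u i.1 * j.2.2 (stdVec i.2) v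
        * inner ℝ (stdVec i.1) (curv (h l) 0 x (stdVec i.2) x) = j.2.2 (curv (h l) 0 x u x) v := by
      rw [← N.curvOp_apply, ← bilin_apply_sum j.2.2 (N.curvOp x) u v]
      refine Finset.sum_congr rfl fun i _ => ?_
      rw [N.curvOp_apply, ← N.curvForm_apply, ← N.curvForm_apply, N.curvForm_symm]
    rw [Finset.sum_congr rfl fun i _ => h4 i] at h5
    simp only [Finset.sum_add_distrib, Finset.sum_sub_distrib, ← Finset.mul_sum] at h5
    rw [h6, h7] at h5
    have h8 : (liftJet n (L x) + contractHess n (O' x)) j u v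
        = L x (j.1, j.2.1) u v + ∑ i, hessOp i j u v * evalBasis i (O' x) := by
      rw [← contractHess_apply]
      rfl
    have h9 : sphereForm T (ρ, l, x, (j.1, j.2.1)) u v = inner ℝ u v
        + 1 / 3 * curvForm (h l) x u v * ρ ^ 2 + 1 / 4 * covForm (h l) x u v * ρ ^ 3
        + ρ ^ 4 * O x u v + j.1 * inner ℝ u v - 1 / 3 * j.1 * curvForm (h l) x u v * ρ ^ 2
        - gradForm (h l) x j.2.1 u v * ρ ^ 2 + ρ ^ 3 * L x (j.1, j.2.1) u v
        + Q (x, (j.1, j.2.1)) u v := by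
      rw [h2]
      simp only [Finset.sum_range_succ, Finset.sum_range_zero, formCoeff, formLinCoeff]
      simp [innerForm_apply]
      ring
    beta_reduce
    rw [h8, h9, ← h5, ContinuousLinearMap.id_apply]
    ring

end ShapeExpansion

/-! ### Elementary symmetric functions of a matrix -/

section Esymm

variable {ι κ : Type*} [Fintype ι] [DecidableEq ι] [Fintype κ] [DecidableEq κ]

/-- The sum of the principal minors of size `k`. -/
noncomputable def matEsymm (k : ℕ) (M : Matrix ι ι ℝ) : ℝ :=
  ∑ s ∈ Finset.univ.powersetCard k,
    (M.submatrix (Subtype.val : {x // x ∈ s} → ι) (Subtype.val : {x // x ∈ s} → ι)).det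

/-- The polynomial `det (1 + X M)`. -/
noncomputable def detPoly (M : Matrix ι ι ℝ) : Polynomial ℝ :=
  (1 + (Polynomial.X : Polynomial ℝ) • M.map Polynomial.C).det

theorem coeff_detPoly (M : Matrix ι ι ℝ) (k : ℕ) : (detPoly M).coeff k = matEsymm k M :=
  Matrix.coeff_det_one_add_X_smul_eq_sum_minors M k

theorem eval_detPoly (M : Matrix ι ι ℝ) (t : ℝ) : (detPoly M).eval t = (1 + t • M).det := by
  rw [detPoly, ← Polynomial.coe_evalRingHom, RingHom.map_det]
  congr 1
  ext i j
  by_cases hij : i = j <;> simp [hij, mul_comm t]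

theorem detPoly_eq_sum (M : Matrix ι ι ℝ) :
    detPoly M = ∑ j ∈ Finset.range (Fintype.card ι + 1),
      Polynomial.C (matEsymm j M) * Polynomial.X ^ j := by
  ext k
  rw [coeff_detPoly]
  simp only [Polynomial.finsetSum_coeff, Polynomial.coeff_C_mul, Polynomial.coeff_X_pow, mul_ite,
    mul_one, mul_zero, Finset.sum_ite_eq, Finset.mem_range]
  split_ifs with hk
  · rfl
  · rw [matEsymm, Finset.powersetCard_eq_empty.2 (by simpa using hk), Finset.sum_empty]

theorem det_one_add_smul_eq_sum (M : Matrix ι ι ℝ) (t : ℝ) :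
    (1 + t • M).det = ∑ j ∈ Finset.range (Fintype.card ι + 1), matEsymm j M * t ^ j := by
  rw [← eval_detPoly, detPoly_eq_sum]
  simp [Polynomial.eval_finsetSum]

theorem matEsymm_zero (M : Matrix ι ι ℝ) : matEsymm 0 M = 1 := by
  simp [matEsymm]

theorem matEsymm_one (M : Matrix ι ι ℝ) : matEsymm 1 M = M.trace := by
  rw [← coeff_detPoly, detPoly, Matrix.coeff_det_one_add_X_smul_one]

theorem detPoly_ext {M : Matrix ι ι ℝ} {p : Polynomial ℝ}
    (h : ∀ t : ℝ, 0 < t → p.eval t = (1 + t • M).det) : detPoly M = p :=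
  Polynomial.eq_of_infinite_eval_eq _ _ ((Ioi_infinite (0 : ℝ)).mono fun t ht => by
    rw [mem_ofPred_eq, eval_detPoly, h t ht])

/-- Compare the coefficients of `t^k` in `det (1 + t (1 + N)) = (1 + t)^n det (1 + t/(1 + t) N)`,
where `n` is the size of the matrix. The identity is used for `t > 0`, where `1 + t` is invertible,
and this determines the polynomials. -/
theorem matEsymm_one_add {k : ℕ} (hk : k ≤ Fintype.card ι) (N : Matrix ι ι ℝ) :
    matEsymm k (1 + N) = ∑ j ∈ Finset.range (k + 1),
      ((Fintype.card ι - j).choose (k - j) : ℝ) * matEsymm j N := by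
  have h1 : detPoly (1 + N) = ∑ j ∈ Finset.range (Fintype.card ι + 1),
      Polynomial.C (matEsymm j N) * (Polynomial.X ^ j * (1 + Polynomial.X) ^ (Fintype.card ι - j)) := by
    refine detPoly_ext fun t ht => ?_
    have ht' : 1 + t ≠ 0 := by positivity
    have h2 : (1 + t • (1 + N) : Matrix ι ι ℝ) = (1 + t) • (1 + (t / (1 + t)) • N) := by
      rw [smul_add, smul_add, smul_smul, mul_div_cancel₀ _ ht', add_smul, one_smul, add_assoc]
    rw [h2, Matrix.det_smul, det_one_add_smul_eq_sum, Polynomial.eval_finsetSum, Finset.mul_sum]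
    refine Finset.sum_congr rfl fun j hj => ?_
    have hj' : j ≤ Fintype.card ι := by simpa [Nat.lt_succ_iff] using hj
    simp only [Polynomial.eval_mul, Polynomial.eval_C, Polynomial.eval_pow, Polynomial.eval_X,
      Polynomial.eval_add, Polynomial.eval_one]
    rw [div_pow, ← Nat.sub_add_cancel hj', Nat.add_sub_cancel, pow_add]
    field_simp
  rw [← coeff_detPoly, h1, Polynomial.finsetSum_coeff]
  simp only [Polynomial.coeff_C_mul, Polynomial.coeff_X_pow_mul', Polynomial.coeff_one_add_X_pow]
  rw [← Finset.sum_subset (Finset.range_mono (Nat.succ_le_succ hk))]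
  · refine Finset.sum_congr rfl fun j hj => ?_
    rw [if_pos (by simpa [Nat.lt_succ_iff] using hj), mul_comm]
  · intro j _ hj
    rw [if_neg (by simpa [Nat.lt_succ_iff] using hj), mul_zero]

/-- The coefficient of `t²` in `det (1 + t N) det (1 - t N) = det (1 - t² N²)`. -/
theorem two_mul_matEsymm_two (N : Matrix ι ι ℝ) :
    2 * matEsymm 2 N = N.trace ^ 2 - (N * N).trace := by
  have h1 : (detPoly N * (detPoly N).comp (-Polynomial.X))
      = Polynomial.expand ℝ 2 (detPoly (-(N * N))) := by
    refine Polynomial.funext fun t => ?_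
    rw [Polynomial.eval_mul, Polynomial.eval_comp, Polynomial.expand_eval, eval_detPoly,
      eval_detPoly, eval_detPoly, ← Matrix.det_mul]
    congr 1
    simp only [Polynomial.eval_neg, Polynomial.eval_X, mul_add, add_mul, one_mul, mul_one,
      neg_smul, smul_neg, Matrix.mul_neg, Matrix.smul_mul, Matrix.mul_smul, smul_smul, pow_two]
    abel
  have h2 := congrArg (fun p => Polynomial.coeff p 2) h1
  have hc : ∀ k, ((detPoly N).comp (-Polynomial.X)).coeff k = (-1) ^ k * matEsymm k N := fun k => by
    have : (-Polynomial.X : Polynomial ℝ) = Polynomial.C (-1) * Polynomial.X := by simp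
    rw [this, Polynomial.comp_C_mul_X_coeff, coeff_detPoly, mul_comm]
  have h3 : (Polynomial.expand ℝ 2 (detPoly (-(N * N)))).coeff 2 = -(N * N).trace := by
    have := Polynomial.coeff_expand_mul (p := 2) (by norm_num) (detPoly (-(N * N))) 1
    rw [one_mul] at this
    rw [this, coeff_detPoly, matEsymm_one, Matrix.trace_neg]
  simp only [h3, Polynomial.coeff_mul, Finset.Nat.antidiagonal_succ, hc, coeff_detPoly] at h2
  simp [matEsymm_zero, matEsymm_one] at h2
  linarith

theorem matEsymm_smul (k : ℕ) (c : ℝ) (M : Matrix ι ι ℝ) :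
    matEsymm k (c • M) = c ^ k * matEsymm k M := by
  rw [matEsymm, matEsymm, Finset.mul_sum]
  refine Finset.sum_congr rfl fun s hs => ?_
  rw [Matrix.submatrix_smul, Pi.smul_apply, Pi.smul_apply, Matrix.det_smul, Fintype.card_coe,
    (Finset.mem_powersetCard.1 hs).2]

/-- Sylvester's identity `det (1 + U B) = det (1 + B U)` holds for rectangular matrices, so the size
of the matrix may change; this allows the passage from `n + 1` ambient to `n` tangential
coordinates. -/
theorem matEsymm_conj (k : ℕ) {U : Matrix ι κ ℝ} {V : Matrix κ ι ℝ} (hU : V * U = 1)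
    (A : Matrix κ κ ℝ) : matEsymm k (U * A * V) = matEsymm k A := by
  rw [← coeff_detPoly, ← coeff_detPoly]
  congr 1
  refine detPoly_ext fun t _ => ?_
  rw [eval_detPoly, ← Matrix.smul_mul, ← Matrix.mul_smul, Matrix.mul_assoc,
    Matrix.det_one_add_mul_comm, Matrix.mul_assoc, hU, Matrix.mul_one]

/-- Up to the same sign, both sides are the same coefficient of the characteristic polynomial, once
by Vieta and once in terms of minors. -/
theorem matEsymm_of_splits {k : ℕ} (hk : k ≤ Fintype.card ι) {A : Matrix ι ι ℝ}
    (hA : A.charpoly.Splits) : A.charpoly.roots.esymm k = matEsymm k A := by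
  have h1 := Matrix.charpoly_coeff_eq_sum_minors A k hk
  have hn := A.charpoly_natDegree_eq_dim
  rw [Polynomial.coeff_eq_esymm_roots_of_splits hA (by rw [hn]; exact Nat.sub_le _ _), hn,
    Nat.sub_sub_self hk, A.charpoly_monic.leadingCoeff, one_mul] at h1
  exact mul_left_cancel₀ (by positivity) h1

theorem contDiffOn_matEsymm {E : Type*} [NormedAddCommGroup E] [NormedSpace ℝ E] {s : Set E}
    {M : E → Matrix ι ι ℝ} (hM : ∀ i j, ContDiffOn ℝ ∞ (fun x => M x i j) s) (k : ℕ) :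
    ContDiffOn ℝ ∞ (fun x => matEsymm k (M x)) s := by
  unfold matEsymm
  refine ContDiffOn.sum fun r _ => ?_
  simp only [Matrix.det_apply']
  exact ContDiffOn.sum fun σ _ => contDiffOn_const.mul (contDiffOn_prod fun i _ => hM _ _)

theorem isBigO_prod {α β : Type*} {l : Filter α} {g : α → ℝ} {f : β → α → ℝ} (s : Finset β)
    (hf : ∀ i ∈ s, f i =O[l] g) : (fun x => ∏ i ∈ s, f i x) =O[l] fun x => g x ^ s.card := by
  classical
  induction s using Finset.induction_on with
  | empty => simpa using Asymptotics.isBigO_refl (fun _ : α => (1 : ℝ)) l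
  | insert a s ha ih =>
    simp only [Finset.prod_insert ha, Finset.card_insert_of_notMem ha, pow_succ']
    exact (hf a (Finset.mem_insert_self _ _)).mul
      (ih fun i hi => hf i (Finset.mem_insert_of_mem hi))

theorem isBigO_sq_pow {j : ℕ} (hj : 2 ≤ j) :
    (fun ρ : ℝ => (ρ ^ 2) ^ j) =O[𝓝[>] 0] fun ρ : ℝ => ρ ^ 4 := by
  refine Asymptotics.IsBigO.mono ?_ nhdsWithin_le_nhds
  have h1 : (fun ρ : ℝ => (ρ ^ 2) ^ j) = fun ρ : ℝ => ρ ^ 4 * ρ ^ (2 * j - 4) := by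
    ext ρ
    rw [← pow_mul, ← pow_add]
    congr 1
    omega
  rw [h1]
  have h2 : (fun ρ : ℝ => ρ ^ (2 * j - 4)) =O[𝓝 0] fun _ : ℝ => (1 : ℝ) :=
    (Continuous.tendsto (by fun_prop) 0).isBigO_one ℝ
  simpa using (Asymptotics.isBigO_refl (fun ρ : ℝ => ρ ^ 4) (𝓝 0)).mul h2

theorem isBigO_matEsymm {α : ℝ → Matrix ι ι ℝ}
    (hα : ∀ i j, (fun ρ => α ρ i j) =O[𝓝[>] 0] fun ρ : ℝ => ρ ^ 2) {j : ℕ} (hj : 2 ≤ j) :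
    (fun ρ => matEsymm j (α ρ)) =O[𝓝[>] 0] fun ρ : ℝ => ρ ^ 4 := by
  unfold matEsymm
  refine Asymptotics.IsBigO.fun_sum fun s hs => ?_
  simp only [Matrix.det_apply', Matrix.submatrix_apply]
  refine Asymptotics.IsBigO.fun_sum fun σ _ => Asymptotics.IsBigO.const_mul_left ?_ _
  refine (isBigO_prod (f := fun (i : {x // x ∈ s}) ρ => α ρ (σ i) i) Finset.univ
    fun i _ => hα _ _).trans ?_
  rw [Finset.card_univ, Fintype.card_coe, (Finset.mem_powersetCard.1 hs).2]
  exact isBigO_sq_pow hj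

/-- A minor of size `j` is a sum of products of `j` entries, hence `O(ρ^{2j})`. Up to `O(ρ⁴)` only
the terms with `j = 0` and `j = 1` remain. -/
theorem isBigO_matEsymm_one_add {α : ℝ → Matrix ι ι ℝ}
    (hα : ∀ i j, (fun ρ => α ρ i j) =O[𝓝[>] 0] fun ρ : ℝ => ρ ^ 2) {k : ℕ} (hk : 1 ≤ k)
    (hkn : k ≤ Fintype.card ι) :
    (fun ρ => matEsymm k (1 + α ρ) - (((Fintype.card ι).choose k : ℝ)
      + ((Fintype.card ι - 1).choose (k - 1) : ℝ) * (α ρ).trace)) =O[𝓝[>] 0]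
      fun ρ : ℝ => ρ ^ 4 := by
  obtain ⟨k, rfl⟩ := Nat.exists_eq_add_of_le' hk
  have h1 : (fun ρ => ∑ j ∈ Finset.range k, ((Fintype.card ι - (j + 1 + 1)).choose
      (k + 1 - (j + 1 + 1)) : ℝ) * matEsymm (j + 1 + 1) (α ρ)) =O[𝓝[>] 0] fun ρ : ℝ => ρ ^ 4 :=
    Asymptotics.IsBigO.fun_sum fun j _ =>
      Asymptotics.IsBigO.const_mul_left (isBigO_matEsymm hα (by omega)) _
  refine h1.congr_left fun ρ => ?_
  rw [matEsymm_one_add hkn, Finset.sum_range_succ', Finset.sum_range_succ', matEsymm_zero]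
  simp only [Nat.zero_add, matEsymm_one]
  simp
  ring

theorem hasDerivAt_matEsymm {N : ℝ → Matrix ι ι ℝ} {β : Matrix ι ι ℝ} {t : ℝ}
    (hN : ∀ i j, HasDerivAt (fun s => N s i j) (β i j) t) (j : ℕ) :
    HasDerivAt (fun s => matEsymm j (N s)) (∑ r ∈ Finset.univ.powersetCard j,
      ∑ σ : Equiv.Perm {x // x ∈ r}, ((Equiv.Perm.sign σ : ℤ) : ℝ) *
        ∑ i : {x // x ∈ r}, (∏ i' ∈ Finset.univ.erase i, N t (σ i').1 i'.1) • β (σ i).1 i.1) t := by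
  unfold matEsymm
  simp only [Matrix.det_apply', Matrix.submatrix_apply]
  exact HasDerivAt.fun_sum fun r _ => HasDerivAt.fun_sum fun σ _ =>
    (HasDerivAt.fun_finsetProd fun i _ => hN _ _).const_mul _

/-- Differentiation removes one small factor from each product of `j` entries; for `j ≥ 3` at least
two factors of size `ρ²` are left. -/
theorem isBigO_deriv_matEsymm {N : ℝ → ℝ → Matrix ι ι ℝ} {β : ℝ → Matrix ι ι ℝ}
    (hN : ∀ᶠ ρ in 𝓝[>] 0, ∀ i j, HasDerivAt (fun s => N ρ s i j) (β ρ i j) 0)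
    (hα : ∀ i j, (fun ρ => N ρ 0 i j) =O[𝓝[>] 0] fun ρ : ℝ => ρ ^ 2)
    (hβ : ∀ i j, (fun ρ => β ρ i j) =O[𝓝[>] 0] fun _ : ℝ => (1 : ℝ)) {j : ℕ} (hj : 3 ≤ j) :
    (fun ρ => deriv (fun s => matEsymm j (N ρ s)) 0) =O[𝓝[>] 0] fun ρ : ℝ => ρ ^ 4 := by
  refine Asymptotics.IsBigO.congr' (f₁ := fun ρ => ∑ r ∈ Finset.univ.powersetCard j,
      ∑ σ : Equiv.Perm {x // x ∈ r}, ((Equiv.Perm.sign σ : ℤ) : ℝ) *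
        ∑ i : {x // x ∈ r}, (∏ i' ∈ Finset.univ.erase i, N ρ 0 (σ i').1 i'.1) • β ρ (σ i).1 i.1) ?_ ?_ EventuallyEq.rfl
  · refine Asymptotics.IsBigO.fun_sum fun s hs => Asymptotics.IsBigO.fun_sum fun σ _ =>
      Asymptotics.IsBigO.const_mul_left (Asymptotics.IsBigO.fun_sum fun i _ => ?_) _
    have h1 := (isBigO_prod (f := fun (i : {x // x ∈ s}) ρ => N ρ 0 (σ i) i)
      (Finset.univ.erase i) fun i _ => hα _ _).mul (hβ (σ i) i)
    refine h1.trans ?_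
    simp only [mul_one]
    refine isBigO_sq_pow ?_
    rw [Finset.card_erase_of_mem (Finset.mem_univ _), Finset.card_univ, Fintype.card_coe,
      (Finset.mem_powersetCard.1 hs).2]
    omega
  · filter_upwards [hN] with ρ hρ
    exact (hasDerivAt_matEsymm hρ j).deriv.symm

/-- By the previous estimate only `e_1` and `e_2` contribute to the linearization, and the
derivative of `e_2` follows from `2 e_2(N) = (tr N)² - tr N²`. -/
theorem isBigO_deriv_matEsymm_one_add {N : ℝ → ℝ → Matrix ι ι ℝ} {β : ℝ → Matrix ι ι ℝ}
    (hN : ∀ᶠ ρ in 𝓝[>] 0, ∀ i j, HasDerivAt (fun s => N ρ s i j) (β ρ i j) 0)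
    (hα : ∀ i j, (fun ρ => N ρ 0 i j) =O[𝓝[>] 0] fun ρ : ℝ => ρ ^ 2)
    (hβ : ∀ i j, (fun ρ => β ρ i j) =O[𝓝[>] 0] fun _ : ℝ => (1 : ℝ)) {k : ℕ} (hk : 1 ≤ k)
    (hkn : k ≤ Fintype.card ι) :
    (fun ρ => deriv (fun s => matEsymm k (1 + N ρ s)) 0
      - (((Fintype.card ι - 1).choose (k - 1) : ℝ) * (β ρ).trace
        + (if 2 ≤ k then ((Fintype.card ι - 2).choose (k - 2) : ℝ) else 0)
          * ((N ρ 0).trace * (β ρ).trace - (N ρ 0 * β ρ).trace))) =O[𝓝[>] 0]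
      fun ρ : ℝ => ρ ^ 4 := by
  have e1 : ∀ᶠ ρ in 𝓝[>] 0, deriv (fun s => matEsymm k (1 + N ρ s)) 0
      = ∑ j ∈ Finset.range (k + 1), ((Fintype.card ι - j).choose (k - j) : ℝ)
        * deriv (fun s => matEsymm j (N ρ s)) 0 := by
    filter_upwards [hN] with ρ hρ
    simp only [matEsymm_one_add hkn]
    rw [deriv_fun_sum fun j _ => ((hasDerivAt_matEsymm hρ j).const_mul _).differentiableAt]
    exact Finset.sum_congr rfl fun j _ =>
      deriv_const_mul _ (hasDerivAt_matEsymm hρ j).differentiableAt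
  have htr : ∀ ρ, (∀ i j, HasDerivAt (fun s => N ρ s i j) (β ρ i j) 0) →
      HasDerivAt (fun s => (N ρ s).trace) (β ρ).trace 0 := fun ρ hρ =>
    HasDerivAt.fun_sum fun i _ => hρ i i
  have e2 : ∀ᶠ ρ in 𝓝[>] 0, deriv (fun s => matEsymm 2 (N ρ s)) 0
      = (N ρ 0).trace * (β ρ).trace - (N ρ 0 * β ρ).trace := by
    filter_upwards [hN] with ρ hρ
    have h1 : HasDerivAt (fun s => (N ρ s * N ρ s).trace) (2 * (N ρ 0 * β ρ).trace) 0 := by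
      simp only [Matrix.trace, Matrix.diag_apply, Matrix.mul_apply]
      have := HasDerivAt.fun_sum (u := Finset.univ) fun i _ => HasDerivAt.fun_sum (u := Finset.univ)
        fun j _ => (hρ i j).fun_mul (hρ j i)
      refine this.congr_deriv ?_
      simp only [Finset.sum_add_distrib]
      rw [Finset.sum_comm, two_mul]
      congr 1
      exact Finset.sum_congr rfl fun i _ => Finset.sum_congr rfl fun j _ => mul_comm _ _
    have h2 := (((htr ρ hρ).fun_pow 2).fun_sub h1).const_mul (1 / 2 : ℝ)
    have h3 : (fun s => matEsymm 2 (N ρ s))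
        = fun s => (1 / 2 : ℝ) * ((N ρ s).trace ^ 2 - (N ρ s * N ρ s).trace) := by
      ext s
      rw [← two_mul_matEsymm_two]
      ring
    rw [h3, h2.deriv]
    push_cast
    ring
  have e3 : ∀ᶠ ρ in 𝓝[>] 0, deriv (fun s => matEsymm 1 (N ρ s)) 0 = (β ρ).trace := by
    filter_upwards [hN] with ρ hρ
    simp only [matEsymm_one]
    exact (htr ρ hρ).deriv
  obtain ⟨k, rfl⟩ := Nat.exists_eq_add_of_le' hk
  -- For `k = 1` the sum ends before `e_2`. The condition `2 ≤ k` is needed because with truncated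
  -- subtraction the binomial coefficient would be `1` instead of `0`.
  rcases k with - | k
  · refine (Asymptotics.isBigO_zero _ _).congr' ?_ EventuallyEq.rfl
    filter_upwards [e1, e3] with ρ h1 h3
    rw [h1]
    simp [Finset.sum_range_succ, h3, matEsymm_zero]
  · have h1 : (fun ρ => ∑ j ∈ Finset.range k, ((Fintype.card ι - (j + 1 + 1 + 1)).choose
        (k + 1 + 1 - (j + 1 + 1 + 1)) : ℝ) * deriv (fun s => matEsymm (j + 1 + 1 + 1) (N ρ s)) 0)
        =O[𝓝[>] 0] fun ρ : ℝ => ρ ^ 4 :=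
      Asymptotics.IsBigO.fun_sum fun j _ =>
        Asymptotics.IsBigO.const_mul_left (isBigO_deriv_matEsymm hN hα hβ (by omega)) _
    refine h1.congr' ?_ EventuallyEq.rfl
    filter_upwards [e1, e2, e3] with ρ h1 h2 h3
    rw [h1, Finset.sum_range_succ', Finset.sum_range_succ', Finset.sum_range_succ', if_pos (by omega)]
    simp only [Nat.zero_add, Nat.reduceAdd, h2, h3, matEsymm_zero, deriv_const, mul_zero]
    simp
    ring

end Esymm

/-! ### The expansion of the `k`-curvature -/

section Traces

variable {n : ℕ} {θ : Euc (n + 1)} {e : Fin n → Euc (n + 1)}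

theorem exists_adaptedFrame {θ : Euc (n + 1)} (hθ : ‖θ‖ = 1) :
    ∃ e : Fin n → Euc (n + 1), AdaptedFrame θ e := by
  have hfact : Fact (Module.finrank ℝ (Euc (n + 1)) = n + 1) := ⟨finrank_euclideanSpace_fin⟩
  let b := OrthonormalBasis.fromOrthogonalSpanSingleton (𝕜 := ℝ) (E := Euc (n + 1)) n
    (ne_zero_of_norm_eq_one hθ : θ ≠ 0)
  refine ⟨fun i => b i, hθ, fun i => ?_, fun i j => ?_⟩
  · exact Submodule.mem_orthogonal_singleton_iff_inner_right.1 (b i).2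
  · exact orthonormal_iff_ite.1 b.orthonormal i j

theorem sum_bilin_basis (B : Bilin n) (b : OrthonormalBasis (Fin (n + 1)) ℝ (Euc (n + 1))) :
    ∑ i, B (b i) (b i) = LinearMap.trace ℝ (Euc (n + 1))
      (∑ a, (B.flip (stdVec a)).smulRight (stdVec a) : Euc (n + 1) →L[ℝ] Euc (n + 1)) := by
  rw [LinearMap.trace_eq_sum_inner _ b]
  refine Finset.sum_congr rfl fun i _ => ?_
  have h1 : ∀ u v, B u v = ∑ a, v a * B u (stdVec a) := fun u v => by
    conv_lhs => rw [← sum_smul_stdVec v, map_sum]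
    simp only [map_smul, smul_eq_mul]
  rw [h1 (b i) (b i)]
  simp only [ContinuousLinearMap.coe_coe, _root_.sum_apply, ContinuousLinearMap.smulRight_apply,
    ContinuousLinearMap.flip_apply, inner_sum, inner_smul_right, inner_stdVec_right]
  exact Finset.sum_congr rfl fun a _ => mul_comm _ _

/-- The trace of a bilinear form does not depend on the orthonormal basis. -/
theorem AdaptedFrame.sum_bilin (A : AdaptedFrame θ e) (B : Bilin n) :
    ∑ i, B (e i) (e i) = ∑ a, B (stdVec a) (stdVec a) - B θ θ := by
  have h1 := sum_bilin_basis B A.basis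
  have h2 := sum_bilin_basis B (EuclideanSpace.basisFun (Fin (n + 1)) ℝ)
  rw [← h2, Fin.sum_univ_succ] at h1
  simp only [A.basis_zero, A.basis_succ, EuclideanSpace.basisFun_apply] at h1
  simp only [stdVec]
  linarith

/-- The matrix of a bilinear form, restricted to the orthogonal complement of `x`. -/
noncomputable def tangForm (x : Euc (n + 1)) (B : Bilin n) :
    Matrix (Fin (n + 1)) (Fin (n + 1)) ℝ :=
  Matrix.of fun a b => B (stdVec a - x a • x) (stdVec b - x b • x)

/-- The left-hand side involves no tangent frame and is smooth in `θ`, whereas in general a tangent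
frame cannot be chosen continuously over the whole sphere. The matrices are related by the
rectangular matrix of frame coordinates, whose columns are orthonormal. -/
theorem AdaptedFrame.matEsymm_tangForm (A : AdaptedFrame θ e) (B : Bilin n) (k : ℕ) :
    matEsymm k (tangForm θ B) = matEsymm k (Matrix.of fun i j => B (e i) (e j)) := by
  have h1 : ∀ a, stdVec a - θ a • θ = ∑ i, (e i) a • e i := fun a => by
    have h2 := A.expand (stdVec a)
    simp only [inner_stdVec_right] at h2
    rw [h2]
    abel
  have h3 : tangForm θ B = (Matrix.of fun a i => (e i) a) * (Matrix.of fun i j => B (e i) (e j))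
      * (Matrix.of fun j b => (e j) b) := by
    ext a b
    rw [tangForm, Matrix.of_apply, h1, h1]
    simp only [map_sum, map_smul, _root_.sum_apply, _root_.smul_apply, smul_eq_mul,
      Matrix.mul_apply, Matrix.of_apply, Finset.sum_mul, Finset.mul_sum]
    refine Finset.sum_congr rfl fun i _ => Finset.sum_congr rfl fun j _ => by ring
  rw [h3, matEsymm_conj]
  ext i j
  rw [Matrix.mul_apply, Matrix.one_apply, ← A.orthonormal i j, inner_eq_sum]
  rfl

/-- The contraction of the curvature with a bilinear form. -/
noncomputable def curvTrace (h : Euc (n + 1) → Euc (n + 1) → Euc (n + 1) → ℝ) (x : Euc (n + 1))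
    (W : Bilin n) : ℝ :=
  ∑ a, W (curv h 0 x (stdVec a) x) (stdVec a)

variable {h : Euc (n + 1) → Euc (n + 1) → Euc (n + 1) → ℝ}
  {T : Euc (n + 1) → Euc (n + 1) →L[ℝ] Euc (n + 1)} {R : ℝ}

theorem curv_self (x a : Euc (n + 1)) : curv h 0 x x a = 0 := sub_self _

/-- The radial direction contributes `R(θ, θ)θ = 0`, so the trace over the tangent space is the full
one. The sign appears because Ricci is the trace of `R(e, θ)θ`, with the first two arguments
exchanged. -/
theorem AdaptedFrame.sum_curvForm (A : AdaptedFrame θ e) (N : NormalMetricOn h T R) :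
    ∑ i, curvForm h θ (e i) (e i) = -ricci h 0 θ θ := by
  rw [A.sum_bilin, N.curvForm_apply, curv_self, inner_zero_right, sub_zero, ricci,
    ← Finset.sum_neg_distrib]
  refine Finset.sum_congr rfl fun a _ => ?_
  rw [N.curvForm_apply, N.curv_swap, inner_neg_right, inner_stdVec_left]

theorem covCurv_swap (N : NormalMetricOn h T R) (b u v a : Euc (n + 1)) :
    covCurv h 0 b u v a = -covCurv h 0 b v u a := by
  rw [N.covCurv_zero, N.covCurv_zero, ← neg_apply, ← fderiv_fun_neg]
  congr 2
  ext1 y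
  rw [curv, curv, neg_sub]

theorem NormalMetricOn.covRicci_zero (N : NormalMetricOn h T R) (b u v : Euc (n + 1)) :
    covRicci h 0 b u v = ∑ i, covCurv h 0 b (stdVec i) u v i := by
  have hz : ∀ a b, ricci h 0 a 0 = 0 ∧ ricci h 0 0 b = 0 := fun a b => by
    have hz : ∀ a c, dGamma h a c 0 = 0 := fun a c => by simpa using N.dGamma_add a c 0 0
    have hz' : ∀ a c, dGamma h a 0 c = 0 := fun a c => by rw [N.dGamma_symm, hz]
    have hz'' : ∀ b c, dGamma h 0 b c = 0 := fun b c => map_zero _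
    constructor <;> simp [ricci, N.curv_zero, hz, hz', hz'']
  rw [covRicci, N.christoffel_zero, N.christoffel_zero, (hz u v).1, (hz u v).2, sub_zero, sub_zero]
  have hd : ∀ i, HasFDerivAt (fun y => curv h y (stdVec i) u v)
      (fderiv ℝ (fun y => curv h y (stdVec i) u v) 0) 0 := fun i =>
    (((N.contDiffOn_curv (stdVec i) u v).contDiffAt N.mem_nhds).differentiableAt
      (by simp)).hasFDerivAt
  have h1 : HasFDerivAt (fun y => ricci h y u v) _ 0 := HasFDerivAt.fun_sum (u := Finset.univ)
    fun i _ => ((EuclideanSpace.proj i : Euc (n + 1) →L[ℝ] ℝ).hasFDerivAt.comp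
      (0 : Euc (n + 1)) (hd i))
  rw [h1.fderiv, _root_.sum_apply]
  refine Finset.sum_congr rfl fun i _ => ?_
  rw [N.covCurv_zero]
  rfl

theorem AdaptedFrame.sum_covForm (A : AdaptedFrame θ e) (N : NormalMetricOn h T R) :
    ∑ i, covForm h θ (e i) (e i) = -covRicci h 0 θ θ θ := by
  have h0 : covCurv h 0 θ θ θ θ = 0 := by
    have := covCurv_swap N θ θ θ θ
    have h2 : (2 : ℝ) • covCurv h 0 θ θ θ θ = 0 := by rw [two_smul]; nth_rw 1 [this]; exact neg_add_cancel _
    exact (smul_eq_zero.1 h2).resolve_left two_ne_zero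
  rw [A.sum_bilin, N.covForm_apply, h0, inner_zero_right, sub_zero, N.covRicci_zero,
    ← Finset.sum_neg_distrib]
  refine Finset.sum_congr rfl fun a _ => ?_
  rw [N.covForm_apply, covCurv_swap N, inner_neg_right, inner_stdVec_left]

/-- On the diagonal the two curvature terms of `three_dGamma` coincide, which gives the factor
`2/3`; the pair symmetry turns each into a summand of the Ricci trace. -/
theorem AdaptedFrame.sum_gradForm (A : AdaptedFrame θ e) (N : NormalMetricOn h T R)
    (ξ : Euc (n + 1)) : ∑ i, gradForm h θ ξ (e i) (e i) = 2 / 3 * ricci h 0 ξ θ := by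
  rw [A.sum_bilin, N.gradForm_apply, N.dGamma_self, inner_zero_right, sub_zero, ricci,
    Finset.mul_sum]
  refine Finset.sum_congr rfl fun a _ => ?_
  rw [N.gradForm_apply, N.three_dGamma, inner_smul_right, inner_add_right, real_inner_comm,
    N.curv_pair, inner_stdVec_right]
  ring

theorem AdaptedFrame.sum_curvTrace (A : AdaptedFrame θ e) (N : NormalMetricOn h T R) (W : Bilin n) :
    ∑ i, W (curv h 0 θ (e i) θ) (e i) = curvTrace h θ W := by
  have h1 := A.sum_bilin (W.comp (N.curvOp θ))
  simp only [ContinuousLinearMap.comp_apply, N.curvOp_apply, curv_self, map_zero,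
    _root_.zero_apply, sub_zero] at h1
  exact h1

theorem NormalMetricOn.inner_curv_self (N : NormalMetricOn h T R) (x u : Euc (n + 1)) :
    inner ℝ x (curv h 0 x u x) = (0 : ℝ) := by
  rw [← N.curvForm_apply, N.curvForm_symm, N.curvForm_apply, curv_self, inner_zero_right]

theorem AdaptedFrame.curv_expand (A : AdaptedFrame θ e) (N : NormalMetricOn h T R) (u : Euc (n + 1)) :
    curv h 0 θ u θ = ∑ j, curvForm h θ u (e j) • e j := by
  conv_lhs => rw [A.expand_of_perp (N.inner_curv_self θ u)]
  exact Finset.sum_congr rfl fun j _ => by rw [N.curvForm_symm, N.curvForm_apply]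

end Traces

/-! ### The `k`-curvature as a smooth function of the 2-jet -/

section CurvatureExpansion

variable {Λ : Type} [NormedAddCommGroup Λ] [NormedSpace ℝ Λ] {n : ℕ}
  {T : Λ × Euc (n + 1) → Euc (n + 1) →L[ℝ] Euc (n + 1)} {𝒱 K : Set Λ} {R : ℝ}
  {h : Λ → Euc (n + 1) → Euc (n + 1) → Euc (n + 1) → ℝ}

/-- The second fundamental form of a perturbed sphere as a function of the `2`-jet. -/
noncomputable def shapeForm (T : Λ × Euc (n + 1) → Euc (n + 1) →L[ℝ] Euc (n + 1))
    (p : ℝ × Λ × Euc (n + 1) × (ℝ × EuclideanSpace ℝ (Fin (n + 1)) × Bilin n)) : Bilin n :=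
  sphereForm T (p.1, p.2.1, p.2.2.1, (p.2.2.2.1, p.2.2.2.2.1))
    + p.2.2.2.2.2.comp (sphereFrame T (p.1, p.2.1, p.2.2.1, (p.2.2.2.1, p.2.2.2.2.1)))

/-- The set where `shapeForm` is smooth. -/
def jetDomain (T : Λ × Euc (n + 1) → Euc (n + 1) →L[ℝ] Euc (n + 1)) (𝒱 : Set Λ) (R : ℝ) :
    Set (ℝ × Λ × Euc (n + 1) × (ℝ × EuclideanSpace ℝ (Fin (n + 1)) × Bilin n)) :=
  (fun p => (p.1, p.2.1, p.2.2.1, (p.2.2.2.1, p.2.2.2.2.1))) ⁻¹' shapeDomain T 𝒱 R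

theorem shapeForm_zero (ρ : ℝ) (l : Λ) (x : Euc (n + 1)) :
    shapeForm T (ρ, l, x, (0 : ℝ × EuclideanSpace ℝ (Fin (n + 1)) × Bilin n))
      = sphereForm T (ρ, l, x, (0 : ℝ × Euc (n + 1))) := by
  simp only [shapeForm, Prod.snd_zero, ContinuousLinearMap.zero_comp, add_zero]
  rfl

theorem contDiffOn_shapeForm (h𝒱 : IsOpen 𝒱) (hT : ContDiffOn ℝ ∞ T (𝒱 ×ˢ Metric.ball 0 R)) :
    ContDiffOn ℝ ∞ (shapeForm T) (jetDomain T 𝒱 R) := by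
  have hc : ContDiff ℝ ∞ fun p : ℝ × Λ × Euc (n + 1) ×
      (ℝ × EuclideanSpace ℝ (Fin (n + 1)) × Bilin n) =>
      (p.1, p.2.1, p.2.2.1, (p.2.2.2.1, p.2.2.2.2.1)) := by fun_prop
  refine ContDiffOn.add ((contDiffOn_sphereForm h𝒱 hT).comp hc.contDiffOn fun p hp => hp) ?_
  refine ContDiffOn.clm_comp ?_ ((contDiffOn_sphereFrame hT).comp hc.contDiffOn fun p hp => hp)
  exact ContDiff.contDiffOn (by fun_prop)

/-- The `k`-curvature, multiplied by `ρ ^ k`, as a function of the `2`-jet. -/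
noncomputable def curvFun (k : ℕ) (T : Λ × Euc (n + 1) → Euc (n + 1) →L[ℝ] Euc (n + 1))
    (p : ℝ × Λ × Euc (n + 1) × (ℝ × EuclideanSpace ℝ (Fin (n + 1)) × Bilin n)) : ℝ :=
  matEsymm k (tangForm p.2.2.1 (shapeForm T p))

theorem contDiffOn_curvFun (k : ℕ) (h𝒱 : IsOpen 𝒱) (hT : ContDiffOn ℝ ∞ T (𝒱 ×ˢ Metric.ball 0 R)) :
    ContDiffOn ℝ ∞ (curvFun k T) (jetDomain T 𝒱 R) := by
  refine contDiffOn_matEsymm (fun a b => ?_) k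
  have hP : ∀ a : Fin (n + 1), ContDiff ℝ ∞ fun p : ℝ × Λ × Euc (n + 1) ×
      (ℝ × EuclideanSpace ℝ (Fin (n + 1)) × Bilin n) =>
      stdVec a - p.2.2.1 a • p.2.2.1 := fun a => by
    have : ContDiff ℝ ∞ fun p : ℝ × Λ × Euc (n + 1) ×
      (ℝ × EuclideanSpace ℝ (Fin (n + 1)) × Bilin n) => p.2.2.1 a :=
      (EuclideanSpace.proj a : Euc (n + 1) →L[ℝ] ℝ).contDiff.comp (by fun_prop)
    fun_prop
  exact ((contDiffOn_shapeForm h𝒱 hT).clm_apply (hP a).contDiffOn).clm_apply (hP b).contDiffOn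

/-- The coefficients of the `k`-curvature of geodesic spheres. -/
noncomputable def curvCoeff (k : ℕ) (h : Euc (n + 1) → Euc (n + 1) → Euc (n + 1) → ℝ) (i : ℕ)
    (x : Euc (n + 1)) : ℝ :=
  if i = 0 then (n.choose k : ℝ)
    else if i = 2 then ((n - 1).choose (k - 1) : ℝ) * (-(1 / 3) * ricci h 0 x x)
    else if i = 3 then ((n - 1).choose (k - 1) : ℝ) * (-(1 / 4) * covRicci h 0 x x x) else 0

/-- The trace of a bilinear form over the orthogonal complement of `x`. -/
noncomputable def perpTrace (x : Euc (n + 1)) (W : Bilin n) : ℝ :=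
  ∑ a, W (stdVec a) (stdVec a) - W x x

/-- The coefficients of its linearization. -/
noncomputable def curvLinCoeff (k : ℕ) (h : Euc (n + 1) → Euc (n + 1) → Euc (n + 1) → ℝ) (i : ℕ)
    (x : Euc (n + 1)) (j : ℝ × EuclideanSpace ℝ (Fin (n + 1)) × Bilin n) : ℝ :=
  if i = 0 then ((n - 1).choose (k - 1) : ℝ) * (perpTrace x j.2.2 + n * j.1)
    else if i = 2 then ((n - 1).choose (k - 1) : ℝ) * (1 / 3 * (ricci h 0 x x * j.1
        - 2 * ricci h 0 j.2.1 x - curvTrace h x j.2.2))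
      - (if 2 ≤ k then ((n - 2).choose (k - 2) : ℝ) else 0) *
        (1 / 3 * (ricci h 0 x x * (perpTrace x j.2.2 + (n - 1) * j.1) + curvTrace h x j.2.2))
    else 0

variable {x : Euc (n + 1)} {e : Fin n → Euc (n + 1)} {l : Λ}

theorem isBigO_bilin_apply {α : Type*} {f : Filter α} {G : α → Bilin n} {g : α → ℝ}
    (hG : G =O[f] g) (u v : Euc (n + 1)) : (fun t => G t u v) =O[f] g := by
  refine Asymptotics.IsBigO.trans (g := G) (Asymptotics.IsBigO.of_bound (‖u‖ * ‖v‖)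
    (Eventually.of_forall fun t => ?_)) hG
  exact ((G t).le_opNorm₂ u v).trans (le_of_eq (by ring))

theorem isBigO_pow_of_le {a b : ℕ} (hab : b ≤ a) :
    (fun ρ : ℝ => ρ ^ a) =O[𝓝[>] 0] fun ρ : ℝ => ρ ^ b := by
  refine Asymptotics.IsBigO.mono ?_ nhdsWithin_le_nhds
  have h2 : (fun ρ : ℝ => ρ ^ (a - b)) =O[𝓝 0] fun _ : ℝ => (1 : ℝ) :=
    (Continuous.tendsto (by fun_prop) 0).isBigO_one ℝ
  refine ((Asymptotics.isBigO_refl (fun ρ : ℝ => ρ ^ b) (𝓝 0)).mul h2).congr (fun ρ => ?_)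
    fun ρ => mul_one _
  rw [← pow_add, Nat.add_sub_cancel' hab]

theorem isBigO_mul_expand {α β : ℝ → ℝ} {a b b' : ℝ}
    (hα : (fun ρ => α ρ - ρ ^ 2 * a) =O[𝓝[>] 0] fun ρ : ℝ => ρ ^ 3)
    (hβ : (fun ρ => β ρ - (b + ρ ^ 2 * b')) =O[𝓝[>] 0] fun ρ : ℝ => ρ ^ 3) :
    (fun ρ => α ρ * β ρ - ρ ^ 2 * (a * b)) =O[𝓝[>] 0] fun ρ : ℝ => ρ ^ 3 := by
  have hb : (fun ρ => β ρ) =O[𝓝[>] 0] fun _ : ℝ => (1 : ℝ) := by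
    have h1 : (fun ρ : ℝ => b + ρ ^ 2 * b') =O[𝓝[>] 0] fun _ : ℝ => (1 : ℝ) :=
      ((Continuous.tendsto (by fun_prop) 0).isBigO_one ℝ).mono nhdsWithin_le_nhds
    have h2 := (isBigO_pow_of_le (Nat.zero_le 3))
    simp only [pow_zero] at h2
    exact ((hβ.trans h2).add h1).congr_left fun ρ => by ring
  have h3 := hα.mul hb
  have h4 := (isBigO_pow_of_le (a := 2) (Nat.zero_le 2)).mul hβ
  have h5 := (isBigO_pow_of_le (a := 4) (b := 3) (by norm_num)).const_mul_left (a * b')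
  refine ((((h3.congr_right fun ρ => mul_one _).add ((h4.const_mul_left a).congr_right
    fun ρ => by rw [pow_zero, one_mul])).add h5)).congr_left fun ρ => by ring

theorem NormalFamily.isBigO_shape_zero (F : NormalFamily h T 𝒱 K R) (hl : l ∈ K)
    (A : AdaptedFrame x e) (i j : Fin n) :
    (fun ρ : ℝ => sphereForm T (ρ, l, x, (0 : ℝ × Euc (n + 1))) (e i) (e j)
      - ((1 : Matrix (Fin n) (Fin n) ℝ) i j + ρ ^ 2 * (1 / 3 * curvForm (h l) x (e i) (e j))
        + ρ ^ 3 * (1 / 4 * covForm (h l) x (e i) (e j)))) =O[𝓝[>] 0] fun ρ : ℝ => ρ ^ 4 := by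
  refine (isBigO_bilin_apply (F.isBigO_sphereForm hl x) (e i) (e j)).congr_left fun ρ => ?_
  simp [Finset.sum_range_succ, formCoeff, innerForm_apply, A.orthonormal, Matrix.one_apply]

/-- The derivative of the second fundamental form at the zero jet, in the direction `j`. -/
noncomputable def shapeDeriv (T : Λ × Euc (n + 1) → Euc (n + 1) →L[ℝ] Euc (n + 1)) (l : Λ)
    (x : Euc (n + 1)) (j : ℝ × EuclideanSpace ℝ (Fin (n + 1)) × Bilin n) (ρ : ℝ) : Bilin n :=
  fderiv ℝ (fun j => sphereForm T (ρ, l, x, j)) 0 (j.1, j.2.1)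
    + j.2.2.comp (sphereFrame T (ρ, l, x, (0 : ℝ × Euc (n + 1))))

theorem NormalFamily.isBigO_shapeDeriv (F : NormalFamily h T 𝒱 K R) (hl : l ∈ K)
    (j : ℝ × EuclideanSpace ℝ (Fin (n + 1)) × Bilin n) (u v : Euc (n + 1)) :
    (fun ρ : ℝ => shapeDeriv T l x j ρ u v - (j.1 * inner ℝ u v + j.2.2 u v
      + ρ ^ 2 * (-(1 / 3) * j.1 * curvForm (h l) x u v - gradForm (h l) x j.2.1 u v
        - 1 / 3 * j.2.2 (curv (h l) 0 x u x) v))) =O[𝓝[>] 0] fun ρ : ℝ => ρ ^ 3 := by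
  have h1 := isBigO_bilin_apply (F.isBigO_fderiv_sphereForm hl x (j.1, j.2.1)) u v
  have h2 := ((F.normal l hl).isBigO_inverse_ray x u).mono
    (nhdsWithin_le_nhds (s := Ioi (0 : ℝ)))
  have h3 : (fun ρ : ℝ => j.2.2 (sphereFrame T (ρ, l, x, (0 : ℝ × Euc (n + 1))) u
      - u + (ρ ^ 2 / 3) • curv (h l) 0 x u x) v) =O[𝓝[>] 0] fun ρ : ℝ => ρ ^ 3 := by
    simp only [sphereFrame_zero]
    refine Asymptotics.IsBigO.trans (Asymptotics.IsBigO.of_bound (‖j.2.2‖ * ‖v‖)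
      (Eventually.of_forall fun t => ?_)) h2
    exact (j.2.2.le_opNorm₂ _ v).trans (le_of_eq (by ring))
  refine (h1.add h3).congr_left fun ρ => ?_
  simp [shapeDeriv, Finset.sum_range_succ, formLinCoeff, innerForm_apply]
  ring

theorem NormalFamily.hasDerivAt_shapeForm (F : NormalFamily h T 𝒱 K R) {ρ : ℝ}
    (hp : (ρ, l, x, (0 : ℝ × Euc (n + 1))) ∈ shapeDomain T 𝒱 R)
    (j : ℝ × EuclideanSpace ℝ (Fin (n + 1)) × Bilin n) (u v : Euc (n + 1)) :
    HasDerivAt (fun s : ℝ => shapeForm T (ρ, l, x, s • j) u v) (shapeDeriv T l x j ρ u v) 0 := by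
  have hop := isOpen_shapeDomain F.isOpen F.smooth
  have hd : HasFDerivAt (fun j => sphereForm T (ρ, l, x, j))
      (fderiv ℝ (fun j => sphereForm T (ρ, l, x, j)) 0) ((0 : ℝ) • (j.1, j.2.1)) := by
    rw [zero_smul]
    refine DifferentiableAt.hasFDerivAt ?_
    have h1 : DifferentiableAt ℝ (sphereForm T)
        ((fun j : ℝ × Euc (n + 1) => (ρ, l, x, j)) 0) :=
      (((contDiffOn_sphereForm F.isOpen F.smooth).contDiffAt (hop.mem_nhds hp)).differentiableAt
        (by simp))
    have h2 : DifferentiableAt ℝ (sphereForm T ∘ fun j : ℝ × Euc (n + 1) => (ρ, l, x, j)) 0 :=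
      h1.comp (0 : ℝ × Euc (n + 1)) (by fun_prop)
    exact h2
  have h2 : HasDerivAt (fun t : ℝ => t • ((j.1, j.2.1) : ℝ × Euc (n + 1))) (j.1, j.2.1) 0 := by
    simpa using (hasDerivAt_id (0 : ℝ)).smul_const ((j.1, j.2.1) : ℝ × Euc (n + 1))
  have h3 := hd.comp_hasDerivAt (0 : ℝ) h2
  have h4 := (((ContinuousLinearMap.apply ℝ ℝ v).comp (ContinuousLinearMap.apply ℝ
    (Euc (n + 1) →L[ℝ] ℝ) u)).hasFDerivAt.comp_hasDerivAt (0 : ℝ) h3)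
  have h5 : ContinuousAt (fun s : ℝ => j.2.2 (sphereFrame T (ρ, l, x, (s * j.1, s • j.2.1)) u) v)
      0 := by
    have hc : Continuous fun s : ℝ => (ρ, l, x, (s * j.1, s • j.2.1)) := by fun_prop
    have h6 : ContinuousAt (sphereFrame T) ((fun s : ℝ => (ρ, l, x, (s * j.1, s • j.2.1))) 0) := by
      refine (contDiffOn_sphereFrame F.smooth).continuousOn.continuousAt (hop.mem_nhds ?_)
      simp only [zero_mul, zero_smul]
      exact hp
    have h7 := ContinuousAt.comp (f := fun s : ℝ => (ρ, l, x, (s * j.1, s • j.2.1))) h6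
      hc.continuousAt
    exact ((continuousAt_const (y := j.2.2)).clm_apply (h7.clm_apply continuousAt_const)).clm_apply
      continuousAt_const
  have h8 := HasDerivAt.fun_add h4 (hasDerivAt_mul_continuousAt h5)
  refine (h8.congr_deriv ?_).congr_of_eventuallyEq (Eventually.of_forall fun s => ?_)
  · simp [shapeDeriv]
    rfl
  · simp [shapeForm]

theorem NormalFamily.isBigO_curvFun (F : NormalFamily h T 𝒱 K R) (hl : l ∈ K) (hx : ‖x‖ = 1)
    {k : ℕ} (hk : 1 ≤ k) (hkn : k ≤ n) :
    (fun ρ : ℝ => curvFun k T (ρ, l, x, (0 : ℝ × EuclideanSpace ℝ (Fin (n + 1)) × Bilin n))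
      - ∑ i ∈ Finset.range 4, ρ ^ i • curvCoeff k (h l) i x) =O[𝓝[>] 0] fun ρ : ℝ => ρ ^ 4 := by
  -- The asymptotics are needed only at each fixed point, so a frame chosen pointwise, with no
  -- smoothness in `x`, is enough.
  obtain ⟨e, A⟩ := exists_adaptedFrame hx
  have N := F.normal l hl
  let α : ℝ → Matrix (Fin n) (Fin n) ℝ := fun ρ => Matrix.of fun i j =>
    sphereForm T (ρ, l, x, (0 : ℝ × Euc (n + 1))) (e i) (e j) - (1 : Matrix (Fin n) (Fin n) ℝ) i j
  have h1 := fun i j => F.isBigO_shape_zero hl A i j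
  have hα : ∀ i j, (fun ρ => α ρ i j) =O[𝓝[>] 0] fun ρ : ℝ => ρ ^ 2 := fun i j => by
    have h2 := (((h1 i j).trans (isBigO_pow_of_le (b := 2) (by norm_num))).add
      ((isBigO_pow_of_le (b := 2) le_rfl).const_mul_left (1 / 3 * curvForm (h l) x (e i) (e j)))).add
      ((isBigO_pow_of_le (a := 3) (b := 2) (by norm_num)).const_mul_left
        (1 / 4 * covForm (h l) x (e i) (e j)))
    refine h2.congr_left fun ρ => ?_
    simp only [α, Matrix.of_apply]
    ring
  have h3 := isBigO_matEsymm_one_add hα hk (by simpa using hkn)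
  have h4 := (Asymptotics.IsBigO.fun_sum (s := Finset.univ)
    (A := fun i ρ => sphereForm T (ρ, l, x, (0 : ℝ × Euc (n + 1))) (e i) (e i)
      - ((1 : Matrix (Fin n) (Fin n) ℝ) i i + ρ ^ 2 * (1 / 3 * curvForm (h l) x (e i) (e i))
        + ρ ^ 3 * (1 / 4 * covForm (h l) x (e i) (e i)))) fun i _ => h1 i i).const_mul_left
    ((n - 1).choose (k - 1) : ℝ)
  refine (h3.add h4).congr_left fun ρ => ?_
  have h5 : curvFun k T (ρ, l, x, (0 : ℝ × EuclideanSpace ℝ (Fin (n + 1)) × Bilin n))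
      = matEsymm k (1 + α ρ) := by
    rw [curvFun, A.matEsymm_tangForm]
    congr 1
    ext i j
    simp [α, shapeForm_zero]
  have h6 : (α ρ).trace = ∑ i, (sphereForm T (ρ, l, x, (0 : ℝ × Euc (n + 1))) (e i) (e i)
      - (1 : Matrix (Fin n) (Fin n) ℝ) i i) := rfl
  rw [h5, h6]
  simp only [Finset.sum_sub_distrib, Finset.sum_add_distrib, ← Finset.mul_sum, A.sum_curvForm N,
    A.sum_covForm N, Finset.sum_range_succ, curvCoeff, Fintype.card_fin]
  simp
  ring

theorem NormalFamily.isBigO_fderiv_curvFun (F : NormalFamily h T 𝒱 K R) (hl : l ∈ K)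
    (hx : ‖x‖ = 1) {k : ℕ} (hk : 1 ≤ k) (hkn : k ≤ n)
    (J : ℝ × EuclideanSpace ℝ (Fin (n + 1)) × Bilin n) :
    (fun ρ : ℝ => fderiv ℝ (fun j => curvFun k T (ρ, l, x, j)) 0 J
      - ∑ i ∈ Finset.range 3, ρ ^ i • curvLinCoeff k (h l) i x J) =O[𝓝[>] 0]
      fun ρ : ℝ => ρ ^ 3 := by
  obtain ⟨e, A⟩ := exists_adaptedFrame hx
  have N := F.normal l hl
  have hop := isOpen_shapeDomain F.isOpen F.smooth
  let S : Fin n → Fin n → ℝ := fun i j => 1 / 3 * curvForm (h l) x (e i) (e j)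
  let b : Fin n → Fin n → ℝ := fun i j => J.1 * (if i = j then 1 else 0) + J.2.2 (e i) (e j)
  let b' : Fin n → Fin n → ℝ := fun i j => -(1 / 3) * J.1 * curvForm (h l) x (e i) (e j)
    - gradForm (h l) x J.2.1 (e i) (e j) - 1 / 3 * J.2.2 (curv (h l) 0 x (e i) x) (e j)
  let M : ℝ → ℝ → Matrix (Fin n) (Fin n) ℝ := fun ρ s => Matrix.of fun i j =>
    shapeForm T (ρ, l, x, s • J) (e i) (e j) - (1 : Matrix (Fin n) (Fin n) ℝ) i j
  let β : ℝ → Matrix (Fin n) (Fin n) ℝ := fun ρ => Matrix.of fun i j =>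
    shapeDeriv T l x J ρ (e i) (e j)
  have hdom := (F.eventually_mem_shapeDomain hl x).filter_mono
    (nhdsWithin_le_nhds (s := Ioi (0 : ℝ)))
  have hM : ∀ᶠ ρ in 𝓝[>] 0, ∀ i j, HasDerivAt (fun s => M ρ s i j) (β ρ i j) 0 := by
    filter_upwards [hdom] with ρ hρ i j
    exact (F.hasDerivAt_shapeForm hρ J (e i) (e j)).sub_const _
  have hα : ∀ i j, (fun ρ => M ρ 0 i j - ρ ^ 2 * S i j) =O[𝓝[>] 0] fun ρ : ℝ => ρ ^ 3 := by
    intro i j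
    refine (((F.isBigO_shape_zero hl A i j).trans (isBigO_pow_of_le (b := 3) (by norm_num))).add
      ((isBigO_pow_of_le (a := 3) le_rfl).const_mul_left
        (1 / 4 * covForm (h l) x (e i) (e j)))).congr_left fun ρ => ?_
    simp only [M, S, zero_smul, shapeForm_zero, Matrix.of_apply]
    ring
  have hβ : ∀ i j, (fun ρ => β ρ i j - (b i j + ρ ^ 2 * b' i j)) =O[𝓝[>] 0]
      fun ρ : ℝ => ρ ^ 3 := by
    intro i j
    refine (F.isBigO_shapeDeriv (x := x) hl J (e i) (e j)).congr_left fun ρ => ?_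
    simp only [β, b, b', Matrix.of_apply, A.orthonormal]
  have hα' : ∀ i j, (fun ρ => M ρ 0 i j) =O[𝓝[>] 0] fun ρ : ℝ => ρ ^ 2 := fun i j =>
    (((hα i j).trans (isBigO_pow_of_le (b := 2) (by norm_num))).add
      ((isBigO_pow_of_le (a := 2) le_rfl).const_mul_left (S i j))).congr_left fun ρ => by ring
  have hβ' : ∀ i j, (fun ρ => β ρ i j) =O[𝓝[>] 0] fun _ : ℝ => (1 : ℝ) := fun i j => by
    have h1 : (fun ρ : ℝ => b i j + ρ ^ 2 * b' i j) =O[𝓝[>] 0] fun _ : ℝ => (1 : ℝ) :=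
      ((Continuous.tendsto (by fun_prop) 0).isBigO_one ℝ).mono nhdsWithin_le_nhds
    have h2 := (isBigO_pow_of_le (Nat.zero_le 3))
    simp only [pow_zero] at h2
    exact (((hβ i j).trans h2).add h1).congr_left fun ρ => by ring
  have h1 := (isBigO_deriv_matEsymm_one_add hM hα' hβ' hk (by simpa using hkn)).trans
    (isBigO_pow_of_le (b := 3) (by norm_num))
  have hprod : ∀ i j i' j', (fun ρ => M ρ 0 i j * β ρ i' j' - ρ ^ 2 * (S i j * b i' j'))
      =O[𝓝[>] 0] fun ρ : ℝ => ρ ^ 3 := fun i j i' j' => isBigO_mul_expand (hα i j) (hβ i' j')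
  have h2 := Asymptotics.IsBigO.fun_sum (s := Finset.univ)
    (A := fun i ρ => β ρ i i - (b i i + ρ ^ 2 * b' i i)) fun i _ => hβ i i
  have h3 := Asymptotics.IsBigO.fun_sum (s := Finset.univ)
    (A := fun i ρ => ∑ j, (M ρ 0 i i * β ρ j j - ρ ^ 2 * (S i i * b j j))) fun i _ =>
      Asymptotics.IsBigO.fun_sum (s := Finset.univ)
        (A := fun j ρ => M ρ 0 i i * β ρ j j - ρ ^ 2 * (S i i * b j j)) fun j _ => hprod i i j j
  have h4 := Asymptotics.IsBigO.fun_sum (s := Finset.univ)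
    (A := fun i ρ => ∑ j, (M ρ 0 i j * β ρ j i - ρ ^ 2 * (S i j * b j i))) fun i _ =>
      Asymptotics.IsBigO.fun_sum (s := Finset.univ)
        (A := fun j ρ => M ρ 0 i j * β ρ j i - ρ ^ 2 * (S i j * b j i)) fun j _ => hprod i j j i
  have h5 := (h1.add (h2.const_mul_left ((n - 1).choose (k - 1) : ℝ))).add
    ((h3.sub h4).const_mul_left (if 2 ≤ k then ((n - 2).choose (k - 2) : ℝ) else 0))
  refine h5.congr' ?_ EventuallyEq.rfl
  filter_upwards [hdom] with ρ hρ
  -- the derivative along a line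
  have e1 : fderiv ℝ (fun j => curvFun k T (ρ, l, x, j)) 0 J
      = deriv (fun s => matEsymm k (1 + M ρ s)) 0 := by
    have hd : HasFDerivAt (fun j => curvFun k T (ρ, l, x, j))
        (fderiv ℝ (fun j => curvFun k T (ρ, l, x, j)) 0) ((0 : ℝ) • J) := by
      rw [zero_smul]
      refine DifferentiableAt.hasFDerivAt ?_
      have hopen : IsOpen (jetDomain T 𝒱 R) := hop.preimage (by fun_prop)
      have h1 : DifferentiableAt ℝ (curvFun k T)
          ((fun j : ℝ × EuclideanSpace ℝ (Fin (n + 1)) × Bilin n => (ρ, l, x, j)) 0) :=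
        (((contDiffOn_curvFun k F.isOpen F.smooth).contDiffAt (hopen.mem_nhds hρ)).differentiableAt
          (by simp))
      have h2 : DifferentiableAt ℝ (curvFun k T ∘
          fun j : ℝ × EuclideanSpace ℝ (Fin (n + 1)) × Bilin n => (ρ, l, x, j)) 0 :=
        h1.comp (0 : ℝ × EuclideanSpace ℝ (Fin (n + 1)) × Bilin n) (by fun_prop)
      exact h2
    have hs : HasDerivAt (fun t : ℝ => t • J) J 0 := by
      simpa using (hasDerivAt_id (0 : ℝ)).smul_const J
    rw [← (hd.comp_hasDerivAt (0 : ℝ) hs).deriv]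
    congr 1
    ext s
    rw [Function.comp_apply, curvFun, A.matEsymm_tangForm]
    congr 1
    ext i j
    simp [M]
  -- the traces
  have t1 : ∑ i, b i i = perpTrace x J.2.2 + n * J.1 := by
    simp only [b, Finset.sum_add_distrib, A.sum_bilin, perpTrace]
    simp
    ring
  have t2 : ∑ i, b' i i = 1 / 3 * (ricci (h l) 0 x x * J.1 - 2 * ricci (h l) 0 J.2.1 x
      - curvTrace (h l) x J.2.2) := by
    simp only [b', Finset.sum_sub_distrib, ← Finset.mul_sum, A.sum_curvForm N, A.sum_gradForm N,
      A.sum_curvTrace N]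
    ring
  have t3 : ∑ i, S i i = -(1 / 3) * ricci (h l) 0 x x := by
    simp only [S, ← Finset.mul_sum, A.sum_curvForm N]
    ring
  -- In the trace of the product, the multiple of the identity picks out the trace of the curvature
  -- form, which is minus Ricci, and the Hessian is contracted with the curvature.
  have t4 : ∑ i, ∑ j, S i j * b j i
      = 1 / 3 * (-ricci (h l) 0 x x * J.1 + curvTrace (h l) x J.2.2) := by
    rw [← A.sum_curvTrace N, ← A.sum_curvForm N, Finset.sum_mul, ← Finset.sum_add_distrib,
      Finset.mul_sum]
    refine Finset.sum_congr rfl fun i _ => ?_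
    rw [A.curv_expand N (e i)]
    simp only [map_sum, map_smul, _root_.sum_apply, _root_.smul_apply, smul_eq_mul, S, b, mul_add,
      Finset.sum_add_distrib]
    congr 1
    · simp
      ring
    · rw [Finset.mul_sum]
      exact Finset.sum_congr rfl fun j _ => by ring
  have m1 : (M ρ 0).trace * (β ρ).trace = ∑ i, ∑ j, M ρ 0 i i * β ρ j j := by
    rw [Matrix.trace, Matrix.trace, Finset.sum_mul_sum]
    rfl
  have m2 : (M ρ 0 * β ρ).trace = ∑ i, ∑ j, M ρ 0 i j * β ρ j i := rfl
  have m3 : (β ρ).trace = ∑ i, β ρ i i := rfl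
  rw [e1, m1, m2, m3]
  simp only [Finset.sum_sub_distrib, Finset.sum_add_distrib, ← Finset.mul_sum, t1, t2, t4,
    ← Finset.sum_mul, t3, Finset.sum_range_succ, curvLinCoeff, Fintype.card_fin]
  generalize (if 2 ≤ k then ((n - 2).choose (k - 2) : ℝ) else 0) = c
  simp
  ring

/-- The expansion of the `k`-curvature of perturbed spheres. -/
theorem NormalFamily.exists_curv_expansion (F : NormalFamily h T 𝒱 K R) {k : ℕ} (hk : 1 ≤ k)
    (hkn : k ≤ n) :
    ∃ ρ₀ > 0, ∃ δ > 0, ∃ C : ℕ → ℝ, ∀ l ∈ K, ∀ ρ, 0 < ρ → ρ < ρ₀ →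
      ∃ (O : Euc (n + 1) → ℝ)
        (L : Euc (n + 1) → (ℝ × EuclideanSpace ℝ (Fin (n + 1)) × Bilin n) →L[ℝ] ℝ)
        (Q : Euc (n + 1) × (ℝ × EuclideanSpace ℝ (Fin (n + 1)) × Bilin n) → ℝ),
        SmoothOnSphere C O ∧ SmoothOnSphere C L ∧ QuadraticOp C δ Q ∧
        ∀ x j, ‖x‖ = 1 → ‖j‖ < δ →
          curvFun k T (ρ, l, x, j) = ∑ i ∈ Finset.range 4, ρ ^ i • curvCoeff k (h l) i x
            + ρ ^ 4 • O x + ∑ i ∈ Finset.range 3, ρ ^ i • curvLinCoeff k (h l) i x j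
            + ρ ^ 3 • L x j + Q (x, j) :=
  exists_expansion F.isCompact (𝒰 := jetDomain T 𝒱 R)
    ((isOpen_shapeDomain F.isOpen F.smooth).preimage (by fun_prop))
    (fun l hl x _ => F.zero_mem_shapeDomain hl x) (contDiffOn_curvFun k F.isOpen F.smooth) 4 3
    (fun l hl x hx => F.isBigO_curvFun hl hx hk hkn)
    (fun l hl x hx j => F.isBigO_fderiv_curvFun hl hx hk hkn j)

end CurvatureExpansion

/-! ### The expansions in a family of metrics in normal coordinates -/

section Splits

-- Writing `G⁻¹ = B* B`, the matrix `B* (B b)` has the same characteristic polynomial as the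
-- Hermitian matrix `B b B*`. Hence all principal curvatures are real and the multiset of real roots
-- contains all `n` of them.
open scoped MatrixOrder Matrix.Norms.L2Operator in
theorem splits_charpoly_inv_mul {n : ℕ} {G b : Matrix (Fin n) (Fin n) ℝ} (hG : G.PosDef)
    (hb : b.IsHermitian) : (G⁻¹ * b).charpoly.Splits := by
  obtain ⟨B, hB⟩ := CStarAlgebra.nonneg_iff_eq_star_mul_self.1 hG.inv.posSemidef.nonneg
  rw [hB, Matrix.mul_assoc, Matrix.charpoly_mul_comm]
  exact (Matrix.isHermitian_mul_mul_conjTranspose B hb).splits_charpoly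

end Splits

/-! ### The shape operator of a perturbed sphere as a value of the jet functions -/

section Pointwise

variable {Λ : Type} [NormedAddCommGroup Λ] [NormedSpace ℝ Λ] {n : ℕ}
  {T : Λ × Euc (n + 1) → Euc (n + 1) →L[ℝ] Euc (n + 1)} {𝒱 K : Set Λ} {R : ℝ}
  {h : Λ → Euc (n + 1) → Euc (n + 1) → Euc (n + 1) → ℝ} {l : Λ} {ρ : ℝ}
  {w : Metric.sphere (0 : EuclideanSpace ℝ (Fin (n + 1))) 1 → ℝ}
  {Θ : EuclideanSpace ℝ (Fin n) → Metric.sphere (0 : EuclideanSpace ℝ (Fin (n + 1))) 1}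
  {z : EuclideanSpace ℝ (Fin n)}

theorem NormalFamily.shape_perturbedSphere (F : NormalFamily h T 𝒱 K R) (hl : l ∈ K) (hρ : 0 < ρ)
    (hρR : 2 * ρ ≤ R) (hw : ContMDiff (𝓡 n) 𝓘(ℝ, ℝ) 2 w) (hP : IsNormalParam Θ z)
    (hj : ‖jet1 w Θ z‖ < 1 / 2) :
    (shapeMatrix (h l) (perturbedSphere ρ w Θ) (amb Θ) z).charpoly.Splits ∧
    ∀ i j, ρ * shapeMatrix (h l) (perturbedSphere ρ w Θ) (amb Θ) z i j
      = shapeForm T (ρ, l, amb Θ z, jet2 w Θ z) (tang Θ z i) (tang Θ z j) := by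
  -- The bound keeps `1 - w` positive and the radius `ρ (1 - w)` below `3 ρ / 2`, hence inside the
  -- ball of radius `R ≥ 2 ρ`.
  have h1 : |w (Θ z)| < 1 / 2 := (norm_fst_le (jet1 w Θ z)).trans_lt hj
  rw [abs_lt] at h1
  have hy : (ρ * (1 - w (Θ z))) • amb Θ z ∈ Metric.ball (0 : Euc (n + 1)) R := by
    rw [mem_ball_zero_iff, norm_smul, norm_amb, mul_one, Real.norm_of_nonneg
      (mul_nonneg hρ.le (by linarith))]
    nlinarith
  obtain ⟨hG, hb, H⟩ := (F.normal l hl).shapeMatrix_perturbedSphere hρ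
    (contDiffAt_comp_sphere hw hP.smooth) hP (by linarith) hy
  refine ⟨splits_charpoly_inv_mul hG hb, fun i j => ?_⟩
  rw [H i j, shapeForm, _root_.add_apply, _root_.add_apply, sphereForm_apply]
  rfl

theorem NormalFamily.kCurvature_perturbedSphere (F : NormalFamily h T 𝒱 K R) (hl : l ∈ K)
    (hρ : 0 < ρ) (hρR : 2 * ρ ≤ R) (hw : ContMDiff (𝓡 n) 𝓘(ℝ, ℝ) 2 w) (hP : IsNormalParam Θ z)
    (hj : ‖jet1 w Θ z‖ < 1 / 2) {k : ℕ} (hk : k ≤ n) :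
    ρ ^ k * kCurvature k (shapeMatrix (h l) (perturbedSphere ρ w Θ) (amb Θ) z)
      = curvFun k T (ρ, l, amb Θ z, jet2 w Θ z) := by
  obtain ⟨hs, H⟩ := F.shape_perturbedSphere hl hρ hρR hw hP hj
  rw [kCurvature, matEsymm_of_splits (by simpa using hk) hs, ← matEsymm_smul, curvFun,
    hP.frame.matEsymm_tangForm]
  congr 1
  ext i j
  exact H i j

theorem jet2_apply (u v : Euc (n + 1)) : (jet2 w Θ z).2.2 u v
    = ∑ k, ∑ l, d2 w Θ z k l * (inner ℝ (tang Θ z k) u * inner ℝ (tang Θ z l) v) := by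
  simp [jet2]

theorem jet2_apply_tang (hP : IsNormalParam Θ z) (u : Euc (n + 1)) (j : Fin n) :
    (jet2 w Θ z).2.2 u (tang Θ z j) = ∑ k, inner ℝ (tang Θ z k) u * d2 w Θ z k j := by
  rw [jet2_apply]
  refine Finset.sum_congr rfl fun k _ => ?_
  rw [Finset.sum_eq_single j]
  · rw [hP.orthonormal, if_pos rfl]; ring
  · intro l _ hl
    rw [hP.orthonormal, if_neg hl]; ring
  · simp

theorem jet2_tang_tang (hP : IsNormalParam Θ z) (i j : Fin n) :
    (jet2 w Θ z).2.2 (tang Θ z i) (tang Θ z j) = d2 w Θ z i j := by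
  rw [jet2_apply_tang hP, Finset.sum_eq_single i]
  · rw [hP.orthonormal, if_pos rfl]; ring
  · intro l _ hl
    rw [hP.orthonormal, if_neg hl]; ring
  · simp

end Pointwise

/-! ### The two expansions as properties of a metric in normal coordinates -/

section Expansions

variable {n : ℕ}

/-- The expansion of the shape operator, for the metric `h` in normal coordinates. -/
def ShapeExpansion (m : ℕ)
    (h : EuclideanSpace ℝ (Fin (n + 1)) → EuclideanSpace ℝ (Fin (n + 1)) →
      EuclideanSpace ℝ (Fin (n + 1)) → ℝ) (ρ δ : ℝ) (C : ℕ → ℝ) : Prop :=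
  ∃ (O : EuclideanSpace ℝ (Fin (n + 1)) → Bilin n)
    (L : EuclideanSpace ℝ (Fin (n + 1)) →
      (ℝ × EuclideanSpace ℝ (Fin (n + 1)) × Bilin n) →L[ℝ] Bilin n)
    (Q : EuclideanSpace ℝ (Fin (n + 1)) × (ℝ × EuclideanSpace ℝ (Fin (n + 1))) → Bilin n)
    (L₂ L₂' : Fin m → EuclideanSpace ℝ (Fin (n + 1)) →
      (ℝ × EuclideanSpace ℝ (Fin (n + 1)) × Bilin n) →L[ℝ] Bilin n)
    (L₀ : Fin m → EuclideanSpace ℝ (Fin (n + 1)) → ℝ →L[ℝ] ℝ)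
    (Q₁ : Fin m → EuclideanSpace ℝ (Fin (n + 1)) × (ℝ × EuclideanSpace ℝ (Fin (n + 1))) → ℝ),
  SmoothOnSphere C O ∧ SmoothOnSphere C L ∧ QuadraticOp C δ Q ∧
  (∀ a, SmoothOnSphere C (L₂ a) ∧ SmoothOnSphere C (L₂' a) ∧
    SmoothOnSphere C (L₀ a) ∧ QuadraticOp C δ (Q₁ a)) ∧
  ∀ (w : Metric.sphere (0 : EuclideanSpace ℝ (Fin (n + 1))) 1 → ℝ),
    ContMDiff (𝓡 n) 𝓘(ℝ, ℝ) 2 w →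
  ∀ (Θ : EuclideanSpace ℝ (Fin n) → Metric.sphere (0 : EuclideanSpace ℝ (Fin (n + 1))) 1)
    (z : EuclideanSpace ℝ (Fin n)), IsNormalParam Θ z →
    ‖jet1 w Θ z‖ < δ →
  ∀ i j : Fin n,
    ρ * shapeMatrix h (perturbedSphere ρ w Θ) (amb Θ) z i j =
      (1 + w (Θ z)) * (if i = j then 1 else 0) + d2 w Θ z i j
      + 1 / 3 * h 0 (curv h 0 (amb Θ z) (tang Θ z i) (amb Θ z)) (tang Θ z j) * ρ ^ 2
      - 1 / 3 * (h 0 (curv h 0 (amb Θ z) (tang Θ z i) (amb Θ z)) (tang Θ z j) * w (Θ z)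
          + ∑ k, h 0 (curv h 0 (amb Θ z) (tang Θ z i) (amb Θ z)) (tang Θ z k) * d2 w Θ z k j
          - ∑ k, (h 0 (curv h 0 (tang Θ z k) (tang Θ z i) (amb Θ z)) (tang Θ z j)
              + h 0 (curv h 0 (amb Θ z) (tang Θ z i) (tang Θ z k)) (tang Θ z j))
            * d1 w Θ z k) * ρ ^ 2
      + 1 / 4 * h 0 (covCurv h 0 (amb Θ z) (amb Θ z) (tang Θ z i) (amb Θ z)) (tang Θ z j)
          * ρ ^ 3
      + ρ ^ 4 * O (amb Θ z) (tang Θ z i) (tang Θ z j)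
      + ρ ^ 3 * L (amb Θ z) (jet2 w Θ z) (tang Θ z i) (tang Θ z j)
      + Q (amb Θ z, jet1 w Θ z) (tang Θ z i) (tang Θ z j)
      + ∑ a, L₂ a (amb Θ z) (jet2 w Θ z) (tang Θ z i) (tang Θ z j) * L₀ a (amb Θ z) (w (Θ z))
      + ∑ a, L₂' a (amb Θ z) (jet2 w Θ z) (tang Θ z i) (tang Θ z j) * Q₁ a (amb Θ z, jet1 w Θ z)

/-- The expansion of the `k`-curvature, for the metric `h` in normal coordinates. -/
def CurvExpansion (k : ℕ)
    (h : EuclideanSpace ℝ (Fin (n + 1)) → EuclideanSpace ℝ (Fin (n + 1)) →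
      EuclideanSpace ℝ (Fin (n + 1)) → ℝ) (ρ δ : ℝ) (C : ℕ → ℝ) : Prop :=
  ∃ (O : EuclideanSpace ℝ (Fin (n + 1)) → ℝ)
    (L : EuclideanSpace ℝ (Fin (n + 1)) →
      (ℝ × EuclideanSpace ℝ (Fin (n + 1)) × Bilin n) →L[ℝ] ℝ)
    (Q : EuclideanSpace ℝ (Fin (n + 1)) × (ℝ × EuclideanSpace ℝ (Fin (n + 1)) × Bilin n) → ℝ),
  SmoothOnSphere C O ∧ SmoothOnSphere C L ∧ QuadraticOp C δ Q ∧
  ∀ (w : Metric.sphere (0 : EuclideanSpace ℝ (Fin (n + 1))) 1 → ℝ),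
    ContMDiff (𝓡 n) 𝓘(ℝ, ℝ) 2 w →
  ∀ (Θ : EuclideanSpace ℝ (Fin n) → Metric.sphere (0 : EuclideanSpace ℝ (Fin (n + 1))) 1)
    (z : EuclideanSpace ℝ (Fin n)), IsNormalParam Θ z →
    ‖jet2 w Θ z‖ < δ →
  ρ ^ k * kCurvature k (shapeMatrix h (perturbedSphere ρ w Θ) (amb Θ) z) =
    (n.choose k : ℝ)
    + ((n - 1).choose (k - 1) : ℝ) *
      ((∑ i, d2 w Θ z i i) + n * w (Θ z) - 1 / 3 * ricci h 0 (amb Θ z) (amb Θ z) * ρ ^ 2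
        - 1 / 4 * covRicci h 0 (amb Θ z) (amb Θ z) (amb Θ z) * ρ ^ 3
        + 1 / 3 * (ricci h 0 (amb Θ z) (amb Θ z) * w (Θ z)
            - 2 * ricci h 0 (sphGrad w Θ z) (amb Θ z)
            - ∑ i, ∑ j, h 0 (curv h 0 (amb Θ z) (tang Θ z i) (amb Θ z)) (tang Θ z j)
                * d2 w Θ z i j) * ρ ^ 2)
    - (if 2 ≤ k then ((n - 2).choose (k - 2) : ℝ) else 0) *
        (1 / 3 * (ricci h 0 (amb Θ z) (amb Θ z)
          * ((∑ i, d2 w Θ z i i) + (n - 1) * w (Θ z))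
          + ∑ i, ∑ j, h 0 (curv h 0 (amb Θ z) (tang Θ z i) (amb Θ z)) (tang Θ z j)
              * d2 w Θ z i j) * ρ ^ 2)
    + ρ ^ 4 * O (amb Θ z)
    + ρ ^ 3 * L (amb Θ z) (jet2 w Θ z)
    + Q (amb Θ z, jet2 w Θ z)

variable {m k : ℕ} {h : Euc (n + 1) → Euc (n + 1) → Euc (n + 1) → ℝ} {ρ δ δ' : ℝ} {C C' : ℕ → ℝ}

theorem ShapeExpansion.mono (H : ShapeExpansion m h ρ δ C) (hδ : δ' ≤ δ) (hC : ∀ r, C r ≤ C' r) :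
    ShapeExpansion m h ρ δ' C' := by
  obtain ⟨O, L, Q, L₂, L₂', L₀, Q₁, hO, hL, hQ, hall, H⟩ := H
  exact ⟨O, L, Q, L₂, L₂', L₀, Q₁, hO.mono hC, hL.mono hC, hQ.mono hC hδ,
    fun a => ⟨(hall a).1.mono hC, (hall a).2.1.mono hC, (hall a).2.2.1.mono hC,
      (hall a).2.2.2.mono hC hδ⟩, fun w hw Θ z hP hj => H w hw Θ z hP (hj.trans_le hδ)⟩

theorem CurvExpansion.mono (H : CurvExpansion k h ρ δ C) (hδ : δ' ≤ δ) (hC : ∀ r, C r ≤ C' r) :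
    CurvExpansion k h ρ δ' C' := by
  obtain ⟨O, L, Q, hO, hL, hQ, H⟩ := H
  exact ⟨O, L, Q, hO.mono hC, hL.mono hC, hQ.mono hC hδ,
    fun w hw Θ z hP hj => H w hw Θ z hP (hj.trans_le hδ)⟩

end Expansions

/-! ### The two expansions for a normal family -/

section Family

variable {Λ : Type} [NormedAddCommGroup Λ] [NormedSpace ℝ Λ] {n : ℕ}
  {T : Λ × Euc (n + 1) → Euc (n + 1) →L[ℝ] Euc (n + 1)} {𝒱 K : Set Λ} {R : ℝ}
  {h : Λ → Euc (n + 1) → Euc (n + 1) → Euc (n + 1) → ℝ}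

theorem NormalMetricOn.apply_zero {h : Euc (n + 1) → Euc (n + 1) → Euc (n + 1) → ℝ}
    {T : Euc (n + 1) → Euc (n + 1) →L[ℝ] Euc (n + 1)} (N : NormalMetricOn h T R)
    (u v : Euc (n + 1)) : h 0 u v = inner ℝ u v := by
  rw [N.eq 0 N.zero_mem, N.zero_eq]
  rfl

theorem NormalFamily.exists_shapeExpansion (F : NormalFamily h T 𝒱 K R) (hR : 0 < R) :
    ∃ ρ₀ > 0, ∃ δ > 0, ∃ C : ℕ → ℝ, ∀ l ∈ K, ∀ ρ, 0 < ρ → ρ < ρ₀ →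
      ShapeExpansion ((n + 1) * (n + 1)) (h l) ρ δ C := by
  obtain ⟨ρ₀, hρ₀, δ, hδ, C, H⟩ := F.exists_shape_expansion
  refine ⟨min ρ₀ (R / 2), lt_min hρ₀ (by linarith), min δ (1 / 2), lt_min hδ (by norm_num), C,
    fun l hl ρ h0 h1 => ?_⟩
  obtain ⟨O, L, Q, L₂, L₀, Q₁, hO, hL, hQ, hall, E⟩ := H l hl ρ h0 (h1.trans_le (min_le_left _ _))
  have hρR : 2 * ρ ≤ R := by linarith [h1.trans_le (min_le_right _ _)]
  have N := F.normal l hl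
  -- The products are indexed by pairs of standard basis vectors, one for each entry of the frame
  -- operator; this fixes the number of summands.
  let σ : Fin ((n + 1) * (n + 1)) ≃ Fin (n + 1) × Fin (n + 1) := finProdFinEquiv.symm
  refine ⟨O, L, Q, fun a => L₂ (σ a), fun a => L₂ (σ a), fun a => L₀ (σ a), fun a => Q₁ (σ a),
    hO, hL, hQ.mono (fun _ => le_rfl) (min_le_left _ _), fun a => ⟨(hall _).1, (hall _).1,
      (hall _).2.1, (hall _).2.2.mono (fun _ => le_rfl) (min_le_left _ _)⟩,
    fun w hw Θ z hP hj i j => ?_⟩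
  have e1 := E (amb Θ z) (jet2 w Θ z) (tang Θ z i) (tang Θ z j) (norm_amb z)
    (hj.trans_le (min_le_left _ _))
  rw [(F.shape_perturbedSphere hl h0 hρR hw hP (hj.trans_le (min_le_right _ _))).2]
  have s1 := Equiv.sum_comp σ fun a => L₂ a (amb Θ z) (jet2 w Θ z) (tang Θ z i) (tang Θ z j)
    * L₀ a (amb Θ z) (w (Θ z))
  have s2 := Equiv.sum_comp σ fun a => L₂ a (amb Θ z) (jet2 w Θ z) (tang Θ z i) (tang Θ z j)
    * Q₁ a (amb Θ z, jet1 w Θ z)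
  rw [s1, s2]
  -- The forms were defined with the curvature operator acting on the second argument. The pair
  -- symmetries, also that of the differentiated curvature, exchange the arguments.
  have c1 : ∀ j, h l 0 (curv (h l) 0 (amb Θ z) (tang Θ z i) (amb Θ z)) (tang Θ z j)
      = curvForm (h l) (amb Θ z) (tang Θ z i) (tang Θ z j) := fun j => by
    rw [N.apply_zero, N.curvForm_symm, N.curvForm_apply, real_inner_comm]
  have c2 : h l 0 (covCurv (h l) 0 (amb Θ z) (amb Θ z) (tang Θ z i) (amb Θ z)) (tang Θ z j)
      = covForm (h l) (amb Θ z) (tang Θ z i) (tang Θ z j) := by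
    rw [N.apply_zero, N.covForm_apply, N.covCurv_pair, real_inner_comm]
  have c3 : gradForm (h l) (amb Θ z) (sphGrad w Θ z) (tang Θ z i) (tang Θ z j)
      = -(1 / 3) * ∑ k, (h l 0 (curv (h l) 0 (tang Θ z k) (tang Θ z i) (amb Θ z)) (tang Θ z j)
        + h l 0 (curv (h l) 0 (amb Θ z) (tang Θ z i) (tang Θ z k)) (tang Θ z j))
          * d1 w Θ z k := by
    rw [N.gradForm_apply, sphGrad, sum_inner, Finset.mul_sum]
    refine Finset.sum_congr rfl fun k _ => ?_
    rw [real_inner_smul_left, real_inner_comm, N.inner_dGamma, N.apply_zero, N.apply_zero]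
    ring
  have c4 : (jet2 w Θ z).2.2 (curv (h l) 0 (amb Θ z) (tang Θ z i) (amb Θ z)) (tang Θ z j)
      = ∑ k, h l 0 (curv (h l) 0 (amb Θ z) (tang Θ z i) (amb Θ z)) (tang Θ z k)
        * d2 w Θ z k j := by
    rw [jet2_apply_tang hP]
    exact Finset.sum_congr rfl fun k _ => by rw [N.apply_zero, real_inner_comm]
  rw [c4, jet2_tang_tang hP, hP.orthonormal] at e1
  have e2 : shapeForm T (ρ, l, amb Θ z, jet2 w Θ z) (tang Θ z i) (tang Θ z j) = _ := e1
  rw [e2, show (jet2 w Θ z).2.1 = sphGrad w Θ z from rfl, c3, c2, ← c1,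
    show (jet2 w Θ z).1 = w (Θ z) from rfl]
  rw [show (w (Θ z), sphGrad w Θ z) = jet1 w Θ z from rfl]
  ring

theorem NormalFamily.exists_curvExpansion (F : NormalFamily h T 𝒱 K R) (hR : 0 < R) {k : ℕ}
    (hk : 1 ≤ k) (hkn : k ≤ n) :
    ∃ ρ₀ > 0, ∃ δ > 0, ∃ C : ℕ → ℝ, ∀ l ∈ K, ∀ ρ, 0 < ρ → ρ < ρ₀ →
      CurvExpansion k (h l) ρ δ C := by
  obtain ⟨ρ₀, hρ₀, δ, hδ, C, H⟩ := F.exists_curv_expansion hk hkn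
  refine ⟨min ρ₀ (R / 2), lt_min hρ₀ (by linarith), min δ (1 / 2), lt_min hδ (by norm_num), C,
    fun l hl ρ h0 h1 => ?_⟩
  obtain ⟨O, L, Q, hO, hL, hQ, E⟩ := H l hl ρ h0 (h1.trans_le (min_le_left _ _))
  have hρR : 2 * ρ ≤ R := by linarith [h1.trans_le (min_le_right _ _)]
  have N := F.normal l hl
  refine ⟨O, L, Q, hO, hL, hQ.mono (fun _ => le_rfl) (min_le_left _ _), fun w hw Θ z hP hj => ?_⟩
  have hj1 : ‖jet1 w Θ z‖ < 1 / 2 := by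
    refine lt_of_le_of_lt ?_ (hj.trans_le (min_le_right _ _))
    refine max_le (norm_fst_le (jet2 w Θ z)) ?_
    exact (norm_fst_le (jet2 w Θ z).2).trans (norm_snd_le (jet2 w Θ z))
  have A := hP.frame
  rw [F.kCurvature_perturbedSphere hl h0 hρR hw hP hj1 hkn, E (amb Θ z) (jet2 w Θ z) (norm_amb z)
    (hj.trans_le (min_le_left _ _))]
  have c1 : ∀ i j, h l 0 (curv (h l) 0 (amb Θ z) (tang Θ z i) (amb Θ z)) (tang Θ z j)
      = curvForm (h l) (amb Θ z) (tang Θ z i) (tang Θ z j) := fun i j => by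
    rw [N.apply_zero, N.curvForm_symm, N.curvForm_apply, real_inner_comm]
  have t1 : perpTrace (amb Θ z) (jet2 w Θ z).2.2 = ∑ i, d2 w Θ z i i := by
    rw [perpTrace, ← A.sum_bilin]
    exact Finset.sum_congr rfl fun i _ => jet2_tang_tang hP i i
  have t2 : curvTrace (h l) (amb Θ z) (jet2 w Θ z).2.2
      = ∑ i, ∑ j, h l 0 (curv (h l) 0 (amb Θ z) (tang Θ z i) (amb Θ z)) (tang Θ z j)
          * d2 w Θ z i j := by
    rw [← A.sum_curvTrace N, Finset.sum_comm]
    refine Finset.sum_congr rfl fun i _ => ?_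
    rw [jet2_apply_tang hP]
    exact Finset.sum_congr rfl fun k _ => by rw [c1, N.curvForm_apply]
  rw [← t2, ← t1]
  simp only [Finset.sum_range_succ, Finset.sum_range_zero, curvCoeff, curvLinCoeff, jet2]
  generalize (if 2 ≤ k then ((n - 2).choose (k - 2) : ℝ) else 0) = c
  simp
  ring

end Family

/-! ### The metric in a chart -/

/-- The operator that represents the bilinear form with the same coefficients as `b`. -/
noncomputable def formOp {m : ℕ} (b : Euc m → Euc m → ℝ) : Euc m →L[ℝ] Euc m :=
  ∑ i, ∑ j, b (stdVec i) (stdVec j) • (innerSL ℝ (stdVec i)).smulRight (stdVec j)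

theorem inner_formOp {m : ℕ} (B : Euc m →ₗ[ℝ] Euc m →ₗ[ℝ] ℝ) (u v : Euc m) :
    inner ℝ (formOp (fun u v => B u v) u) v = B u v := by
  conv_rhs => rw [← sum_smul_stdVec u, ← sum_smul_stdVec v]
  simp only [formOp, map_sum, map_smul, LinearMap.sum_apply, LinearMap.smul_apply, _root_.sum_apply, _root_.smul_apply, sum_inner,
    real_inner_smul_left, ContinuousLinearMap.smulRight_apply, innerSL_apply_apply,
    inner_stdVec_left, smul_eq_mul, Finset.mul_sum]
  rw [Finset.sum_comm]
  exact Finset.sum_congr rfl fun i _ => Finset.sum_congr rfl fun j _ => by ring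

theorem exists_bilinear_comp {V W : Type*} [AddCommGroup V] [Module ℝ V] [TopologicalSpace V]
    [AddCommGroup W] [Module ℝ W] [TopologicalSpace W] (B : W →L[ℝ] W →L[ℝ] ℝ) (A : V →L[ℝ] W) :
    ∃ L : V →ₗ[ℝ] V →ₗ[ℝ] ℝ, ∀ u v, L u v = B (A u) (A v) :=
  ⟨LinearMap.mk₂ ℝ (fun u v => B (A u) (A v)) (by simp) (by simp) (by simp) (by simp),
    fun _ _ => rfl⟩

section Chart

variable {m : ℕ} {M : Type*} [TopologicalSpace M] [ChartedSpace (Euc m) M] [IsManifold (𝓡 m) ∞ M]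
  (g : Bundle.ContMDiffRiemannianMetric (𝓡 m) ∞ (Euc m) (fun x : M => TangentSpace (𝓡 m) x))

/-- The tangent map of `σ` sends constant vector fields to smooth vector fields along `σ`, and `g`
is a smooth section of bilinear forms; the coefficient is the base-point-free part of their pairing.
-/
theorem contDiffOn_pullback {σ : Euc m → M} {U : Set (Euc m)} (hU : IsOpen U)
    (hσ : ContMDiffOn (𝓡 m) (𝓡 m) ∞ σ U) (u v : Euc m) :
    ContDiffOn ℝ ∞ (fun y => pullback g σ y u v) U := by
  have sec (u : Euc m) : ContMDiffOn (𝓡 m) (𝓡 m).tangent ∞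
      (fun y => (⟨σ y, mfderiv (𝓡 m) (𝓡 m) σ y u⟩ : TangentBundle (𝓡 m) M)) U := by
    have h1 := hσ.contMDiffOn_tangentMapWithin (m := ∞) (by simp) hU.uniqueMDiffOn
    have h2 : ContMDiffOn (𝓡 m) (𝓡 m).tangent ∞
        (fun y => (⟨y, u⟩ : TangentBundle (𝓡 m) (Euc m))) U :=
      (contMDiffOn_vectorSpace_iff_contDiffOn (𝕜 := ℝ) (E := Euc m) (n := ∞)
        (V := fun _ => u) (s := U)).2 contDiffOn_const
    refine (h1.comp h2 fun y hy => hy).congr fun y hy => ?_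
    simp [tangentMapWithin, mfderivWithin_of_isOpen hU hy]
  have key : ContMDiffOn (𝓡 m) ((𝓡 m).prod 𝓘(ℝ)) ∞ (fun y =>
      (Bundle.TotalSpace.mk' ℝ (E := Bundle.Trivial M ℝ) (σ y) (pullback g σ y u v))) U := by
    intro y hy
    apply ContMDiffWithinAt.clm_bundle_apply₂ (F₁ := Euc m) (F₂ := Euc m)
    · exact ContMDiffAt.comp_contMDiffWithinAt y g.contMDiff.contMDiffAt (hσ y hy)
    · exact sec u y hy
    · exact sec v y hy
  rw [← contMDiffOn_iff_contDiffOn]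
  intro y hy
  have := key y hy
  simp only [Bundle.contMDiffWithinAt_totalSpace] at this
  exact this.2

theorem inner_formOp_pullback (σ : Euc m → M) (y u v : Euc m) :
    inner ℝ (formOp (pullback g σ y) u) v = pullback g σ y u v := by
  have h : ∃ L : Euc m →ₗ[ℝ] Euc m →ₗ[ℝ] ℝ, ∀ u v, L u v = pullback g σ y u v :=
    exists_bilinear_comp (V := TangentSpace (𝓡 m) y) (g.inner (σ y)) (mfderiv (𝓡 m) (𝓡 m) σ y)
  obtain ⟨L, hL⟩ := h
  have hL' : pullback g σ y = fun u v => L u v := by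
    funext u v
    exact (hL u v).symm
  rw [hL']
  exact inner_formOp L u v

theorem metricOn_pullback {σ : Euc m → M} {U : Set (Euc m)} (hU : IsOpen U)
    (hσ : ContMDiffOn (𝓡 m) (𝓡 m) ∞ σ U)
    (hinj : ∀ y ∈ U, Function.Injective (mfderiv (𝓡 m) (𝓡 m) σ y)) :
    MetricOn (pullback g σ) (fun y => formOp (pullback g σ y)) U := by
  have key := inner_formOp_pullback g σ
  refine ⟨hU, ?_, fun y _ u v => (key y u v).symm, fun y _ u v => ?_, fun y hy u hu => ?_⟩
  · unfold formOp
    exact ContDiffOn.sum fun i _ => ContDiffOn.sum fun j _ =>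
      (contDiffOn_pullback g hU hσ _ _).fun_smul contDiffOn_const
  · rw [key, key]
    exact g.symm _ _ _
  · rw [key]
    exact g.pos _ _ fun h0 => hu (hinj y hy (h0.trans (map_zero (mfderiv (𝓡 m) (𝓡 m) σ y)).symm))

theorem pullback_comp {σ : Euc m → M} {τ : Euc m → Euc m} {x : Euc m}
    (hσ : MDifferentiableAt (𝓡 m) (𝓡 m) σ (τ x)) (hτ : DifferentiableAt ℝ τ x) (u v : Euc m) :
    pullback g (σ ∘ τ) x u v = pullback g σ (τ x) (fderiv ℝ τ x u) (fderiv ℝ τ x v) := by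
  simp only [pullback]
  rw [mfderiv_comp x hσ hτ.mdifferentiableAt, mfderiv_eq_fderiv]
  rfl

theorem pullback_congr {σ σ' : Euc m → M} {x : Euc m} (h : σ =ᶠ[𝓝 x] σ') (u v : Euc m) :
    pullback g σ x u v = pullback g σ' x u v := by
  have h1 := h.mfderiv_eq (I := 𝓡 m) (I' := 𝓡 m)
  have h2 := h.eq_of_nhds
  unfold pullback
  -- The two differentials take values in tangent spaces at points that are equal only by a proof,
  -- so they are abstracted before the points are identified.
  generalize mfderiv (𝓡 m) (𝓡 m) σ x = A at h1
  generalize mfderiv (𝓡 m) (𝓡 m) σ' x = B at h1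
  revert A B
  rw [← h2]
  intro A B h1
  rw [show A = B from h1]

variable (M) in
/-- The coefficients of the metric in the chart at `a`. -/
noncomputable def chartMetric (a : M) : Euc m → Euc m → Euc m → ℝ :=
  pullback g (extChartAt (𝓡 m) a).symm

theorem contMDiffOn_chart_symm (a : M) :
    ContMDiffOn (𝓡 m) (𝓡 m) ∞ (extChartAt (𝓡 m) a).symm (extChartAt (𝓡 m) a).target :=
  contMDiffOn_extChartAt_symm a

theorem isOpen_chart_target (a : M) : IsOpen (extChartAt (𝓡 m) a).target :=
  isOpen_extChartAt_target a

theorem mdifferentiableAt_chart_symm {a : M} {y : Euc m} (hy : y ∈ (extChartAt (𝓡 m) a).target) :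
    MDifferentiableAt (𝓡 m) (𝓡 m) (extChartAt (𝓡 m) a).symm y :=
  (((contMDiffOn_chart_symm a).contMDiffAt ((isOpen_chart_target a).mem_nhds hy))
    ).mdifferentiableAt (by simp)

theorem isInvertible_mfderiv_chart_symm {a : M} {y : Euc m}
    (hy : y ∈ (extChartAt (𝓡 m) a).target) :
    (mfderiv (𝓡 m) (𝓡 m) (extChartAt (𝓡 m) a).symm y).IsInvertible := by
  have := isInvertible_mfderivWithin_extChartAt_symm (I := 𝓡 m) hy
  simpa [mfderivWithin_univ] using this

theorem metricOn_chartMetric (a : M) :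
    MetricOn (chartMetric M g a) (fun y => formOp (chartMetric M g a y))
      (extChartAt (𝓡 m) a).target :=
  metricOn_pullback g (isOpen_chart_target a) (contMDiffOn_chart_symm a)
    fun _ hy => (isInvertible_mfderiv_chart_symm hy).injective

/-- The coordinate change from the chart at `a` to the chart at `b`. -/
noncomputable def coordChange (a b : M) : Euc m → Euc m :=
  extChartAt (𝓡 m) b ∘ (extChartAt (𝓡 m) a).symm

/-- The domain of the coordinate change. -/
def coordDomain (a b : M) : Set (Euc m) :=
  (extChartAt (𝓡 m) a).target ∩ (extChartAt (𝓡 m) a).symm ⁻¹' (extChartAt (𝓡 m) b).source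

theorem isOpen_coordDomain (a b : M) : IsOpen (coordDomain (m := m) a b) :=
  (continuousOn_extChartAt_symm a).isOpen_inter_preimage (isOpen_chart_target a)
    (isOpen_extChartAt_source b)

theorem contDiffOn_coordChange (a b : M) :
    ContDiffOn ℝ ∞ (coordChange (m := m) a b) (coordDomain a b) := by
  rw [← contMDiffOn_iff_contDiffOn]
  exact (contMDiffOn_extChartAt (x := b)).comp ((contMDiffOn_chart_symm a).mono inter_subset_left)
    fun y hy => by simpa using hy.2

theorem coordChange_mem {a b : M} {y : Euc m} (hy : y ∈ coordDomain a b) :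
    coordChange a b y ∈ coordDomain b a := by
  refine ⟨(extChartAt (𝓡 m) b).map_source hy.2, ?_⟩
  simp only [coordChange, mem_preimage, Function.comp_apply]
  rw [(extChartAt (𝓡 m) b).left_inv hy.2]
  exact (extChartAt (𝓡 m) a).map_target hy.1

theorem coordChange_coordChange {a b : M} {y : Euc m} (hy : y ∈ coordDomain a b) :
    coordChange b a (coordChange a b y) = y := by
  simp only [coordChange, Function.comp_apply]
  rw [(extChartAt (𝓡 m) b).left_inv hy.2, (extChartAt (𝓡 m) a).right_inv hy.1]

theorem contDiffAt_coordChange {a b : M} {y : Euc m} (hy : y ∈ coordDomain a b) :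
    ContDiffAt ℝ ∞ (coordChange a b) y :=
  (contDiffOn_coordChange a b).contDiffAt ((isOpen_coordDomain a b).mem_nhds hy)

theorem surjective_fderiv_coordChange {a b : M} {y : Euc m} (hy : y ∈ coordDomain a b) :
    Function.Surjective (fderiv ℝ (coordChange a b) y) := by
  have h1 := (contDiffAt_coordChange hy).differentiableAt (by simp)
  have h2 := (contDiffAt_coordChange (coordChange_mem hy)).differentiableAt (by simp)
  have h3 : coordChange b a ∘ coordChange a b =ᶠ[𝓝 y] id := by
    filter_upwards [(isOpen_coordDomain a b).mem_nhds hy] with x hx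
    exact coordChange_coordChange hx
  have h4 := h3.fderiv_eq (𝕜 := ℝ)
  rw [fderiv_comp y h2 h1, fderiv_id] at h4
  have hinj : Function.Injective (fderiv ℝ (coordChange a b) y) := by
    intro u v huv
    have h5 := congrArg (fun A => A u) h4
    have h6 := congrArg (fun A => A v) h4
    simp only [ContinuousLinearMap.comp_apply, ContinuousLinearMap.id_apply] at h5 h6
    rw [← h5, ← h6, huv]
  exact LinearMap.injective_iff_surjective.1 hinj

theorem chartMetric_coordChange {a b : M} {y : Euc m} (hy : y ∈ coordDomain a b) (u v : Euc m) :
    chartMetric M g a y u v = chartMetric M g b (coordChange a b y)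
      (fderiv ℝ (coordChange a b) y u) (fderiv ℝ (coordChange a b) y v) := by
  unfold chartMetric
  rw [← pullback_comp g (mdifferentiableAt_chart_symm (coordChange_mem hy).1)
    ((contDiffAt_coordChange hy).differentiableAt (by simp))]
  have h : (extChartAt (𝓡 m) a).symm =ᶠ[𝓝 y]
      (extChartAt (𝓡 m) b).symm ∘ coordChange a b := by
    filter_upwards [(isOpen_coordDomain a b).mem_nhds hy] with x hx
    simp only [coordChange, Function.comp_apply]
    rw [(extChartAt (𝓡 m) b).left_inv hx.2]
  exact pullback_congr g h u v

theorem christoffel_coordChange {a b : M} {y : Euc m} (hy : y ∈ coordDomain a b) (u v : Euc m) :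
    fderiv ℝ (coordChange a b) y (christoffel (chartMetric M g a) y u v)
      = fderiv ℝ (fderiv ℝ (coordChange a b)) y u v
        + christoffel (chartMetric M g b) (coordChange a b y)
          (fderiv ℝ (coordChange a b) y u) (fderiv ℝ (coordChange a b) y v) := by
  refine (metricOn_chartMetric g b).christoffel_pullback (metricOn_chartMetric g a) hy.1
    ((contDiffAt_coordChange hy).of_le ENat.LEInfty.out) (coordChange_mem hy).1
    (surjective_fderiv_coordChange hy) ?_ u v
  filter_upwards [(isOpen_coordDomain a b).mem_nhds hy] with x hx u v
  exact chartMetric_coordChange g hx u v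

end Chart

/-! ### Geodesics in charts and their uniqueness -/

theorem differentiableAt_deriv_of_contDiffAt {E : Type*} [NormedAddCommGroup E] [NormedSpace ℝ E]
    {c : ℝ → E} {t : ℝ} (hc : ContDiffAt ℝ 2 c t) : DifferentiableAt ℝ (deriv c) t := by
  have h : deriv c = fun s => fderiv ℝ c s 1 := by
    funext s
    exact fderiv_apply_one_eq_deriv.symm
  rw [h]
  exact ((hc.fderiv_right (m := 1) (by norm_num)).differentiableAt (by simp)).clm_apply
    (differentiableAt_const _)

theorem deriv_deriv_comp {E F : Type*} [NormedAddCommGroup E] [NormedSpace ℝ E]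
    [NormedAddCommGroup F] [NormedSpace ℝ F] {τ : E → F} {c : ℝ → E} {t : ℝ}
    (hτ : ContDiffAt ℝ 2 τ (c t)) (hc : ContDiffAt ℝ 2 c t) :
    deriv (deriv (τ ∘ c)) t = fderiv ℝ (fderiv ℝ τ) (c t) (deriv c t) (deriv c t)
      + fderiv ℝ τ (c t) (deriv (deriv c) t) := by
  have h1 : ∀ᶠ s in 𝓝 t, DifferentiableAt ℝ c s :=
    (hc.eventually (by simp)).mono fun s hs => hs.differentiableAt (by simp)
  have h2 : ∀ᶠ s in 𝓝 t, DifferentiableAt ℝ τ (c s) :=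
    hc.continuousAt.eventually ((hτ.eventually (by simp)).mono fun s hs =>
      hs.differentiableAt (by simp))
  have h3 : deriv (τ ∘ c) =ᶠ[𝓝 t] fun s => fderiv ℝ τ (c s) (deriv c s) := by
    filter_upwards [h1, h2] with s hs hs'
    exact (hs'.hasFDerivAt.comp_hasDerivAt s hs.hasDerivAt).deriv
  rw [h3.deriv_eq]
  have hτ' : DifferentiableAt ℝ (fderiv ℝ τ) (c t) :=
    (hτ.fderiv_right (m := 1) (by norm_num)).differentiableAt (by simp)
  have hc' : DifferentiableAt ℝ (deriv c) t :=
    differentiableAt_deriv_of_contDiffAt hc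
  have h4 := hτ'.hasFDerivAt.comp_hasDerivAt t (hc.differentiableAt (by simp)).hasDerivAt
  exact (h4.clm_apply hc'.hasDerivAt).deriv

section Geodesic

variable {m : ℕ} {M : Type*} [TopologicalSpace M] [ChartedSpace (Euc m) M] [IsManifold (𝓡 m) ∞ M]
  (g : Bundle.ContMDiffRiemannianMetric (𝓡 m) ∞ (Euc m) (fun x : M => TangentSpace (𝓡 m) x))

/-- The geodesic equation at time `t`, read in the chart at `a`. -/
structure IsGeodesicIn (a : M) (γ : ℝ → M) (t : ℝ) : Prop where
  continuousAt : ContinuousAt γ t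
  mem_source : γ t ∈ (extChartAt (𝓡 m) a).source
  contDiffAt : ContDiffAt ℝ 2 (fun s => extChartAt (𝓡 m) a (γ s)) t
  eq : deriv (deriv fun s => extChartAt (𝓡 m) a (γ s)) t
    + christoffel (chartMetric M g a) (extChartAt (𝓡 m) a (γ t))
      (deriv (fun s => extChartAt (𝓡 m) a (γ s)) t)
      (deriv (fun s => extChartAt (𝓡 m) a (γ s)) t) = 0

theorem isGeodesicAt_iff (γ : ℝ → M) (t : ℝ) :
    IsGeodesicAt g γ t ↔ IsGeodesicIn g (γ t) γ t :=
  ⟨fun h => ⟨h.1, mem_extChartAt_source _, h.2.1, h.2.2⟩, fun h => ⟨h.1, h.3, h.4⟩⟩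

variable {g}

/-- The second derivative of the transformed curve has the extra term `D²τ(c', c')`, exactly the
inhomogeneous term in the transformation law of the Christoffel symbols. This is needed because the
definition of a geodesic uses a different chart at each time. -/
theorem IsGeodesicIn.change {a b : M} {γ : ℝ → M} {t : ℝ} (H : IsGeodesicIn g a γ t)
    (hb : γ t ∈ (extChartAt (𝓡 m) b).source) : IsGeodesicIn g b γ t := by
  have hy : extChartAt (𝓡 m) a (γ t) ∈ coordDomain a b := by
    refine ⟨(extChartAt (𝓡 m) a).map_source H.mem_source, ?_⟩
    rw [mem_preimage, (extChartAt (𝓡 m) a).left_inv H.mem_source]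
    exact hb
  have hc : (fun s => extChartAt (𝓡 m) b (γ s))
      =ᶠ[𝓝 t] coordChange a b ∘ fun s => extChartAt (𝓡 m) a (γ s) := by
    filter_upwards [H.continuousAt.eventually
      ((isOpen_extChartAt_source a).mem_nhds H.mem_source)] with s hs
    simp only [coordChange, Function.comp_apply]
    rw [(extChartAt (𝓡 m) a).left_inv hs]
  have hτ : ContDiffAt ℝ 2 (coordChange a b) (extChartAt (𝓡 m) a (γ t)) :=
    (contDiffAt_coordChange hy).of_le ENat.LEInfty.out
  have hd : deriv (fun s => extChartAt (𝓡 m) b (γ s)) t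
      = fderiv ℝ (coordChange a b) (extChartAt (𝓡 m) a (γ t))
        (deriv (fun s => extChartAt (𝓡 m) a (γ s)) t) := by
    rw [hc.deriv_eq]
    exact ((hτ.differentiableAt (by simp)).hasFDerivAt.comp_hasDerivAt t
      (H.contDiffAt.differentiableAt (by simp)).hasDerivAt).deriv
  refine ⟨H.continuousAt, hb, ContDiffAt.congr_of_eventuallyEq
    (ContDiffAt.comp t hτ H.contDiffAt) hc, ?_⟩
  have h2 := deriv_deriv_comp (τ := coordChange a b) hτ H.contDiffAt
  have h3 := christoffel_coordChange g hy (deriv (fun s => extChartAt (𝓡 m) a (γ s)) t)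
    (deriv (fun s => extChartAt (𝓡 m) a (γ s)) t)
  have h4 : extChartAt (𝓡 m) b (γ t) = coordChange a b (extChartAt (𝓡 m) a (γ t)) :=
    hc.eq_of_nhds
  have h5 := congrArg (fderiv ℝ (coordChange a b) (extChartAt (𝓡 m) a (γ t))) H.eq
  rw [map_add, map_zero, h3] at h5
  rw [hc.deriv.deriv_eq, h2, hd, h4, ← h5]
  abel

/-- The vector field of the geodesic equation. -/
noncomputable def geodesicField (h : Euc m → Euc m → Euc m → ℝ) (p : Euc m × Euc m) : Euc m × Euc m :=
  (p.2, -christoffel h p.1 p.2 p.2)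

theorem MetricOn.contDiffAt_geodesicField {h : Euc m → Euc m → Euc m → ℝ}
    {T : Euc m → Euc m →L[ℝ] Euc m} {U : Set (Euc m)} (H : MetricOn h T U) {p : Euc m × Euc m}
    (hp : p.1 ∈ U) : ContDiffAt ℝ ∞ (geodesicField h) p := by
  have h1 : ContDiffOn ℝ ∞ (fun p : Euc m × Euc m => christoffel h p.1 p.2 p.2) (Prod.fst ⁻¹' U) :=
    H.contDiffOn_christoffel contDiff_fst.contDiffOn contDiff_snd.contDiffOn
      contDiff_snd.contDiffOn fun p hp => hp
  exact contDiff_snd.contDiffAt.prodMk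
    (h1.contDiffAt ((H.isOpen.preimage continuous_fst).mem_nhds hp)).neg

theorem IsGeodesicIn.hasDerivAt {a : M} {γ : ℝ → M} {t : ℝ} (H : IsGeodesicIn g a γ t) :
    HasDerivAt (fun s => (extChartAt (𝓡 m) a (γ s), deriv (fun s => extChartAt (𝓡 m) a (γ s)) s))
      (geodesicField (chartMetric M g a)
        (extChartAt (𝓡 m) a (γ t), deriv (fun s => extChartAt (𝓡 m) a (γ s)) t)) t := by
  have h1 := (H.contDiffAt.differentiableAt (by simp)).hasDerivAt
  have h2 : HasDerivAt (deriv fun s => extChartAt (𝓡 m) a (γ s)) _ t :=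
    (differentiableAt_deriv_of_contDiffAt H.contDiffAt).hasDerivAt
  rw [eq_neg_of_add_eq_zero_left H.eq] at h2
  exact h1.prodMk h2

/-- Uniqueness for the first order system of position and velocity: its vector field is locally
Lipschitz, and by continuity both curves stay for a short time in a set where the Lipschitz bound
holds. -/
theorem IsGeodesicIn.eventually_eq {a : M} {γ₁ γ₂ : ℝ → M} {x b : ℝ} (hb : x < b)
    (H₁ : ∀ t ∈ Icc x b, IsGeodesicIn g a γ₁ t) (H₂ : ∀ t ∈ Icc x b, IsGeodesicIn g a γ₂ t)
    (h0 : γ₁ x = γ₂ x) (h1 : deriv (fun s => extChartAt (𝓡 m) a (γ₁ s)) x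
      = deriv (fun s => extChartAt (𝓡 m) a (γ₂ s)) x) :
    ∀ᶠ t in 𝓝[>] x, γ₁ t = γ₂ t := by
  set f₁ : ℝ → Euc m × Euc m :=
    fun s => (extChartAt (𝓡 m) a (γ₁ s), deriv (fun s => extChartAt (𝓡 m) a (γ₁ s)) s)
  set f₂ : ℝ → Euc m × Euc m :=
    fun s => (extChartAt (𝓡 m) a (γ₂ s), deriv (fun s => extChartAt (𝓡 m) a (γ₂ s)) s)
  have hx : x ∈ Icc x b := ⟨le_rfl, hb.le⟩
  have hf : f₁ x = f₂ x := by simp only [f₁, f₂]; rw [h0, h1]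
  obtain ⟨L, s, hs, hL⟩ := (((metricOn_chartMetric g a).contDiffAt_geodesicField (p := f₁ x)
    ((extChartAt (𝓡 m) a).map_source (H₁ x hx).mem_source)).of_le
      (m := 1) ENat.LEInfty.out).exists_lipschitzOnWith
  have e1 : ∀ᶠ t in 𝓝 x, f₁ t ∈ s := (H₁ x hx).hasDerivAt.continuousAt.eventually hs
  have e2 : ∀ᶠ t in 𝓝 x, f₂ t ∈ s :=
    (H₂ x hx).hasDerivAt.continuousAt.eventually (show s ∈ 𝓝 (f₂ x) from hf ▸ hs)
  obtain ⟨ε, hε, he⟩ := Metric.eventually_nhds_iff.1 (e1.and e2)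
  set b' := min b (x + ε) with hb'
  have hxb : x < b' := lt_min hb (by linarith)
  have hsub : ∀ t ∈ Icc x b', t ∈ Icc x b := fun t ht => ⟨ht.1, ht.2.trans (min_le_left _ _)⟩
  have hdist : ∀ t ∈ Ico x b', dist t x < ε := fun t ht => by
    rw [Real.dist_eq, abs_of_nonneg (by linarith [ht.1])]
    linarith [ht.2, min_le_right b (x + ε)]
  have key := ODE_solution_unique_of_mem_Icc_right (v := fun _ => geodesicField (chartMetric M g a))
    (s := fun _ => s) (K := L) (f := f₁) (g := f₂) (a := x) (b := b') (fun t _ => hL)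
    (fun t ht => (H₁ t (hsub t ht)).hasDerivAt.continuousAt.continuousWithinAt)
    (fun t ht => (H₁ t (hsub t (Ico_subset_Icc_self ht))).hasDerivAt.hasDerivWithinAt)
    (fun t ht => (he (hdist t ht)).1)
    (fun t ht => (H₂ t (hsub t ht)).hasDerivAt.continuousAt.continuousWithinAt)
    (fun t ht => (H₂ t (hsub t (Ico_subset_Icc_self ht))).hasDerivAt.hasDerivWithinAt)
    (fun t ht => (he (hdist t ht)).2) hf
  filter_upwards [Ioc_mem_nhdsGT hxb] with t ht
  have ht' := Ioc_subset_Icc_self ht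
  exact (extChartAt (𝓡 m) a).injOn (H₁ t (hsub t ht')).mem_source (H₂ t (hsub t ht')).mem_source
    (congrArg Prod.fst (key ht'))

/-- Continuous induction on `[0, 1]`: the times up to which the curves agree form a closed set,
because the manifold is Hausdorff, and local uniqueness carries agreement beyond each of them. -/
theorem IsGeodesicFrom.eqOn [T2Space M] {p : M} {v : TangentSpace (𝓡 m) p} {γ₁ γ₂ : ℝ → M}
    (H₁ : IsGeodesicFrom g p v γ₁) (H₂ : IsGeodesicFrom g p v γ₂) : EqOn γ₁ γ₂ (Icc 0 1) := by
  set S : Set ℝ := {t | ∀ r ∈ Icc 0 t, γ₁ r = γ₂ r} with hS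
  have h0 : (0 : ℝ) ∈ S := by
    intro r hr
    rw [le_antisymm hr.2 hr.1, H₁.1, H₂.1]
  have hclosed : IsClosed (S ∩ Icc 0 1) := by
    refine isClosed_of_closure_subset fun t ht => ?_
    have htI : t ∈ Icc (0 : ℝ) 1 := by
      have := closure_mono (inter_subset_right (s := S)) ht
      rwa [isClosed_Icc.closure_eq] at this
    refine ⟨fun r hr => ?_, htI⟩
    rcases hr.2.lt_or_eq with hrt | rfl
    · obtain ⟨t', ht', hS', -⟩ := mem_closure_iff.1 ht (Ioi r) isOpen_Ioi hrt
      exact hS' r ⟨hr.1, le_of_lt ht'⟩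
    · by_contra hne
      have := ((H₁.2.2 r htI).1.prodMk (H₂.2.2 r htI).1).eventually
        (isOpen_ne_fun continuous_fst continuous_snd |>.mem_nhds hne)
      obtain ⟨V, hV, hVo, hVr⟩ := mem_nhds_iff.1 this
      obtain ⟨t', ht', hS', hI⟩ := mem_closure_iff.1 ht V hVo hVr
      exact hV ht' (hS' t' ⟨hI.1, le_rfl⟩)
  have hstep : ∀ x ∈ S ∩ Ico 0 1, S ∈ 𝓝[>] x := by
    rintro x ⟨hxS, hx⟩
    have hxI : x ∈ Icc (0 : ℝ) 1 := Ico_subset_Icc_self hx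
    have hx12 : γ₁ x = γ₂ x := hxS x ⟨hx.1, le_rfl⟩
    have G₁ := (isGeodesicAt_iff g γ₁ x).1 (H₁.2.2 x hxI)
    have G₂ := (isGeodesicAt_iff g γ₂ x).1 (H₂.2.2 x hxI)
    rw [← hx12] at G₂
    have hev : ∀ᶠ t in 𝓝 x, t < 1 ∧ γ₁ t ∈ (extChartAt (𝓡 m) (γ₁ x)).source
        ∧ γ₂ t ∈ (extChartAt (𝓡 m) (γ₁ x)).source :=
      (eventually_lt_nhds hx.2).and
        ((G₁.continuousAt.eventually ((isOpen_extChartAt_source _).mem_nhds G₁.mem_source)).and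
        (G₂.continuousAt.eventually ((isOpen_extChartAt_source _).mem_nhds G₂.mem_source)))
    obtain ⟨ε, hε, he⟩ := Metric.eventually_nhds_iff.1 hev
    have he' : ∀ t ∈ Icc x (x + ε / 2), t ∈ Icc (0 : ℝ) 1 ∧
        γ₁ t ∈ (extChartAt (𝓡 m) (γ₁ x)).source ∧ γ₂ t ∈ (extChartAt (𝓡 m) (γ₁ x)).source := by
      intro t ht
      have := he (y := t) (by rw [Real.dist_eq, abs_of_nonneg (by linarith [ht.1])]; linarith [ht.2])
      exact ⟨⟨hx.1.trans ht.1, this.1.le⟩, this.2⟩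
    -- At time `0` the velocities are prescribed. At a later time they are determined by the values
    -- to the left, where the curves already agree.
    have hd : deriv (fun s => extChartAt (𝓡 m) (γ₁ x) (γ₁ s)) x
        = deriv (fun s => extChartAt (𝓡 m) (γ₁ x) (γ₂ s)) x := by
      rcases hx.1.eq_or_lt with rfl | hx0
      · have h1 := H₁.2.1
        have h2 := H₂.2.1
        rw [H₁.1]
        exact h1.trans h2.symm
      · have d1 := (G₁.contDiffAt.differentiableAt (by simp)).hasDerivAt.hasDerivWithinAt
          (s := Icc 0 x)
        have d2 := (G₂.contDiffAt.differentiableAt (by simp)).hasDerivAt.hasDerivWithinAt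
          (s := Icc 0 x)
        refine (uniqueDiffOn_Icc hx0 x ⟨hx.1, le_rfl⟩).eq_deriv _ d1 (d2.congr (fun r hr => ?_) ?_)
        · rw [hxS r hr]
        · rw [hx12]
    have hev2 := IsGeodesicIn.eventually_eq (a := γ₁ x) (x := x) (b := x + ε / 2) (by linarith)
      (fun t ht => ((isGeodesicAt_iff g γ₁ t).1 (H₁.2.2 t (he' t ht).1)).change (he' t ht).2.1)
      (fun t ht => ((isGeodesicAt_iff g γ₂ t).1 (H₂.2.2 t (he' t ht).1)).change (he' t ht).2.2)
      hx12 hd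
    obtain ⟨u, hu, hsub⟩ := (mem_nhdsGT_iff_exists_Ioc_subset).1 hev2
    filter_upwards [Ioc_mem_nhdsGT hu] with t ht r hr
    rcases le_or_gt r x with hrx | hrx
    · exact hxS r ⟨hr.1, hrx⟩
    · exact hsub ⟨hrx, hr.2.trans ht.2⟩
  have := hclosed.Icc_subset_of_forall_mem_nhdsWithin h0 hstep
  exact fun t ht => this ht t ⟨ht.1, le_rfl⟩

theorem IsGeodesicFrom.expMap_eq [T2Space M] {p : M} {v : TangentSpace (𝓡 m) p} {γ : ℝ → M}
    (H : IsGeodesicFrom g p v γ) : expMap g p v = γ 1 := by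
  have h : ∃ γ : ℝ → M, IsGeodesicFrom g p v γ := ⟨γ, H⟩
  rw [expMap, dif_pos h]
  exact h.choose_spec.eqOn H ⟨zero_le_one, le_rfl⟩

end Geodesic

/-! ### Smooth dependence of geodesics on the initial data -/

/-- The source is restricted to the open set where the derivative is invertible; the inverse is then
smooth on its whole domain and not only at the image of `a`. -/
theorem exists_local_inverse {E F : Type*} [NormedAddCommGroup E] [NormedSpace ℝ E]
    [CompleteSpace E] [NormedAddCommGroup F] [NormedSpace ℝ F] [CompleteSpace F] {f : E → F}
    {𝒰 : Set E} (hU : IsOpen 𝒰) (hf : ContDiffOn ℝ ∞ f 𝒰) {a : E} (ha : a ∈ 𝒰) {f' : E ≃L[ℝ] F}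
    (hf' : HasFDerivAt f (f' : E →L[ℝ] F) a) :
    ∃ φ : OpenPartialHomeomorph E F, a ∈ φ.source ∧ φ.source ⊆ 𝒰 ∧ (∀ x, φ x = f x) ∧
      ContDiffOn ℝ ∞ φ.symm φ.target := by
  set S : Set E := 𝒰 ∩ fderiv ℝ f ⁻¹' range ((↑) : (E ≃L[ℝ] F) → E →L[ℝ] F)
  have hS : IsOpen S := (hf.fderiv_of_isOpen (m := ∞) hU le_rfl).continuousOn.isOpen_inter_preimage
    hU (ContinuousLinearEquiv.isOpen (𝕜 := ℝ) (E := E) (F := F))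
  have hfa := hf.contDiffAt (hU.mem_nhds ha)
  have haS : a ∈ S := ⟨ha, f', hf'.fderiv.symm⟩
  refine ⟨(hfa.toOpenPartialHomeomorph f hf' (by simp)).restrOpen S hS,
    ⟨hfa.mem_toOpenPartialHomeomorph_source hf' (by simp), haS⟩,
    fun x hx => hx.2.1, fun x => rfl, fun y hy => ?_⟩
  obtain ⟨hm, e, he⟩ := (OpenPartialHomeomorph.map_target _ hy).2
  refine (OpenPartialHomeomorph.contDiffAt_symm _ hy (f₀' := e) ?_ ?_).contDiffWithinAt
  · rw [he]
    exact ((hf.contDiffAt (hU.mem_nhds hm)).differentiableAt (by simp)).hasFDerivAt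
  · exact hf.contDiffAt (hU.mem_nhds hm)

section Curve

variable (m : ℕ)

/-- The time interval on which geodesics are considered. -/
abbrev TimeInterval : Type := Icc (-1 : ℝ) 2

/-- The nearest time in the time interval. -/
noncomputable def toTime : ℝ → TimeInterval := projIcc (-1) 2 (by norm_num)

theorem continuous_toTime : Continuous toTime := continuous_projIcc

theorem toTime_of_mem {t : ℝ} (ht : t ∈ Icc (-1 : ℝ) 2) : toTime t = ⟨t, ht⟩ :=
  projIcc_of_mem _ ht

variable {m}

/-- The integral from `0` to `t` of a curve, extended by constants. -/
noncomputable def prim (e : C(TimeInterval, Euc m)) (t : ℝ) : Euc m :=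
  ∫ s in (0 : ℝ)..t, e (toTime s)

theorem hasDerivAt_prim (e : C(TimeInterval, Euc m)) (t : ℝ) :
    HasDerivAt (prim e) (e (toTime t)) t :=
  intervalIntegral.integral_hasDerivAt_right
    (e.continuous.comp continuous_toTime).continuousOn.intervalIntegrable
    ((e.continuous.comp continuous_toTime).stronglyMeasurableAtFilter _ _)
    (e.continuous.comp continuous_toTime).continuousAt

theorem continuous_prim (e : C(TimeInterval, Euc m)) : Continuous (prim e) :=
  continuous_iff_continuousAt.2 fun t => (hasDerivAt_prim e t).continuousAt

theorem norm_prim_le (e : C(TimeInterval, Euc m)) (t : TimeInterval) : ‖prim e t‖ ≤ 2 * ‖e‖ := by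
  have h := intervalIntegral.norm_integral_le_of_norm_le_const (a := (0 : ℝ)) (b := t)
    (f := fun s => e (toTime s)) (C := ‖e‖) fun s _ => e.norm_coe_le_norm _
  refine h.trans ?_
  rw [mul_comm]
  refine mul_le_mul_of_nonneg_right ?_ (norm_nonneg _)
  rw [sub_zero, abs_le]
  constructor <;> linarith [t.2.1, t.2.2]

/-- The map that sends `(y, e)` to the curve `t ↦ (y + ∫₀ᵗ e, e t)`. -/
noncomputable def curveMap (m : ℕ) :
    Euc m × C(TimeInterval, Euc m) →L[ℝ] C(TimeInterval, Euc m × Euc m) :=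
  LinearMap.mkContinuous
    { toFun := fun q => ⟨fun t => (q.1 + prim q.2 t, q.2 t),
        (continuous_const.add ((continuous_prim q.2).comp continuous_subtype_val)).prodMk
          q.2.continuous⟩
      map_add' := fun q q' => by
        ext1 t
        refine Prod.ext ?_ rfl
        have : prim (q.2 + q'.2) t = prim q.2 t + prim q'.2 t :=
          intervalIntegral.integral_add
            (q.2.continuous.comp continuous_toTime).continuousOn.intervalIntegrable
            (q'.2.continuous.comp continuous_toTime).continuousOn.intervalIntegrable
        simp only [ContinuousMap.coe_mk, Prod.fst_add, Prod.snd_add, ContinuousMap.add_apply, this]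
        abel
      map_smul' := fun r q => by
        ext1 t
        refine Prod.ext ?_ rfl
        have : prim (r • q.2) t = r • prim q.2 t := intervalIntegral.integral_smul r fun s => q.2 (toTime s)
        simp [this] } 3
    (fun q => by
      refine (ContinuousMap.norm_le _ (by positivity)).2 fun t => ?_
      have h1 := norm_fst_le q
      have h2 := norm_snd_le q
      refine (Prod.norm_def _).trans_le (max_le ?_ ?_)
      · exact (norm_add_le _ _).trans (by linarith [norm_prim_le q.2 t])
      · exact (q.2.norm_coe_le_norm t).trans (by linarith [norm_nonneg q]))

theorem curveMap_apply (q : Euc m × C(TimeInterval, Euc m)) (t : TimeInterval) :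
    curveMap m q t = (q.1 + prim q.2 t, q.2 t) := rfl

/-- The primitive that vanishes at time `0`. -/
noncomputable def primOp (m : ℕ) : C(TimeInterval, Euc m) →L[ℝ] C(TimeInterval, Euc m) :=
  ((ContinuousLinearMap.fst ℝ (Euc m) (Euc m)).compLeftContinuous ℝ TimeInterval).comp
    ((curveMap m).comp (ContinuousLinearMap.inr ℝ (Euc m) C(TimeInterval, Euc m)))

theorem primOp_apply (e : C(TimeInterval, Euc m)) (t : TimeInterval) :
    primOp m e t = prim e t := zero_add _

/-- Constant curves. -/
noncomputable def constOp (m : ℕ) : Euc m →L[ℝ] C(TimeInterval, Euc m) :=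
  ((ContinuousLinearMap.fst ℝ (Euc m) (Euc m)).compLeftContinuous ℝ TimeInterval).comp
    ((curveMap m).comp (ContinuousLinearMap.inl ℝ (Euc m) C(TimeInterval, Euc m)))

theorem constOp_apply (v : Euc m) (t : TimeInterval) : constOp m v t = v := by
  change v + prim 0 t = v
  simp [prim]

/-- The quadratic term `Γ_x(u, u)` of the geodesic equation. -/
noncomputable def christoffelQuad (h : Euc m → Euc m → Euc m → ℝ) (p : Euc m × Euc m) : Euc m :=
  christoffel h p.1 p.2 p.2

variable {h : Euc m → Euc m → Euc m → ℝ} {T : Euc m → Euc m →L[ℝ] Euc m} {U : Set (Euc m)}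

theorem MetricOn.contDiffOn_christoffelQuad (H : MetricOn h T U) :
    ContDiffOn ℝ ∞ (christoffelQuad h) (U ×ˢ univ) :=
  H.contDiffOn_christoffel contDiff_fst.contDiffOn contDiff_snd.contDiffOn
    contDiff_snd.contDiffOn fun _ hp => hp.1

theorem MetricOn.isOpen_prod (H : MetricOn h T U) : IsOpen (U ×ˢ (univ : Set (Euc m))) :=
  H.isOpen.prod isOpen_univ

/-- The expression `Γ_x(u, u)` is quadratic in `u`, so it vanishes to second order at `u = 0`. -/
theorem MetricOn.fderiv_christoffelQuad (H : MetricOn h T U) {x : Euc m} (hx : x ∈ U) :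
    fderiv ℝ (christoffelQuad h) (x, 0) = 0 := by
  have hd : HasFDerivAt (christoffelQuad h) (fderiv ℝ (christoffelQuad h) (x, 0)) (x, 0) :=
    ((H.contDiffOn_christoffelQuad.contDiffAt (H.isOpen_prod.mem_nhds ⟨hx, mem_univ _⟩)
      ).differentiableAt (by simp)).hasFDerivAt
  have hz : ∀ y ∈ U, ∀ r : ℝ, ∀ b, christoffelQuad h (y, r • b) = (r * r) • christoffelQuad h (y, b) := by
    intro y hy r b
    simp only [christoffelQuad]
    rw [H.christoffel_smul hy, H.christoffel_smul_left hy, smul_smul]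
  have key : ∀ a b : Euc m, fderiv ℝ (christoffelQuad h) (x, 0) (a, b) = 0 := by
    intro a b
    have hl : HasDerivAt (fun s : ℝ => ((x + s • a, s • b) : Euc m × Euc m)) (a, b) 0 := by
      have h1 : HasDerivAt (fun s : ℝ => s • a) a 0 := by
        simpa using (hasDerivAt_id (0 : ℝ)).smul_const a
      have h2 : HasDerivAt (fun s : ℝ => s • b) b 0 := by
        simpa using (hasDerivAt_id (0 : ℝ)).smul_const b
      exact (h1.const_add x).prodMk h2
    have e0 : ((x + (0 : ℝ) • a, (0 : ℝ) • b) : Euc m × Euc m) = (x, 0) := by simp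
    have h1 : HasDerivAt (fun s : ℝ => christoffelQuad h (x + s • a, s • b))
        (fderiv ℝ (christoffelQuad h) (x, 0) (a, b)) 0 :=
      HasFDerivAt.comp_hasDerivAt_of_eq (0 : ℝ) hd hl e0.symm
    have hcont : Continuous fun s : ℝ => x + s • a := by fun_prop
    have hev : ∀ᶠ s : ℝ in 𝓝 0, x + s • a ∈ U :=
      hcont.continuousAt.eventually (H.isOpen.mem_nhds (by simpa using hx))
    have hl' : HasDerivAt (fun s : ℝ => ((x + s • a, b) : Euc m × Euc m)) (a, 0) 0 := by
      have h1 : HasDerivAt (fun s : ℝ => s • a) a 0 := by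
        simpa using (hasDerivAt_id (0 : ℝ)).smul_const a
      exact (h1.const_add x).prodMk (hasDerivAt_const _ _)
    have hd' : HasFDerivAt (christoffelQuad h) (fderiv ℝ (christoffelQuad h) (x, b)) (x, b) :=
      ((H.contDiffOn_christoffelQuad.contDiffAt (H.isOpen_prod.mem_nhds ⟨hx, mem_univ _⟩)
        ).differentiableAt (by simp)).hasFDerivAt
    have h2 : HasDerivAt (fun s : ℝ => christoffelQuad h (x + s • a, b))
        (fderiv ℝ (christoffelQuad h) (x, b) (a, 0)) 0 :=
      HasFDerivAt.comp_hasDerivAt_of_eq (0 : ℝ) hd' hl' (by simp)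
    have h3 := ((hasDerivAt_id (0 : ℝ)).fun_mul (hasDerivAt_id (0 : ℝ))).fun_smul h2
    have h4 : HasDerivAt (fun s : ℝ => christoffelQuad h (x + s • a, s • b)) 0 0 := by
      refine (h3.congr_of_eventuallyEq ?_).congr_deriv (by simp)
      filter_upwards [hev] with s hs
      rw [hz _ hs]
      rfl
    exact h1.unique h4
  exact ContinuousLinearMap.ext fun p => key p.1 p.2

/-- The integrated geodesic equation, as a map on curves: the velocity curve `e` of the geodesic
with initial data `(y, v)` is the solution of `geodesicOp h (y, e) = (y, v)`. -/
noncomputable def geodesicOp (h : Euc m → Euc m → Euc m → ℝ)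
    (q : Euc m × C(TimeInterval, Euc m)) : Euc m × C(TimeInterval, Euc m) :=
  (q.1, q.2 + primOp m (compOp (christoffelQuad h) (curveMap m q)))

/-- The curves that stay in `U`. -/
def geodesicDomain (U : Set (Euc m)) : Set (Euc m × C(TimeInterval, Euc m)) :=
  curveMap m ⁻¹' mapsInto TimeInterval (U ×ˢ univ)

theorem MetricOn.isOpen_geodesicDomain (H : MetricOn h T U) : IsOpen (geodesicDomain U) :=
  (isOpen_mapsInto H.isOpen_prod).preimage (curveMap m).continuous

theorem MetricOn.contDiffOn_geodesicOp (H : MetricOn h T U) :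
    ContDiffOn ℝ ∞ (geodesicOp h) (geodesicDomain U) := by
  have h1 : ContDiffOn ℝ ∞ (fun q => compOp (christoffelQuad h) (curveMap m q)) (geodesicDomain U) :=
    (contDiffOn_compOp (X := TimeInterval) H.isOpen_prod H.contDiffOn_christoffelQuad).comp
      (curveMap m).contDiff.contDiffOn fun q hq => hq
  exact contDiff_fst.contDiffOn.prodMk (contDiff_snd.contDiffOn.add
    ((primOp m).contDiff.comp_contDiffOn h1))

theorem mem_geodesicDomain_zero {y : Euc m} (hy : y ∈ U) :
    ((y, 0) : Euc m × C(TimeInterval, Euc m)) ∈ geodesicDomain U := by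
  intro t
  rw [curveMap_apply]
  simpa [prim] using hy

/-- At a constant curve the quadratic term has derivative zero, so the derivative of the integrated
equation is the identity, whatever the length of the time interval. -/
theorem MetricOn.hasFDerivAt_geodesicOp (H : MetricOn h T U) {y : Euc m} (hy : y ∈ U) :
    HasFDerivAt (geodesicOp h)
      ((ContinuousLinearEquiv.refl ℝ (Euc m × C(TimeInterval, Euc m)) :) :
        Euc m × C(TimeInterval, Euc m) →L[ℝ] Euc m × C(TimeInterval, Euc m)) (y, 0) := by
  have hm := mem_geodesicDomain_zero hy
  have h1 := hasFDerivAt_compOp (X := TimeInterval) H.isOpen_prod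
    (H.contDiffOn_christoffelQuad.of_le (m := 1) ENat.LEInfty.out) (c := curveMap m (y, 0)) hm
  have h2 : pointwiseApply TimeInterval (Euc m × Euc m) (Euc m)
      (compOp (fderiv ℝ (christoffelQuad h)) (curveMap m (y, 0))) = 0 := by
    have h3 : ContinuousOn (fderiv ℝ (christoffelQuad h)) (U ×ˢ univ) :=
      H.contDiffOn_christoffelQuad.continuousOn_fderiv_of_isOpen H.isOpen_prod ENat.LEInfty.out
    refine ContinuousLinearMap.ext fun d => ContinuousMap.ext fun t => ?_
    rw [pointwiseApply_apply, compOp_apply h3 hm, curveMap_apply]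
    have h4 := H.fderiv_christoffelQuad hy
    have h5 : prim (0 : C(TimeInterval, Euc m)) t = 0 := by simp [prim]
    rw [h5, add_zero]
    exact congrArg (fun A => A (d t)) h4
  rw [h2] at h1
  have h3 : HasFDerivAt (fun q => compOp (christoffelQuad h) (curveMap m q))
      ((0 : C(TimeInterval, Euc m × Euc m) →L[ℝ] C(TimeInterval, Euc m)).comp (curveMap m))
      (y, 0) := h1.comp (y, 0) (curveMap m).hasFDerivAt
  have h4 := hasFDerivAt_fst (𝕜 := ℝ) (p := ((y, 0) : Euc m × C(TimeInterval, Euc m))) |>.prodMk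
    (hasFDerivAt_snd.fun_add ((primOp m).hasFDerivAt.comp (y, 0) h3))
  refine h4.congr_fderiv (ContinuousLinearMap.ext fun p => ?_)
  simp

theorem MetricOn.geodesicOp_zero (H : MetricOn h T U) {y : Euc m} (hy : y ∈ U) :
    geodesicOp h (y, 0) = (y, 0) := by
  have h1 : compOp (christoffelQuad h) (curveMap m (y, 0)) = 0 := by
    ext1 t
    have hm := mem_geodesicDomain_zero hy
    rw [compOp_apply H.contDiffOn_christoffelQuad.continuousOn hm]
    have h2 := (hm t).1
    have h3 := H.christoffel_smul h2 0 0 0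
    rw [zero_smul, zero_smul] at h3
    exact h3
  simp [geodesicOp, h1]

/-- The inverse function theorem solves `e + ∫ Γ(e, e) = v` for the velocity curve `e`, smoothly in
the initial data; smallness of `v` replaces smallness of time. The interval from `-1` to `2`
contains `[0, 1]` in its interior because the geodesic equation is required on both sides of the end
points `0` and `1`. -/
theorem MetricOn.exists_geodesics (H : MetricOn h T U) {y₀ : Euc m} (hy₀ : y₀ ∈ U) :
    ∃ r > 0, ∃ c c' : Euc m × Euc m → ℝ → Euc m,
      ContDiffOn ℝ ∞ (fun q => c q 1) (Metric.ball y₀ r ×ˢ Metric.ball 0 r) ∧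
      ∀ q ∈ Metric.ball y₀ r ×ˢ Metric.ball (0 : Euc m) r, c q 0 = q.1 ∧ c' q 0 = q.2 ∧
        ∀ t ∈ Ioo (-1 : ℝ) 2, c q t ∈ U ∧ HasDerivAt (c q) (c' q t) t ∧
          HasDerivAt (c' q) (-christoffel h (c q t) (c' q t) (c' q t)) t := by
  obtain ⟨φ, hφm, hφs, hφ, hφc⟩ := exists_local_inverse H.isOpen_geodesicDomain
    H.contDiffOn_geodesicOp (mem_geodesicDomain_zero hy₀) (H.hasFDerivAt_geodesicOp hy₀)
  have hj : Continuous fun q : Euc m × Euc m => (q.1, constOp m q.2) := by fun_prop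
  have hopen : IsOpen ((fun q : Euc m × Euc m => (q.1, constOp m q.2)) ⁻¹' φ.target) :=
    φ.open_target.preimage hj
  have h0 : (y₀, (0 : Euc m)) ∈ (fun q : Euc m × Euc m => (q.1, constOp m q.2)) ⁻¹' φ.target := by
    have := φ.map_source hφm
    rw [hφ, H.geodesicOp_zero hy₀] at this
    simpa using this
  obtain ⟨r, hr, hball⟩ := Metric.isOpen_iff.1 hopen _ h0
  rw [← ball_prod_same] at hball
  set Q : Euc m × Euc m → Euc m × C(TimeInterval, Euc m) := fun q => φ.symm (q.1, constOp m q.2)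
  set N : Euc m × Euc m → C(TimeInterval, Euc m) :=
    fun q => compOp (christoffelQuad h) (curveMap m (Q q))
  have hQ : ContDiffOn ℝ ∞ Q (Metric.ball y₀ r ×ˢ Metric.ball 0 r) :=
    hφc.comp (contDiff_fst.prodMk ((constOp m).contDiff.comp contDiff_snd)).contDiffOn hball
  refine ⟨r, hr, fun q t => q.1 + prim (Q q).2 t, fun q t => q.2 - prim (N q) t, ?_, ?_⟩
  · have h1 : ContDiffOn ℝ ∞ (fun q => (Q q).2) (Metric.ball y₀ r ×ˢ Metric.ball 0 r) :=
      contDiff_snd.comp_contDiffOn hQ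
    -- The position at time `1` is a continuous linear function of the starting point and the
    -- velocity curve.
    have h2 := h1.continuousLinearMap_comp (integralIcc (by norm_num : (-1 : ℝ) ≤ 2) 0 1)
    exact contDiff_fst.contDiffOn.add h2
  intro q hq
  have hsrc := φ.map_target (hball hq)
  have hright := φ.right_inv (hball hq)
  rw [hφ] at hright
  have e1 : (Q q).1 = q.1 := congrArg Prod.fst hright
  have e2 (t : TimeInterval) : (Q q).2 t = q.2 - prim (N q) t := by
    have := congrArg (fun p => p.2 t) hright
    simp only [geodesicOp, ContinuousMap.add_apply, primOp_apply, constOp_apply] at this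
    exact eq_sub_of_add_eq this
  refine ⟨by simp [prim], by simp [prim], fun t ht => ?_⟩
  have htI : t ∈ Icc (-1 : ℝ) 2 := Ioo_subset_Icc_self ht
  have hmem := hφs hsrc
  have h1 := hasDerivAt_prim (Q q).2 t
  have h2 := hasDerivAt_prim (N q) t
  have e3 : curveMap m (Q q) ⟨t, htI⟩ = (q.1 + prim (Q q).2 t, q.2 - prim (N q) t) := by
    rw [curveMap_apply, e2, e1]
  have e4 : N q ⟨t, htI⟩ = christoffelQuad h (q.1 + prim (Q q).2 t, q.2 - prim (N q) t) := by
    rw [← e3]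
    exact compOp_apply H.contDiffOn_christoffelQuad.continuousOn hmem _
  rw [toTime_of_mem htI] at h1 h2
  rw [e2] at h1
  rw [e4] at h2
  refine ⟨?_, h1.const_add _, h2.const_sub _⟩
  have := (hmem ⟨t, htI⟩).1
  rwa [e3] at this

end Curve

/-! ### The exponential map in a chart -/

section ChartExp

variable {m : ℕ} {M : Type*} [TopologicalSpace M] [ChartedSpace (Euc m) M] [IsManifold (𝓡 m) ∞ M]
  (g : Bundle.ContMDiffRiemannianMetric (𝓡 m) ∞ (Euc m) (fun x : M => TangentSpace (𝓡 m) x))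

/-- The tangent space at the image point is identified with the model space by the preferred chart
there, so this differential is that of a coordinate change. It translates velocities in the chart at
`a` into initial velocities as used by `expMap`. -/
theorem mfderiv_chart_symm {a : M} {y : Euc m} (hy : y ∈ (extChartAt (𝓡 m) a).target) (v : Euc m) :
    mfderiv (𝓡 m) (𝓡 m) (extChartAt (𝓡 m) a).symm y v
      = fderiv ℝ (coordChange a ((extChartAt (𝓡 m) a).symm y)) y v := by
  have h1 : ∀ A : Euc m →L[ℝ] Euc m, HasFDerivWithinAt
      (coordChange a ((extChartAt (𝓡 m) a).symm y)) A (range (𝓡 m)) y →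
      A v = fderiv ℝ (coordChange a ((extChartAt (𝓡 m) a).symm y)) y v := by
    intro A hA
    rw [ModelWithCorners.range_eq_univ, hasFDerivWithinAt_univ] at hA
    rw [hA.fderiv]
  exact h1 _ (mdifferentiableAt_chart_symm hy).hasMFDerivAt.2

/-- The curve `c` with velocity `c'` satisfies the geodesic equation at time `t`. -/
def IsGeodesicCurve (h : Euc m → Euc m → Euc m → ℝ) (U : Set (Euc m)) (c c' : ℝ → Euc m) (t : ℝ) :
    Prop :=
  c t ∈ U ∧ HasDerivAt c (c' t) t ∧ HasDerivAt c' (-christoffel h (c t) (c' t) (c' t)) t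

theorem MetricOn.isGeodesicCurve_scale {h : Euc m → Euc m → Euc m → ℝ}
    {T : Euc m → Euc m →L[ℝ] Euc m} {U : Set (Euc m)} (H : MetricOn h T U) {c c' : ℝ → Euc m}
    {s t : ℝ} (hc : IsGeodesicCurve h U c c' (s * t)) :
    IsGeodesicCurve h U (fun t => c (s * t)) (fun t => s • c' (s * t)) t := by
  have hs : HasDerivAt (fun t => s * t) s t := by simpa using (hasDerivAt_id t).const_mul s
  refine ⟨hc.1, hc.2.1.scomp t hs, ?_⟩
  have h1 : HasDerivAt (fun t => c' (s * t)) _ t := hc.2.2.scomp t hs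
  refine (h1.const_smul s).congr_deriv ?_
  rw [H.christoffel_smul hc.1, H.christoffel_smul_left hc.1]
  simp

theorem IsGeodesicCurve.deriv_deriv {h : Euc m → Euc m → Euc m → ℝ} {U : Set (Euc m)}
    {c c' : ℝ → Euc m} {t : ℝ} (hc : ∀ᶠ s in 𝓝 t, IsGeodesicCurve h U c c' s) :
    deriv (deriv c) t + christoffel h (c t) (deriv c t) (deriv c t) = 0 := by
  have h1 : deriv c =ᶠ[𝓝 t] c' := hc.mono fun s hs => hs.2.1.deriv
  rw [h1.deriv_eq, h1.eq_of_nhds, hc.self_of_nhds.2.2.deriv]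
  abel

theorem MetricOn.contDiffAt_geodesicCurve {h : Euc m → Euc m → Euc m → ℝ}
    {T : Euc m → Euc m →L[ℝ] Euc m} {U : Set (Euc m)} (H : MetricOn h T U)
    {c c' : ℝ → Euc m} {t : ℝ} (hc : ∀ᶠ s in 𝓝 t, IsGeodesicCurve h U c c' s) :
    ContDiffAt ℝ 2 c t := by
  obtain ⟨S, hS, hSo, htS⟩ := mem_nhds_iff.1 hc
  have h2 : ContDiffOn ℝ 1 c' S := by
    rw [← zero_add (1 : ℕ∞ω)]
    refine (contDiffOn_succ_iff_deriv_of_isOpen hSo).2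
      ⟨fun s hs => (hS hs).2.2.differentiableAt.differentiableWithinAt, by simp,
        contDiffOn_zero.2 ?_⟩
    have h3 : ContinuousOn (fun s => -christoffelQuad h (c s, c' s)) S :=
      (H.contDiffOn_christoffelQuad.continuousOn.comp
        (fun s hs => ((hS hs).2.1.continuousAt.prodMk (hS hs).2.2.continuousAt).continuousWithinAt)
        fun s hs => ⟨(hS hs).1, mem_univ _⟩).neg
    exact h3.congr fun s hs => (hS hs).2.2.deriv
  have h1 : ContDiffOn ℝ (1 + 1) c S :=
    (contDiffOn_succ_iff_deriv_of_isOpen hSo).2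
      ⟨fun s hs => (hS hs).2.1.differentiableAt.differentiableWithinAt, by simp,
        h2.congr fun s hs => (hS hs).2.1.deriv⟩
  have h3 := h1.contDiffAt (hSo.mem_nhds htS)
  rwa [one_add_one_eq_two] at h3

theorem isGeodesicIn_of_curve {a : M} {c c' : ℝ → Euc m} {t : ℝ}
    (hc : ∀ᶠ s in 𝓝 t, IsGeodesicCurve (chartMetric M g a) (extChartAt (𝓡 m) a).target c c' s) :
    IsGeodesicIn g a (fun s => (extChartAt (𝓡 m) a).symm (c s)) t := by
  have e : (fun s => extChartAt (𝓡 m) a ((extChartAt (𝓡 m) a).symm (c s))) =ᶠ[𝓝 t] c :=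
    hc.mono fun s hs => (extChartAt (𝓡 m) a).right_inv hs.1
  have ht := hc.self_of_nhds
  refine ⟨?_, (extChartAt (𝓡 m) a).map_target ht.1, ?_, ?_⟩
  · exact ((mdifferentiableAt_chart_symm ht.1).continuousAt).comp ht.2.1.continuousAt
  · exact ((metricOn_chartMetric g a).contDiffAt_geodesicCurve hc).congr_of_eventuallyEq e
  · rw [e.deriv.deriv_eq, e.deriv_eq, (extChartAt (𝓡 m) a).right_inv ht.1]
    exact IsGeodesicCurve.deriv_deriv hc

theorem expMap_chart [T2Space M] {a : M} {c c' : ℝ → Euc m} {y v : Euc m} (hy : c 0 = y)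
    (hv : c' 0 = v) (hc : ∀ t ∈ Ioo (-1 : ℝ) 2,
      IsGeodesicCurve (chartMetric M g a) (extChartAt (𝓡 m) a).target c c' t) :
    expMap g ((extChartAt (𝓡 m) a).symm y)
      (mfderiv (𝓡 m) (𝓡 m) (extChartAt (𝓡 m) a).symm y v)
      = (extChartAt (𝓡 m) a).symm (c 1) := by
  subst hy hv
  have hev : ∀ t ∈ Ioo (-1 : ℝ) 2, ∀ᶠ s in 𝓝 t,
      IsGeodesicCurve (chartMetric M g a) (extChartAt (𝓡 m) a).target c c' s := fun t ht =>
    Filter.mem_of_superset (isOpen_Ioo.mem_nhds ht) hc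
  have h0 := hc 0 (by norm_num)
  refine IsGeodesicFrom.expMap_eq (γ := fun s => (extChartAt (𝓡 m) a).symm (c s))
    ⟨rfl, ?_, fun t ht => ?_⟩
  · rw [mfderiv_chart_symm h0.1]
    have hm : c 0 ∈ coordDomain a ((extChartAt (𝓡 m) a).symm (c 0)) :=
      ⟨h0.1, mem_extChartAt_source _⟩
    exact (((contDiffAt_coordChange hm).differentiableAt
      (by simp)).hasFDerivAt.comp_hasDerivAt (0 : ℝ) h0.2.1).deriv
  · rw [isGeodesicAt_iff]
    exact (isGeodesicIn_of_curve g (hev t ⟨by linarith [ht.1], by linarith [ht.2]⟩)).change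
      (mem_extChartAt_source _)

/-- `Φ` is the exponential map read in the chart at `a`. Uniqueness of geodesics yields the
homogeneity `c(y, s v)(1) = c(y, v)(s)`. It gives the derivative in `v` at `v = 0`, which is the
identity, and the geodesic equation along rays. Invertibility of the derivative in `v` persists
nearby since it is an open condition. -/
theorem exists_chart_exp [T2Space M] (a : M) :
    ∃ r > 0, ∃ Φ : Euc m × Euc m → Euc m,
      ContDiffOn ℝ ∞ Φ (Metric.ball (extChartAt (𝓡 m) a a) r ×ˢ Metric.ball 0 r) ∧
      ∀ y ∈ Metric.ball (extChartAt (𝓡 m) a a) r, Φ (y, 0) = y ∧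
        (∀ v, fderiv ℝ Φ (y, 0) (0, v) = v) ∧
        ∀ v ∈ Metric.ball (0 : Euc m) r, Φ (y, v) ∈ (extChartAt (𝓡 m) a).target ∧
          expMap g ((extChartAt (𝓡 m) a).symm y)
            (mfderiv (𝓡 m) (𝓡 m) (extChartAt (𝓡 m) a).symm y v)
            = (extChartAt (𝓡 m) a).symm (Φ (y, v)) ∧
          (∀ u, fderiv ℝ Φ (y, v) (0, u) = 0 → u = 0) ∧
          deriv (deriv fun t : ℝ => Φ (y, t • v)) 1 + christoffel (chartMetric M g a) (Φ (y, v))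
            (deriv (fun t : ℝ => Φ (y, t • v)) 1) (deriv (fun t : ℝ => Φ (y, t • v)) 1) = 0 := by
  set y₀ := extChartAt (𝓡 m) a a
  have H := metricOn_chartMetric g a
  obtain ⟨r, hr, c, c', hsm, hc⟩ := H.exists_geodesics (mem_extChartAt_target a)
  have hO : IsOpen (Metric.ball y₀ r ×ˢ Metric.ball (0 : Euc m) r) :=
    Metric.isOpen_ball.prod Metric.isOpen_ball
  have hz : (0 : Euc m) ∈ Metric.ball (0 : Euc m) r := Metric.mem_ball_self hr
  have hexp : ∀ q ∈ Metric.ball y₀ r ×ˢ Metric.ball (0 : Euc m) r, ∀ s ∈ Icc (0 : ℝ) 1,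
      expMap g ((extChartAt (𝓡 m) a).symm q.1)
        (mfderiv (𝓡 m) (𝓡 m) (extChartAt (𝓡 m) a).symm q.1 (s • q.2 : Euc m))
        = (extChartAt (𝓡 m) a).symm (c q s) := by
    intro q hq s hs
    have hI : ∀ t ∈ Ioo (-1 : ℝ) 2, s * t ∈ Ioo (-1 : ℝ) 2 := by
      rintro t ⟨h1, h2⟩
      rcases le_total 0 t with h | h
      · exact ⟨by linarith [mul_nonneg hs.1 h], (mul_le_of_le_one_left h hs.2).trans_lt h2⟩
      · exact ⟨h1.trans_le (by nlinarith [hs.2]), by linarith [mul_nonpos_of_nonneg_of_nonpos hs.1 h]⟩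
    have h1 := expMap_chart g (a := a) (c := fun t => c q (s * t))
      (c' := fun t => s • c' q (s * t)) (y := q.1) (v := s • q.2)
      (by rw [mul_zero, (hc q hq).1]) (by rw [mul_zero, (hc q hq).2.1])
      fun t ht => H.isGeodesicCurve_scale ((hc q hq).2.2 _ (hI t ht))
    rwa [mul_one] at h1
  -- Both points are the exponential of `s v`, and the inverse chart is injective on its domain.
  have hscale : ∀ y ∈ Metric.ball y₀ r, ∀ v ∈ Metric.ball (0 : Euc m) r, ∀ s ∈ Icc (0 : ℝ) 1,
      c (y, s • v) 1 = c (y, v) s := by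
    intro y hy v hv s hs
    have hsv : s • v ∈ Metric.ball (0 : Euc m) r := by
      rw [mem_ball_zero_iff] at hv ⊢
      rw [norm_smul, Real.norm_of_nonneg hs.1]
      exact (mul_le_of_le_one_left (norm_nonneg v) hs.2).trans_lt hv
    have h1 := hexp (y, v) ⟨hy, hv⟩ s hs
    have h2 := hexp (y, s • v) ⟨hy, hsv⟩ 1 ⟨zero_le_one, le_rfl⟩
    rw [one_smul] at h2
    exact (extChartAt (𝓡 m) a).symm.injOn
      ((hc (y, s • v) ⟨hy, hsv⟩).2.2 1 (by norm_num)).1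
      ((hc (y, v) ⟨hy, hv⟩).2.2 s ⟨by linarith [hs.1], by linarith [hs.2]⟩).1 (h2.symm.trans h1)
  have hd : ∀ q ∈ Metric.ball y₀ r ×ˢ Metric.ball (0 : Euc m) r,
      HasFDerivAt (fun q => c q 1) (fderiv ℝ (fun q => c q 1) q) q := fun q hq =>
    ((hsm.contDiffAt (hO.mem_nhds hq)).differentiableAt (by simp)).hasFDerivAt
  have hzero : ∀ y ∈ Metric.ball y₀ r, ∀ v, fderiv ℝ (fun q => c q 1) (y, 0) (0, v) = v := by
    intro y hy
    have small : ∀ v ∈ Metric.ball (0 : Euc m) r,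
        fderiv ℝ (fun q => c q 1) (y, 0) (0, v) = v := by
      intro v hv
      have hl : HasDerivAt (fun s : ℝ => ((y, s • v) : Euc m × Euc m)) (0, v) 0 := by
        have h2 : HasDerivAt (fun s : ℝ => s • v) v 0 := by
          simpa using (hasDerivAt_id (0 : ℝ)).smul_const v
        exact (hasDerivAt_const _ _).prodMk h2
      have h1 : HasDerivAt (fun s : ℝ => c (y, s • v) 1)
          (fderiv ℝ (fun q => c q 1) (y, 0) (0, v)) 0 :=
        HasFDerivAt.comp_hasDerivAt_of_eq (0 : ℝ) (hd (y, 0) ⟨hy, hz⟩) hl (by simp)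
      have h2 := ((hc (y, v) ⟨hy, hv⟩).2.2 0 (by norm_num)).2.1
      rw [(hc (y, v) ⟨hy, hv⟩).2.1] at h2
      exact (uniqueDiffOn_Icc zero_lt_one 0 ⟨le_rfl, zero_le_one⟩).eq_deriv _
        (h1.hasDerivWithinAt (s := Icc 0 1)) (h2.hasDerivWithinAt.congr
          (fun s hs => hscale y hy v hv s hs) (hscale y hy v hv 0 ⟨le_rfl, zero_le_one⟩))
    intro v
    -- A small multiple of `v` lies in the ball where the claim is known; linearity removes the
    -- factor.
    set t : ℝ := r / (2 * (‖v‖ + 1)) with ht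
    have ht0 : 0 < t := by positivity
    have htv : t • v ∈ Metric.ball (0 : Euc m) r := by
      rw [mem_ball_zero_iff, norm_smul, Real.norm_of_nonneg ht0.le, ht, div_mul_eq_mul_div,
        div_lt_iff₀ (by positivity)]
      nlinarith [norm_nonneg v]
    have h1 := small (t • v) htv
    rw [show ((0, t • v) : Euc m × Euc m) = t • (0, v) by simp, map_smul] at h1
    exact smul_right_injective _ ht0.ne' h1
  have hop : ∀ᶠ q : Euc m × Euc m in 𝓝 (y₀, 0), IsUnit
      ((fderiv ℝ (fun q => c q 1) q).comp (ContinuousLinearMap.inr ℝ (Euc m) (Euc m))) := by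
    have h1 : ContinuousAt (fun q : Euc m × Euc m => (fderiv ℝ (fun q => c q 1) q).comp
        (ContinuousLinearMap.inr ℝ (Euc m) (Euc m))) (y₀, 0) := by
      have h2 := (hsm.continuousOn_fderiv_of_isOpen hO ENat.LEInfty.out).continuousAt
        (hO.mem_nhds (show (y₀, (0 : Euc m)) ∈ _ from ⟨Metric.mem_ball_self hr, hz⟩))
      exact h2.clm_comp continuousAt_const
    have h3 : (fderiv ℝ (fun q => c q 1) (y₀, 0)).comp
        (ContinuousLinearMap.inr ℝ (Euc m) (Euc m)) = 1 :=
      ContinuousLinearMap.ext fun v => hzero y₀ (Metric.mem_ball_self hr) v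
    have h4 : {A : Euc m →L[ℝ] Euc m | IsUnit A} ∈ 𝓝 ((fderiv ℝ (fun q => c q 1) (y₀, 0)).comp
        (ContinuousLinearMap.inr ℝ (Euc m) (Euc m))) := by
      rw [h3]
      exact Units.isOpen.mem_nhds isUnit_one
    exact h1.eventually h4
  obtain ⟨r₁, hr₁, hball⟩ := Metric.eventually_nhds_iff_ball.1 hop
  rw [← ball_prod_same] at hball
  have sub (x : Euc m) : Metric.ball x (min r r₁) ⊆ Metric.ball x r :=
    Metric.ball_subset_ball (min_le_left _ _)
  have sub₁ (x : Euc m) : Metric.ball x (min r r₁) ⊆ Metric.ball x r₁ :=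
    Metric.ball_subset_ball (min_le_right _ _)
  refine ⟨min r r₁, lt_min hr hr₁, fun q => c q 1, hsm.mono (prod_mono (sub _) (sub _)),
    fun y hy => ⟨?_, hzero y (sub _ hy), fun v hv => ⟨?_, ?_, ?_, ?_⟩⟩⟩
  · have h1 := hscale y (sub _ hy) 0 hz 0 ⟨le_rfl, zero_le_one⟩
    rw [smul_zero] at h1
    exact h1.trans (hc (y, 0) ⟨sub _ hy, hz⟩).1
  · exact ((hc (y, v) ⟨sub _ hy, sub _ hv⟩).2.2 1 (by norm_num)).1
  · have h1 := hexp (y, v) ⟨sub _ hy, sub _ hv⟩ 1 ⟨zero_le_one, le_rfl⟩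
    rwa [one_smul] at h1
  · intro u hu
    obtain ⟨A, hA⟩ := hball (y, v) ⟨sub₁ _ hy, sub₁ _ hv⟩
    have h1 : (A : Euc m →L[ℝ] Euc m) u = 0 := by rw [hA]; exact hu
    have h2 := congrArg (fun B : Euc m →L[ℝ] Euc m => B u) A.inv_mul
    simp only [mul_apply_eq_comp, h1, map_zero] at h2
    exact h2.symm
  · have hv' := mem_ball_zero_iff.1 (sub _ hv)
    -- Homogeneity is known only for factors in `[0, 1]`. Starting from `k v` with `k > 1`, the
    -- curve `t ↦ t v` is covered on both sides of `t = 1`, as the derivatives there require.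
    obtain ⟨k, hk1, hk2⟩ : ∃ k : ℝ, 1 < k ∧ k * ‖v‖ < r := by
      have h1 : ContinuousAt (fun k : ℝ => k * ‖v‖) 1 := by fun_prop
      have h2 : ∀ᶠ k : ℝ in 𝓝[>] 1, k * ‖v‖ < r :=
        (h1.eventually (gt_mem_nhds (by simpa using hv'))).filter_mono nhdsWithin_le_nhds
      obtain ⟨k, hk⟩ := (h2.and self_mem_nhdsWithin).exists
      exact ⟨k, hk.2, hk.1⟩
    have hk0 : 0 < k := by linarith
    have hkv : k • v ∈ Metric.ball (0 : Euc m) r := by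
      rwa [mem_ball_zero_iff, norm_smul, Real.norm_of_nonneg hk0.le]
    have hkI : k⁻¹ ∈ Ioo (0 : ℝ) 1 := ⟨inv_pos.2 hk0, inv_lt_one_of_one_lt₀ hk1⟩
    have hlin : ContinuousAt (fun t : ℝ => k⁻¹ * t) 1 := by fun_prop
    have hev : ∀ᶠ t : ℝ in 𝓝 1, k⁻¹ * t ∈ Ioo (0 : ℝ) 1 :=
      hlin.eventually (isOpen_Ioo.mem_nhds (by simpa using hkI))
    have e : (fun t : ℝ => c (y, t • v) 1) =ᶠ[𝓝 1] fun t => c (y, k • v) (k⁻¹ * t) := by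
      filter_upwards [hev] with t ht
      rw [← hscale y (sub _ hy) (k • v) hkv (k⁻¹ * t) (Ioo_subset_Icc_self ht), smul_smul]
      congr 3
      field_simp
    have h1 : ∀ᶠ t : ℝ in 𝓝 1, IsGeodesicCurve (chartMetric M g a) (extChartAt (𝓡 m) a).target
        (fun t => c (y, k • v) (k⁻¹ * t)) (fun t => k⁻¹ • c' (y, k • v) (k⁻¹ * t)) t := by
      filter_upwards [hev] with t ht
      exact H.isGeodesicCurve_scale ((hc (y, k • v) ⟨sub _ hy, hkv⟩).2.2 _
        ⟨by linarith [ht.1], by linarith [ht.2]⟩)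
    have h2 := IsGeodesicCurve.deriv_deriv h1
    have h3 := e.eq_of_nhds
    simp only [one_smul] at h3
    rw [← h3] at h2
    rw [e.deriv.deriv_eq, e.deriv_eq]
    exact h2

end ChartExp

/-! ### Normal coordinates around nearby points form a normal family -/

section LocalFamily

variable {m : ℕ}

theorem opNorm_le_sum_stdVec (A : Euc m →L[ℝ] Euc m) : ‖A‖ ≤ ∑ i, ‖A (stdVec i)‖ := by
  refine A.opNorm_le_bound (Finset.sum_nonneg fun i _ => norm_nonneg _) fun x => ?_
  conv_lhs => rw [← sum_smul_stdVec x]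
  rw [map_sum, Finset.sum_mul]
  refine (norm_sum_le _ _).trans (Finset.sum_le_sum fun i _ => ?_)
  rw [map_smul, norm_smul, mul_comm]
  exact mul_le_mul_of_nonneg_left (PiLp.norm_apply_le x i) (norm_nonneg _)

theorem apply_apply_eq_inner {S A : Euc m →L[ℝ] Euc m}
    (hA : ∀ i j, inner ℝ (S (A (stdVec i))) (A (stdVec j)) = if i = j then (1 : ℝ) else 0)
    (u v : Euc m) : inner ℝ (S (A u)) (A v) = inner ℝ u v := by
  conv_rhs => rw [inner_eq_sum]
  conv_lhs => rw [← sum_smul_stdVec u, ← sum_smul_stdVec v]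
  simp only [map_sum, map_smul, sum_inner, inner_sum, real_inner_smul_left, inner_smul_right, hA]
  simp [mul_comm]

variable {h : Euc m → Euc m → Euc m → ℝ} {T : Euc m → Euc m →L[ℝ] Euc m} {U : Set (Euc m)}

/-- The linear maps whose columns form an orthonormal frame at a point near `y₀`. -/
def frameSet (T : Euc m → Euc m →L[ℝ] Euc m) (y₀ : Euc m) (r : ℝ) :
    Set (Euc m × (Euc m →L[ℝ] Euc m)) :=
  {l | l.1 ∈ Metric.closedBall y₀ r ∧ ∀ i j, inner ℝ (T l.1 (l.2 (stdVec i))) (l.2 (stdVec j))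
    = if i = j then (1 : ℝ) else 0}

/-- On the compact ball the metric has a positive minimum `k` on Euclidean unit vectors, so a vector
of length one for the metric has Euclidean length at most `k^{-1/2}`. -/
theorem MetricOn.exists_bound_frameSet (H : MetricOn h T U) {y₀ : Euc m} {r : ℝ}
    (hr : Metric.closedBall y₀ r ⊆ U) :
    ∃ C, ∀ l ∈ frameSet T y₀ r, ‖l.2‖ < C := by
  have hc : ContinuousOn (fun p : Euc m × Euc m => inner ℝ (T p.1 p.2) p.2)
      (Metric.closedBall y₀ r ×ˢ Metric.sphere (0 : Euc m) 1) := by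
    have h1 : ContinuousOn (fun p : Euc m × Euc m => T p.1)
        (Metric.closedBall y₀ r ×ˢ Metric.sphere (0 : Euc m) 1) :=
      H.smooth.continuousOn.comp continuousOn_fst fun p hp => hr hp.1
    exact (h1.clm_apply continuousOn_snd).inner continuousOn_snd
  obtain ⟨k, hk, hk'⟩ := ((isCompact_closedBall y₀ r).prod
    (isCompact_sphere (0 : Euc m) 1)).exists_forall_le' hc (a := 0) fun p hp =>
      H.pos _ (hr hp.1) _ (ne_zero_of_mem_unit_sphere ⟨p.2, hp.2⟩)
  have hk2 : ∀ y ∈ Metric.closedBall y₀ r, ∀ u, k * (‖u‖ * ‖u‖) ≤ inner ℝ (T y u) u := by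
    intro y hy u
    rcases eq_or_ne u 0 with rfl | hu
    · simp
    have h0 : 0 < ‖u‖ := norm_pos_iff.2 hu
    have h1 := hk' (y, ‖u‖⁻¹ • u) ⟨hy, by simp [norm_smul, h0.ne']⟩
    simp only [map_smul, real_inner_smul_left, inner_smul_right] at h1
    calc k * (‖u‖ * ‖u‖) ≤ (‖u‖⁻¹ * (‖u‖⁻¹ * inner ℝ (T y u) u)) * (‖u‖ * ‖u‖) :=
          mul_le_mul_of_nonneg_right h1 (by positivity)
      _ = inner ℝ (T y u) u := by field_simp
  -- The length `a` of a column satisfies `a² ≤ k⁻¹`, and `a ≤ 1 + a²`; the last summand makes the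
  -- bound strict.
  refine ⟨∑ _i : Fin m, (1 + k⁻¹) + 1, fun l hl => (opNorm_le_sum_stdVec l.2).trans_lt
    (lt_of_le_of_lt (Finset.sum_le_sum fun i _ => ?_) (lt_add_one _))⟩
  have h1 := hk2 l.1 hl.1 (l.2 (stdVec i))
  rw [hl.2 i i, if_pos rfl] at h1
  have h2 : ‖l.2 (stdVec i)‖ * ‖l.2 (stdVec i)‖ ≤ k⁻¹ := by
    rw [← one_div, le_div_iff₀ hk]
    linarith
  nlinarith [norm_nonneg (l.2 (stdVec i)), sq_nonneg (‖l.2 (stdVec i)‖ - 1)]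

/-- Orthonormal frames are part of the compact parameter set, so uniformity in the frame comes
together with uniformity in the centre. -/
theorem MetricOn.isCompact_frameSet (H : MetricOn h T U) {y₀ : Euc m} {r : ℝ}
    (hr : Metric.closedBall y₀ r ⊆ U) : IsCompact (frameSet T y₀ r) := by
  obtain ⟨C, hC⟩ := H.exists_bound_frameSet hr
  refine Metric.isCompact_of_isClosed_isBounded ?_ ?_
  · have h1 : IsClosed (Metric.closedBall y₀ r ×ˢ (univ : Set (Euc m →L[ℝ] Euc m))) :=
      Metric.isClosed_closedBall.prod isClosed_univ
    have h2 : frameSet T y₀ r = (Metric.closedBall y₀ r ×ˢ univ) ∩ ⋂ i, ⋂ j,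
        ((Metric.closedBall y₀ r ×ˢ univ) ∩ (fun l : Euc m × (Euc m →L[ℝ] Euc m) =>
          inner ℝ (T l.1 (l.2 (stdVec i))) (l.2 (stdVec j))) ⁻¹'
          {if i = j then (1 : ℝ) else 0}) := by
      ext l
      simp only [frameSet, mem_inter_iff, mem_iInter, mem_prod, mem_univ, and_true, mem_preimage,
        mem_singleton_iff, Set.mem_ofPred_eq]
      exact ⟨fun hl => ⟨hl.1, fun i j => ⟨hl.1, hl.2 i j⟩⟩, fun hl => ⟨hl.1, fun i j => (hl.2 i j).2⟩⟩
    rw [h2]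
    refine h1.inter (isClosed_iInter fun i => isClosed_iInter fun j =>
      ContinuousOn.preimage_isClosed_of_isClosed ?_ h1 isClosed_singleton)
    have h3 : ContinuousOn (fun l : Euc m × (Euc m →L[ℝ] Euc m) => T l.1)
        (Metric.closedBall y₀ r ×ˢ univ) :=
      H.smooth.continuousOn.comp continuousOn_fst fun p hp => hr hp.1
    have h4 (i : Fin m) : Continuous fun l : Euc m × (Euc m →L[ℝ] Euc m) => l.2 (stdVec i) := by
      fun_prop
    exact (h3.clm_apply (h4 i).continuousOn).inner (h4 j).continuousOn
  · refine (Metric.isBounded_closedBall (x := y₀) (r := r)).prod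
      (Metric.isBounded_ball (x := (0 : Euc m →L[ℝ] Euc m)) (r := C)) |>.subset fun l hl =>
      ⟨hl.1, by simpa using hC l hl⟩

/-- The derivative of `x ↦ Φ (y, A x)`. -/
noncomputable def frameDeriv (Φ : Euc m × Euc m → Euc m)
    (q : (Euc m × (Euc m →L[ℝ] Euc m)) × Euc m) (u : Euc m) : Euc m :=
  fderiv ℝ Φ (q.1.1, q.1.2 q.2) (0, q.1.2 u)

/-- The operator of the pull-back of the metric by `x ↦ Φ (y, A x)`. -/
noncomputable def frameMetric (T : Euc m → Euc m →L[ℝ] Euc m) (Φ : Euc m × Euc m → Euc m)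
    (q : (Euc m × (Euc m →L[ℝ] Euc m)) × Euc m) : Euc m →L[ℝ] Euc m :=
  formOp fun u v => inner ℝ (T (Φ (q.1.1, q.1.2 q.2)) (frameDeriv Φ q u)) (frameDeriv Φ q v)

theorem inner_frameMetric (T : Euc m → Euc m →L[ℝ] Euc m) (Φ : Euc m × Euc m → Euc m)
    (q : (Euc m × (Euc m →L[ℝ] Euc m)) × Euc m) (u v : Euc m) :
    inner ℝ (frameMetric T Φ q u) v
      = inner ℝ (T (Φ (q.1.1, q.1.2 q.2)) (frameDeriv Φ q u)) (frameDeriv Φ q v) := by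
  have hadd (u u' : Euc m) : frameDeriv Φ q (u + u') = frameDeriv Φ q u + frameDeriv Φ q u' := by
    rw [frameDeriv, frameDeriv, frameDeriv, ← map_add]
    simp
  have hsmul (r : ℝ) (u : Euc m) : frameDeriv Φ q (r • u) = r • frameDeriv Φ q u := by
    rw [frameDeriv, frameDeriv, ← map_smul]
    simp
  exact inner_formOp (LinearMap.mk₂ ℝ (fun u v => inner ℝ
    (T (Φ (q.1.1, q.1.2 q.2)) (frameDeriv Φ q u)) (frameDeriv Φ q v))
    (fun _ _ _ => by rw [hadd, map_add, inner_add_left])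
    (fun _ _ _ => by rw [hsmul, map_smul, real_inner_smul_left]; rfl)
    (fun _ _ _ => by rw [hadd, inner_add_right])
    (fun _ _ _ => by rw [hsmul, inner_smul_right]; rfl)) u v

theorem contDiffOn_frameMetric (H : MetricOn h T U) {Φ : Euc m × Euc m → Euc m}
    {s : Set (Euc m × Euc m)} (hs : IsOpen s) (hΦ : ContDiffOn ℝ ∞ Φ s) (hΦU : MapsTo Φ s U)
    {s' : Set ((Euc m × (Euc m →L[ℝ] Euc m)) × Euc m)}
    (hs' : MapsTo (fun q : (Euc m × (Euc m →L[ℝ] Euc m)) × Euc m => (q.1.1, q.1.2 q.2)) s' s) :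
    ContDiffOn ℝ ∞ (frameMetric T Φ) s' := by
  have hmap : ContDiff ℝ ∞
      (fun q : (Euc m × (Euc m →L[ℝ] Euc m)) × Euc m => (q.1.1, q.1.2 q.2)) := by fun_prop
  have h1 : ContDiffOn ℝ ∞ (fun q : (Euc m × (Euc m →L[ℝ] Euc m)) × Euc m =>
      fderiv ℝ Φ (q.1.1, q.1.2 q.2)) s' :=
    (hΦ.fderiv_of_isOpen (m := ∞) hs le_rfl).comp hmap.contDiffOn hs'
  have h2 (u : Euc m) : ContDiffOn ℝ ∞ (fun q => frameDeriv Φ q u) s' := by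
    have h3 : ContDiff ℝ ∞ fun q : (Euc m × (Euc m →L[ℝ] Euc m)) × Euc m =>
        ((0, q.1.2 u) : Euc m × Euc m) := by fun_prop
    exact h1.clm_apply h3.contDiffOn
  have h4 : ContDiffOn ℝ ∞ (fun q : (Euc m × (Euc m →L[ℝ] Euc m)) × Euc m =>
      T (Φ (q.1.1, q.1.2 q.2))) s' :=
    H.smooth.comp (hΦ.comp hmap.contDiffOn hs') fun q hq => hΦU (hs' hq)
  unfold frameMetric formOp
  exact ContDiffOn.sum fun i _ => ContDiffOn.sum fun j _ =>
    (((h4.clm_apply (h2 _)).inner ℝ (h2 _))).fun_smul contDiffOn_const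

theorem contDiffAt_frameMap {Φ : Euc m × Euc m → Euc m} {s : Set (Euc m × Euc m)} (hs : IsOpen s)
    (hΦ : ContDiffOn ℝ ∞ Φ s) {y x : Euc m} {A : Euc m →L[ℝ] Euc m} (hx : (y, A x) ∈ s) :
    ContDiffAt ℝ ∞ (fun x => Φ (y, A x)) x := by
  have h1 : ContDiffAt ℝ ∞ (fun x => (y, A x)) x := contDiffAt_const.prodMk A.contDiff.contDiffAt
  exact (hΦ.contDiffAt (hs.mem_nhds hx)).comp x h1

theorem fderiv_frameMap {Φ : Euc m × Euc m → Euc m} {s : Set (Euc m × Euc m)} (hs : IsOpen s)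
    (hΦ : ContDiffOn ℝ ∞ Φ s) {y x : Euc m} {A : Euc m →L[ℝ] Euc m} (hx : (y, A x) ∈ s)
    (u : Euc m) : fderiv ℝ (fun x => Φ (y, A x)) x u = frameDeriv Φ ((y, A), x) u := by
  have h1 : HasFDerivAt (fun x => (y, A x)) ((0 : Euc m →L[ℝ] Euc m).prod A) x :=
    (hasFDerivAt_const y x).prodMk A.hasFDerivAt
  have h2 : HasFDerivAt Φ (fderiv ℝ Φ (y, A x)) (y, A x) :=
    ((hΦ.contDiffAt (hs.mem_nhds hx)).differentiableAt (by simp)).hasFDerivAt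
  have h3 : HasFDerivAt (fun x => Φ (y, A x)) _ x := h2.comp x h1
  rw [h3.fderiv]
  rfl

variable {M : Type*} [TopologicalSpace M] [ChartedSpace (Euc m) M] [IsManifold (𝓡 m) ∞ M]
  (g : Bundle.ContMDiffRiemannianMetric (𝓡 m) ∞ (Euc m) (fun x : M => TangentSpace (𝓡 m) x))

theorem normalCoord_frame {p : M} {B : Euc m →L[ℝ] TangentSpace (𝓡 m) p}
    (A : Euc m →L[ℝ] Euc m) (x : Euc m) :
    normalCoord g p (fun i => B (A (stdVec i))) x = expMap g p (B (A x)) := by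
  unfold normalCoord
  congr 1
  conv_rhs => rw [← sum_smul_stdVec x]
  simp only [map_sum, map_smul]

/-- The metric in the normal coordinates given by the frame with columns `A`, at the point with
coordinates `y`. -/
noncomputable def frameNormalMetric (a : M) (l : Euc m × (Euc m →L[ℝ] Euc m)) :
    Euc m → Euc m → Euc m → ℝ :=
  normalMetric g ((extChartAt (𝓡 m) a).symm l.1) fun i =>
    mfderiv (𝓡 m) (𝓡 m) (extChartAt (𝓡 m) a).symm l.1 (l.2 (stdVec i))

theorem exists_map_stdVec (b : Fin m → Euc m) :
    ∃ A : Euc m →L[ℝ] Euc m, ∀ i, A (stdVec i) = b i := by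
  refine ⟨∑ i, (innerSL ℝ (stdVec i)).smulRight (b i), fun i => ?_⟩
  simp only [_root_.sum_apply, ContinuousLinearMap.smulRight_apply, innerSL_apply_apply,
    inner_stdVec_left]
  rw [Finset.sum_eq_single i (fun j _ hj => by simp [stdVec, hj]) (by simp)]
  simp [stdVec]

theorem exists_frame_eq (a : M) {y : Euc m} (hy : y ∈ (extChartAt (𝓡 m) a).target)
    (E : Fin m → TangentSpace (𝓡 m) ((extChartAt (𝓡 m) a).symm y))
    (hE : IsOrthonormalFrame g ((extChartAt (𝓡 m) a).symm y) E) :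
    ∃ A : Euc m →L[ℝ] Euc m,
      (∀ i j, chartMetric M g a y (A (stdVec i)) (A (stdVec j)) = if i = j then (1 : ℝ) else 0) ∧
      frameNormalMetric g a (y, A) = normalMetric g ((extChartAt (𝓡 m) a).symm y) E := by
  have hsurj := (isInvertible_mfderiv_chart_symm hy).surjective
  choose b hb using fun i => hsurj (E i)
  obtain ⟨A, hA⟩ := exists_map_stdVec b
  have hAE (i : Fin m) :
      mfderiv (𝓡 m) (𝓡 m) (extChartAt (𝓡 m) a).symm y (A (stdVec i)) = E i := by
    rw [hA]
    exact hb i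
  refine ⟨A, fun i j => ?_, ?_⟩
  · rw [← hE i j, ← hAE i, ← hAE j]
    rfl
  · unfold frameNormalMetric
    congr 1
    exact funext hAE

-- The parameter is a pair of chart coordinates `y` of the centre and a linear map `A` whose columns
-- are the frame. In the chart, normal coordinates are `x ↦ Φ(y, A x)`, which is smooth in all
-- variables, and so is the pulled-back metric.
set_option maxHeartbeats 600000 in
theorem exists_normalFamily [T2Space M] (a : M) :
    ∃ s ∈ 𝓝 a, ∃ (T : (Euc m × (Euc m →L[ℝ] Euc m)) × Euc m → Euc m →L[ℝ] Euc m)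
      (𝒱 K : Set (Euc m × (Euc m →L[ℝ] Euc m))) (R : ℝ), 0 < R ∧
      NormalFamily (frameNormalMetric g a) T 𝒱 K R ∧
      ∀ p ∈ s, ∀ E : Fin m → TangentSpace (𝓡 m) p, IsOrthonormalFrame g p E →
        ∃ l ∈ K, frameNormalMetric g a l = normalMetric g p E := by
  obtain ⟨r, hr, Φ, hΦ, hexp⟩ := exists_chart_exp g a
  have H := metricOn_chartMetric g a
  set y₀ := extChartAt (𝓡 m) a a
  set S : Euc m → Euc m →L[ℝ] Euc m := fun y => formOp (chartMetric M g a y)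
  have hz : (0 : Euc m) ∈ Metric.ball (0 : Euc m) r := Metric.mem_ball_self hr
  have hcb : Metric.closedBall y₀ (r / 2) ⊆ Metric.ball y₀ r :=
    Metric.closedBall_subset_ball (half_lt_self hr)
  have hU : Metric.closedBall y₀ (r / 2) ⊆ (extChartAt (𝓡 m) a).target := by
    intro y hy
    have h1 := ((hexp y (hcb hy)).2.2 0 hz).1
    rwa [(hexp y (hcb hy)).1] at h1
  obtain ⟨C, hC⟩ := H.exists_bound_frameSet hU
  -- The maximum makes the bound positive even if there are no frames. On the ball of radius `r /
  -- C'`, every admissible frame maps into the domain of `Φ`.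
  set C' := max C 1
  have hC' : 0 < C' := lt_max_of_lt_right one_pos
  have hO : IsOpen (Metric.ball y₀ r ×ˢ Metric.ball (0 : Euc m) r) :=
    Metric.isOpen_ball.prod Metric.isOpen_ball
  have hball : ∀ A : Euc m →L[ℝ] Euc m, ‖A‖ < C' → ∀ x ∈ Metric.ball (0 : Euc m) (r / C'),
      A x ∈ Metric.ball (0 : Euc m) r := by
    intro A hA x hx
    rw [mem_ball_zero_iff, lt_div_iff₀ hC'] at hx
    rw [mem_ball_zero_iff]
    calc ‖A x‖ ≤ ‖A‖ * ‖x‖ := A.le_opNorm x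
      _ ≤ C' * ‖x‖ := mul_le_mul_of_nonneg_right hA.le (norm_nonneg _)
      _ < r := by rwa [mul_comm]
  have hsm : ContDiffOn ℝ ∞ (frameMetric S Φ)
      ((Metric.ball y₀ r ×ˢ Metric.ball 0 C') ×ˢ Metric.ball 0 (r / C')) :=
    contDiffOn_frameMetric H hO hΦ (fun q hq => ((hexp q.1 hq.1).2.2 q.2 hq.2).1)
      fun q hq => ⟨hq.1.1, hball q.1.2 (mem_ball_zero_iff.1 hq.1.2) q.2 hq.2⟩
  refine ⟨(extChartAt (𝓡 m) a).source ∩ extChartAt (𝓡 m) a ⁻¹' Metric.closedBall y₀ (r / 2),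
    inter_mem (extChartAt_source_mem_nhds a) ((continuousAt_extChartAt a).preimage_mem_nhds
      (Metric.closedBall_mem_nhds _ (half_pos hr))),
    frameMetric S Φ, Metric.ball y₀ r ×ˢ Metric.ball 0 C', frameSet S y₀ (r / 2), r / C',
    div_pos hr hC', ⟨Metric.isOpen_ball.prod Metric.isOpen_ball, H.isCompact_frameSet hU,
      fun l hl => ⟨hcb hl.1, mem_ball_zero_iff.2 ((hC l hl).trans_le (le_max_left _ _))⟩, hsm, ?_⟩, ?_⟩
  · rintro ⟨y, A⟩ hl
    have hy : y ∈ Metric.ball y₀ r := hcb hl.1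
    have hA : ‖A‖ < C' := (hC _ hl).trans_le (le_max_left _ _)
    have hAx := hball A hA
    have hin := apply_apply_eq_inner hl.2
    have hinj : ∀ u, A u = 0 → u = 0 := by
      intro u hu
      have h1 := hin u u
      rw [hu, map_zero, inner_zero_left] at h1
      exact inner_self_eq_zero.1 h1.symm
    have hmem : ∀ x ∈ Metric.ball (0 : Euc m) (r / C'),
        (y, A x) ∈ Metric.ball y₀ r ×ˢ Metric.ball (0 : Euc m) r := fun x hx => ⟨hy, hAx x hx⟩
    have hτ : ∀ x ∈ Metric.ball (0 : Euc m) (r / C'),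
        ContDiffAt ℝ ∞ (fun x => Φ (y, A x)) x := fun x hx => contDiffAt_frameMap hO hΦ (hmem x hx)
    have hτd : ∀ x ∈ Metric.ball (0 : Euc m) (r / C'), ∀ u,
        fderiv ℝ (fun x => Φ (y, A x)) x u = frameDeriv Φ ((y, A), x) u := fun x hx u =>
      fderiv_frameMap hO hΦ (hmem x hx) u
    have hτU : ∀ x ∈ Metric.ball (0 : Euc m) (r / C'),
        Φ (y, A x) ∈ (extChartAt (𝓡 m) a).target := fun x hx =>
      ((hexp y hy).2.2 (A x) (hAx x hx)).1
    have hτinj : ∀ x ∈ Metric.ball (0 : Euc m) (r / C'), ∀ u,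
        frameDeriv Φ ((y, A), x) u = 0 → u = 0 := fun x hx u hu =>
      hinj u (((hexp y hy).2.2 (A x) (hAx x hx)).2.2.1 _ hu)
    have hpull : ∀ x ∈ Metric.ball (0 : Euc m) (r / C'), ∀ u v,
        frameNormalMetric g a (y, A) x u v = chartMetric M g a (Φ (y, A x))
          (fderiv ℝ (fun x => Φ (y, A x)) x u) (fderiv ℝ (fun x => Φ (y, A x)) x v) := by
      intro x hx u v
      have h1 : normalCoord g ((extChartAt (𝓡 m) a).symm y) (fun i =>
          mfderiv (𝓡 m) (𝓡 m) (extChartAt (𝓡 m) a).symm y (A (stdVec i))) =ᶠ[𝓝 x]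
          (extChartAt (𝓡 m) a).symm ∘ fun x => Φ (y, A x) := by
        filter_upwards [Metric.isOpen_ball.mem_nhds hx] with x' hx'
        exact (normalCoord_frame g (B := mfderiv (𝓡 m) (𝓡 m) (extChartAt (𝓡 m) a).symm y)
          A x').trans ((hexp y hy).2.2 (A x') (hAx x' hx')).2.1
      exact (pullback_congr g h1 u v).trans (pullback_comp g
        (mdifferentiableAt_chart_symm (hτU x hx)) ((hτ x hx).differentiableAt (by simp)) u v)
    have hmetric : MetricOn (frameNormalMetric g a (y, A)) (fun x => frameMetric S Φ ((y, A), x))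
        (Metric.ball 0 (r / C')) := by
      refine ⟨Metric.isOpen_ball, ?_, fun x hx u v => ?_, fun x hx u v => ?_, fun x hx u hu => ?_⟩
      · exact hsm.comp (contDiff_const.prodMk contDiff_id).contDiffOn
          fun x hx => ⟨⟨hy, mem_ball_zero_iff.2 hA⟩, hx⟩
      · rw [hpull x hx, hτd x hx, hτd x hx, inner_frameMetric, H.eq _ (hτU x hx)]
      · rw [inner_frameMetric, inner_frameMetric]
        exact H.symm _ (hτU x hx) _ _
      · rw [inner_frameMetric]
        exact H.pos _ (hτU x hx) _ fun h0 => hu (hτinj x hx u h0)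
    refine ⟨hmetric, div_pos hr hC', ?_, fun x hx => ?_⟩
    · refine ContinuousLinearMap.ext fun u => ext_inner_right ℝ fun v => ?_
      rw [inner_frameMetric]
      simp only [frameDeriv, map_zero, (hexp y hy).1, (hexp y hy).2.1]
      exact hin u v
    · have hinjx : Function.Injective (fderiv ℝ (fun x => Φ (y, A x)) x) := by
        refine (injective_iff_map_eq_zero _).2 fun u hu => hτinj x hx u ?_
        rw [← hτd x hx]
        exact hu
      have hsurj : Function.Surjective (fderiv ℝ (fun x => Φ (y, A x)) x) :=
        LinearMap.injective_iff_surjective.1 hinjx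
      -- The transformation law for `x ↦ Φ(y, A x)` turns the geodesic equation of `t ↦ Φ(y, t A x)`
      -- at `t = 1` into the vanishing of `Γ_x(x, x)`, since the derivative of the coordinate map is
      -- injective.
      have h1 := H.christoffel_pullback hmetric hx ((hτ x hx).of_le ENat.LEInfty.out)
        (hτU x hx) hsurj (Filter.mem_of_superset (Metric.isOpen_ball.mem_nhds hx) hpull) x x
      have hline : ∀ t : ℝ, HasDerivAt (fun t : ℝ => t • x) x t := fun t => by
        simpa using (hasDerivAt_id t).smul_const x
      have hline' : deriv (fun t : ℝ => t • x) = fun _ => x := funext fun t => (hline t).deriv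
      have hone : (fun t : ℝ => t • x) 1 = x := one_smul ℝ x
      have e : (fun t : ℝ => Φ (y, t • A x)) = (fun x => Φ (y, A x)) ∘ fun t : ℝ => t • x := by
        funext t
        simp
      have hτ2 : ContDiffAt ℝ 2 (fun x => Φ (y, A x)) ((fun t : ℝ => t • x) 1) := by
        rw [hone]
        exact (hτ x hx).of_le ENat.LEInfty.out
      have h2 := deriv_deriv_comp hτ2 (c := fun t : ℝ => t • x) (t := 1) (by fun_prop)
      have h3 : deriv ((fun x => Φ (y, A x)) ∘ fun t : ℝ => t • x) 1
          = fderiv ℝ (fun x => Φ (y, A x)) x x := by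
        have h4 := (hτ2.differentiableAt (by simp)).hasFDerivAt.comp_hasDerivAt (1 : ℝ) (hline 1)
        rw [h4.deriv, hone]
      have h5 := ((hexp y hy).2.2 (A x) (hAx x hx)).2.2.2
      rw [e, h2, h3, hline', one_smul, deriv_const, map_zero, add_zero, ← h1] at h5
      exact hinjx (h5.trans (map_zero _).symm)
  · rintro p ⟨hp, hpb⟩
    obtain ⟨y, hy, rfl⟩ : ∃ y ∈ Metric.closedBall y₀ (r / 2), (extChartAt (𝓡 m) a).symm y = p :=
      ⟨_, hpb, (extChartAt (𝓡 m) a).left_inv hp⟩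
    intro E hE
    obtain ⟨A, hA, hAE⟩ := exists_frame_eq g a (hU hy) E hE
    refine ⟨(y, A), ⟨hy, fun i j => ?_⟩, hAE⟩
    rw [← hA i j, H.eq y (hU hy)]

end LocalFamily

/-! ### Uniformity on compact sets -/

section Uniform

variable {n : ℕ}

/-- Induction over the finitely many `k` merges the constants of the separate expansions; shrinking
`ρ₀` and `δ` and enlarging `C` is harmless. -/
theorem NormalFamily.exists_expansions {Λ : Type} [NormedAddCommGroup Λ] [NormedSpace ℝ Λ]
    {T : Λ × Euc (n + 1) → Euc (n + 1) →L[ℝ] Euc (n + 1)} {𝒱 K : Set Λ} {R : ℝ}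
    {h : Λ → Euc (n + 1) → Euc (n + 1) → Euc (n + 1) → ℝ} (F : NormalFamily h T 𝒱 K R)
    (hR : 0 < R) :
    ∃ ρ₀ > 0, ∃ δ > 0, ∃ C, ∀ l ∈ K, ∀ ρ, 0 < ρ → ρ < ρ₀ →
      ShapeExpansion ((n + 1) * (n + 1)) (h l) ρ δ C ∧
      ∀ k, 1 ≤ k → k ≤ n → CurvExpansion k (h l) ρ δ C := by
  suffices H : ∀ j ≤ n, ∃ ρ₀ > 0, ∃ δ > 0, ∃ C, ∀ l ∈ K, ∀ ρ, 0 < ρ → ρ < ρ₀ →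
      ShapeExpansion ((n + 1) * (n + 1)) (h l) ρ δ C ∧
      ∀ k, 1 ≤ k → k ≤ j → CurvExpansion k (h l) ρ δ C from H n le_rfl
  intro j
  induction j with
  | zero =>
    intro _
    obtain ⟨ρ₀, hρ₀, δ, hδ, C, H⟩ := F.exists_shapeExpansion hR
    exact ⟨ρ₀, hρ₀, δ, hδ, C, fun l hl ρ h0 h1 => ⟨H l hl ρ h0 h1, fun k h2 h3 => by omega⟩⟩
  | succ j ih =>
    intro hj
    obtain ⟨ρ₁, hρ₁, δ₁, hδ₁, C₁, H₁⟩ := ih (by omega)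
    obtain ⟨ρ₂, hρ₂, δ₂, hδ₂, C₂, H₂⟩ := F.exists_curvExpansion hR (k := j + 1) (by omega) hj
    refine ⟨min ρ₁ ρ₂, lt_min hρ₁ hρ₂, min δ₁ δ₂, lt_min hδ₁ hδ₂, fun r => max (C₁ r) (C₂ r),
      fun l hl ρ h0 h1 => ?_⟩
    obtain ⟨hS, hH⟩ := H₁ l hl ρ h0 (h1.trans_le (min_le_left _ _))
    refine ⟨hS.mono (min_le_left _ _) fun r => le_max_left _ _, fun k hk hkj => ?_⟩
    rcases hkj.lt_or_eq with hlt | rfl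
    · exact (hH k hk (by omega)).mono (min_le_left _ _) fun r => le_max_left _ _
    · exact (H₂ l hl ρ h0 (h1.trans_le (min_le_right _ _))).mono (min_le_right _ _)
        fun r => le_max_right _ _

variable {M : Type*} [TopologicalSpace M] [ChartedSpace (Euc (n + 1)) M]
  [IsManifold (𝓡 (n + 1)) ∞ M]
  (g : Bundle.ContMDiffRiemannianMetric (𝓡 (n + 1)) ∞ (Euc (n + 1))
    (fun x : M => TangentSpace (𝓡 (n + 1)) x))

/-- The expansions hold uniformly for the centers in `s`. -/
def UniformExpansions (s : Set M) : Prop :=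
  ∃ ρ₀ > 0, ∃ δ > 0, ∃ C, ∀ p ∈ s, ∀ E : Fin (n + 1) → TangentSpace (𝓡 (n + 1)) p,
    IsOrthonormalFrame g p E → ∀ ρ : ℝ, 0 < ρ → ρ < ρ₀ →
      ShapeExpansion ((n + 1) * (n + 1)) (normalMetric g p E) ρ δ C ∧
      ∀ k, 1 ≤ k → k ≤ n → CurvExpansion k (normalMetric g p E) ρ δ C

theorem UniformExpansions.union {s t : Set M} (hs : UniformExpansions g s)
    (ht : UniformExpansions g t) : UniformExpansions g (s ∪ t) := by
  obtain ⟨ρ₁, hρ₁, δ₁, hδ₁, C₁, H₁⟩ := hs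
  obtain ⟨ρ₂, hρ₂, δ₂, hδ₂, C₂, H₂⟩ := ht
  refine ⟨min ρ₁ ρ₂, lt_min hρ₁ hρ₂, min δ₁ δ₂, lt_min hδ₁ hδ₂, fun r => max (C₁ r) (C₂ r), ?_⟩
  rintro p (hp | hp) E hE ρ h0 h1
  · obtain ⟨hS, hH⟩ := H₁ p hp E hE ρ h0 (h1.trans_le (min_le_left _ _))
    exact ⟨hS.mono (min_le_left _ _) fun r => le_max_left _ _, fun k hk hkn =>
      (hH k hk hkn).mono (min_le_left _ _) fun r => le_max_left _ _⟩
  · obtain ⟨hS, hH⟩ := H₂ p hp E hE ρ h0 (h1.trans_le (min_le_right _ _))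
    exact ⟨hS.mono (min_le_right _ _) fun r => le_max_right _ _, fun k hk hkn =>
      (hH k hk hkn).mono (min_le_right _ _) fun r => le_max_right _ _⟩

/-- The property passes to subsets and finite unions and holds near every point, hence on compact
sets. -/
theorem UniformExpansions.of_isCompact [T2Space M] {K : Set M} (hK : IsCompact K) :
    UniformExpansions g K := by
  refine hK.induction_on (p := UniformExpansions g) ?_ ?_
    (fun s t hs ht => UniformExpansions.union g hs ht) fun a _ => ?_
  · exact ⟨1, one_pos, 1, one_pos, 0, fun p hp => hp.elim⟩
  · rintro s t hst ⟨ρ₀, hρ₀, δ, hδ, C, H⟩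
    exact ⟨ρ₀, hρ₀, δ, hδ, C, fun p hp => H p (hst hp)⟩
  · obtain ⟨s, hs, T, 𝒱, K', R, hR, F, hF⟩ := exists_normalFamily g a
    obtain ⟨ρ₀, hρ₀, δ, hδ, C, H⟩ := F.exists_expansions hR
    refine ⟨s, mem_nhdsWithin_of_mem_nhds hs, ρ₀, hρ₀, δ, hδ, C, fun p hp E hE ρ h0 h1 => ?_⟩
    obtain ⟨l, hl, hlE⟩ := hF p hp E hE
    rw [← hlE]
    exact H l hl ρ h0 h1

end Uniform

end PerturbedSphere

theorem mainTheorem4 (n : ℕ) {M : Type*} [TopologicalSpace M] [T2Space M]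
    [ChartedSpace (EuclideanSpace ℝ (Fin (n + 1))) M] [IsManifold (𝓡 (n + 1)) ∞ M]
    (g : Bundle.ContMDiffRiemannianMetric (𝓡 (n + 1)) ∞ (EuclideanSpace ℝ (Fin (n + 1)))
      (fun x : M => TangentSpace (𝓡 (n + 1)) x))
    (K : Set M) (hK : IsCompact K) :
    ∃ (ρ₀ : ℝ) (δ : ℝ) (m : ℕ) (C : ℕ → ℝ), 0 < ρ₀ ∧ 0 < δ ∧
      ∀ p ∈ K, ∀ E : Fin (n + 1) → TangentSpace (𝓡 (n + 1)) p,
        IsOrthonormalFrame g p E → ∀ ρ : ℝ, 0 < ρ → ρ < ρ₀ →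
      -- the expansion of the shape operator
      (∃ (O : EuclideanSpace ℝ (Fin (n + 1)) → Bilin n)
          (L : EuclideanSpace ℝ (Fin (n + 1)) →
            (ℝ × EuclideanSpace ℝ (Fin (n + 1)) × Bilin n) →L[ℝ] Bilin n)
          (Q : EuclideanSpace ℝ (Fin (n + 1)) × (ℝ × EuclideanSpace ℝ (Fin (n + 1))) →
            Bilin n)
          (L₂ L₂' : Fin m → EuclideanSpace ℝ (Fin (n + 1)) →
            (ℝ × EuclideanSpace ℝ (Fin (n + 1)) × Bilin n) →L[ℝ] Bilin n)
          (L₀ : Fin m → EuclideanSpace ℝ (Fin (n + 1)) → ℝ →L[ℝ] ℝ)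
          (Q₁ : Fin m → EuclideanSpace ℝ (Fin (n + 1)) × (ℝ × EuclideanSpace ℝ (Fin (n + 1))) →
            ℝ),
        SmoothOnSphere C O ∧ SmoothOnSphere C L ∧ QuadraticOp C δ Q ∧
        (∀ a, SmoothOnSphere C (L₂ a) ∧ SmoothOnSphere C (L₂' a) ∧
          SmoothOnSphere C (L₀ a) ∧ QuadraticOp C δ (Q₁ a)) ∧
        ∀ (w : Metric.sphere (0 : EuclideanSpace ℝ (Fin (n + 1))) 1 → ℝ),
          ContMDiff (𝓡 n) 𝓘(ℝ, ℝ) 2 w →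
        ∀ (Θ : EuclideanSpace ℝ (Fin n) → Metric.sphere (0 : EuclideanSpace ℝ (Fin (n + 1))) 1)
          (z : EuclideanSpace ℝ (Fin n)), IsNormalParam Θ z →
          ‖jet1 w Θ z‖ < δ →
        ∀ i j : Fin n,
          ρ * shapeOp g p E ρ w Θ z i j =
            (1 + w (Θ z)) * (if i = j then 1 else 0) + d2 w Θ z i j
            + 1 / 3 * riemAt g p E (amb Θ z) (tang Θ z i) (amb Θ z) (tang Θ z j) * ρ ^ 2
            - 1 / 3 * (riemAt g p E (amb Θ z) (tang Θ z i) (amb Θ z) (tang Θ z j) * w (Θ z)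
                + ∑ k, riemAt g p E (amb Θ z) (tang Θ z i) (amb Θ z) (tang Θ z k) * d2 w Θ z k j
                - ∑ k, (riemAt g p E (tang Θ z k) (tang Θ z i) (amb Θ z) (tang Θ z j)
                    + riemAt g p E (amb Θ z) (tang Θ z i) (tang Θ z k) (tang Θ z j))
                  * d1 w Θ z k) * ρ ^ 2
            + 1 / 4 * covRiemAt g p E (amb Θ z) (amb Θ z) (tang Θ z i) (amb Θ z) (tang Θ z j)
                * ρ ^ 3
            + ρ ^ 4 * O (amb Θ z) (tang Θ z i) (tang Θ z j)
            + ρ ^ 3 * L (amb Θ z) (jet2 w Θ z) (tang Θ z i) (tang Θ z j)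
            + Q (amb Θ z, jet1 w Θ z) (tang Θ z i) (tang Θ z j)
            + ∑ a, L₂ a (amb Θ z) (jet2 w Θ z) (tang Θ z i) (tang Θ z j)
                * L₀ a (amb Θ z) (w (Θ z))
            + ∑ a, L₂' a (amb Θ z) (jet2 w Θ z) (tang Θ z i) (tang Θ z j)
                * Q₁ a (amb Θ z, jet1 w Θ z)) ∧
      -- the expansion of the `k`-curvature
      (∀ k : ℕ, 1 ≤ k → k ≤ n →
        ∃ (O : EuclideanSpace ℝ (Fin (n + 1)) → ℝ)
          (L : EuclideanSpace ℝ (Fin (n + 1)) →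
            (ℝ × EuclideanSpace ℝ (Fin (n + 1)) × Bilin n) →L[ℝ] ℝ)
          (Q : EuclideanSpace ℝ (Fin (n + 1)) ×
            (ℝ × EuclideanSpace ℝ (Fin (n + 1)) × Bilin n) → ℝ),
        SmoothOnSphere C O ∧ SmoothOnSphere C L ∧ QuadraticOp C δ Q ∧
        ∀ (w : Metric.sphere (0 : EuclideanSpace ℝ (Fin (n + 1))) 1 → ℝ),
          ContMDiff (𝓡 n) 𝓘(ℝ, ℝ) 2 w →
        ∀ (Θ : EuclideanSpace ℝ (Fin n) → Metric.sphere (0 : EuclideanSpace ℝ (Fin (n + 1))) 1)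
          (z : EuclideanSpace ℝ (Fin n)), IsNormalParam Θ z →
          ‖jet2 w Θ z‖ < δ →
        ρ ^ k * kCurvature k (shapeOp g p E ρ w Θ z) =
          (n.choose k : ℝ)
          + ((n - 1).choose (k - 1) : ℝ) *
            ((∑ i, d2 w Θ z i i) + n * w (Θ z) - 1 / 3 * ricAt g p E (amb Θ z) (amb Θ z) * ρ ^ 2
              - 1 / 4 * covRicAt g p E (amb Θ z) (amb Θ z) (amb Θ z) * ρ ^ 3
              + 1 / 3 * (ricAt g p E (amb Θ z) (amb Θ z) * w (Θ z)
                  - 2 * ricAt g p E (sphGrad w Θ z) (amb Θ z)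
                  - ∑ i, ∑ j, riemAt g p E (amb Θ z) (tang Θ z i) (amb Θ z) (tang Θ z j)
                      * d2 w Θ z i j) * ρ ^ 2)
          - (if 2 ≤ k then ((n - 2).choose (k - 2) : ℝ) else 0) *
              (1 / 3 * (ricAt g p E (amb Θ z) (amb Θ z)
                * ((∑ i, d2 w Θ z i i) + (n - 1) * w (Θ z))
                + ∑ i, ∑ j, riemAt g p E (amb Θ z) (tang Θ z i) (amb Θ z) (tang Θ z j)
                    * d2 w Θ z i j) * ρ ^ 2)
          + ρ ^ 4 * O (amb Θ z)
          + ρ ^ 3 * L (amb Θ z) (jet2 w Θ z)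
          + Q (amb Θ z, jet2 w Θ z)) := by
  obtain ⟨ρ₀, hρ₀, δ, hδ, C, H⟩ := UniformExpansions.of_isCompact g hK
  -- The two predicates, taken at the metric in normal coordinates, unfold to the two expansions
  -- claimed.
  exact ⟨ρ₀, δ, (n + 1) * (n + 1), C, hρ₀, hδ, H⟩
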